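/- **Setting.** Let $\Bbbk$ be an algebraically closed field of characteristic $0$, let $n\ge 2$, $N=2n$, and let $V=\Bbbk^{N}$ carry the standard symplectic form, with symplectic basis $v_1,\dots,v_{2n}$ and dual basis $x_1,\dots,x_{2n}$. Let $G=Sp(V)$, $V_2=\langle v_1,v_2\rangle$, and let $P\subset G$ be the stabilizer of $V_2$, so that $X=SpGr(2,V)=G/P$ is the Grassmannian of isotropic $2$-planes in $V$. Let $S=G\times_P V_2$ be the tautological bundle on $X$ and $S^\perp=G\times_P (V/V_2)^*$ the dual of the quotient bundle. Put $\eta=\sum_{i=1}^n x_i\otimes x_{n+i}\in V^*\otimes (V/V_2)^*$. Let $M=\bigoplus_{j\ge 0}\Lambda^\bullet\big(V_2\boxtimes (V/V_2)^*\big)\,T^j$, where $T=(v_1\wedge v_2)\boxtimes\eta$ is a central variable of degree $2$. The group $P\times P$ acts on $M$ by algebra automorphisms: naturally on the exterior algebra, and by $$(p,q)\cdot T=\det(p|_{V_2})\big(T+(v_1\wedge v_2)\boxtimes(q\eta-\eta)\big).$$ Here $q\eta-\eta\in \mathrm{Sym}_2 (V/V_2)^*$, and $\Lambda^2V_2\boxtimes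 \mathrm{Sym}_2(V/V_2)^*$ is regarded as a summand of $\Lambda^2(V_2\boxtimes (V/V_2)^*)$. The Tate resolution $D_\bullet$ of $\mathcal O_\Delta$, $\Delta\subset X\times X$ the diagonal, has the terms $D_i=(G\times G)\times_{P\times P}M_i$, $M_i$ the part of degree $i$. Its differential over $(gP,hP)$ is $$d(wT^j)=(dw)\,T^j+(-1)^{|w|}\,j\,w\,t\,T^{j-1},\qquad t=\sum_{i=1}^n\big((hx_i)(gv_1)\,v_2-(hx_i)(gv_2)\,v_1\big)\boxtimes x_{n+i},$$ where $w\mapsto dw$ is the Koszul differential of the evaluation pairing $v\boxtimes f\mapsto (hf)(gv)$. For a partition $\alpha=(\alpha_1\ge\alpha_2\ge 0)$ with conjugate $\alpha^*$ let $\Lambda_\alpha=\Sigma^\alpha V_2\boxtimes\Sigma^{\alpha^*}(V/V_2)^*\subset\Lambda^{|\alpha|}(V_2\boxtimes(V/V_2)^*)$ be the Cauchy summand ($\Sigma$ denotes Schur functors) and let $$\Sigma^\alpha S\boxtimes\Psi_{\alpha^*}\subset D_{|\alpha|}$$ be the homogeneous subbundle with fibre $M_\alpha=\bigoplus_{j=0}^{\alpha_2}\Lambda_{(\alpha_1-j,\alpha_2-j)}T^j$;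 thus $\Psi_{\alpha^*}$ is a homogeneous bundle on $X$, iteratively extended from the bundles $\Sigma^{\alpha^*-2j}S^\perp$, where $\alpha^*-2j$ is $\alpha^*$ with $j$ rows of length $2$ removed. **Theorem.** For $0\le i\le 2N-6$ let $$B_i=\bigoplus_{|\alpha|=i,\ N-2>\alpha_1\ge\alpha_2\ge 0}\Sigma^\alpha S\boxtimes\Psi_{\alpha^*}\ \subset\ D_i .$$ Then $B_\bullet$ is a sub-complex of $D_\bullet$, and the complex of sheaves on $X\times X$ $$B_{2N-6}\to\cdots\to B_2\to B_1=S\boxtimes S^\perp\to B_0=\mathcal O_{X\times X}$$ is exact, that is, exact at $B_i$ for all $0<i<2N-6$. -/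

import Mathlib

open scoped TensorProduct

noncomputable section

namespace SpGrTate

/-! ### The symplectic space `V = k ^ (2n)`, its group and the symplectic Grassmannian -/

section Symplectic

/-- Indices of the symplectic basis: `Sum.inl i` is the basis vector `v_{i+1}` and `Sum.inr i` is
`v_{n+i+1}`, for `0 ≤ i < n`. -/
abbrev Idx (n : ℕ) : Type := Fin n ⊕ Fin n

/-- The symplectic vector space `V` of dimension `N = 2n`. -/
abbrev V (n : ℕ) (k : Type*) : Type _ := Idx n → k

/-- The symplectic group `G = Sp(V)`. -/
abbrev G (n : ℕ) (k : Type*) [Field k] : Type _ := Matrix.symplecticGroup (Fin n) k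

variable (n : ℕ) (k : Type*) [Field k]

/-- The symplectic Grassmannian `X = SpGr(2, V)` of isotropic two-dimensional subspaces of `V`. -/
def SpGr : Type _ :=
  {W : Submodule k (V n k) // Module.finrank k W = 2 ∧
    ∀ v ∈ W, ∀ w ∈ W, v ⬝ᵥ (Matrix.J (Fin n) k).mulVec w = 0}

variable {n k}

/-- The standard basis vectors of `V`. -/
def e (i : Idx n) : V n k := Pi.single i 1

/-- The dual basis of `V*`. -/
def x (i : Idx n) : Module.Dual k (V n k) := LinearMap.proj i

/-- The action of `g ∈ G` on `V`. -/
def actV (g : G n k) : V n k →ₗ[k] V n k := Matrix.mulVecLin g.1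

/-- The action of `g ∈ G` on `V*`, namely `(g • f) v = f (g⁻¹ v)`. -/
def actDual (g : G n k) : Module.Dual k (V n k) →ₗ[k] Module.Dual k (V n k) :=
  (actV g⁻¹).dualMap

theorem actV_injective (g : G n k) : Function.Injective (actV g) := by
  intro v w h
  have h2 := congrArg (fun u => (g⁻¹).1.mulVec u) h
  have h3 : (g⁻¹).1 * g.1 = 1 := congrArg Subtype.val (inv_mul_cancel g)
  simpa only [actV, Matrix.mulVecLin_apply, Matrix.mulVec_mulVec, h3, Matrix.one_mulVec] using h2

variable [Fact (2 ≤ n)]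

variable (n) in
/-- The index of the basis vector `v₁`. -/
def i₁ : Idx n := Sum.inl ⟨0, lt_of_lt_of_le two_pos (Fact.out : 2 ≤ n)⟩

variable (n) in
/-- The index of the basis vector `v₂`. -/
def i₂ : Idx n := Sum.inl ⟨1, (Fact.out : 2 ≤ n)⟩

variable (n k) in
/-- The first basis vector. -/
def v₁ : V n k := e (i₁ n)

variable (n k) in
/-- The second basis vector. -/
def v₂ : V n k := e (i₂ n)

variable (n k) in
/-- The isotropic plane `V₂` spanned by the first two vectors of the symplectic basis. -/
def V₂ : Submodule k (V n k) := Submodule.span k (Set.range ![v₁ n k, v₂ n k])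

variable (n k) in
/-- The subspace `(V / V₂)*` of `V*`: the linear forms that vanish on `V₂`. -/
def V₂perp : Submodule k (Module.Dual k (V n k)) := (V₂ n k).dualAnnihilator

theorem linearIndependent_v₁_v₂ : LinearIndependent k ![v₁ n k, v₂ n k] := by
  have h : i₁ n ≠ i₂ n := by simp [i₁, i₂]
  rw [LinearIndependent.pair_iff]
  intro s t hst
  have h1 := congrFun hst (i₁ n)
  have h2 := congrFun hst (i₂ n)
  simp [v₁, v₂, e, h, h.symm] at h1 h2
  exact ⟨h1, h2⟩

theorem form_V₂ (v : V n k) (hv : v ∈ V₂ n k) (i : Fin n) : v (Sum.inr i) = 0 := by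
  induction hv using Submodule.span_induction with
  | mem y hy =>
    obtain ⟨j, rfl⟩ := hy
    fin_cases j <;> simp [v₁, v₂, e, i₁, i₂]
  | zero => rfl
  | add y z _ _ hy hz => simp [hy, hz]
  | smul a y _ hy => simp [hy]

/-- The quotient map `G → G / P = X`, `g ↦ g V₂`. -/
def toPoint (g : G n k) : SpGr n k :=
  ⟨(V₂ n k).map (actV g), by
    rw [← (Submodule.equivMapOfInjective _ (actV_injective g) (V₂ n k)).finrank_eq]
    exact (finrank_span_eq_card (linearIndependent_v₁_v₂ (n := n) (k := k))).trans
      (Fintype.card_fin 2), by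
    rintro _ ⟨v, hv, rfl⟩ _ ⟨w, hw, rfl⟩
    have hg := SymplecticGroup.mem_iff'.1 g.2
    have h0 : v ⬝ᵥ (Matrix.J (Fin n) k).mulVec w = 0 := by
      simp [Matrix.J, Matrix.mulVec, dotProduct, Matrix.fromBlocks, Fintype.sum_sum_type,
        form_V₂ v hv, form_V₂ w hw]
    have h1 : v ⬝ᵥ (g.1.transpose * Matrix.J (Fin n) k * g.1).mulVec w = 0 := by rw [hg, h0]
    rw [← Matrix.mulVec_mulVec, ← Matrix.mulVec_mulVec, Matrix.dotProduct_mulVec,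
      Matrix.vecMul_transpose] at h1
    exact h1⟩

variable (n k) in
/-- The parabolic subgroup `P`, the stabilizer of the point `V₂` of `X`. -/
def P : Set (G n k) := {p | (V₂ n k).map (actV p) = V₂ n k}

end Symplectic

/-! ### Zariski topology and regular functions

Open subsets of `X × X = (G × G) / (P × P)` are identified with their preimages in the affine
variety `G × G`, whose coordinates are the matrix entries of the two factors. -/

section Zariski

variable {n : ℕ} {k : Type*} [Field k]

/-- Polynomials in the entries of a pair of matrices. -/
abbrev Poly (n : ℕ) (k : Type*) [Field k] : Type _ :=
  MvPolynomial ((Idx n × Idx n) ⊕ (Idx n × Idx n)) k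

/-- The value of a polynomial at a point of `G × G`. -/
def evalAt (y : G n k × G n k) (Q : Poly n k) : k :=
  MvPolynomial.eval (Sum.elim (fun ij => y.1.1 ij.1 ij.2) (fun ij => y.2.1 ij.1 ij.2)) Q

/-- Zariski open subsets of `G × G`: complements of common zero sets of polynomials. -/
def IsOpenGG (Ω : Set (G n k × G n k)) : Prop :=
  ∃ T : Set (Poly n k), Ω = {y | ∃ Q ∈ T, evalAt y Q ≠ 0}

/-- Regular functions on a Zariski open subset `Ω` of `G × G`: locally quotients of
polynomials. -/
def IsRegularOn (Ω : Set (G n k × G n k)) (f : G n k × G n k → k) : Prop :=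
  ∀ y ∈ Ω, ∃ A Q : Poly n k, evalAt y Q ≠ 0 ∧
    ∀ z ∈ Ω, evalAt z Q ≠ 0 → f z = evalAt z A / evalAt z Q

variable [Fact (2 ≤ n)]

/-- The preimage in `G × G` of a subset of `X × X`. -/
def preim (U : Set (SpGr n k × SpGr n k)) : Set (G n k × G n k) :=
  {y | (toPoint y.1, toPoint y.2) ∈ U}

/-- Zariski open subsets of `X × X`. -/
def IsOpenXX (U : Set (SpGr n k × SpGr n k)) : Prop := IsOpenGG (preim U)

end Zariski

/-! ### Young symmetrizers and Schur functors -/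

section Schur

variable {k : Type*} [Field k] {ι : Type} [Fintype ι] [DecidableEq ι] {E : Type*}
  [AddCommGroup E] [Module k E]

/-- The Young symmetrizer `c = a · b` acting on the right on the tensor power of `E` indexed by
the boxes `ι` of a Young diagram. A permutation `σ` acts by
`(⨂ e_b) · σ = ⨂ e_{σ b}`; `a` is the sum of the permutations that preserve the rows and `b` the
signed sum of the permutations that preserve the columns. -/
def youngSymmetrizer (row col : ι → ℕ) :
    (PiTensorProduct k fun _ : ι => E) →ₗ[k] (PiTensorProduct k fun _ : ι => E) :=
  ∑ p ∈ (Finset.univ : Finset (Equiv.Perm ι)).filter (fun p => ∀ b, row (p b) = row b),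
    ∑ q ∈ (Finset.univ : Finset (Equiv.Perm ι)).filter (fun q => ∀ b, col (q b) = col b),
      ((Equiv.Perm.sign q : ℤ) : k) •
        (PiTensorProduct.reindex k (fun _ : ι => E) (p * q)⁻¹).toLinearMap

/-- The Schur functor applied to a subspace `A` of `E`: the image of the tensor power of `A` under
the Young symmetrizer, inside the tensor power of `E`. -/
def schur (row col : ι → ℕ) (A : Submodule k E) :
    Submodule k (PiTensorProduct k fun _ : ι => E) :=
  (LinearMap.range (PiTensorProduct.map fun _ : ι => A.subtype)).map (youngSymmetrizer row col)

/-- The boxes of the Young diagram with two rows, of lengths `a ≥ b`. -/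
abbrev Box (a b : ℕ) : Type := Fin a ⊕ Fin b

/-- The row of a box. -/
def boxRow (a b : ℕ) : Box a b → ℕ := Sum.elim (fun _ => 0) (fun _ => 1)

/-- The column of a box. -/
def boxCol (a b : ℕ) : Box a b → ℕ := Sum.elim (fun j => j) (fun j => j)

end Schur

/-! ### The representations `M_i` and `M_α` of `P × P` -/

section Representations

variable (n : ℕ) (k : Type*) [Field k]

/-- The tensor product `V ⊗ V*`, which contains `V₂ ⊗ (V / V₂)*`. -/
abbrev E (n : ℕ) (k : Type*) [Field k] : Type _ := V n k ⊗[k] Module.Dual k (V n k)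

/-- The exterior algebra of `V ⊗ V*`. -/
abbrev Lam (n : ℕ) (k : Type*) [Field k] : Type _ := ExteriorAlgebra k (E n k)

/-- The polynomials over the exterior algebra in one central variable
`T = (v₁ ∧ v₂) ⊠ η`, `η = x₁ ⊗ x_{n+1} + ⋯ + x_n ⊗ x_{2n}`, of degree 2. The
representation `M = ⨁ Λ(V₂ ⊗ (V / V₂)*) θ^j`, where `θ^j` is the line spanned by `T^j`, is
contained in it. -/
abbrev Amb (n : ℕ) (k : Type*) [Field k] : Type _ := Polynomial (Lam n k)

/-- The map `w ↦ w T^j`. -/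
def mulT (j : ℕ) : Lam n k →ₗ[k] Amb n k :=
  (Polynomial.monomial (R := Lam n k) j).restrictScalars k

variable [Fact (2 ≤ n)]

/-- The representation `M_i = ⨁_j Λ^{i-2j}(V₂ ⊗ (V / V₂)*) θ^j`, the fibre at the base point of
the term `D_i = Φ_i` of the Tate resolution. -/
def D (i : ℕ) : Submodule k (Amb n k) :=
  ⨆ j : ℕ, ⨆ _ : 2 * j ≤ i,
    (((Submodule.map₂ (TensorProduct.mk k (V n k) (Module.Dual k (V n k)))
      (V₂ n k) (V₂perp n k)).map (ExteriorAlgebra.ι k)) ^ (i - 2 * j)).map (mulT n k j)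

/-- The map `V^{⊗ d} ⊗ (V*)^{⊗ d} → Λ^d(V ⊗ V*)`, `d = a + b`, that sends
`(⨂ w_b) ⊗ (⨂ f_b)` to the exterior product of the `w_b ⊗ f_b` over the boxes `b`. -/
def wedgeBoxes (a b : ℕ) :
    (PiTensorProduct k fun _ : Box a b => V n k) →ₗ[k]
      (PiTensorProduct k fun _ : Box a b => Module.Dual k (V n k)) →ₗ[k] Lam n k :=
  (PiTensorProduct.map₂ fun _ : Box a b =>
      TensorProduct.mk k (V n k) (Module.Dual k (V n k))).compr₂
    (PiTensorProduct.lift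
      ((ExteriorAlgebra.ιMulti k (a + b) (M := E n k)).toMultilinearMap.domDomCongr
        finSumFinEquiv.symm))

/-- The summand `Λ_γ = Σ^γ V₂ ⊠ Σ^{γ*} (V / V₂)*` in the Cauchy decomposition of
`Λ^{|γ|}(V₂ ⊗ (V / V₂)*)`, for `γ = (a, b)`. Here `γ*` is the conjugate partition, whose rows are
the columns of `γ`. -/
def LamPart (a b : ℕ) : Submodule k (Lam n k) :=
  Submodule.map₂ (wedgeBoxes n k a b)
    (schur (boxRow a b) (boxCol a b) (V₂ n k))
    (schur (boxCol a b) (boxRow a b) (V₂perp n k))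

/-- The representation `M_α = ⨁_j Λ_{(α₁ - j, α₂ - j)} θ^j`, for `α = (a, b)`, `a ≥ b`. It is the
fibre at the base point of `Φ_α = Σ^α S ⊠ Ψ_{α*}`: the `j`-th summand is
`Σ^{(a - j, b - j)} V₂ ⊗ (Λ² V₂)^{⊗ j} = Σ^α V₂` on the first factor and
`Σ^{α* - 2j} (V / V₂)* η^j` on the second one, where `α* - 2j` arises from `α*` by the removal of
`j` rows of length 2. -/
def Mpart (a b : ℕ) : Submodule k (Amb n k) :=
  ⨆ j : ℕ, ⨆ _ : j ≤ b, (LamPart n k (a - j) (b - j)).map (mulT n k j)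

/-- The fibre at the base point of `B_i = ⨁ Σ^α S ⊠ Ψ_{α*}`, the sum over the partitions
`α = (a, b)` of `i` with `N - 2 > a ≥ b ≥ 0`, `N = 2n`. It vanishes for `i > 2N - 6`. -/
def B (i : ℕ) : Submodule k (Amb n k) :=
  ⨆ a : ℕ, ⨆ b : ℕ, ⨆ _ : b ≤ a ∧ a + b = i ∧ a + 2 < 2 * n, Mpart n k a b

variable {n k}

/-- The element `η = x₁ ⊗ x_{n+1} + ⋯ + x_n ⊗ x_{2n}` of `V* ⊗ (V / V₂)*`. -/
def eta : Module.Dual k (V n k) ⊗[k] Module.Dual k (V n k) :=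
  ∑ i : Fin n, x (Sum.inl i) ⊗ₜ[k] x (Sum.inr i)

/-- The linear map on `V* ⊗ V*` with `F ⊗ F' ↦ (v₁ ⊗ F) ∧ (v₂ ⊗ F')`. On symmetric tensors it is
the identification of `Λ² V₂ ⊠ Sym₂` with a subspace of `Λ²(V₂ ⊗ (V / V₂)*)`. -/
def wedge₁₂ : Module.Dual k (V n k) ⊗[k] Module.Dual k (V n k) →ₗ[k] Lam n k :=
  TensorProduct.lift ((LinearMap.mul k (Lam n k)).compl₁₂
    ((ExteriorAlgebra.ι k).comp (TensorProduct.mk k (V n k) _ (v₁ n k)))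
    ((ExteriorAlgebra.ι k).comp (TensorProduct.mk k (V n k) _ (v₂ n k))))

/-- For `q ∈ P` the tensor `q η - η` lies in `Sym₂ (V / V₂)*`; this is the element
`(v₁ ∧ v₂) ⊠ (q η - η)` of `Λ²(V₂ ⊗ (V / V₂)*)`. -/
def cocycle (q : G n k) : Lam n k :=
  wedge₁₂ (TensorProduct.map (actDual q) (actDual q) eta - eta)

/-- The determinant of the action of `p ∈ P` on `V₂`. -/
def detV₂ (p : G n k) : k := (p.1.submatrix ![i₁ n, i₂ n] ![i₁ n, i₂ n]).det

/-- The action of `(p, q) ∈ P × P` on `M`: it is multiplicative, natural on the exterior algebra,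
and sends `T = (v₁ ∧ v₂) ⊠ η` to
`p (v₁ ∧ v₂) ⊠ q η = det (p | V₂) (T + (v₁ ∧ v₂) ⊠ (q η - η))`. -/
def actM (p q : G n k) : Amb n k →ₗ[k] Amb n k :=
  Polynomial.lsum fun j =>
    (LinearMap.mulRight k
        ((detV₂ p • (Polynomial.X + Polynomial.C (cocycle q)) : Amb n k) ^ j)).comp
      ((mulT n k 0).comp
        (ExteriorAlgebra.map (TensorProduct.map (actV p) (actDual q))).toLinearMap)

/-! ### The differential -/

/-- The evaluation pairing `S ⊠ S^⊥ → 𝒪` over the point `(gP, hP)`: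
`v ⊗ f ↦ (h f) (g v)`. -/
def pairing (g h : G n k) : Module.Dual k (E n k) :=
  TensorProduct.lift ((Module.Dual.eval k (V n k)).compl₁₂ (actV g) (actDual h))

/-- The cycle `t_{(g,h)} = ∑_i ((h x_i)(g v₁) v₂ - (h x_i)(g v₂) v₁) ⊗ x_{n+i}`. -/
def tCycle (g h : G n k) : E n k :=
  ∑ i : Fin n,
    (actDual h (x (Sum.inl i)) (actV g (v₁ n k)) • v₂ n k -
      actDual h (x (Sum.inl i)) (actV g (v₂ n k)) • v₁ n k) ⊗ₜ[k] x (Sum.inr i)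

/-- The differential over the point `(gP, hP)`, in the trivialization given by `(g, h)`:
`d (w T^j) = (d w) T^j + (-1)^{|w|} j w t T^{j-1}`, where `d w` is the Koszul differential (the
contraction with the pairing). -/
def diff (g h : G n k) : Amb n k →ₗ[k] Amb n k :=
  Polynomial.lsum fun j =>
    (mulT n k j).comp (CliffordAlgebra.contractLeft (pairing g h)) +
      (j : k) • (mulT n k (j - 1)).comp
        ((LinearMap.mulRight k (ExteriorAlgebra.ι k (tCycle g h))).comp
          (CliffordAlgebra.involute (Q := (0 : QuadraticForm k (E n k)))).toLinearMap)

/-! ### Homogeneous bundles, their sections, and exactness -/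

/-- Sections over an open subset `U` of `X × X` of the homogeneous vector bundle
`(G × G) ×_{P × P} F`, `F` a subrepresentation of `M`: the regular functions `s` on the preimage
of `U` with values in `F` that satisfy `(p, q) • s (g p, h q) = s (g, h)`. The values outside
the preimage of `U` are irrelevant. -/
structure IsSection (F : Submodule k (Amb n k)) (U : Set (SpGr n k × SpGr n k))
    (s : G n k × G n k → Amb n k) : Prop where
  mem : ∀ y ∈ preim U, s y ∈ F
  equivariant : ∀ y ∈ preim U, ∀ p ∈ P n k, ∀ q ∈ P n k,
    actM p q (s (y.1 * p, y.2 * q)) = s y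
  regular : ∀ l : Module.Dual k (Amb n k), IsRegularOn (preim U) fun y => l (s y)

/-- The differential on sections. -/
def diffSec (s : G n k × G n k → Amb n k) (y : G n k × G n k) : Amb n k :=
  diff y.1 y.2 (s y)

variable (n k) in
/-- The complex of sheaves of sections of the bundles with fibres `F i` is exact in degree `i`:
each section over an open set that is killed by `d` is, near each point, the image under `d` of a
section in degree `i + 1`. -/
def ExactInDegree (F : ℕ → Submodule k (Amb n k)) (i : ℕ) : Prop :=
  ∀ (U : Set (SpGr n k × SpGr n k)) (s : G n k × G n k → Amb n k),
    IsOpenXX U → IsSection (F i) U s → (∀ y ∈ preim U, diffSec s y = 0) →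
    ∀ z ∈ U, ∃ (U' : Set (SpGr n k × SpGr n k)) (r : G n k × G n k → Amb n k),
      IsOpenXX U' ∧ z ∈ U' ∧ U' ⊆ U ∧ IsSection (F (i + 1)) U' r ∧
        ∀ y ∈ preim U', diffSec r y = s y

variable (n k) in
/-- The bundles with fibres `F i` form, with `d`, a sub-complex of the Tate complex `D`. -/
def IsSubcomplex (F : ℕ → Submodule k (Amb n k)) : Prop :=
  (∀ i, F i ≤ D n k i) ∧
    (∀ (i : ℕ) (U : Set (SpGr n k × SpGr n k)) (s : G n k × G n k → Amb n k), IsOpenXX U →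
      IsSection (F (i + 1)) U s → IsSection (F i) U (diffSec s)) ∧
    ∀ (i : ℕ) (U : Set (SpGr n k × SpGr n k)) (s : G n k × G n k → Amb n k), IsOpenXX U →
      IsSection (F (i + 2)) U s → ∀ y ∈ preim U, diffSec (diffSec s) y = 0

end Representations

end SpGrTate

end

/-! Put `W = (V/V₂)*` and `m = dim W = N - 2`. Over a point `(gP, hP)`, with `u = h⁻¹g`, the Tate
complex consists of polynomials in `T` over `Λ(k² ⊗ W)`, with `d(w T^j) = (φ⌋w) T^j + j t w
T^(j-1)`. The form `φ` is read off from the first two columns of `u`. The cycle is `t = v₂ ⊗ w₁ - v₁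
⊗ w₂`, with `w₁, w₂` coming from the upper halves of these columns. Isotropy of the columns gives
`φ(t) = 0`.

The filtration. Let `sl₂` act on `k²`. The Cauchy summand of `α` is the isotypic component with
highest weight vectors `Q^(α₂) (v₁ ⊗ W)^(α₁ - α₂)`, where `Q = Λ²V₂ ⊠ Sym² W`. Hence the summands
with `α₂ ≥ β` fill the degree `d` part of the `β`-th power of the ideal generated by `Q`. `filQ β d`
describes this part by the vanishing of powers of the raising operator (`filQ_eq_tot`,
`iSup_LamPart`). In degree `i`, the condition `α₁ < m` says `α₂ ≥ i + 1 - m`, so `B_i` is the step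
`i + 1 - m` of a filtration `Fil` of `D_i` (`B_eq`). A contraction destroys at most one factor of
`Q`. Multiplication by `t` destroys none and lowers the exponent of `T` by one. So `d` lowers the
filtration by at most one, and `B` is a subcomplex (`gdiff_mem_Fil`).

Exactness rests on three facts. (1) `D` is locally exact in positive degrees. Off the diagonal some
`φ(m) ≠ 0`, and multiplication by `m` is a homotopy. At the diagonal all but one of the coordinates
of `φ` are independent coordinates on a slice, and `t` has coefficient one in the remaining
direction. Integration in `T` removes `T` together with this direction. What is left is a Koszul
complex on coordinate functions, contracted by Euler's formula (`exists_primitive_of_coordinates`).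
(2) At a point where `w₁, w₂` are independent, `D/B` is exact in degrees `1, …, 2m - 2`
(`exists_sub_gdiff_mem_Fil`). On the graded pieces of the filtration only multiplication by `t`
matters. Its exactness becomes a linear recursion for highest weight vectors, solved by dividing by
`w₂` (`exists_sub_mul_mem_filQ`). The induction starts because the exterior power of degree `d` lies
entirely in step `d - m`. (3) Exactness of a family of complexes of finite-dimensional spaces at two
consecutive spots over one point spreads to a neighbourhood, by homotopies and adjugates
(`exists_lift_of_exact_at`).

Now a cycle of `B` bounds some `r₁` in `D`. This `r₁` is a cycle of `D/B`, so a boundary corrects it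
into `B` (`exists_primitive_of_exact`). Fact (2) is used in two consecutive degrees, which gives the
upper limit of the range.

For the passage to `X × X`, every pair of points has representatives with `w₁, w₂` independent and
`u = 1` or `u ∉ P` (`exists_adapted_representatives`). A neighbourhood is parametrized by an affine
space through explicit symplectic matrices, primitives are found among polynomial functions there,
and the action of `P × P` turns them into equivariant sections (`exists_section_primitive`). -/

noncomputable section

namespace TateModel

/-! ### Derivations of exterior algebras -/

section Derivation

variable {k : Type*} [Field k] {E : Type*} [AddCommGroup E] [Module k E]

open ExteriorAlgebra in
/-- The algebra map `ι m ↦ ι m + ε ι (A m)` into the dual numbers over the exterior algebra. -/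
def dualLift (A : E →ₗ[k] E) :
    ExteriorAlgebra k E →ₐ[k] TrivSqZeroExt (ExteriorAlgebra k E) (ExteriorAlgebra k E) :=
  lift k ⟨(TrivSqZeroExt.inlAlgHom k (ExteriorAlgebra k E) (ExteriorAlgebra k E)).toLinearMap.comp
      (ι k) + (TrivSqZeroExt.inrHom (ExteriorAlgebra k E) (ExteriorAlgebra k E)).restrictScalars k
        ∘ₗ (ι k) ∘ₗ A, fun m => by
    ext
    · simp
    · simp [ι_add_mul_swap]⟩

/-- The derivation of the exterior algebra that extends an endomorphism of the module. -/
def der (A : E →ₗ[k] E) : ExteriorAlgebra k E →ₗ[k] ExteriorAlgebra k E :=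
  (TrivSqZeroExt.sndHom (ExteriorAlgebra k E) (ExteriorAlgebra k E)).restrictScalars k
    ∘ₗ (dualLift A).toLinearMap

theorem fst_dualLift (A : E →ₗ[k] E) (x : ExteriorAlgebra k E) : (dualLift A x).fst = x := by
  have : (TrivSqZeroExt.fstHom k (ExteriorAlgebra k E) (ExteriorAlgebra k E)).comp (dualLift A)
      = AlgHom.id k _ := by
    apply ExteriorAlgebra.hom_ext
    ext m
    simp [dualLift]
  exact congrArg (fun f => f x) this

/-- Multiplicativity of `dualLift`, read off in the `ε`-component. -/
theorem der_mul (A : E →ₗ[k] E) (x y : ExteriorAlgebra k E) :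
    der A (x * y) = der A x * y + x * der A y := by
  simp [der, fst_dualLift, add_comm]

@[simp]
theorem der_ι (A : E →ₗ[k] E) (m : E) :
    der A (ExteriorAlgebra.ι k m) = ExteriorAlgebra.ι k (A m) := by
  simp [der, dualLift]

@[simp]
theorem der_algebraMap (A : E →ₗ[k] E) (r : k) : der A (algebraMap k _ r) = 0 := by
  simp only [der, LinearMap.comp_apply, AlgHom.toLinearMap_apply, AlgHom.commutes]
  rfl

theorem der_ι_mul (A : E →ₗ[k] E) (m : E) (x : ExteriorAlgebra k E) :
    der A (ExteriorAlgebra.ι k m * x) =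
      ExteriorAlgebra.ι k (A m) * x + ExteriorAlgebra.ι k m * der A x := by
  rw [der_mul, der_ι]

theorem exterior_induction {p : ExteriorAlgebra k E → Prop}
    (algebraMap : ∀ r : k, p (algebraMap _ _ r)) (add : ∀ x y, p x → p y → p (x + y))
    (ι_mul : ∀ x m, p x → p (ExteriorAlgebra.ι k m * x)) : ∀ x, p x :=
  CliffordAlgebra.left_induction 0 algebraMap add ι_mul

theorem der_comm (A B : E →ₗ[k] E) (x : ExteriorAlgebra k E) :
    der A (der B x) = der B (der A x) + der (A ∘ₗ B - B ∘ₗ A) x := by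
  induction x using exterior_induction with
  | algebraMap r => simp
  | add x y hx hy => simp only [map_add, hx, hy]; abel
  | ι_mul x m hx =>
    simp only [der_ι_mul, map_add, hx, LinearMap.sub_apply, LinearMap.comp_apply, map_sub]
    noncomm_ring

local notation:70 φ "⌋" x:70 => CliffordAlgebra.contractLeft (Q := (0 : QuadraticForm k _)) φ x

theorem contract_ι_mul (φ : Module.Dual k E) (m : E) (x : ExteriorAlgebra k E) :
    φ⌋(ExteriorAlgebra.ι k m * x) = φ m • x - ExteriorAlgebra.ι k m * (φ⌋x) :=
  CliffordAlgebra.contractLeft_ι_mul _ _ _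

/-- Infinitesimal form of the naturality of contraction under `1 + εA`; the second term is the
effect of `A` on the form. -/
theorem contract_der (φ : Module.Dual k E) (A : E →ₗ[k] E) (x : ExteriorAlgebra k E) :
    φ⌋(der A x) = der A (φ⌋x) + (φ ∘ₗ A)⌋x := by
  induction x using exterior_induction with
  | algebraMap r =>
    simp only [der_algebraMap, map_zero]
    erw [CliffordAlgebra.contractLeft_algebraMap, CliffordAlgebra.contractLeft_algebraMap]
    rw [map_zero, add_zero]
  | add x y hx hy => simp only [map_add, hx, hy]; abel
  | ι_mul x m hx =>
    simp only [der_ι_mul, map_add, contract_ι_mul, hx, LinearMap.comp_apply, map_sub, map_smul,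
      mul_add]
    abel

theorem contract_comm (φ ψ : Module.Dual k E) (x : ExteriorAlgebra k E) :
    φ⌋(ψ⌋x) = -(ψ⌋(φ⌋x)) :=
  CliffordAlgebra.contractLeft_comm _ _ _

theorem contract_contract (φ : Module.Dual k E) (x : ExteriorAlgebra k E) :
    φ⌋(φ⌋x) = 0 :=
  CliffordAlgebra.contractLeft_contractLeft _ _

theorem contract_algebraMap (φ : Module.Dual k E) (r : k) :
    φ⌋(algebraMap k (ExteriorAlgebra k E) r) = 0 :=
  CliffordAlgebra.contractLeft_algebraMap _ _ _

theorem ι_mul_mem (m : E) {d : ℕ} {x : ExteriorAlgebra k E} (hx : x ∈ ⋀[k]^d E) :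
    ExteriorAlgebra.ι k m * x ∈ ⋀[k]^(d + 1) E := by
  rw [ExteriorAlgebra.exteriorPower, pow_succ']
  exact Submodule.mul_mem_mul ⟨m, rfl⟩ hx

theorem algebraMap_mem (r : k) : algebraMap k (ExteriorAlgebra k E) r ∈ ⋀[k]^0 E := by
  rw [ExteriorAlgebra.exteriorPower, pow_zero]
  exact Submodule.mem_one.2 ⟨r, rfl⟩

/-- Induction over the elements of an exterior power. -/
@[elab_as_elim]
theorem exteriorPower_induction {p : ∀ (d : ℕ) (x : ExteriorAlgebra k E), x ∈ ⋀[k]^d E → Prop}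
    (algebraMap : ∀ r : k, p 0 (algebraMap _ _ r) (algebraMap_mem r))
    (add : ∀ d x y hx hy, p d x hx → p d y hy → p d (x + y) (add_mem hx hy))
    (ι_mul : ∀ d x m, ∀ hx : x ∈ ⋀[k]^d E, p d x hx →
      p (d + 1) (ExteriorAlgebra.ι k m * x) (ι_mul_mem m hx))
    (d : ℕ) (x : ExteriorAlgebra k E) (hx : x ∈ ⋀[k]^d E) : p d x hx := by
  induction d generalizing x with
  | zero =>
    have hx' := hx
    rw [ExteriorAlgebra.exteriorPower, pow_zero, Submodule.mem_one] at hx'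
    obtain ⟨r, rfl⟩ := hx'
    exact algebraMap r
  | succ d ih =>
    suffices h : ∃ hx, p (d + 1) x hx from h.2
    rw [ExteriorAlgebra.exteriorPower, pow_succ'] at hx
    induction hx using Submodule.mul_induction_on' with
    | mem_mul_mem m hm n hn =>
      obtain ⟨m, rfl⟩ := hm
      exact ⟨_, ι_mul d n m hn (ih n hn)⟩
    | add x _ y _ hx hy => exact ⟨_, add _ _ _ _ _ hx.2 hy.2⟩

theorem der_mem (A : E →ₗ[k] E) {d : ℕ} {x : ExteriorAlgebra k E} (hx : x ∈ ⋀[k]^d E) :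
    der A x ∈ ⋀[k]^d E := by
  induction d, x, hx using exteriorPower_induction with
  | algebraMap r => simp
  | add d x y _ _ hx hy => rw [map_add]; exact add_mem hx hy
  | ι_mul d x m hm hx =>
    rw [der_ι_mul]
    exact add_mem (ι_mul_mem _ hm) (ι_mul_mem _ hx)

theorem contract_mem (φ : Module.Dual k E) {d : ℕ} {x : ExteriorAlgebra k E}
    (hx : x ∈ ⋀[k]^(d + 1) E) : φ⌋x ∈ ⋀[k]^d E := by
  -- Degree zero is carried along: when `x` is a scalar, the contraction of `ι m * x` involves the
  -- contraction of `x`, which has to vanish.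
  suffices h : ∀ d x, x ∈ ⋀[k]^d E → (d = 0 → φ⌋x = 0) ∧ ∀ c, d = c + 1 → φ⌋x ∈ ⋀[k]^c E from
    (h _ _ hx).2 d rfl
  intro d x hx
  induction d, x, hx using exteriorPower_induction with
  | algebraMap r => simp
  | add d x y _ _ hx hy =>
    refine ⟨fun h => by rw [map_add, hx.1 h, hy.1 h, add_zero], fun c hc => ?_⟩
    rw [map_add]
    exact add_mem (hx.2 c hc) (hy.2 c hc)
  | ι_mul d x m hm hx =>
    refine ⟨fun h => by omega, fun c hc => ?_⟩
    obtain rfl : d = c := by omega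
    rw [contract_ι_mul]
    refine sub_mem (Submodule.smul_mem _ _ hm) ?_
    rcases d with _ | d
    · rw [hx.1 rfl, mul_zero]; exact zero_mem _
    · exact ι_mul_mem _ (hx.2 d rfl)

theorem contract_zero (φ : Module.Dual k E) {x : ExteriorAlgebra k E}
    (hx : x ∈ ⋀[k]^0 E) : φ⌋x = 0 := by
  rw [ExteriorAlgebra.exteriorPower, pow_zero, Submodule.mem_one] at hx
  obtain ⟨r, rfl⟩ := hx
  exact contract_algebraMap _ _

theorem map_contract {E' : Type*} [AddCommGroup E'] [Module k E'] (f : E →ₗ[k] E')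
    (φ : Module.Dual k E') (x : ExteriorAlgebra k E) :
    φ⌋(ExteriorAlgebra.map f x) = ExteriorAlgebra.map f ((φ ∘ₗ f)⌋x) := by
  induction x using exterior_induction with
  | algebraMap r => simp only [AlgHom.commutes, contract_algebraMap, map_zero]
  | add x y hx hy => simp only [map_add, hx, hy]
  | ι_mul x m hx =>
    simp only [map_mul, ExteriorAlgebra.map_apply_ι, contract_ι_mul, hx, map_sub, map_smul,
      LinearMap.comp_apply]

instance [FiniteDimensional k E] : FiniteDimensional k (ExteriorAlgebra k E) :=
  Module.Finite.of_basis (Module.finBasis k E).ExteriorAlgebra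

end Derivation

/-! ### Representations of `sl₂` -/

section SL2

variable {k : Type*} [Field k] {L : Type*} [AddCommGroup L] [Module k L]

/-- The commutation relations of `sl₂`. -/
structure IsSL2 (E F H : L →ₗ[k] L) : Prop where
  ef : ∀ x, E (F x) = F (E x) + H x
  he : ∀ x, H (E x) = E (H x) + (2 : k) • E x
  hf : ∀ x, H (F x) = F (H x) - (2 : k) • F x

variable {E F H : L →ₗ[k] L} (h : IsSL2 E F H)
include h

theorem IsSL2.h_pow_e {x : L} {ν : k} (hx : H x = ν • x) (a : ℕ) :
    H ((E ^ a) x) = (ν + 2 * a) • (E ^ a) x := by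
  induction a with
  | zero => simp [hx]
  | succ a ih =>
    rw [pow_succ', Module.End.mul_apply, h.he, ih, map_smul, ← add_smul]
    push_cast; congr 1; ring

theorem IsSL2.h_pow_f {x : L} {ν : k} (hx : H x = ν • x) (a : ℕ) :
    H ((F ^ a) x) = (ν - 2 * a) • (F ^ a) x := by
  induction a with
  | zero => simp [hx]
  | succ a ih =>
    rw [pow_succ', Module.End.mul_apply, h.hf, ih, map_smul, ← sub_smul]
    push_cast; congr 1; ring

theorem IsSL2.pow_e_f {x : L} {ν : k} (hx : H x = ν • x) (a : ℕ) :
    (E ^ (a + 1)) (F x) = F ((E ^ (a + 1)) x) + ((a + 1) * (ν + a)) • (E ^ a) x := by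
  induction a with
  | zero => simp [h.ef, hx]
  | succ a ih =>
    rw [pow_succ', Module.End.mul_apply, ih, map_add, h.ef, h.h_pow_e hx, map_smul,
      ← Module.End.mul_apply E (E ^ a), ← Module.End.mul_apply E (E ^ (a + 1)), ← pow_succ',
      ← pow_succ', add_assoc, ← add_smul]
    push_cast; congr 2; ring

theorem IsSL2.e_pow_f {y : L} {r : k} (hE : E y = 0) (hy : H y = r • y) (a : ℕ) :
    E ((F ^ (a + 1)) y) = ((a + 1) * (r - a)) • (F ^ a) y := by
  induction a with
  | zero => simp [h.ef, hy, hE]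
  | succ a ih =>
    rw [pow_succ', Module.End.mul_apply, h.ef, ih, map_smul, h.h_pow_f hy,
      ← Module.End.mul_apply F (F ^ a), ← pow_succ', ← add_smul]
    push_cast; congr 1; ring

omit h in
/-- The scalar by which `E ^ a F ^ a` acts on highest weight vectors of weight `r`. -/
def hwScalar (k : Type*) [Field k] (r : k) (a : ℕ) : k :=
  ∏ j ∈ Finset.range a, ((j + 1 : k) * (r - j))

theorem IsSL2.pow_e_pow_f {y : L} {r : k} (hE : E y = 0) (hy : H y = r • y) (a : ℕ) :
    (E ^ a) ((F ^ a) y) = hwScalar k r a • y := by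
  induction a with
  | zero => simp [hwScalar]
  | succ a ih =>
    rw [pow_succ, Module.End.mul_apply, h.e_pow_f hE hy, map_smul, ih, hwScalar, hwScalar,
      Finset.prod_range_succ, smul_smul, mul_comm]

omit h in
theorem hwScalar_ne_zero [CharZero k] {r a : ℕ} (ha : a ≤ r) : hwScalar k (r : k) a ≠ 0 := by
  refine Finset.prod_ne_zero_iff.2 fun j hj => mul_ne_zero ?_ ?_
  · exact_mod_cast Nat.succ_ne_zero j
  · rw [Finset.mem_range] at hj
    rw [sub_ne_zero]
    exact_mod_cast (by omega : r ≠ j)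

/-- Classical surjectivity of `E` onto positive weights, for vectors killed by a power of `E`. If `E
^ (a + 1)` kills `x`, then by `IsSL2.pow_e_f` the vectors `E (F x)` and `c x`, with `c = (a + 1)(ν +
a) ≠ 0`, have the same image under `E ^ a`. Induction therefore puts their difference into the image
of `E`. The stable subspace `S` serves to control the degree of the preimage. -/
theorem IsSL2.exists_e_eq [CharZero k] {S : Submodule k L} (hSE : ∀ x ∈ S, E x ∈ S)
    (hSF : ∀ x ∈ S, F x ∈ S) {ν : ℕ} (hν : 1 ≤ ν) (a : ℕ) {x : L} (hxS : x ∈ S)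
    (hx : H x = (ν : k) • x) (hE : (E ^ a) x = 0) : ∃ z ∈ S, E z = x := by
  induction a generalizing x with
  | zero =>
    rw [pow_zero, Module.End.one_apply] at hE
    exact ⟨0, zero_mem _, by rw [map_zero, hE]⟩
  | succ a ih =>
    set c : k := (a + 1) * (ν + a) with hc
    have hc0 : c ≠ 0 := by
      rw [hc]
      exact mul_ne_zero (by exact_mod_cast Nat.succ_ne_zero a)
        (by exact_mod_cast (by omega : ν + a ≠ 0))
    have hHF : H (E (F x)) = (ν : k) • E (F x) := by
      rw [h.he, h.hf, hx]
      simp only [map_sub, map_smul]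
      abel
    have hEF : (E ^ a) (E (F x)) = c • (E ^ a) x := by
      have := h.pow_e_f hx a
      rw [hE, map_zero, zero_add] at this
      rw [← this, pow_succ, Module.End.mul_apply]
    obtain ⟨z, hzS, hz⟩ := ih (x := E (F x) - c • x)
      (sub_mem (hSE _ (hSF _ hxS)) (S.smul_mem _ hxS))
      (by rw [map_sub, map_smul, hHF, hx, smul_sub, smul_comm c])
      (by rw [map_sub, map_smul, hEF, sub_self])
    refine ⟨c⁻¹ • (F x - z), S.smul_mem _ (sub_mem (hSF _ hxS) hzS), ?_⟩
    rw [map_smul, map_sub, hz, sub_sub_cancel, smul_smul, inv_mul_cancel₀ hc0, one_smul]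

end SL2

end TateModel

end

/-! ### The exterior algebra of `k² ⊗ W` as a representation of `sl₂` -/

noncomputable section

namespace TateModel

section Model

variable {k : Type*} [Field k] {W : Type*} [AddCommGroup W] [Module k W]

local notation:70 φ "⌋" x:70 => CliffordAlgebra.contractLeft (Q := (0 : QuadraticForm k _)) φ x

variable (k W) in
/-- The exterior algebra of `k² ⊗ W = W × W`. -/
abbrev Lam2 : Type _ := ExteriorAlgebra k (W × W)

variable (k) in
/-- The element `v₁ ⊗ f` of the exterior algebra. -/
def av : W →ₗ[k] Lam2 k W := ExteriorAlgebra.ι k ∘ₗ LinearMap.inl k W W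

variable (k) in
/-- The element `v₂ ⊗ f` of the exterior algebra. -/
def cv : W →ₗ[k] Lam2 k W := ExteriorAlgebra.ι k ∘ₗ LinearMap.inr k W W

theorem ι_eq (m : W × W) : ExteriorAlgebra.ι k m = av k m.1 + cv k m.2 := by
  simp only [av, cv, LinearMap.comp_apply, ← map_add]
  simp

theorem model_induction {p : Lam2 k W → Prop}
    (algebraMap : ∀ r : k, p (algebraMap _ _ r)) (add : ∀ x y, p x → p y → p (x + y))
    (a_mul : ∀ x f, p x → p (av k f * x)) (c_mul : ∀ x f, p x → p (cv k f * x)) : ∀ x, p x := by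
  refine exterior_induction algebraMap add fun x m hx => ?_
  rw [ι_eq, add_mul]
  exact add _ _ (a_mul _ _ hx) (c_mul _ _ hx)

theorem av_mul_av (f g : W) : av k f * av k g = -(av k g * av k f) :=
  eq_neg_of_add_eq_zero_left (ExteriorAlgebra.ι_add_mul_swap _ _)

theorem av_mul_cv (f g : W) : av k f * cv k g = -(cv k g * av k f) :=
  eq_neg_of_add_eq_zero_left (ExteriorAlgebra.ι_add_mul_swap _ _)

theorem cv_mul_av (f g : W) : cv k f * av k g = -(av k g * cv k f) :=
  eq_neg_of_add_eq_zero_left (ExteriorAlgebra.ι_add_mul_swap _ _)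

theorem cv_mul_cv (f g : W) : cv k f * cv k g = -(cv k g * cv k f) :=
  eq_neg_of_add_eq_zero_left (ExteriorAlgebra.ι_add_mul_swap _ _)

theorem av_mul_self (f : W) : av k f * av k f = 0 := ExteriorAlgebra.ι_sq_zero _

theorem cv_mul_self (f : W) : cv k f * cv k f = 0 := ExteriorAlgebra.ι_sq_zero _

theorem av_mul_av_mul (f g : W) (x : Lam2 k W) : av k f * (av k g * x) = -(av k g * (av k f * x)) := by
  rw [← mul_assoc, av_mul_av, neg_mul, mul_assoc]

theorem av_mul_cv_mul (f g : W) (x : Lam2 k W) : av k f * (cv k g * x) = -(cv k g * (av k f * x)) := by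
  rw [← mul_assoc, av_mul_cv, neg_mul, mul_assoc]

theorem av_mul_self_mul (f : W) (x : Lam2 k W) : av k f * (av k f * x) = 0 := by
  rw [← mul_assoc, av_mul_self, zero_mul]

theorem av_mul_mem (f : W) {d : ℕ} {x : Lam2 k W} (hx : x ∈ ⋀[k]^d (W × W)) :
    av k f * x ∈ ⋀[k]^(d + 1) (W × W) := ι_mul_mem _ hx

theorem cv_mul_mem (f : W) {d : ℕ} {x : Lam2 k W} (hx : x ∈ ⋀[k]^d (W × W)) :
    cv k f * x ∈ ⋀[k]^(d + 1) (W × W) := ι_mul_mem _ hx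

variable (k W) in
/-- The raising operator of `sl₂`. -/
def opE : Module.End k (Lam2 k W) := der (LinearMap.inl k W W ∘ₗ LinearMap.snd k W W)

variable (k W) in
/-- The lowering operator of `sl₂`. -/
def opF : Module.End k (Lam2 k W) := der (LinearMap.inr k W W ∘ₗ LinearMap.fst k W W)

variable (k W) in
/-- The semisimple element of `sl₂`. -/
def opH : Module.End k (Lam2 k W) :=
  der (LinearMap.inl k W W ∘ₗ LinearMap.fst k W W - LinearMap.inr k W W ∘ₗ LinearMap.snd k W W)

@[simp] theorem opE_algebraMap (r : k) : opE k W (algebraMap k _ r) = 0 := der_algebraMap _ _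
@[simp] theorem opF_algebraMap (r : k) : opF k W (algebraMap k _ r) = 0 := der_algebraMap _ _
@[simp] theorem opH_algebraMap (r : k) : opH k W (algebraMap k _ r) = 0 := der_algebraMap _ _

theorem opE_mul (x y : Lam2 k W) : opE k W (x * y) = opE k W x * y + x * opE k W y := der_mul _ _ _
theorem opF_mul (x y : Lam2 k W) : opF k W (x * y) = opF k W x * y + x * opF k W y := der_mul _ _ _
theorem opH_mul (x y : Lam2 k W) : opH k W (x * y) = opH k W x * y + x * opH k W y := der_mul _ _ _

@[simp] theorem opE_av (f : W) : opE k W (av k f) = 0 := by simp [opE, av]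
@[simp] theorem opE_cv (f : W) : opE k W (cv k f) = av k f := by simp [opE, av, cv]
@[simp] theorem opF_av (f : W) : opF k W (av k f) = cv k f := by simp [opF, av, cv]
@[simp] theorem opF_cv (f : W) : opF k W (cv k f) = 0 := by simp [opF, cv]
@[simp] theorem opH_av (f : W) : opH k W (av k f) = av k f := by simp [opH, av]
@[simp] theorem opH_cv (f : W) : opH k W (cv k f) = -cv k f := by
  rw [opH, cv, LinearMap.comp_apply, der_ι, ← map_neg]; simp

theorem opE_av_mul (f : W) (x : Lam2 k W) : opE k W (av k f * x) = av k f * opE k W x := by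
  rw [opE_mul, opE_av, zero_mul, zero_add]

theorem opE_cv_mul (f : W) (x : Lam2 k W) :
    opE k W (cv k f * x) = av k f * x + cv k f * opE k W x := by
  rw [opE_mul, opE_cv]

theorem opF_av_mul (f : W) (x : Lam2 k W) :
    opF k W (av k f * x) = cv k f * x + av k f * opF k W x := by
  rw [opF_mul, opF_av]

theorem opF_cv_mul (f : W) (x : Lam2 k W) : opF k W (cv k f * x) = cv k f * opF k W x := by
  rw [opF_mul, opF_cv, zero_mul, zero_add]

theorem isSL2 : IsSL2 (opE k W) (opF k W) (opH k W) where
  ef x := by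
    rw [opE, opF, opH, der_comm]
    congr 3
  he x := by
    rw [opE, opH, der_comm, add_right_inj]
    have h2 : ∀ y : Lam2 k W, (2 : k) • y = y + y := fun y => two_smul k y
    have : ((LinearMap.inl k W W ∘ₗ LinearMap.fst k W W - LinearMap.inr k W W ∘ₗ
        LinearMap.snd k W W) ∘ₗ LinearMap.inl k W W ∘ₗ LinearMap.snd k W W -
      (LinearMap.inl k W W ∘ₗ LinearMap.snd k W W) ∘ₗ (LinearMap.inl k W W ∘ₗ
        LinearMap.fst k W W - LinearMap.inr k W W ∘ₗ LinearMap.snd k W W)) =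
        (2 : k) • (LinearMap.inl k W W ∘ₗ LinearMap.snd k W W) := by
      ext <;> simp [two_smul]
    rw [this]
    induction x using exterior_induction with
    | algebraMap r => simp
    | add x y hx hy => simp only [map_add, hx, hy, smul_add]
    | ι_mul x m hx => simp only [der_ι_mul, hx, LinearMap.smul_apply, map_smul, smul_add,
        smul_mul_assoc, mul_smul_comm]
  hf x := by
    rw [opF, opH, der_comm, sub_eq_add_neg (der _ (der _ x)), add_right_inj]
    have : ((LinearMap.inl k W W ∘ₗ LinearMap.fst k W W - LinearMap.inr k W W ∘ₗ
        LinearMap.snd k W W) ∘ₗ LinearMap.inr k W W ∘ₗ LinearMap.fst k W W -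
      (LinearMap.inr k W W ∘ₗ LinearMap.fst k W W) ∘ₗ (LinearMap.inl k W W ∘ₗ
        LinearMap.fst k W W - LinearMap.inr k W W ∘ₗ LinearMap.snd k W W)) =
        (-2 : k) • (LinearMap.inr k W W ∘ₗ LinearMap.fst k W W) := by
      ext <;> simp [two_smul, sub_eq_add_neg]
    rw [this]
    induction x using exterior_induction with
    | algebraMap r => simp
    | add x y hx hy => simp only [map_add, hx, hy, smul_add, neg_add]
    | ι_mul x m hx => simp only [der_ι_mul, hx, LinearMap.smul_apply, map_smul, smul_add,
        smul_mul_assoc, mul_smul_comm, neg_smul, neg_mul, mul_neg, neg_add, map_neg]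

theorem opE_mem {d : ℕ} {x : Lam2 k W} (hx : x ∈ ⋀[k]^d (W × W)) : opE k W x ∈ ⋀[k]^d (W × W) :=
  der_mem _ hx

theorem opF_mem {d : ℕ} {x : Lam2 k W} (hx : x ∈ ⋀[k]^d (W × W)) : opF k W x ∈ ⋀[k]^d (W × W) :=
  der_mem _ hx

theorem pow_opE_mem (a : ℕ) {d : ℕ} {x : Lam2 k W} (hx : x ∈ ⋀[k]^d (W × W)) :
    (opE k W ^ a) x ∈ ⋀[k]^d (W × W) := by
  induction a with
  | zero => exact hx
  | succ a ih => rw [pow_succ', Module.End.mul_apply]; exact opE_mem ih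

theorem pow_opF_mem (a : ℕ) {d : ℕ} {x : Lam2 k W} (hx : x ∈ ⋀[k]^d (W × W)) :
    (opF k W ^ a) x ∈ ⋀[k]^d (W × W) := by
  induction a with
  | zero => exact hx
  | succ a ih => rw [pow_succ', Module.End.mul_apply]; exact opF_mem ih

theorem pow_opE_av_mul (a : ℕ) (f : W) (x : Lam2 k W) :
    (opE k W ^ a) (av k f * x) = av k f * (opE k W ^ a) x := by
  induction a with
  | zero => rfl
  | succ a ih => rw [pow_succ', Module.End.mul_apply, ih, opE_av_mul, Module.End.mul_apply]

theorem pow_opE_cv_mul (a : ℕ) (f : W) (x : Lam2 k W) :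
    (opE k W ^ (a + 1)) (cv k f * x) =
      (a + 1 : k) • (av k f * (opE k W ^ a) x) + cv k f * (opE k W ^ (a + 1)) x := by
  induction a with
  | zero => simp [opE_cv_mul]
  | succ a ih =>
    rw [pow_succ', Module.End.mul_apply, ih, map_add, map_smul, opE_av_mul, opE_cv_mul,
      ← Module.End.mul_apply (opE k W), ← Module.End.mul_apply (opE k W), ← pow_succ',
      ← pow_succ']
    push_cast
    module

theorem pow_opF_cv_mul (a : ℕ) (f : W) (x : Lam2 k W) :
    (opF k W ^ a) (cv k f * x) = cv k f * (opF k W ^ a) x := by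
  induction a with
  | zero => rfl
  | succ a ih => rw [pow_succ', Module.End.mul_apply, ih, opF_cv_mul, Module.End.mul_apply]

theorem pow_opF_av_mul (a : ℕ) (f : W) (x : Lam2 k W) :
    (opF k W ^ (a + 1)) (av k f * x) =
      (a + 1 : k) • (cv k f * (opF k W ^ a) x) + av k f * (opF k W ^ (a + 1)) x := by
  induction a with
  | zero => simp [opF_av_mul]
  | succ a ih =>
    rw [pow_succ', Module.End.mul_apply, ih, map_add, map_smul, opF_cv_mul, opF_av_mul,
      ← Module.End.mul_apply (opF k W), ← Module.End.mul_apply (opF k W), ← pow_succ',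
      ← pow_succ']
    push_cast
    module

/-! ### The grading by the number of factors `v₂` -/

variable (k W) in
/-- The algebra map `v₁ ⊗ f ↦ v₁ ⊗ f`, `v₂ ⊗ f ↦ (v₂ ⊗ f) X`. -/
def split : Lam2 k W →ₐ[k] Polynomial (Lam2 k W) :=
  ExteriorAlgebra.lift k
    ⟨(Polynomial.monomial 0).restrictScalars k ∘ₗ av k ∘ₗ LinearMap.fst k W W +
      (Polynomial.monomial 1).restrictScalars k ∘ₗ cv k ∘ₗ LinearMap.snd k W W, fun m => by
      simp only [LinearMap.add_apply, LinearMap.comp_apply, LinearMap.coe_restrictScalars,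
        LinearMap.fst_apply, LinearMap.snd_apply, mul_add, add_mul,
        Polynomial.monomial_mul_monomial, av_mul_self, cv_mul_self, map_zero, zero_add, add_zero]
      rw [← map_add, av_mul_cv, add_neg_cancel, map_zero]⟩

/-- The component with `b` factors `v₂`. -/
def comp (b : ℕ) : Lam2 k W →ₗ[k] Lam2 k W :=
  (Polynomial.lcoeff (Lam2 k W) b).restrictScalars k ∘ₗ (split k W).toLinearMap

theorem split_av (f : W) : split k W (av k f) = Polynomial.monomial 0 (av k f) := by
  simp [split, av, cv]

theorem split_cv (f : W) : split k W (cv k f) = Polynomial.monomial 1 (cv k f) := by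
  simp [split, av, cv]

theorem comp_av_mul (b : ℕ) (f : W) (x : Lam2 k W) :
    comp b (av k f * x) = av k f * comp b x := by
  simp [comp, split_av]

theorem comp_cv_mul (b : ℕ) (f : W) (x : Lam2 k W) :
    comp (b + 1) (cv k f * x) = cv k f * comp b x := by
  simp only [comp, LinearMap.comp_apply, AlgHom.toLinearMap_apply, map_mul, split_cv,
    LinearMap.coe_restrictScalars, Polynomial.lcoeff_apply]
  exact Polynomial.coeff_monomial_mul _ _ _ _

theorem comp_zero_cv_mul (f : W) (x : Lam2 k W) : comp 0 (cv k f * x) = 0 := by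
  simp [comp, split_cv, Polynomial.mul_coeff_zero, Polynomial.coeff_monomial]

theorem comp_algebraMap (b : ℕ) (r : k) :
    comp b (algebraMap k (Lam2 k W) r) = if b = 0 then algebraMap k _ r else 0 := by
  simp only [comp, LinearMap.comp_apply, AlgHom.toLinearMap_apply, AlgHom.commutes,
    LinearMap.coe_restrictScalars, Polynomial.lcoeff_apply]
  rw [Polynomial.algebraMap_apply, Polynomial.coeff_C]

theorem comp_opE (b : ℕ) (x : Lam2 k W) : comp b (opE k W x) = opE k W (comp (b + 1) x) := by
  induction x using model_induction generalizing b with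
  | algebraMap r => simp [comp_algebraMap]
  | add x y hx hy => simp only [map_add, hx, hy]
  | a_mul x f hx => rw [opE_av_mul, comp_av_mul, comp_av_mul, opE_av_mul, hx]
  | c_mul x f hx =>
    rw [opE_cv_mul, map_add, comp_av_mul, comp_cv_mul, opE_cv_mul]
    rcases b with _ | b
    · rw [comp_zero_cv_mul, add_zero]
      have : opE k W (comp 0 x) = 0 := by
        clear hx
        induction x using model_induction with
        | algebraMap r => simp [comp_algebraMap]
        | add x y hx hy => simp only [map_add, hx, hy, add_zero]
        | a_mul x f hx => rw [comp_av_mul, opE_av_mul, hx, mul_zero]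
        | c_mul x f hx => rw [comp_zero_cv_mul, map_zero]
      rw [this, mul_zero, add_zero]
    · rw [comp_cv_mul, hx]

theorem opE_comp_zero (x : Lam2 k W) : opE k W (comp 0 x) = 0 := by
  induction x using model_induction with
  | algebraMap r => simp [comp_algebraMap]
  | add x y hx hy => simp only [map_add, hx, hy, add_zero]
  | a_mul x f hx => rw [comp_av_mul, opE_av_mul, hx, mul_zero]
  | c_mul x f hx => rw [comp_zero_cv_mul, map_zero]

theorem comp_opF (b : ℕ) (x : Lam2 k W) : comp (b + 1) (opF k W x) = opF k W (comp b x) := by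
  induction x using model_induction generalizing b with
  | algebraMap r => simp only [opF_algebraMap, map_zero, comp_algebraMap]; split_ifs <;> simp
  | add x y hx hy => simp only [map_add, hx, hy]
  | a_mul x f hx => rw [opF_av_mul, map_add, comp_cv_mul, comp_av_mul, comp_av_mul, opF_av_mul, hx]
  | c_mul x f hx =>
    rw [opF_cv_mul, comp_cv_mul]
    rcases b with _ | b
    · rw [comp_zero_cv_mul, map_zero]
      have : comp 0 (opF k W x) = 0 := by
        clear hx
        induction x using model_induction with
        | algebraMap r => simp
        | add x y hx hy => simp only [map_add, hx, hy, add_zero]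
        | a_mul x f hx => rw [opF_av_mul, map_add, comp_av_mul, hx, mul_zero, comp_zero_cv_mul,
            add_zero]
        | c_mul x f hx => rw [opF_cv_mul, comp_zero_cv_mul]
      rw [this, mul_zero]
    · rw [comp_cv_mul, hx, opF_cv_mul]

theorem comp_comp (b c : ℕ) (x : Lam2 k W) :
    comp b (comp c x) = if b = c then comp c x else 0 := by
  induction x using model_induction generalizing b c with
  | algebraMap r =>
    simp only [comp_algebraMap]
    split_ifs <;> simp_all [comp_algebraMap]
  | add x y hx hy => simp only [map_add, hx, hy]; split_ifs <;> simp
  | a_mul x f hx => rw [comp_av_mul, comp_av_mul, hx]; split_ifs <;> simp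
  | c_mul x f hx =>
    rcases c with _ | c
    · simp [comp_zero_cv_mul]
    · rw [comp_cv_mul]
      rcases b with _ | b
      · simp [comp_zero_cv_mul]
      · rw [comp_cv_mul, hx]
        simp only [add_left_inj]
        split_ifs <;> simp

theorem comp_mem (b : ℕ) {d : ℕ} {x : Lam2 k W} (hx : x ∈ ⋀[k]^d (W × W)) :
    comp b x ∈ ⋀[k]^d (W × W) := by
  induction d, x, hx using exteriorPower_induction generalizing b with
  | algebraMap r =>
    rw [comp_algebraMap]; split_ifs
    · exact algebraMap_mem _
    · exact zero_mem _
  | add d x y _ _ hx hy => rw [map_add]; exact add_mem (hx b) (hy b)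
  | ι_mul d x m hm hx =>
    rw [ι_eq, add_mul, map_add, comp_av_mul]
    refine add_mem (av_mul_mem _ (hx b)) ?_
    rcases b with _ | b
    · rw [comp_zero_cv_mul]; exact zero_mem _
    · rw [comp_cv_mul]; exact cv_mul_mem _ (hx b)

/-- A factor with `v₁` has weight `1`, a factor with `v₂` weight `-1`, and there are `d - b` and `b`
of them. -/
theorem opH_comp (b : ℕ) {d : ℕ} {x : Lam2 k W} (hx : x ∈ ⋀[k]^d (W × W)) :
    opH k W (comp b x) = (d - 2 * b : k) • comp b x := by
  induction d, x, hx using exteriorPower_induction generalizing b with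
  | algebraMap r =>
    rw [comp_algebraMap]; split_ifs with h
    · simp [h]
    · simp
  | add d x y _ _ hx hy => simp only [map_add, hx b, hy b, smul_add]
  | ι_mul d x m hm hx =>
    rw [ι_eq, add_mul, map_add, comp_av_mul, map_add, opH_mul, hx, opH_av, smul_add,
      mul_smul_comm]
    congr 1
    · rw [Nat.cast_succ]
      module
    · rcases b with _ | b
      · rw [comp_zero_cv_mul, map_zero, smul_zero]
      · rw [comp_cv_mul, opH_mul, opH_cv, hx, mul_smul_comm, neg_mul]
        push_cast
        module

theorem pow_opE_comp (a b : ℕ) (x : Lam2 k W) :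
    (opE k W ^ a) (comp (b + a) x) = comp b ((opE k W ^ a) x) := by
  induction a generalizing x with
  | zero => rfl
  | succ a ih =>
    rw [pow_succ, Module.End.mul_apply, Module.End.mul_apply, ← ih, ← add_assoc, comp_opE]

/-- Each application of `E` turns one `v₂` into a `v₁`, and only `b` of them are available. -/
theorem pow_opE_comp_eq_zero {a b : ℕ} (h : b < a) (x : Lam2 k W) :
    (opE k W ^ a) (comp b x) = 0 := by
  obtain ⟨c, rfl⟩ := Nat.exists_eq_add_of_lt h
  have := pow_opE_comp b 0 x
  rw [zero_add] at this
  rw [show b + c + 1 = c + (1 + b) by ring, pow_add, pow_add, Module.End.mul_apply,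
    Module.End.mul_apply, this, pow_one, opE_comp_zero, map_zero]

theorem comp_pow_opF (a b : ℕ) (x : Lam2 k W) :
    comp (b + a) ((opF k W ^ a) x) = (opF k W ^ a) (comp b x) := by
  induction a with
  | zero => rfl
  | succ a ih => rw [pow_succ', Module.End.mul_apply, Module.End.mul_apply, ← add_assoc, comp_opF,
      ih]

end Model

end TateModel

end

/-! ### Isotypic components and the filtration by powers of `Λ²V₂ ⊠ Sym² W` -/

noncomputable section

namespace TateModel

section Filtration

variable {k : Type*} [Field k] {W : Type*} [AddCommGroup W] [Module k W]

local notation:70 φ "⌋" x:70 => CliffordAlgebra.contractLeft (Q := (0 : QuadraticForm k _)) φ x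

/-- The element `(v₁ ∧ v₂) ⊠ f g` of `Λ² V₂ ⊠ Sym² W`. -/
def qv (f g : W) : Lam2 k W := av k f * cv k g + av k g * cv k f

theorem qv_mul_av (f g h : W) : qv (k := k) f g * av k h = av k h * qv f g := by
  simp only [qv, add_mul, mul_add, mul_assoc, cv_mul_av _ h, mul_neg]
  rw [← mul_assoc, ← mul_assoc, av_mul_av f h, av_mul_av g h]
  noncomm_ring

theorem qv_mul_cv (f g h : W) : qv (k := k) f g * cv k h = cv k h * qv f g := by
  simp only [qv, add_mul, mul_add, mul_assoc, cv_mul_cv _ h, mul_neg]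
  rw [← mul_assoc, ← mul_assoc, av_mul_cv f h, av_mul_cv g h]
  noncomm_ring

theorem opE_qv (f g : W) : opE k W (qv f g) = 0 := by
  simp only [qv, map_add, opE_av_mul, opE_cv]
  rw [av_mul_av, neg_add_cancel]

theorem opF_qv (f g : W) : opF k W (qv f g) = 0 := by
  simp only [qv, map_add, opF_av_mul, opF_cv, mul_zero, add_zero]
  rw [cv_mul_cv, neg_add_cancel]

theorem comp_qv_mul (b : ℕ) (f g : W) (x : Lam2 k W) :
    comp (b + 1) (qv f g * x) = qv f g * comp b x := by
  simp only [qv, add_mul, mul_assoc, map_add, comp_av_mul, comp_cv_mul]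

theorem comp_zero_qv_mul (f g : W) (x : Lam2 k W) : comp 0 (qv f g * x) = 0 := by
  simp only [qv, add_mul, mul_assoc, map_add, comp_av_mul, comp_zero_cv_mul, mul_zero, add_zero]

variable (k W) in
/-- The span `Λ² V₂ ⊠ Sym² W` of the elements `qv f g`. -/
def Qspan : Submodule k (Lam2 k W) := Submodule.span k (Set.range fun p : W × W => qv p.1 p.2)

variable (k W) in
/-- The span of highest weight vectors `Q ^ β (v₁ ⊗ W) ^ r`. -/
def gen (β r : ℕ) : Submodule k (Lam2 k W) := Qspan k W ^ β * LinearMap.range (av k (W := W)) ^ r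

theorem qv_mem_Qspan (f g : W) : qv f g ∈ Qspan k W := Submodule.subset_span ⟨(f, g), rfl⟩

theorem gen_succ_left (β r : ℕ) : gen k W (β + 1) r = Qspan k W * gen k W β r := by
  rw [gen, gen, pow_succ', mul_assoc]

theorem gen_zero_succ (r : ℕ) :
    gen k W 0 (r + 1) = LinearMap.range (av k (W := W)) * gen k W 0 r := by
  rw [gen, gen, pow_zero, one_mul, one_mul, pow_succ']

theorem gen_zero_zero : gen k W 0 0 = 1 := by
  rw [gen, pow_zero, pow_zero, one_mul]

theorem qv_mul_gen (f g : W) {β r : ℕ} {x : Lam2 k W} (hx : x ∈ gen k W β r) :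
    qv f g * x ∈ gen k W (β + 1) r := by
  rw [gen_succ_left]
  exact Submodule.mul_mem_mul (qv_mem_Qspan f g) hx

/-- Induction over the highest weight vectors `Q ^ β (v₁ ⊗ W) ^ r`. -/
@[elab_as_elim]
theorem gen_induction {p : ∀ (β r : ℕ) (x : Lam2 k W), x ∈ gen k W β r → Prop}
    (zero : ∀ β r, p β r 0 (zero_mem _))
    (add : ∀ β r x y hx hy, p β r x hx → p β r y hy → p β r (x + y) (add_mem hx hy))
    (algebraMap : ∀ c : k, p 0 0 (algebraMap k _ c)
      (by rw [gen_zero_zero]; exact Submodule.mem_one.2 ⟨c, rfl⟩))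
    (a_mul : ∀ r f x, ∀ hx : x ∈ gen k W 0 r, p 0 r x hx → p 0 (r + 1) (av k f * x)
      (by rw [gen_zero_succ]; exact Submodule.mul_mem_mul ⟨f, rfl⟩ hx))
    (q_mul : ∀ β r f g x, ∀ hx : x ∈ gen k W β r, p β r x hx →
      p (β + 1) r (qv f g * x) (qv_mul_gen f g hx))
    (β r : ℕ) (x : Lam2 k W) (hx : x ∈ gen k W β r) : p β r x hx := by
  induction β generalizing x with
  | zero =>
    induction r generalizing x with
    | zero =>
      have hx' := hx
      rw [gen_zero_zero, Submodule.mem_one] at hx'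
      obtain ⟨c, rfl⟩ := hx'
      exact algebraMap c
    | succ r ih =>
      suffices h : ∃ hx, p 0 (r + 1) x hx from h.2
      rw [gen_zero_succ] at hx
      induction hx using Submodule.mul_induction_on' with
      | mem_mul_mem m hm n hn =>
        obtain ⟨m, rfl⟩ := hm
        exact ⟨_, a_mul r m n hn (ih n hn)⟩
      | add x _ y _ hx hy => exact ⟨_, add _ _ _ _ _ _ hx.2 hy.2⟩
  | succ β ih =>
    suffices h : ∃ hx, p (β + 1) r x hx from h.2
    rw [gen_succ_left] at hx
    induction hx using Submodule.mul_induction_on' with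
    | mem_mul_mem m hm n hn =>
      induction hm using Submodule.span_induction generalizing n with
      | mem m hm =>
        obtain ⟨m, rfl⟩ := hm
        exact ⟨_, q_mul β r m.1 m.2 n hn (ih n hn)⟩
      | zero =>
        suffices h : ∀ z, z = 0 → ∃ hx, p (β + 1) r z hx from h _ (zero_mul n)
        rintro z rfl
        exact ⟨_, zero _ _⟩
      | add x y _ _ hx hy =>
        suffices h : ∀ z, z = x * n + y * n → ∃ hx, p (β + 1) r z hx from h _ (add_mul x y n)
        rintro z rfl
        exact ⟨_, add _ _ _ _ _ _ (hx n hn).2 (hy n hn).2⟩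
      | smul c x _ hx =>
        suffices h : ∀ z, z = x * (c • n) → ∃ hx, p (β + 1) r z hx from
          h _ (by rw [smul_mul_assoc, mul_smul_comm])
        rintro z rfl
        exact hx _ (Submodule.smul_mem _ c hn)
    | add x _ y _ hx hy => exact ⟨_, add _ _ _ _ _ _ hx.2 hy.2⟩

theorem opE_qv_mul (f g : W) (x : Lam2 k W) : opE k W (qv f g * x) = qv f g * opE k W x := by
  rw [opE_mul, opE_qv, zero_mul, zero_add]

theorem opF_qv_mul (f g : W) (x : Lam2 k W) : opF k W (qv f g * x) = qv f g * opF k W x := by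
  rw [opF_mul, opF_qv, zero_mul, zero_add]

theorem pow_opE_qv_mul (a : ℕ) (f g : W) (x : Lam2 k W) :
    (opE k W ^ a) (qv f g * x) = qv f g * (opE k W ^ a) x := by
  induction a with
  | zero => rfl
  | succ a ih => rw [pow_succ', Module.End.mul_apply, ih, opE_qv_mul, Module.End.mul_apply]

theorem pow_opF_qv_mul (a : ℕ) (f g : W) (x : Lam2 k W) :
    (opF k W ^ a) (qv f g * x) = qv f g * (opF k W ^ a) x := by
  induction a with
  | zero => rfl
  | succ a ih => rw [pow_succ', Module.End.mul_apply, ih, opF_qv_mul, Module.End.mul_apply]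

theorem qv_mul_mem (f g : W) {d : ℕ} {x : Lam2 k W} (hx : x ∈ ⋀[k]^d (W × W)) :
    qv f g * x ∈ ⋀[k]^(d + 2) (W × W) := by
  rw [qv, add_mul, mul_assoc, mul_assoc]
  exact add_mem (av_mul_mem _ (cv_mul_mem _ hx)) (av_mul_mem _ (cv_mul_mem _ hx))

theorem opE_gen {β r : ℕ} {x : Lam2 k W} (hx : x ∈ gen k W β r) : opE k W x = 0 := by
  induction β, r, x, hx using gen_induction with
  | zero => exact map_zero _
  | add β r x y _ _ hx hy => rw [map_add, hx, hy, add_zero]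
  | algebraMap c => exact opE_algebraMap c
  | a_mul r f x _ hx => rw [opE_av_mul, hx, mul_zero]
  | q_mul β r f g x _ hx => rw [opE_qv_mul, hx, mul_zero]

theorem comp_gen {β r : ℕ} {x : Lam2 k W} (hx : x ∈ gen k W β r) : comp β x = x := by
  induction β, r, x, hx using gen_induction with
  | zero => exact map_zero _
  | add β r x y _ _ hx hy => rw [map_add, hx, hy]
  | algebraMap c => simp [comp_algebraMap]
  | a_mul r f x _ hx => rw [comp_av_mul, hx]
  | q_mul β r f g x _ hx => rw [comp_qv_mul, hx]

theorem gen_mem {β r : ℕ} {x : Lam2 k W} (hx : x ∈ gen k W β r) :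
    x ∈ ⋀[k]^(2 * β + r) (W × W) := by
  induction β, r, x, hx using gen_induction with
  | zero => exact zero_mem _
  | add β r x y _ _ hx hy => exact add_mem hx hy
  | algebraMap c => exact algebraMap_mem c
  | a_mul r f x _ hx => exact av_mul_mem f hx
  | q_mul β r f g x _ hx =>
    have := qv_mul_mem f g hx
    rwa [show 2 * β + r + 2 = 2 * (β + 1) + r by ring] at this

/-- The factors from `Q` are killed by `F`, and each of the `r` factors with `v₁` can be lowered
only once. -/
theorem pow_opF_gen {β r : ℕ} {x : Lam2 k W} (hx : x ∈ gen k W β r) : (opF k W ^ (r + 1)) x = 0 := by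
  induction β, r, x, hx using gen_induction with
  | zero => exact map_zero _
  | add β r x y _ _ hx hy => rw [map_add, hx, hy, add_zero]
  | algebraMap c => simp
  | a_mul r f x _ hx =>
    rw [pow_opF_av_mul, hx, pow_succ' _ (r + 1), Module.End.mul_apply, hx, map_zero, mul_zero,
      mul_zero, smul_zero, add_zero]
  | q_mul β r f g x _ hx => rw [pow_opF_qv_mul, hx, mul_zero]

theorem pow_opF_gen_of_lt {β r a : ℕ} (h : r < a) {x : Lam2 k W} (hx : x ∈ gen k W β r) :
    (opF k W ^ a) x = 0 := by
  obtain ⟨c, rfl⟩ := Nat.exists_eq_add_of_lt h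
  rw [show r + c + 1 = c + (r + 1) by ring, pow_add, Module.End.mul_apply, pow_opF_gen hx, map_zero]

theorem av_mul_gen (f : W) {β r : ℕ} {x : Lam2 k W} (hx : x ∈ gen k W β r) :
    av k f * x ∈ gen k W β (r + 1) := by
  induction β, r, x, hx using gen_induction with
  | zero => rw [mul_zero]; exact zero_mem _
  | add β r x y _ _ hx hy => rw [mul_add]; exact add_mem hx hy
  | algebraMap c =>
    rw [gen_zero_succ]
    exact Submodule.mul_mem_mul ⟨f, rfl⟩
      (by rw [gen_zero_zero]; exact Submodule.mem_one.2 ⟨c, rfl⟩)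
  | a_mul r g x h hx =>
    rw [gen_zero_succ]
    exact Submodule.mul_mem_mul ⟨f, rfl⟩
      (by rw [gen_zero_succ]; exact Submodule.mul_mem_mul ⟨g, rfl⟩ h)
  | q_mul β r g g' x h hx =>
    rw [← mul_assoc, ← qv_mul_av, mul_assoc]
    exact qv_mul_gen _ _ hx

/-- Multiplication by `v₂ ⊗ g` on highest weight vectors, up to factors in the span of the
`qv f g`. -/
theorem av_mul_opF_gen (g : W) {β r : ℕ} {x : Lam2 k W} (hx : x ∈ gen k W β r) :
    (r = 0 → opF k W x = 0) ∧
      ∀ s, r = s + 1 → av k g * opF k W x - (r : k) • (cv k g * x) ∈ gen k W (β + 1) s := by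
  induction β, r, x, hx using gen_induction with
  | zero => simp
  | add β r x y _ _ hx hy =>
    refine ⟨fun h => by rw [map_add, hx.1 h, hy.1 h, add_zero], fun s hs => ?_⟩
    have := add_mem (hx.2 s hs) (hy.2 s hs)
    rw [map_add, mul_add, mul_add, smul_add, add_sub_add_comm]
    exact this
  | algebraMap c => simp
  | a_mul r f x h hx =>
    refine ⟨fun h => by omega, fun s hs => ?_⟩
    obtain rfl : r = s := by omega
    -- Exchanging `f` and `g` produces the factor `qv g f`; what remains is `v₁ ⊗ f` times the same
    -- expression for `x`.
    have key : av k g * opF k W (av k f * x) - ((r + 1 : ℕ) : k) • (cv k g * (av k f * x)) =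
        qv g f * x - av k f * (av k g * opF k W x - (r : k) • (cv k g * x)) := by
      rw [opF_av_mul, mul_add, av_mul_av_mul g f, mul_sub, mul_smul_comm, av_mul_cv_mul f g,
        qv, add_mul, mul_assoc, mul_assoc, av_mul_cv_mul f g]
      push_cast
      module
    rw [key]
    refine sub_mem (qv_mul_gen _ _ h) ?_
    rcases r with _ | r
    · rw [hx.1 rfl]; simp
    · exact av_mul_gen _ (hx.2 r rfl)
  | q_mul β r f f' x _ hx =>
    refine ⟨fun h => by rw [opF_qv_mul, hx.1 h, mul_zero], fun s hs => ?_⟩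
    have := qv_mul_gen f f' (hx.2 s hs)
    rwa [mul_sub, mul_smul_comm, ← mul_assoc, ← mul_assoc, qv_mul_av, qv_mul_cv, mul_assoc,
      mul_assoc, ← opF_qv_mul] at this

variable (k W) in
/-- The isotypic component with highest weight vectors `gen β r`. -/
def SS (β r : ℕ) : Submodule k (Lam2 k W) where
  carrier := {x | ∃ u : ℕ → Lam2 k W, (∀ a, u a ∈ gen k W β r) ∧
    x = ∑ a ∈ Finset.range (r + 1), (opF k W ^ a) (u a)}
  zero_mem' := ⟨fun _ => 0, fun _ => zero_mem _, by simp⟩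
  add_mem' := by
    rintro _ _ ⟨u, hu, rfl⟩ ⟨v, hv, rfl⟩
    exact ⟨fun a => u a + v a, fun a => add_mem (hu a) (hv a), by
      simp only [map_add, Finset.sum_add_distrib]⟩
  smul_mem' := by
    rintro c _ ⟨u, hu, rfl⟩
    exact ⟨fun a => c • u a, fun a => Submodule.smul_mem _ _ (hu a), by
      simp only [map_smul, Finset.smul_sum]⟩

theorem pow_opF_mem_SS (a : ℕ) {β r : ℕ} {u : Lam2 k W} (hu : u ∈ gen k W β r) :
    (opF k W ^ a) u ∈ SS k W β r := by
  rcases le_or_gt a r with h | h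
  · refine ⟨fun j => if j = a then u else 0, fun j => ?_, ?_⟩
    · dsimp only
      split_ifs
      · exact hu
      · exact zero_mem _
    · rw [Finset.sum_eq_single a]
      · simp
      · intro j _ hj; simp [hj]
      · intro hj; simp at hj; omega
  · rw [pow_opF_gen_of_lt h hu]; exact zero_mem _

theorem gen_le_SS (β r : ℕ) : gen k W β r ≤ SS k W β r := fun _ hu =>
  pow_opF_mem_SS 0 hu

variable (k W) in
/-- The sum of the isotypic components in degree `d` with at least `β` columns of length two. -/
def tot (β d : ℕ) : Submodule k (Lam2 k W) :=
  ⨆ β', ⨆ r, ⨆ _ : β ≤ β' ∧ 2 * β' + r = d, SS k W β' r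

theorem SS_le_tot {β β' r d : ℕ} (h : β ≤ β') (hd : 2 * β' + r = d) :
    SS k W β' r ≤ tot k W β d :=
  le_iSup_of_le β' (le_iSup_of_le r (le_iSup_of_le ⟨h, hd⟩ le_rfl))

theorem tot_le {β d : ℕ} {S : Submodule k (Lam2 k W)}
    (h : ∀ β' r a u, β ≤ β' → 2 * β' + r = d → u ∈ gen k W β' r → (opF k W ^ a) u ∈ S) :
    tot k W β d ≤ S := by
  refine iSup_le fun β' => iSup_le fun r => iSup_le fun hβ => ?_
  rintro _ ⟨u, hu, rfl⟩
  exact sum_mem fun a _ => h β' r a (u a) hβ.1 hβ.2 (hu a)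

theorem tot_anti {β β' d : ℕ} (h : β ≤ β') : tot k W β' d ≤ tot k W β d :=
  tot_le fun _ _ a _ h1 h2 hu => SS_le_tot (h.trans h1) h2 (pow_opF_mem_SS a hu)

theorem opF_tot {β d : ℕ} {x : Lam2 k W} (hx : x ∈ tot k W β d) : opF k W x ∈ tot k W β d := by
  refine tot_le (S := (tot k W β d).comap (opF k W)) (fun β' r a u h1 h2 hu => ?_) hx
  rw [Submodule.mem_comap, ← Module.End.mul_apply, ← pow_succ']
  exact SS_le_tot h1 h2 (pow_opF_mem_SS _ hu)

theorem pow_opF_tot (a : ℕ) {β d : ℕ} {x : Lam2 k W} (hx : x ∈ tot k W β d) :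
    (opF k W ^ a) x ∈ tot k W β d := by
  induction a with
  | zero => exact hx
  | succ a ih => rw [pow_succ', Module.End.mul_apply]; exact opF_tot ih

variable [CharZero k]

/-- Up to the factor `r + 1`, the product is `F ((v₁ ⊗ g) u)` minus the expression of
`av_mul_opF_gen`. The first term lies in the component of `gen β (r + 1)`; the second has one more
factor from `Q`. -/
theorem cv_mul_gen (g : W) {β r : ℕ} {u : Lam2 k W} (hu : u ∈ gen k W β r) :
    cv k g * u ∈ tot k W β (2 * β + r + 1) := by
  have h0 : ((r + 1 : ℕ) : k) ≠ 0 := by exact_mod_cast Nat.succ_ne_zero r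
  have key : cv k g * u = ((r + 1 : ℕ) : k)⁻¹ • (opF k W (av k g * u) -
      (av k g * opF k W u - (r : k) • (cv k g * u))) := by
    rw [opF_av_mul, eq_inv_smul_iff₀ h0]
    push_cast
    module
  rw [key]
  refine Submodule.smul_mem _ _ (sub_mem ?_ ?_)
  · exact opF_tot (SS_le_tot le_rfl (by ring) (gen_le_SS _ _ (av_mul_gen g hu)))
  · obtain ⟨h1, h2⟩ := av_mul_opF_gen g hu
    rcases r with _ | s
    · rw [h1 rfl]; simp
    · exact SS_le_tot (Nat.le_add_right β 1) (by ring) (gen_le_SS _ _ (h2 s rfl))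

/-- The spanning half of the Cauchy decomposition: the sum of the isotypic components is stable
under multiplication by `v₁ ⊗ f` and `v₂ ⊗ g`. -/
theorem exteriorPower_le_tot (d : ℕ) : ⋀[k]^d (W × W) ≤ tot k W 0 d := by
  intro x hx
  induction d, x, hx using exteriorPower_induction with
  | algebraMap r =>
    have h : algebraMap k (Lam2 k W) r ∈ gen k W 0 0 := by
      rw [gen_zero_zero]; exact Submodule.mem_one.2 ⟨r, rfl⟩
    exact SS_le_tot (β' := 0) (r := 0) le_rfl rfl (gen_le_SS _ _ h)
  | add d x y _ _ hx hy => exact add_mem hx hy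
  | ι_mul d x m hm hx =>
    have hc : ∀ (g : W) (β r a : ℕ) (u : Lam2 k W), 2 * β + r = d → u ∈ gen k W β r →
        cv k g * (opF k W ^ a) u ∈ tot k W 0 (d + 1) := by
      intro g β r a u h hu
      -- Multiplication by `v₂ ⊗ g` commutes with `F`, which reduces the claim to highest weight
      -- vectors.
      rw [← pow_opF_cv_mul]
      refine pow_opF_tot a (tot_anti (Nat.zero_le β) ?_)
      have := cv_mul_gen g hu
      rwa [h] at this
    rw [ι_eq, add_mul]
    refine add_mem ?_ ?_
    · refine tot_le (S := (tot k W 0 (d + 1)).comap (LinearMap.mulLeft k (av k m.1)))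
        (fun β r a u _ h hu => ?_) hx
      simp only [Submodule.mem_comap, LinearMap.mulLeft_apply]
      rcases a with _ | a
      · exact SS_le_tot (Nat.zero_le β) (by omega) (gen_le_SS _ _ (av_mul_gen _ hu))
      -- Moving `F ^ (a + 1)` past `v₁ ⊗ f` costs a multiple of `(v₂ ⊗ f) F ^ a u`, which `hc`
      -- covers.
      · rw [eq_sub_of_add_eq' (pow_opF_av_mul a m.1 u).symm]
        refine sub_mem (SS_le_tot (Nat.zero_le β) (by omega)
          (pow_opF_mem_SS _ (av_mul_gen _ hu))) (Submodule.smul_mem _ _ (hc _ _ _ _ _ h hu))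
    · refine tot_le (S := (tot k W 0 (d + 1)).comap (LinearMap.mulLeft k (cv k m.2)))
        (fun β r a u _ h hu => ?_) hx
      exact hc _ _ _ _ _ h hu

omit [CharZero k]

variable (k W) in
/-- The part of degree `d` of the `β`-th power of the ideal generated by the elements `qv f g`,
in terms of the representation theory of `sl₂`. -/
def filQ (β d : ℕ) : Submodule k (Lam2 k W) where
  carrier := {x | x ∈ ⋀[k]^d (W × W) ∧ ∀ b, (opE k W ^ (b + 1 - β)) (comp b x) = 0}
  zero_mem' := ⟨zero_mem _, by simp⟩
  add_mem' hx hy := ⟨add_mem hx.1 hy.1, fun b => by rw [map_add, map_add, hx.2, hy.2, add_zero]⟩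
  smul_mem' c x hx := ⟨Submodule.smul_mem _ _ hx.1, fun b => by
    rw [map_smul, map_smul, hx.2, smul_zero]⟩

theorem filQ_le (β d : ℕ) : filQ k W β d ≤ ⋀[k]^d (W × W) := fun _ h => h.1

theorem filQ_zero (d : ℕ) : filQ k W 0 d = ⋀[k]^d (W × W) :=
  le_antisymm (filQ_le _ _) fun x h => ⟨h, fun b => pow_opE_comp_eq_zero (by omega) x⟩

theorem filQ_anti {β β' d : ℕ} (h : β ≤ β') : filQ k W β' d ≤ filQ k W β d := fun x hx =>
  ⟨hx.1, fun b => by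
    obtain ⟨c, hc⟩ : ∃ c, b + 1 - β = c + (b + 1 - β') :=
      ⟨b + 1 - β - (b + 1 - β'), by omega⟩
    rw [hc, pow_add, Module.End.mul_apply, hx.2, map_zero]⟩

theorem av_mul_filQ (f : W) {β d : ℕ} {x : Lam2 k W} (hx : x ∈ filQ k W β d) :
    av k f * x ∈ filQ k W β (d + 1) :=
  ⟨av_mul_mem f hx.1, fun b => by rw [comp_av_mul, pow_opE_av_mul, hx.2, mul_zero]⟩

theorem cv_mul_filQ (f : W) {β d : ℕ} {x : Lam2 k W} (hx : x ∈ filQ k W β d) :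
    cv k f * x ∈ filQ k W β (d + 1) := by
  refine ⟨cv_mul_mem f hx.1, fun b => ?_⟩
  rcases b with _ | b
  · rw [comp_zero_cv_mul, map_zero]
  · rw [comp_cv_mul]
    have h := hx.2 b
    rcases le_or_gt β (b + 1) with hb | hb
    · rw [show b + 1 + 1 - β = b + 1 - β + 1 by omega, pow_opE_cv_mul, h, pow_succ',
        Module.End.mul_apply, h]
      simp
    -- Below `β` the truncated exponent is zero, and the condition in `filQ` says that the component
    -- itself vanishes.
    · rw [show b + 1 - β = 0 by omega, pow_zero, Module.End.one_apply] at h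
      rw [h, mul_zero, map_zero]

theorem ι_mul_filQ (m : W × W) {β d : ℕ} {x : Lam2 k W} (hx : x ∈ filQ k W β d) :
    ExteriorAlgebra.ι k m * x ∈ filQ k W β (d + 1) := by
  rw [ι_eq, add_mul]
  exact add_mem (av_mul_filQ _ hx) (cv_mul_filQ _ hx)

theorem qv_mul_filQ (f g : W) {β d : ℕ} {x : Lam2 k W} (hx : x ∈ filQ k W β d) :
    qv f g * x ∈ filQ k W (β + 1) (d + 2) := by
  refine ⟨qv_mul_mem f g hx.1, fun b => ?_⟩
  rcases b with _ | b
  · rw [comp_zero_qv_mul, map_zero]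
  · rw [comp_qv_mul, pow_opE_qv_mul, show b + 1 + 1 - (β + 1) = b + 1 - β by omega, hx.2, mul_zero]

end Filtration

end TateModel

end

/-! ### Contractions, vanishing above the rank, and the two descriptions of the filtration -/

noncomputable section

namespace TateModel

section Exactness

variable {k : Type*} [Field k] {W : Type*} [AddCommGroup W] [Module k W]

local notation:70 φ "⌋" x:70 => CliffordAlgebra.contractLeft (Q := (0 : QuadraticForm k _)) φ x

theorem contract_av_mul (φ : Module.Dual k (W × W)) (f : W) (x : Lam2 k W) :
    φ⌋(av k f * x) = φ (f, 0) • x - av k f * (φ⌋x) := contract_ι_mul _ _ _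

theorem contract_cv_mul (φ : Module.Dual k (W × W)) (f : W) (x : Lam2 k W) :
    φ⌋(cv k f * x) = φ (0, f) • x - cv k f * (φ⌋x) := contract_ι_mul _ _ _

theorem contract_snd_comp_zero (φ : Module.Dual k W) (x : Lam2 k W) :
    (φ ∘ₗ LinearMap.snd k W W)⌋(comp 0 x) = 0 := by
  induction x using model_induction with
  | algebraMap r => rw [comp_algebraMap, if_pos rfl, contract_algebraMap]
  | add x y hx hy => rw [map_add, map_add, hx, hy, add_zero]
  | a_mul x f hx => rw [comp_av_mul, contract_av_mul, hx]; simp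
  | c_mul x f hx => rw [comp_zero_cv_mul, map_zero]

theorem comp_contract (φ : Module.Dual k (W × W)) (b : ℕ) (x : Lam2 k W) :
    comp b (φ⌋x) = ((φ ∘ₗ LinearMap.inl k W W) ∘ₗ LinearMap.fst k W W)⌋(comp b x) +
      ((φ ∘ₗ LinearMap.inr k W W) ∘ₗ LinearMap.snd k W W)⌋(comp (b + 1) x) := by
  induction x using model_induction generalizing b with
  | algebraMap r =>
    rw [contract_algebraMap, map_zero, comp_algebraMap, comp_algebraMap]
    split_ifs <;> simp_all
  | add x y hx hy => simp only [map_add, hx, hy]; abel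
  | a_mul x f hx =>
    simp only [contract_av_mul, comp_av_mul, map_sub, map_smul, hx, LinearMap.comp_apply,
      LinearMap.fst_apply, LinearMap.snd_apply, map_zero, zero_smul, LinearMap.inl_apply, mul_add]
    abel
  | c_mul x f hx =>
    rw [contract_cv_mul, comp_cv_mul, contract_cv_mul, map_sub, map_smul]
    rcases b with _ | b
    · rw [comp_zero_cv_mul, comp_zero_cv_mul, contract_snd_comp_zero]
      simp
    · rw [comp_cv_mul, comp_cv_mul, contract_cv_mul, hx]
      simp only [LinearMap.comp_apply, LinearMap.fst_apply, LinearMap.snd_apply, map_zero,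
        zero_smul, LinearMap.inr_apply, mul_add]
      abel

theorem opE_contract (φ : Module.Dual k (W × W)) (x : Lam2 k W) :
    opE k W (φ⌋x) = φ⌋(opE k W x) -
      (φ ∘ₗ LinearMap.inl k W W ∘ₗ LinearMap.snd k W W)⌋x := by
  rw [opE, contract_der, add_sub_cancel_right]

theorem pow_opE_contract_snd (a : ℕ) (φ : Module.Dual k W) (x : Lam2 k W) :
    (opE k W ^ a) ((φ ∘ₗ LinearMap.snd k W W)⌋x) =
      (φ ∘ₗ LinearMap.snd k W W)⌋((opE k W ^ a) x) := by
  have h0 : (φ ∘ₗ LinearMap.snd k W W) ∘ₗ LinearMap.inl k W W ∘ₗ LinearMap.snd k W W = 0 := by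
    ext <;> simp
  induction a with
  | zero => rfl
  | succ a ih =>
    rw [pow_succ', Module.End.mul_apply, ih, opE_contract, h0]
    simp

theorem pow_opE_contract_fst (a : ℕ) (φ : Module.Dual k W) (x : Lam2 k W) :
    (opE k W ^ (a + 1)) ((φ ∘ₗ LinearMap.fst k W W)⌋x) =
      (φ ∘ₗ LinearMap.fst k W W)⌋((opE k W ^ (a + 1)) x) -
        (a + 1 : k) • ((φ ∘ₗ LinearMap.snd k W W)⌋((opE k W ^ a) x)) := by
  have h0 : (φ ∘ₗ LinearMap.fst k W W) ∘ₗ LinearMap.inl k W W ∘ₗ LinearMap.snd k W W =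
      φ ∘ₗ LinearMap.snd k W W := by
    ext <;> simp
  induction a with
  | zero => simp [opE_contract, h0]
  | succ a ih =>
    have h1 := pow_opE_contract_snd 1 φ ((opE k W ^ a) x)
    rw [pow_one] at h1
    rw [pow_succ', Module.End.mul_apply, ih, map_sub, map_smul, opE_contract, h0, h1,
      ← Module.End.mul_apply (opE k W), ← Module.End.mul_apply (opE k W), ← pow_succ',
      ← pow_succ']
    push_cast
    module

/-- A contraction removes at most one factor from `Q`. In terms of `E`: contraction with the
`v₂`-part commutes with `E` and shifts the component by one, while the `v₁`-part commutes with `E`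
only up to one application, so that one more power of `E` is needed. -/
theorem contract_filQ (φ : Module.Dual k (W × W)) {β d : ℕ} {x : Lam2 k W}
    (hx : x ∈ filQ k W β (d + 1)) : φ⌋x ∈ filQ k W (β - 1) d := by
  rcases β with _ | β
  · rw [Nat.zero_sub, filQ_zero]
    exact contract_mem _ hx.1
  refine ⟨contract_mem _ hx.1, fun b => ?_⟩
  rw [Nat.add_sub_cancel, comp_contract, map_add]
  have h0 := hx.2 b
  have h1 := hx.2 (b + 1)
  rw [show b + 1 + 1 - (β + 1) = b + 1 - β by omega] at h1
  rw [pow_opE_contract_snd, h1, map_zero, add_zero]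
  rcases le_or_gt β b with hb | hb
  · rw [show b + 1 - (β + 1) = b - β by omega] at h0
    rw [show b + 1 - β = b - β + 1 by omega, pow_opE_contract_fst, h0, pow_succ',
      Module.End.mul_apply, h0]
    simp
  · rw [show b + 1 - (β + 1) = 0 by omega, pow_zero, Module.End.one_apply] at h0
    rw [h0, map_zero, map_zero]

theorem contract_filQ_zero (φ : Module.Dual k (W × W)) {β : ℕ} {x : Lam2 k W}
    (hx : x ∈ filQ k W β 0) : φ⌋x = 0 := contract_zero _ hx.1

/-! ### Vanishing above the rank -/

theorem cv_mul_map_inl (g : W) (d : ℕ) (y : ExteriorAlgebra k W) (hy : y ∈ ⋀[k]^d W)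
    (x : Lam2 k W) :
    cv k g * (ExteriorAlgebra.map (LinearMap.inl k W W) y * x) =
      (-1 : k) ^ d • (ExteriorAlgebra.map (LinearMap.inl k W W) y * (cv k g * x)) := by
  induction d, y, hy using exteriorPower_induction generalizing x with
  | algebraMap r =>
    rw [AlgHom.commutes, pow_zero, one_smul, Algebra.commutes, ← mul_assoc,
      Algebra.commutes r (cv k g * x), mul_assoc, ← Algebra.commutes r x]
  | add d y z _ _ hy hz => simp only [map_add, add_mul, mul_add, hy, hz, smul_add]
  | ι_mul d y m hm hy =>
    have : ExteriorAlgebra.map (LinearMap.inl k W W) (ExteriorAlgebra.ι k m) = av k m := by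
      rw [ExteriorAlgebra.map_apply_ι]; rfl
    rw [map_mul, this, mul_assoc, mul_assoc, ← neg_eq_iff_eq_neg.2 (av_mul_cv_mul _ _ _), hy,
      mul_smul_comm, pow_succ]
    simp

theorem mem_map_inl_zero (x : Lam2 k W) :
    x ∈ (⋀[k]^0 W).map (ExteriorAlgebra.map (LinearMap.inl k W W)).toLinearMap *
      (⊤ : Submodule k (Lam2 k W)) := by
  have h : (1 : Lam2 k W) ∈ (⋀[k]^0 W).map
      (ExteriorAlgebra.map (LinearMap.inl k W W)).toLinearMap :=
    ⟨1, (map_one (algebraMap k (ExteriorAlgebra k W))) ▸ algebraMap_mem (1 : k),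
      map_one (ExteriorAlgebra.map (LinearMap.inl k W W))⟩
  have := Submodule.mul_mem_mul h (Submodule.mem_top (x := x) (R := k))
  rwa [one_mul] at this

/-- With `b` factors `v₂` in degree `d` there remain `c = d - b` factors `v₁`, and their product
comes from the `c`-th exterior power of `W`. This power vanishes for `c > dim W`. -/
theorem comp_mem_map_inl (b d : ℕ) (x : Lam2 k W) (hx : x ∈ ⋀[k]^d (W × W)) (c : ℕ) (h : b + c = d) :
    comp b x ∈ (⋀[k]^c W).map (ExteriorAlgebra.map (LinearMap.inl k W W)).toLinearMap *
      (⊤ : Submodule k (Lam2 k W)) := by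
  induction d, x, hx using exteriorPower_induction generalizing b c with
  | algebraMap r =>
    obtain ⟨rfl, rfl⟩ : b = 0 ∧ c = 0 := by omega
    exact mem_map_inl_zero _
  | add d x y _ _ hx hy => rw [map_add]; exact add_mem (hx _ _ h) (hy _ _ h)
  | ι_mul d x m hm hx =>
    rw [ι_eq, add_mul, map_add, comp_av_mul]
    refine add_mem ?_ ?_
    · rcases c with _ | c
      · exact mem_map_inl_zero _
      · have := hx b c (by omega)
        generalize comp b x = z at this ⊢
        induction this using Submodule.mul_induction_on' with
        | mem_mul_mem y hy z _ =>
          obtain ⟨y, hy, rfl⟩ := hy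
          rw [← mul_assoc]
          refine Submodule.mul_mem_mul ⟨ExteriorAlgebra.ι k m.1 * y, ι_mul_mem _ hy, ?_⟩ trivial
          rw [AlgHom.toLinearMap_apply, AlgHom.toLinearMap_apply, map_mul,
            ExteriorAlgebra.map_apply_ι]
          rfl
        | add x _ y _ hx hy => rw [mul_add]; exact add_mem hx hy
    · rcases b with _ | b
      · rw [comp_zero_cv_mul]; exact zero_mem _
      · rw [comp_cv_mul]
        have := hx b c (by omega)
        generalize comp b x = z at this ⊢
        induction this using Submodule.mul_induction_on' with
        | mem_mul_mem y hy z _ =>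
          obtain ⟨y, hy, rfl⟩ := hy
          rw [AlgHom.toLinearMap_apply, cv_mul_map_inl _ c y hy]
          exact Submodule.smul_mem _ _ (Submodule.mul_mem_mul ⟨y, hy, rfl⟩ trivial)
        | add x _ y _ hx hy => rw [mul_add]; exact add_mem hx hy

theorem exteriorPower_eq_bot [FiniteDimensional k W] {c : ℕ} (h : Module.finrank k W < c) :
    (⋀[k]^c W) = ⊥ := by
  rw [← Submodule.finrank_eq_zero (R := k)]
  rw [exteriorPower.finrank_eq, Nat.choose_eq_zero_of_lt h]

theorem comp_eq_zero [FiniteDimensional k W] {b d : ℕ} {x : Lam2 k W} (hx : x ∈ ⋀[k]^d (W × W))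
    (h : b + Module.finrank k W < d) : comp b x = 0 := by
  have := comp_mem_map_inl b d x hx (d - b) (by omega)
  rw [exteriorPower_eq_bot (by omega), Submodule.map_bot, Submodule.bot_mul] at this
  exact this

/-- Partitions contributing to `Λ^d(k² ⊗ W)` have `α₁ ≤ dim W`, hence `α₂ ≥ d - dim W`. Here this
appears as follows: the prescribed power of `E` ends in the component with `d - dim W - 1` factors
`v₂`, which would contain `dim W + 1` factors `v₁`. -/
theorem exteriorPower_le_filQ [FiniteDimensional k W] (d : ℕ) :
    ⋀[k]^d (W × W) ≤ filQ k W (d - Module.finrank k W) d := by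
  intro x hx
  refine ⟨hx, fun b => ?_⟩
  rcases le_or_gt d (Module.finrank k W) with h | h
  · exact pow_opE_comp_eq_zero (by omega) x
  · rcases le_or_gt (b + 1) (d - Module.finrank k W) with hb | hb
    · rw [comp_eq_zero hx (by omega), map_zero]
    · have := pow_opE_comp (b + 1 - (d - Module.finrank k W)) (d - Module.finrank k W - 1) x
      rw [show d - Module.finrank k W - 1 + (b + 1 - (d - Module.finrank k W)) = b by omega] at this
      rw [this, comp_eq_zero (pow_opE_mem _ hx) (by omega)]

/-! ### The filtration in terms of generators -/

theorem opH_gen {β r : ℕ} {u : Lam2 k W} (hu : u ∈ gen k W β r) : opH k W u = (r : k) • u := by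
  have := opH_comp β (gen_mem hu)
  rw [comp_gen hu] at this
  rw [this]
  congr 1
  push_cast
  ring

theorem comp_pow_opF_gen {β r : ℕ} {u : Lam2 k W} (hu : u ∈ gen k W β r) (a b : ℕ) :
    comp b ((opF k W ^ a) u) = if b = β + a then (opF k W ^ a) u else 0 := by
  have h := comp_pow_opF a β u
  rw [comp_gen hu] at h
  rw [← h, comp_comp, h]

/-- For `u` in `gen β' r` the vector `F ^ a u` lives only in the component `b = β' + a`, and `E ^ (a
+ 1)` kills it. The exponent `b + 1 - β = (β' - β) + a + 1` is at least that large. -/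
theorem tot_le_filQ (β d : ℕ) : tot k W β d ≤ filQ k W β d := by
  refine tot_le fun β' r a u hβ hd hu => ⟨pow_opF_mem _ (hd ▸ gen_mem hu), fun b => ?_⟩
  rw [comp_pow_opF_gen hu]
  split_ifs with h
  · rw [show b + 1 - β = (β' - β + 1) + a by omega, pow_add, Module.End.mul_apply,
      isSL2.pow_e_pow_f (opE_gen hu) (opH_gen hu), map_smul, pow_succ, Module.End.mul_apply,
      opE_gen hu, map_zero, smul_zero]
  · exact map_zero _

theorem tot_eq_sup (β r : ℕ) :
    tot k W β (2 * β + r) ≤ SS k W β r ⊔ tot k W (β + 1) (2 * β + r) := by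
  refine tot_le fun β' r' a u hβ hd hu => ?_
  rcases hβ.eq_or_lt with rfl | h
  · obtain rfl : r' = r := by omega
    exact Submodule.mem_sup_left (pow_opF_mem_SS a hu)
  · exact Submodule.mem_sup_right (SS_le_tot h hd (pow_opF_mem_SS a hu))

variable [CharZero k]

/-- Induction on `β`. Modulo components with more factors from `Q`, an element is a sum of `F ^ a (u
a)` with `u a` in `gen β r`. The component `β + a` isolates one summand, and `E ^ a F ^ a` acts on
`u a` by a nonzero scalar, so the condition for `β + 1` forces `u a = 0`. -/
theorem filQ_eq_tot (β d : ℕ) : filQ k W β d = tot k W β d := by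
  refine le_antisymm ?_ (tot_le_filQ β d)
  induction β with
  | zero => rw [filQ_zero]; exact exteriorPower_le_tot d
  | succ β ih =>
    intro x hx
    have hx0 := ih (filQ_anti (Nat.le_succ β) hx)
    rcases le_or_gt (2 * β) d with h | h
    · obtain ⟨r, rfl⟩ := Nat.exists_eq_add_of_le h
      obtain ⟨x0, ⟨u, hu, rfl⟩, x1, hx1, rfl⟩ := Submodule.mem_sup.1 (tot_eq_sup β r hx0)
      refine add_mem ?_ hx1
      have hy := sub_mem hx (tot_le_filQ _ _ hx1)
      rw [add_sub_cancel_right] at hy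
      suffices h0 : ∀ a ∈ Finset.range (r + 1), u a = 0 by
        rw [Finset.sum_eq_zero fun a ha => by rw [h0 a ha, map_zero]]
        exact zero_mem _
      intro a ha
      have := hy.2 (β + a)
      rw [map_sum, Finset.sum_eq_single a, comp_pow_opF_gen (hu a), if_pos rfl,
        show β + a + 1 - (β + 1) = a by omega,
        isSL2.pow_e_pow_f (opE_gen (hu a)) (opH_gen (hu a))] at this
      · exact (smul_eq_zero.1 this).resolve_left
          (hwScalar_ne_zero (by simpa [Nat.lt_succ_iff] using ha))
      · intro c _ hc
        rw [comp_pow_opF_gen (hu c), if_neg (by omega)]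
      · exact fun h => absurd ha h
    · refine (tot_le (S := tot k W (β + 1) d) fun β' r' a u hβ hd hu => ?_) hx0
      omega

/-- A contribution `F ^ a' u` to this component has `β' + a' = β + a`. For `β' = β` it is zero
because `a` exceeds the highest weight `r`; for `β' > β` one has `a' < a`, and `E ^ a` kills it. -/
theorem pow_opE_comp_filQ_eq_zero {β r a : ℕ} (ha : r < a) {x : Lam2 k W}
    (hx : x ∈ filQ k W β (2 * β + r)) : (opE k W ^ a) (comp (β + a) x) = 0 := by
  rw [filQ_eq_tot] at hx
  refine tot_le (S := LinearMap.ker ((opE k W ^ a) ∘ₗ comp (β + a)))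
    (fun β' r' a' u hβ hd hu => ?_) hx
  rw [LinearMap.mem_ker, LinearMap.comp_apply, comp_pow_opF_gen hu]
  split_ifs with h
  · rcases hβ.eq_or_lt with rfl | hlt
    · obtain rfl : a = a' := by omega
      rw [pow_opF_gen_of_lt (by omega) hu, map_zero]
    · rw [show a = (β' - β - 1 + 1) + a' by omega, pow_add, Module.End.mul_apply,
        isSL2.pow_e_pow_f (opE_gen hu) (opH_gen hu), map_smul, pow_succ, Module.End.mul_apply,
        opE_gen hu, map_zero, smul_zero]
  · exact map_zero _

end Exactness

end TateModel

end

/-! ### Multiplication by the cycle on the graded pieces -/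

noncomputable section

namespace TateModel

section Koszul

variable {k : Type*} [Field k] {W : Type*} [AddCommGroup W] [Module k W]

local notation:70 φ "⌋" x:70 => CliffordAlgebra.contractLeft (Q := (0 : QuadraticForm k _)) φ x

/-- Highest weight vectors with `b` factors `v₂` in degree `d`. -/
structure IsHW (d b : ℕ) (y : Lam2 k W) : Prop where
  mem : y ∈ ⋀[k]^d (W × W)
  comp_eq : comp b y = y
  opE_eq : opE k W y = 0

theorem isHW_zero (d b : ℕ) : IsHW d b (0 : Lam2 k W) := ⟨zero_mem _, map_zero _, map_zero _⟩

theorem IsHW.add {d b : ℕ} {y z : Lam2 k W} (hy : IsHW d b y) (hz : IsHW d b z) :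
    IsHW d b (y + z) :=
  ⟨add_mem hy.1 hz.1, by rw [map_add, hy.2, hz.2], by rw [map_add, hy.3, hz.3, add_zero]⟩

theorem IsHW.smul {d b : ℕ} {y : Lam2 k W} (hy : IsHW d b y) (c : k) : IsHW d b (c • y) :=
  ⟨Submodule.smul_mem _ _ hy.1, by rw [map_smul, hy.2], by rw [map_smul, hy.3, smul_zero]⟩

theorem IsHW.sub {d b : ℕ} {y z : Lam2 k W} (hy : IsHW d b y) (hz : IsHW d b z) :
    IsHW d b (y - z) :=
  ⟨sub_mem hy.1 hz.1, by rw [map_sub, hy.2, hz.2], by rw [map_sub, hy.3, hz.3, sub_zero]⟩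

theorem IsHW.av_mul {d b : ℕ} {y : Lam2 k W} (hy : IsHW d b y) (f : W) :
    IsHW (d + 1) b (av k f * y) :=
  ⟨av_mul_mem _ hy.1, by rw [comp_av_mul, hy.2], by rw [opE_av_mul, hy.3, mul_zero]⟩

theorem IsHW.opH_eq {d b : ℕ} {y : Lam2 k W} (hy : IsHW d b y) :
    opH k W y = (d - 2 * b : k) • y := by
  have := opH_comp b hy.1
  rwa [hy.2] at this

/-- Contraction with `v₁* ⊗ ζ`. -/
def cont (ζ : Module.Dual k W) : Lam2 k W →ₗ[k] Lam2 k W :=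
  CliffordAlgebra.contractLeft (Q := (0 : QuadraticForm k (W × W))) (ζ ∘ₗ LinearMap.fst k W W)

theorem cont_av_mul (ζ : Module.Dual k W) (f : W) (x : Lam2 k W) :
    cont ζ (av k f * x) = ζ f • x - av k f * cont ζ x := by
  rw [cont, contract_av_mul]; rfl

theorem cont_mem (ζ : Module.Dual k W) {d : ℕ} {x : Lam2 k W} (hx : x ∈ ⋀[k]^(d + 1) (W × W)) :
    cont ζ x ∈ ⋀[k]^d (W × W) := contract_mem _ hx

theorem comp_cont (ζ : Module.Dual k W) (b : ℕ) (x : Lam2 k W) :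
    comp b (cont ζ x) = cont ζ (comp b x) := by
  rw [cont, comp_contract]
  have h1 : ((ζ ∘ₗ LinearMap.fst k W W) ∘ₗ LinearMap.inl k W W) ∘ₗ LinearMap.fst k W W =
    ζ ∘ₗ LinearMap.fst k W W := by ext <;> simp
  have h2 : ((ζ ∘ₗ LinearMap.fst k W W) ∘ₗ LinearMap.inr k W W) ∘ₗ LinearMap.snd k W W = 0 := by
    ext <;> simp
  rw [h1, h2]; simp

theorem eq_av_mul_cont {ζ : Module.Dual k W} {w : W} (h : ζ w = 1) {x : Lam2 k W}
    (hx : av k w * x = 0) : x = av k w * cont ζ x := by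
  have := cont_av_mul ζ w x
  rw [hx, map_zero, h, one_smul] at this
  exact (sub_eq_zero.1 this.symm)

/-- Contracting the product with `ζ₁` and then `ζ₂` and expanding gives the identity: for
independent `w₁, w₂`, an element annihilated by both factors together lies in the ideal they
generate. -/
theorem eq_of_av_mul_av_mul_eq_zero {ζ₁ ζ₂ : Module.Dual k W} {w₁ w₂ : W} (h11 : ζ₁ w₁ = 1)
    (h12 : ζ₁ w₂ = 0) (h21 : ζ₂ w₁ = 0) (h22 : ζ₂ w₂ = 1) {x : Lam2 k W}
    (hx : av k w₁ * (av k w₂ * x) = 0) :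
    x = av k w₁ * (cont ζ₁ x - av k w₂ * cont ζ₂ (cont ζ₁ x)) + av k w₂ * cont ζ₂ x := by
  have h := congrArg (fun y => cont ζ₂ (cont ζ₁ y)) hx
  simp only [cont_av_mul, map_zero, h11, h12, h21, h22, one_smul, zero_smul,
    zero_sub, mul_neg, sub_neg_eq_add, map_add] at h
  rw [← sub_eq_zero, ← h]
  abel

variable [CharZero k]

/-- The weight `d - 2b` of `z` is positive, so `IsSL2.exists_e_eq` applies; the component `b + 1` of
a preimage is still a preimage. -/
theorem exists_opE_eq {d b : ℕ} (h : 2 * b + 1 ≤ d) {z : Lam2 k W} (hz : z ∈ ⋀[k]^d (W × W))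
    (hb : comp b z = z) : ∃ y ∈ ⋀[k]^d (W × W), comp (b + 1) y = y ∧ opE k W y = z := by
  obtain ⟨y, hy, hyz⟩ := isSL2.exists_e_eq (S := ⋀[k]^d (W × W)) (fun x hx => opE_mem hx)
    (fun x hx => opF_mem hx) (ν := d - 2 * b) (by omega) (b + 1) hz
    (by
      have := opH_comp b hz
      rw [hb] at this
      rw [this, Nat.cast_sub (by omega)]
      push_cast
      rfl)
    (by rw [← hb]; exact pow_opE_comp_eq_zero (by omega) z)
  refine ⟨comp (b + 1) y, comp_mem _ hy, ?_, ?_⟩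
  · rw [comp_comp, if_pos rfl]
  · rw [← comp_opE, hyz, hb]

omit [CharZero k] in
theorem comp_opE_of_comp {b : ℕ} {z : Lam2 k W} (hb : comp (b + 1) z = z) :
    comp b (opE k W z) = opE k W z := by rw [comp_opE, hb]

omit [CharZero k] in
theorem opE_of_comp_zero {z : Lam2 k W} (hb : comp 0 z = z) : opE k W z = 0 := by
  rw [← hb, opE_comp_zero]

/-- A quotient `z` of `y` by `v₁ ⊗ w` need not be a highest weight vector, but `E z` is again
annihilated, so `E z = (v₁ ⊗ w) c`. Since `2b ≤ d`, the weight of `c` is positive, so `c = E u`, and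
`z - (v₁ ⊗ w) u` is the desired quotient. -/
theorem IsHW.exists_eq_av_mul {ζ : Module.Dual k W} {w : W} (h : ζ w = 1) {d b : ℕ}
    (hd : 2 * b ≤ d) {y : Lam2 k W} (hy : IsHW (d + 1) b y) (h0 : av k w * y = 0) :
    ∃ z, IsHW d b z ∧ y = av k w * z := by
  have hz := eq_av_mul_cont h h0
  have hzm := cont_mem ζ hy.1
  have hzc : comp b (cont ζ y) = cont ζ y := by rw [comp_cont, hy.2]
  set z := cont ζ y
  rcases b with _ | b
  · exact ⟨z, ⟨hzm, hzc, opE_of_comp_zero hzc⟩, hz⟩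
  · obtain ⟨d, rfl⟩ : ∃ c, d = c + 1 := ⟨d - 1, by omega⟩
    have hE : av k w * opE k W z = 0 := by rw [← opE_av_mul, ← hz, hy.3]
    have hE' := eq_av_mul_cont h hE
    obtain ⟨u, hu, huc, huE⟩ := exists_opE_eq (b := b) (d := d) (by omega)
      (cont_mem ζ (opE_mem hzm)) (by rw [comp_cont, comp_opE_of_comp hzc])
    refine ⟨z - av k w * u, ⟨sub_mem hzm (av_mul_mem _ hu), ?_, ?_⟩, ?_⟩
    · rw [map_sub, comp_av_mul, hzc, huc]
    · rw [map_sub, opE_av_mul, huE, ← hE', sub_self]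
    · rw [mul_sub, av_mul_self_mul, sub_zero, ← hz]

/-- As for one vector, with errors `E z₁` and `E z₂` that satisfy `w₁ E z₁ + w₂ E z₂ = 0`. Such a
pair is `(w₁ c + w₂ c', w₁ c' + w₂ c'')`. The off-diagonal term is shared, so preimages `u, u', u''`
of `c, c', c''` correct both quotients without changing the sum. -/
theorem IsHW.exists_eq_av_mul_add {ζ₁ ζ₂ : Module.Dual k W} {w₁ w₂ : W} (h11 : ζ₁ w₁ = 1)
    (h12 : ζ₁ w₂ = 0) (h21 : ζ₂ w₁ = 0) (h22 : ζ₂ w₂ = 1) {d b : ℕ}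
    (hd : 2 * b ≤ d) {y : Lam2 k W} (hy : IsHW (d + 1) b y)
    (h0 : av k w₁ * (av k w₂ * y) = 0) :
    ∃ p p', IsHW d b p ∧ IsHW d b p' ∧ y = av k w₁ * p + av k w₂ * p' := by
  have hz := eq_of_av_mul_av_mul_eq_zero h11 h12 h21 h22 h0
  have hm1 := cont_mem ζ₁ hy.1
  have hm2 := cont_mem ζ₂ hy.1
  have hz1m : cont ζ₁ y - av k w₂ * cont ζ₂ (cont ζ₁ y) ∈ ⋀[k]^d (W × W) := by
    refine sub_mem hm1 ?_
    rcases d with _ | d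
    · have : cont ζ₂ (cont ζ₁ y) = 0 := contract_zero _ hm1
      rw [this, mul_zero]; exact zero_mem _
    · exact av_mul_mem _ (cont_mem _ hm1)
  have hz1c : comp b (cont ζ₁ y - av k w₂ * cont ζ₂ (cont ζ₁ y)) =
      cont ζ₁ y - av k w₂ * cont ζ₂ (cont ζ₁ y) := by
    simp only [map_sub, comp_av_mul, comp_cont, hy.2]
  have hz2c : comp b (cont ζ₂ y) = cont ζ₂ y := by rw [comp_cont, hy.2]
  generalize cont ζ₁ y - av k w₂ * cont ζ₂ (cont ζ₁ y) = z₁ at hz hz1m hz1c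
  generalize cont ζ₂ y = z₂ at hz hz2c hm2
  rcases b with _ | b
  · exact ⟨z₁, z₂, ⟨hz1m, hz1c, opE_of_comp_zero hz1c⟩, ⟨hm2, hz2c, opE_of_comp_zero hz2c⟩, hz⟩
  · obtain ⟨d, rfl⟩ : ∃ c, d = c + 1 := ⟨d - 1, by omega⟩
    have hE : av k w₁ * opE k W z₁ + av k w₂ * opE k W z₂ = 0 := by
      rw [← opE_av_mul, ← opE_av_mul, ← map_add, ← hz, hy.3]
    have hE1 : av k w₁ * (av k w₂ * opE k W z₁) = 0 := by
      have := congrArg (fun x => av k w₂ * x) hE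
      simp only [mul_add, av_mul_self_mul, add_zero, mul_zero] at this
      rw [av_mul_av_mul, this, neg_zero]
    have hc := eq_of_av_mul_av_mul_eq_zero h11 h12 h21 h22 hE1
    have hEm := opE_mem hz1m
    have hEc := comp_opE_of_comp hz1c
    have hcm : cont ζ₁ (opE k W z₁) - av k w₂ * cont ζ₂ (cont ζ₁ (opE k W z₁)) ∈
        ⋀[k]^d (W × W) := by
      refine sub_mem (cont_mem ζ₁ hEm) ?_
      rcases d with _ | d
      · have : cont ζ₂ (cont ζ₁ (opE k W z₁)) = 0 := contract_zero _ (cont_mem ζ₁ hEm)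
        rw [this, mul_zero]; exact zero_mem _
      · exact av_mul_mem _ (cont_mem _ (cont_mem ζ₁ hEm))
    have hcc : comp b (cont ζ₁ (opE k W z₁) - av k w₂ * cont ζ₂ (cont ζ₁ (opE k W z₁))) =
        cont ζ₁ (opE k W z₁) - av k w₂ * cont ζ₂ (cont ζ₁ (opE k W z₁)) := by
      simp only [map_sub, comp_av_mul, comp_cont, hEc]
    have hcm' : cont ζ₂ (opE k W z₁) ∈ ⋀[k]^d (W × W) := cont_mem ζ₂ hEm
    have hcc' : comp b (cont ζ₂ (opE k W z₁)) = cont ζ₂ (opE k W z₁) := by rw [comp_cont, hEc]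
    generalize cont ζ₁ (opE k W z₁) - av k w₂ * cont ζ₂ (cont ζ₁ (opE k W z₁)) = c at hc hcm hcc
    generalize cont ζ₂ (opE k W z₁) = c' at hc hcm' hcc'
    have hE2 : av k w₂ * (opE k W z₂ - av k w₁ * c') = 0 := by
      rw [hc] at hE
      rw [mul_sub, av_mul_av_mul w₂ w₁, sub_neg_eq_add, ← hE, mul_add, av_mul_self_mul, zero_add,
        add_comm]
    have hc2 := eq_av_mul_cont h22 hE2
    have hm'' : opE k W z₂ - av k w₁ * c' ∈ ⋀[k]^(d + 1) (W × W) :=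
      sub_mem (opE_mem hm2) (av_mul_mem _ hcm')
    have hcm'' := cont_mem ζ₂ hm''
    have hcc'' : comp b (cont ζ₂ (opE k W z₂ - av k w₁ * c')) =
        cont ζ₂ (opE k W z₂ - av k w₁ * c') := by
      rw [comp_cont, map_sub, comp_av_mul, comp_opE_of_comp hz2c, hcc']
    generalize cont ζ₂ (opE k W z₂ - av k w₁ * c') = c'' at hc2 hcm'' hcc''
    obtain ⟨u, hu, huc, huE⟩ := exists_opE_eq (b := b) (d := d) (by omega) hcm hcc
    obtain ⟨u', hu', huc', huE'⟩ := exists_opE_eq (b := b) (d := d) (by omega) hcm' hcc'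
    obtain ⟨u'', hu'', huc'', huE''⟩ := exists_opE_eq (b := b) (d := d) (by omega) hcm'' hcc''
    refine ⟨z₁ - av k w₁ * u - av k w₂ * u', z₂ - av k w₁ * u' - av k w₂ * u'',
      ⟨sub_mem (sub_mem hz1m (av_mul_mem _ hu)) (av_mul_mem _ hu'), ?_, ?_⟩,
      ⟨sub_mem (sub_mem hm2 (av_mul_mem _ hu')) (av_mul_mem _ hu''), ?_, ?_⟩, ?_⟩
    · simp only [map_sub, comp_av_mul, hz1c, huc, huc']
    · simp only [map_sub, opE_av_mul, huE, huE']
      rw [hc]; abel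
    · simp only [map_sub, comp_av_mul, hz2c, huc', huc'']
    · simp only [map_sub, opE_av_mul, huE', huE'']
      rw [hc2, sub_self]
    · simp only [mul_sub, av_mul_self_mul]
      rw [av_mul_av_mul w₂ w₁ u', hz]
      abel

/-- The linear system `X₀ = - w₂ Y₀`, `X_{a + 1} = (a + 1) w₁ Y_a - w₂ Y_{a + 1}` for highest
weight vectors. -/
theorem exists_hw_solution {ζ₁ ζ₂ : Module.Dual k W} {w₁ w₂ : W} (h11 : ζ₁ w₁ = 1)
    (h12 : ζ₁ w₂ = 0) (h21 : ζ₂ w₁ = 0) (h22 : ζ₂ w₂ = 1) {β r : ℕ} (hr : 1 ≤ r)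
    (X : ℕ → Lam2 k W) (hX : ∀ a, IsHW (2 * β + r + 1) β (X a)) (h0 : av k w₂ * X 0 = 0)
    (hs : ∀ a : ℕ, (a + 1 : k) • (av k w₁ * X a) = av k w₂ * X (a + 1))
    (hv : ∀ a, r + 1 < a → X a = 0) :
    ∃ Y : ℕ → Lam2 k W, (∀ a, IsHW (2 * β + r) β (Y a)) ∧ (∀ a, r < a → Y a = 0) ∧
      X 0 = -(av k w₂ * Y 0) ∧
      ∀ a : ℕ, X (a + 1) = (a + 1 : k) • (av k w₁ * Y a) - av k w₂ * Y (a + 1) := by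
  -- A total choice of quotients by `w₂`, with value zero where division is impossible, so that the
  -- recursion can be written down before divisibility is known.
  have hex : ∀ Z : Lam2 k W, ∃ Y, IsHW (2 * β + r) β Y ∧
      (IsHW (2 * β + r + 1) β Z → av k w₂ * Z = 0 → Z = -(av k w₂ * Y)) := by
    intro Z
    by_cases h : IsHW (2 * β + r + 1) β Z ∧ av k w₂ * Z = 0
    · obtain ⟨Y, hY, hZ⟩ := h.1.exists_eq_av_mul h22 (by omega) h.2
      refine ⟨-Y, ?_, fun _ _ => by rw [mul_neg, neg_neg, ← hZ]⟩
      rw [← neg_one_smul k]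
      exact hY.smul _
    · exact ⟨0, isHW_zero _ _, fun h1 h2 => absurd ⟨h1, h2⟩ h⟩
  choose g hg hg' using hex
  let Y : ℕ → Lam2 k W := fun a =>
    Nat.rec (g (X 0)) (fun a y => g (X (a + 1) - (a + 1 : k) • (av k w₁ * y))) a
  have hY : ∀ a, IsHW (2 * β + r) β (Y a) := by
    intro a; cases a <;> exact hg _
  have hY0 : X 0 = -(av k w₂ * Y 0) := hg' _ (hX 0) h0
  have hstep : ∀ a : ℕ, av k w₁ * X a = -(av k w₁ * (av k w₂ * Y a)) →
      X (a + 1) = (a + 1 : k) • (av k w₁ * Y a) - av k w₂ * Y (a + 1) := by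
    intro a h
    have h2 : X (a + 1) - (a + 1 : k) • (av k w₁ * Y a) = -(av k w₂ * Y (a + 1)) :=
      hg' _ ((hX _).sub (((hY a).av_mul w₁).smul _)) (by
        rw [mul_sub, mul_smul_comm, ← hs, h, av_mul_av_mul w₂ w₁, sub_self])
    rw [sub_eq_add_neg, ← h2]
    abel
  have hA : ∀ a : ℕ, av k w₁ * X a = -(av k w₁ * (av k w₂ * Y a)) := by
    intro a
    induction a with
    | zero => rw [hY0, mul_neg]
    | succ a ih => rw [hstep a ih, mul_sub, mul_smul_comm, av_mul_self_mul, smul_zero, zero_sub]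
  have hYs := fun a => hstep a (hA a)
  -- Since `X (r + 2) = 0`, the last relation becomes `(r + 2) w₁ X (r + 1) = 0`.
  have htop : av k w₁ * X (r + 1) = 0 := by
    have h1 := hs (r + 1)
    rw [hv (r + 1 + 1) (by omega), mul_zero] at h1
    exact (smul_eq_zero.1 h1).resolve_left (Nat.cast_add_one_ne_zero _)
  -- The hypothesis `1 ≤ r` is used here: it gives `2β ≤ d`, the weight condition for the
  -- decomposition of `Y (r + 1)`.
  obtain ⟨d, hd⟩ : ∃ d, 2 * β + r = d + 1 := ⟨2 * β + r - 1, by omega⟩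
  obtain ⟨p, p', hp, -, hpp⟩ := IsHW.exists_eq_av_mul_add h11 h12 h21 h22 (d := d) (by omega)
    (hd ▸ hY (r + 1)) (by have := hA (r + 1); rw [htop] at this; exact neg_eq_zero.1 this.symm)
  have hr0 : (r + 1 : k) ≠ 0 := Nat.cast_add_one_ne_zero _
  -- The recursion may leave `Y (r + 1) = w₁ p + w₂ p'`, which has to be removed. Multiplication by
  -- `w₂` kills the second term, and `w₂ w₁ p = -w₁ w₂ p` can be absorbed into `Y r`. The change of
  -- `Y r` is a multiple of `w₂`, so it does not disturb the preceding relation.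
  refine ⟨fun a => if a < r then Y a else if a = r then Y r + (r + 1 : k)⁻¹ • (av k w₂ * p) else 0,
    fun a => ?_, fun a ha => ?_, ?_, fun a => ?_⟩
  · dsimp only
    split_ifs
    · exact hY a
    · exact (hY r).add (hd ▸ (hp.av_mul w₂).smul _)
    · exact isHW_zero _ _
  · simp only
    rw [if_neg (by omega), if_neg (by omega)]
  · simp only
    rw [if_pos (by omega), hY0]
  · dsimp only
    rcases lt_trichotomy (a + 1) r with h | h | h
    · rw [if_pos h, if_pos (by omega), hYs]
    · subst h
      rw [if_neg (lt_irrefl _), if_pos rfl, if_pos (Nat.lt_succ_self a), hYs, mul_add,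
        mul_smul_comm, av_mul_self_mul, smul_zero, add_zero]
    · rw [if_neg (by omega : ¬ a + 1 < r), if_neg (by omega : ¬ a + 1 = r), if_neg (by omega), mul_zero, sub_zero]
      split_ifs with h'
      · subst h'
        rw [hYs, hpp, mul_add, mul_add, av_mul_self_mul, add_zero, mul_smul_comm, smul_add,
          smul_smul, mul_inv_cancel₀ hr0, one_smul, av_mul_av_mul w₂ w₁, sub_neg_eq_add]
      · rw [hv _ (by omega), mul_zero, smul_zero]

omit [CharZero k] in
theorem pow_opE_comp_zero_mul {β d : ℕ} (w₁ w₂ : W) {x : Lam2 k W} (hx : x ∈ filQ k W β d) :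
    comp β ((cv k w₁ - av k w₂) * x) = -(av k w₂ * comp β x) := by
  rw [sub_mul, map_sub, comp_av_mul, sub_eq_neg_self]
  rcases β with _ | β
  · exact comp_zero_cv_mul _ _
  · have := hx.2 β
    rw [Nat.sub_self, pow_zero, Module.End.one_apply] at this
    rw [comp_cv_mul, this, mul_zero]

-- The highest weight vectors `E ^ a (comp (β + a) x)` are coordinates of `x` modulo `filQ (β + 1)`,
-- and this is multiplication by the cycle in these coordinates. The missing term contains `E ^ (a +
-- 1)` of the component `β + a`, which vanishes on `filQ β`.
omit [CharZero k] in
theorem pow_opE_comp_succ_mul {β d : ℕ} (w₁ w₂ : W) {x : Lam2 k W} (hx : x ∈ filQ k W β d)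
    (a : ℕ) : (opE k W ^ (a + 1)) (comp (β + (a + 1)) ((cv k w₁ - av k w₂) * x)) =
      (a + 1 : k) • (av k w₁ * (opE k W ^ a) (comp (β + a) x)) -
        av k w₂ * (opE k W ^ (a + 1)) (comp (β + (a + 1)) x) := by
  have h := hx.2 (β + a)
  rw [show β + a + 1 - β = a + 1 by omega] at h
  rw [sub_mul, map_sub, map_sub, comp_av_mul, pow_opE_av_mul, ← add_assoc, comp_cv_mul,
    pow_opE_cv_mul, h, mul_zero, add_zero]

omit [CharZero k] in
theorem pow_opF_isHW_mem_filQ {d b : ℕ} {y : Lam2 k W} (hy : IsHW d b y) (a : ℕ) :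
    (opF k W ^ a) y ∈ filQ k W b d := by
  refine ⟨pow_opF_mem _ hy.1, fun c => ?_⟩
  have h := comp_pow_opF a b y
  rw [hy.2] at h
  rw [← h, comp_comp]
  split_ifs with hc
  · rw [h, hc, show b + a + 1 - b = a + 1 by omega, pow_succ', Module.End.mul_apply,
      isSL2.pow_e_pow_f hy.3 hy.opH_eq, map_smul, hy.3, smul_zero]
  · exact map_zero _

omit [CharZero k] in
theorem pow_opE_comp_pow_opF {β r : ℕ} {y : Lam2 k W} (hy : IsHW (2 * β + r) β y) (a c : ℕ) :
    (opE k W ^ a) (comp (β + a) ((opF k W ^ c) y)) = if c = a then hwScalar k r a • y else 0 := by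
  have h := comp_pow_opF c β y
  rw [hy.2] at h
  rw [← h, comp_comp]
  split_ifs with h1 h2 h2
  · subst h2
    rw [h, isSL2.pow_e_pow_f hy.3 (by have := hy.opH_eq; push_cast at this; simpa using this)]
  · omega
  · omega
  · exact map_zero _

-- Passing from `β` to `β + 1` lowers each exponent by one, so the new conditions are the vanishing
-- of the coordinates on the graded piece.
omit [CharZero k] in
theorem mem_filQ_succ_iff {β d : ℕ} {x : Lam2 k W} (hx : x ∈ filQ k W β d) :
    x ∈ filQ k W (β + 1) d ↔ ∀ a, (opE k W ^ a) (comp (β + a) x) = 0 := by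
  refine ⟨fun h a => by simpa [show β + a + 1 - (β + 1) = a by omega] using h.2 (β + a),
    fun h => ⟨hx.1, fun b => ?_⟩⟩
  rcases le_or_gt β b with hb | hb
  · obtain ⟨a, rfl⟩ := Nat.exists_eq_add_of_le hb
    rw [show β + a + 1 - (β + 1) = a by omega, h]
  · have := hx.2 b
    rw [show b + 1 - β = 0 by omega] at this
    rw [show b + 1 - (β + 1) = 0 by omega, this]

/-- Exactness of multiplication by the cycle on the graded pieces. In highest weight coordinates the
hypothesis and the conclusion are the linear relations of `exists_hw_solution`. The restriction to
`1 ≤ r`, that is, to degrees well above `2β`, comes from there. -/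
theorem exists_sub_mul_mem_filQ [FiniteDimensional k W] {ζ₁ ζ₂ : Module.Dual k W} {w₁ w₂ : W}
    (h11 : ζ₁ w₁ = 1) (h12 : ζ₁ w₂ = 0) (h21 : ζ₂ w₁ = 0) (h22 : ζ₂ w₂ = 1) {β r : ℕ}
    (hr : 1 ≤ r) {x : Lam2 k W} (hx : x ∈ filQ k W β (2 * β + r + 1))
    (htx : (cv k w₁ - av k w₂) * x ∈ filQ k W (β + 1) (2 * β + r + 2)) :
    ∃ y ∈ filQ k W β (2 * β + r),
      x - (cv k w₁ - av k w₂) * y ∈ filQ k W (β + 1) (2 * β + r + 1) := by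
  have hmul : ∀ {y : Lam2 k W}, y ∈ filQ k W β (2 * β + r) →
      (cv k w₁ - av k w₂) * y ∈ filQ k W β (2 * β + r + 1) := fun {y} hy => by
    rw [sub_mul]; exact sub_mem (cv_mul_filQ _ hy) (av_mul_filQ _ hy)
  have hmul' : (cv k w₁ - av k w₂) * x ∈ filQ k W β (2 * β + r + 2) := by
    rw [sub_mul]; exact sub_mem (cv_mul_filQ _ hx) (av_mul_filQ _ hx)
  have htx' := (mem_filQ_succ_iff hmul').1 htx
  obtain ⟨Y, hY, hYv, hY0, hYs⟩ := exists_hw_solution h11 h12 h21 h22 (β := β) hr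
    (fun a => (opE k W ^ a) (comp (β + a) x))
    (fun a => ⟨pow_opE_mem _ (comp_mem _ hx.1), by
      rw [pow_opE_comp, comp_comp, if_pos rfl], by
      have := hx.2 (β + a)
      rwa [show β + a + 1 - β = a + 1 by omega, pow_succ', Module.End.mul_apply] at this⟩)
    (by
      have := htx' 0
      rw [pow_zero, Module.End.one_apply, add_zero, pow_opE_comp_zero_mul _ _ hx] at this
      exact neg_eq_zero.1 this)
    (fun a => by
      have := htx' (a + 1)
      rw [pow_opE_comp_succ_mul _ _ hx] at this
      exact sub_eq_zero.1 this)
    (fun a ha => pow_opE_comp_filQ_eq_zero (r := r + 1) (by omega) hx)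
  -- On highest weight vectors of weight `r`, `E ^ c F ^ c` is the scalar `hwScalar`. Dividing by it
  -- gives an element with the prescribed coordinates `Y c`.
  have hym : ∑ c ∈ Finset.range (r + 1), (hwScalar k (r : k) c)⁻¹ • (opF k W ^ c) (Y c) ∈
      filQ k W β (2 * β + r) :=
    sum_mem fun c _ => Submodule.smul_mem _ _ (pow_opF_isHW_mem_filQ (hY c) c)
  have hyc : ∀ a, (opE k W ^ a) (comp (β + a)
      (∑ c ∈ Finset.range (r + 1), (hwScalar k (r : k) c)⁻¹ • (opF k W ^ c) (Y c))) = Y a := by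
    intro a
    simp only [map_sum, map_smul, pow_opE_comp_pow_opF (hY _)]
    rcases le_or_gt a r with ha | ha
    · rw [Finset.sum_eq_single a]
      · rw [if_pos rfl, smul_smul, inv_mul_cancel₀ (hwScalar_ne_zero ha), one_smul]
      · intro c _ hc
        rw [if_neg hc, smul_zero]
      · intro h
        exact absurd (Finset.mem_range.2 (by omega)) h
    · rw [hYv a ha]
      refine Finset.sum_eq_zero fun c hc => ?_
      rw [Finset.mem_range] at hc
      rw [if_neg (by omega), smul_zero]
  refine ⟨_, hym, (mem_filQ_succ_iff (sub_mem hx (hmul hym))).2 fun a => ?_⟩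
  rw [map_sub, map_sub, sub_eq_zero]
  rcases a with _ | a
  · rw [pow_zero, Module.End.one_apply, Module.End.one_apply, add_zero,
      pow_opE_comp_zero_mul _ _ hym]
    have := hyc 0
    rw [pow_zero, Module.End.one_apply, add_zero] at this
    rw [this]
    simpa using hY0
  · rw [pow_opE_comp_succ_mul _ _ hym, hyc, hyc]
    exact hYs a

end Koszul

end TateModel

end

/-! ### The Tate differential and the filtered complex -/

noncomputable section

namespace TateModel

section Differential

variable {k : Type*} [Field k] {M : Type*} [AddCommGroup M] [Module k M]

local notation:70 φ "⌋" x:70 => CliffordAlgebra.contractLeft (Q := (0 : QuadraticForm k _)) φ x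

theorem involute_mul_ι (t : M) (x : ExteriorAlgebra k M) :
    CliffordAlgebra.involute (Q := (0 : QuadraticForm k M)) x * ExteriorAlgebra.ι k t =
      ExteriorAlgebra.ι k t * x := by
  induction x using exterior_induction with
  | algebraMap r => rw [AlgHom.commutes, Algebra.commutes]
  | add x y hx hy => rw [map_add, add_mul, hx, hy, mul_add]
  | ι_mul x m hx =>
    have h1 : CliffordAlgebra.involute (Q := (0 : QuadraticForm k M)) (ExteriorAlgebra.ι k m) =
      -ExteriorAlgebra.ι k m := CliffordAlgebra.involute_ι m
    rw [map_mul, h1, mul_assoc, hx, neg_mul, ← mul_assoc, ← mul_assoc, ← neg_mul]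
    congr 1
    exact neg_eq_of_add_eq_zero_left (ExteriorAlgebra.ι_add_mul_swap t m)

/-- The differential `w T^j ↦ (φ ⌋ w) T^j + j t w T^(j-1)`. -/
def gdiff (φ : Module.Dual k M) (t : M) :
    Polynomial (ExteriorAlgebra k M) →ₗ[k] Polynomial (ExteriorAlgebra k M) :=
  Polynomial.lsum fun j =>
    ((Polynomial.monomial (R := ExteriorAlgebra k M) j).restrictScalars k).comp
        (CliffordAlgebra.contractLeft φ) +
      (j : k) • ((Polynomial.monomial (R := ExteriorAlgebra k M) (j - 1)).restrictScalars k).comp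
        ((LinearMap.mulRight k (ExteriorAlgebra.ι k t)).comp
          (CliffordAlgebra.involute (Q := (0 : QuadraticForm k M))).toLinearMap)

theorem gdiff_monomial (φ : Module.Dual k M) (t : M) (j : ℕ) (w : ExteriorAlgebra k M) :
    gdiff φ t (Polynomial.monomial j w) = Polynomial.monomial j (φ⌋w) +
      Polynomial.monomial (j - 1) ((j : k) • (ExteriorAlgebra.ι k t * w)) := by
  rw [gdiff, Polynomial.lsum_apply, Polynomial.sum_monomial_index, ← involute_mul_ι,
    ← Polynomial.smul_monomial]
  · rfl
  · exact map_zero _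

theorem coeff_gdiff (φ : Module.Dual k M) (t : M) (p : Polynomial (ExteriorAlgebra k M)) (j : ℕ) :
    (gdiff φ t p).coeff j =
      φ⌋(p.coeff j) + (j + 1 : k) • (ExteriorAlgebra.ι k t * p.coeff (j + 1)) := by
  induction p using Polynomial.induction_on' with
  | add p q hp hq =>
    simp only [map_add, Polynomial.coeff_add, hp, hq, mul_add, smul_add]; abel
  | monomial i w =>
    rw [gdiff_monomial, Polynomial.coeff_add]
    simp only [Polynomial.coeff_monomial]
    congr 1
    · split_ifs <;> simp
    · rcases i with _ | i
      · simp
      · simp only [Nat.add_sub_cancel, Nat.add_right_cancel_iff]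
        split_ifs with h
        · subst h; push_cast; rfl
        · simp

theorem gdiff_gdiff {φ : Module.Dual k M} {t : M} (h : φ t = 0)
    (p : Polynomial (ExteriorAlgebra k M)) : gdiff φ t (gdiff φ t p) = 0 := by
  ext j
  rw [coeff_gdiff, coeff_gdiff, coeff_gdiff, map_add, contract_contract, map_smul, contract_ι_mul, h,
    zero_smul, zero_sub, zero_add, mul_add, mul_smul_comm, ← mul_assoc, ExteriorAlgebra.ι_sq_zero,
    zero_mul, smul_zero, add_zero, smul_neg, neg_add_cancel, Polynomial.coeff_zero]

theorem map_gdiff {M' : Type*} [AddCommGroup M'] [Module k M'] (f : M →ₗ[k] M')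
    (φ : Module.Dual k M') (t : M) (p : Polynomial (ExteriorAlgebra k M)) :
    gdiff φ (f t) (p.map (ExteriorAlgebra.map f).toRingHom) =
      (gdiff (φ ∘ₗ f) t p).map (ExteriorAlgebra.map f).toRingHom := by
  ext j
  simp only [coeff_gdiff, Polynomial.coeff_map, AlgHom.toRingHom_eq_coe, RingHom.coe_coe, map_add,
    map_smul, map_mul, ExteriorAlgebra.map_apply_ι, map_contract]

end Differential

section Filtration

variable (k : Type*) [Field k] (W : Type*) [AddCommGroup W] [Module k W]

/-- The polynomials of degree `i` (for `deg T = 2`) whose coefficient of `T^j` lies in the step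
`e - j` of the filtration. -/
def Fil (e i : ℕ) : Submodule k (Polynomial (Lam2 k W)) where
  carrier := {p | ∀ j, (2 * j ≤ i → p.coeff j ∈ filQ k W (e - j) (i - 2 * j)) ∧
    (i < 2 * j → p.coeff j = 0)}
  zero_mem' j := by simp
  add_mem' hp hq j := ⟨fun h => by
    rw [Polynomial.coeff_add]; exact add_mem ((hp j).1 h) ((hq j).1 h), fun h => by
    rw [Polynomial.coeff_add, (hp j).2 h, (hq j).2 h, add_zero]⟩
  smul_mem' c p hp j := ⟨fun h => by
    rw [Polynomial.coeff_smul]; exact Submodule.smul_mem _ _ ((hp j).1 h), fun h => by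
    rw [Polynomial.coeff_smul, (hp j).2 h, smul_zero]⟩

variable {k W}

theorem Fil_anti {e e' i : ℕ} (h : e ≤ e') : Fil k W e' i ≤ Fil k W e i := fun _ hp j =>
  ⟨fun hj => filQ_anti (by omega) ((hp j).1 hj), (hp j).2⟩

theorem monomial_mem_Fil {e i j : ℕ} {w : Lam2 k W} (h : 2 * j ≤ i)
    (hw : w ∈ filQ k W (e - j) (i - 2 * j)) : Polynomial.monomial j w ∈ Fil k W e i := by
  intro l
  rw [Polynomial.coeff_monomial]
  split_ifs with hl
  · subst hl
    exact ⟨fun _ => hw, fun h' => by omega⟩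
  · exact ⟨fun _ => zero_mem _, fun _ => rfl⟩

/-- Contraction lowers the filtration by one in the same power of `T`. Multiplication by `t`
preserves it, but moves the coefficient of `T^(j+1)`, in step `e - (j + 1)`, to `T^j`. Both end in
step `e - 1 - j`. -/
theorem gdiff_mem_Fil (φ : Module.Dual k (W × W)) (t : W × W) {e i : ℕ}
    {p : Polynomial (Lam2 k W)} (hp : p ∈ Fil k W e (i + 1)) :
    gdiff φ t p ∈ Fil k W (e - 1) i := by
  intro j
  rw [coeff_gdiff]
  refine ⟨fun h => add_mem ?_ (Submodule.smul_mem _ _ ?_), fun h => ?_⟩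
  · have := (hp j).1 (by omega)
    rw [show i + 1 - 2 * j = i - 2 * j + 1 by omega] at this
    exact filQ_anti (by omega) (contract_filQ φ this)
  · rcases Nat.lt_or_ge (i + 1) (2 * (j + 1)) with h' | h'
    · rw [(hp (j + 1)).2 h', mul_zero]; exact zero_mem _
    · have := ι_mul_filQ t ((hp (j + 1)).1 h')
      rwa [show i + 1 - 2 * (j + 1) + 1 = i - 2 * j by omega,
        show e - (j + 1) = e - 1 - j by omega] at this
  · rw [(hp (j + 1)).2 (by omega), mul_zero, smul_zero, add_zero]
    rcases Nat.lt_or_ge (i + 1) (2 * j) with h' | h'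
    · rw [(hp j).2 h', map_zero]
    · have := (hp j).1 h'
      rw [show i + 1 - 2 * j = 0 by omega] at this
      exact contract_filQ_zero φ this

variable [CharZero k] [FiniteDimensional k W]

/-- Raises the filtration step of the coefficients of `T^j` one after the other, for `j < j₀`. If
the lower coefficients are good, their contractions lie in the wanted step, so the hypothesis on `d
x` controls `t` times the next coefficient. Exactness of multiplication by `t` then makes this
coefficient a multiple of `t` modulo the next step, and a term in `T^(j₀+1)` removes it. -/
theorem exists_sub_gdiff_mem_Fil_succ {ζ₁ ζ₂ : Module.Dual k W} {w₁ w₂ : W}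
    (h11 : ζ₁ w₁ = 1) (h12 : ζ₁ w₂ = 0) (h21 : ζ₂ w₁ = 0) (h22 : ζ₂ w₂ = 1)
    {φ : Module.Dual k (W × W)} (h : φ (-w₂, w₁) = 0) {e i : ℕ}
    (hi : i + 3 ≤ 2 * Module.finrank k W) (he : e + 1 ≤ i + 2 - Module.finrank k W)
    {x : Polynomial (Lam2 k W)} (hx : x ∈ Fil k W e (i + 1))
    (hdx : gdiff φ (-w₂, w₁) x ∈ Fil k W e i) (j₀ : ℕ) (hj₀ : j₀ ≤ e + 1) :
    ∃ w ∈ Fil k W 0 (i + 2), x - gdiff φ (-w₂, w₁) w ∈ Fil k W e (i + 1) ∧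
      ∀ j < j₀, (x - gdiff φ (-w₂, w₁) w).coeff j ∈ filQ k W (e + 1 - j) (i + 1 - 2 * j) := by
  induction j₀ with
  | zero => exact ⟨0, zero_mem _, by simpa using hx, fun j hj => absurd hj (Nat.not_lt_zero _)⟩
  | succ j₀ ih =>
    obtain ⟨w, hw, hxw, hj⟩ := ih (by omega)
    have hd : gdiff φ (-w₂, w₁) (x - gdiff φ (-w₂, w₁) w) ∈ Fil k W e i := by
      rw [map_sub, gdiff_gdiff h, sub_zero]; exact hdx
    generalize hx' : x - gdiff φ (-w₂, w₁) w = x' at hxw hj hd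
    have ht : ExteriorAlgebra.ι k ((-w₂, w₁) : W × W) = cv k w₁ - av k w₂ := by
      rw [ι_eq, map_neg]; abel
    -- With `m` the rank of `W`: `2(e + 1) ≤ 2(i + 2 - m) ≤ i + 1` by `he` and `hi`, so `i - 2e ≥
    -- 1`; this provides the positive weight that `exists_sub_mul_mem_filQ` requires.
    obtain ⟨r, hr⟩ : ∃ r, i = 2 * e + (r + 1) := ⟨i - 2 * e - 1, by omega⟩
    have htx : (cv k w₁ - av k w₂) * x'.coeff j₀ ∈
        filQ k W (e - j₀ + 1) (2 * (e - j₀) + (r + 1) + 2) := by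
      rw [← ht]
      -- For the constant coefficient there is no equation in `d x`. Instead `t x₀` has degree `i +
      -- 2` and lies in step `i + 2 - dim W ≥ e + 1` for reasons of rank.
      rcases j₀ with _ | j₀
      · have h1 := ι_mul_mem ((-w₂, w₁) : W × W) (filQ_le _ _ ((hxw 0).1 (Nat.zero_le _)))
        have h2 := filQ_anti (β := e + 1) (by omega) (exteriorPower_le_filQ _ h1)
        rwa [show i + 1 - 2 * 0 + 1 = 2 * (e - 0) + (r + 1) + 2 by omega] at h2
      · have h1 := (hd j₀).1 (by omega)
        rw [coeff_gdiff] at h1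
        have h2 := hj j₀ (Nat.lt_succ_self _)
        rw [show i + 1 - 2 * j₀ = i - 2 * j₀ + 1 by omega] at h2
        have h3 := contract_filQ φ h2
        have h4 := (Submodule.add_mem_iff_right _
          (filQ_anti (by omega : e - j₀ ≤ e + 1 - j₀ - 1) h3)).1 h1
        have h5 := (Submodule.smul_mem_iff _ (Nat.cast_add_one_ne_zero (R := k) j₀)).1 h4
        rwa [show e - (j₀ + 1) + 1 = e - j₀ by omega,
          show 2 * (e - (j₀ + 1)) + (r + 1) + 2 = i - 2 * j₀ by omega]
    obtain ⟨y, hy, hxy⟩ := exists_sub_mul_mem_filQ h11 h12 h21 h22 (r := r + 1) (by omega)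
      (by
        have := (hxw j₀).1 (by omega)
        rwa [show i + 1 - 2 * j₀ = 2 * (e - j₀) + (r + 1) + 1 by omega] at this) htx
    -- The factor `(j₀ + 1)⁻¹` cancels the derivative of `T^(j₀+1)`. The contraction of `y` enters
    -- only the coefficient of `T^(j₀+1)`, which is not yet treated.
    have hw' : Polynomial.monomial (j₀ + 1) ((j₀ + 1 : k)⁻¹ • y) ∈ Fil k W (e + 1) (i + 2) :=
      monomial_mem_Fil (by omega) (Submodule.smul_mem _ _ (by
        rwa [show e + 1 - (j₀ + 1) = e - j₀ by omega,
          show i + 2 - 2 * (j₀ + 1) = 2 * (e - j₀) + (r + 1) by omega]))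
    have hc : ∀ j, (Polynomial.monomial (j₀ + 1) ((j₀ + 1 : k)⁻¹ • y)).coeff j =
        if j₀ + 1 = j then (j₀ + 1 : k)⁻¹ • y else 0 := fun j => Polynomial.coeff_monomial
    generalize Polynomial.monomial (j₀ + 1) ((j₀ + 1 : k)⁻¹ • y) = w' at hw' hc
    have hw0 : w' ∈ Fil k W 0 (i + 2) := Fil_anti (Nat.zero_le _) hw'
    have hdw : gdiff φ (-w₂, w₁) w' ∈ Fil k W e (i + 1) := by
      have := gdiff_mem_Fil φ (-w₂, w₁) hw'
      rwa [Nat.add_sub_cancel] at this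
    refine ⟨w + w', add_mem hw hw0, ?_, fun j hj' => ?_⟩
    · rw [map_add, ← sub_sub, hx']
      exact sub_mem hxw hdw
    · rw [map_add, ← sub_sub, hx', Polynomial.coeff_sub, coeff_gdiff, hc, hc, if_neg (by omega),
        map_zero, zero_add]
      rcases Nat.lt_or_ge j j₀ with h' | h'
      · rw [if_neg (by omega), mul_zero, smul_zero, sub_zero]
        exact hj j h'
      · obtain rfl : j = j₀ := by omega
        rw [if_pos rfl, mul_smul_comm, smul_smul, mul_inv_cancel₀ (Nat.cast_add_one_ne_zero _),
          one_smul, ht]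
        rwa [show e + 1 - j = e - j + 1 by omega,
          show i + 1 - 2 * j = 2 * (e - j) + (r + 1) + 1 by omega]

/-- Exactness of `D/B` at a point: the filtration step of `x` is raised one by one up to that of
`B`. Subtracting boundaries does not change `d x`, and its step `i + 1 - dim W` is at least every
`e` with `e + 1 ≤ i + 2 - dim W`. -/
theorem exists_sub_gdiff_mem_Fil {ζ₁ ζ₂ : Module.Dual k W} {w₁ w₂ : W}
    (h11 : ζ₁ w₁ = 1) (h12 : ζ₁ w₂ = 0) (h21 : ζ₂ w₁ = 0) (h22 : ζ₂ w₂ = 1)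
    {φ : Module.Dual k (W × W)} (h : φ (-w₂, w₁) = 0) {i : ℕ}
    (hi : i + 3 ≤ 2 * Module.finrank k W) {x : Polynomial (Lam2 k W)} (hx : x ∈ Fil k W 0 (i + 1))
    (hdx : gdiff φ (-w₂, w₁) x ∈ Fil k W (i + 1 - Module.finrank k W) i) :
    ∃ w ∈ Fil k W 0 (i + 2),
      x - gdiff φ (-w₂, w₁) w ∈ Fil k W (i + 2 - Module.finrank k W) (i + 1) := by
  suffices H : ∀ e, e ≤ i + 2 - Module.finrank k W → ∃ w ∈ Fil k W 0 (i + 2),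
      x - gdiff φ (-w₂, w₁) w ∈ Fil k W e (i + 1) from H _ le_rfl
  intro e he
  induction e with
  | zero => exact ⟨0, zero_mem _, by simpa using hx⟩
  | succ e ih =>
    obtain ⟨w, hw, hxw⟩ := ih (by omega)
    obtain ⟨w', hw', hxw', hj⟩ := exists_sub_gdiff_mem_Fil_succ h11 h12 h21 h22 h hi he hxw (by
      rw [map_sub, gdiff_gdiff h, sub_zero]
      exact Fil_anti (by omega) hdx) (e + 1) le_rfl
    refine ⟨w + w', add_mem hw hw', ?_⟩
    rw [map_add, ← sub_sub]
    refine fun j => ⟨fun h' => ?_, (hxw' j).2⟩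
    rcases Nat.lt_or_ge j (e + 1) with h'' | h''
    · exact hj j h''
    · rw [show e + 1 - j = e - j by omega]
      exact (hxw' j).1 h'

end Filtration

end TateModel

end

/-! ### Vector valued functions and the spreading of exactness from a point -/

noncomputable section

namespace TateModel

section Vals

variable {k : Type*} [Field k] {Y : Type*} (𝒪 : Subalgebra k (Y → k))
variable {V V' V'' : Type*} [AddCommGroup V] [Module k V] [AddCommGroup V'] [Module k V']
  [AddCommGroup V''] [Module k V'']

variable (V) in
/-- The functions with values in a vector space whose coordinates are in the algebra `𝒪`. -/
def Vals : Submodule k (Y → V) :=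
  Submodule.span k {f | ∃ a ∈ 𝒪, ∃ v : V, f = fun y => a y • v}

variable {𝒪}

theorem smul_const_mem_Vals {a : Y → k} (ha : a ∈ 𝒪) (v : V) : (fun y => a y • v) ∈ Vals 𝒪 V :=
  Submodule.subset_span ⟨a, ha, v, rfl⟩

theorem const_mem_Vals (v : V) : (fun _ => v) ∈ Vals 𝒪 V := by
  have := smul_const_mem_Vals (one_mem 𝒪) v
  simpa using this

@[elab_as_elim]
theorem Vals_induction {p : (f : Y → V) → f ∈ Vals 𝒪 V → Prop}
    (smul : ∀ a (ha : a ∈ 𝒪) (v : V), p (fun y => a y • v) (smul_const_mem_Vals ha v))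
    (zero : p 0 (zero_mem _))
    (add : ∀ f g hf hg, p f hf → p g hg → p (f + g) (add_mem hf hg)) (f : Y → V)
    (hf : f ∈ Vals 𝒪 V) : p f hf := by
  refine Submodule.closure_induction (p := p) zero add ?_ hf
  rintro c f ⟨a, ha, v, rfl⟩
  have := smul (c • a) (𝒪.smul_mem ha c) v
  have h : (fun y => (c • a) y • v) = c • fun y => a y • v := by
    ext y
    simp [mul_smul]
  simpa only [h] using this

theorem linear_mem_Vals (l : V →ₗ[k] V') {f : Y → V} (hf : f ∈ Vals 𝒪 V) :
    (fun y => l (f y)) ∈ Vals 𝒪 V' := by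
  induction f, hf using Vals_induction with
  | smul a ha v => simpa using smul_const_mem_Vals ha (l v)
  | zero => simpa using const_mem_Vals (𝒪 := 𝒪) (Y := Y) (0 : V')
  | add f g _ _ hf hg => simp only [Pi.add_apply, map_add]; exact add_mem hf hg

theorem bilinear_mem_Vals (l : V →ₗ[k] V' →ₗ[k] V'') {f : Y → V} {g : Y → V'} (hf : f ∈ Vals 𝒪 V)
    (hg : g ∈ Vals 𝒪 V') : (fun y => l (f y) (g y)) ∈ Vals 𝒪 V'' := by
  induction f, hf using Vals_induction with
  | smul a ha v =>
    induction g, hg using Vals_induction with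
    | smul b hb w =>
      have := smul_const_mem_Vals (mul_mem hb ha) (l v w)
      simpa [mul_smul] using this
    | zero => simpa using const_mem_Vals (𝒪 := 𝒪) (Y := Y) (0 : V'')
    | add f g _ _ hf hg => simp only [Pi.add_apply, map_add]; exact add_mem hf hg
  | zero => simpa using const_mem_Vals (𝒪 := 𝒪) (Y := Y) (0 : V'')
  | add f g _ _ hf hg => 
    simp only [Pi.add_apply, map_add, LinearMap.add_apply]; exact add_mem hf hg

theorem mem_Vals_self {a : Y → k} : a ∈ Vals 𝒪 k ↔ a ∈ 𝒪 := by
  refine ⟨fun h => ?_, fun h => by simpa using smul_const_mem_Vals h (1 : k)⟩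
  induction a, h using Vals_induction with
  | smul a ha v => simp only [smul_eq_mul, mul_comm _ v]; exact 𝒪.smul_mem ha v
  | zero => exact zero_mem _
  | add f g _ _ hf hg => exact add_mem hf hg

theorem dual_mem_of_mem_Vals (l : Module.Dual k V) {f : Y → V} (hf : f ∈ Vals 𝒪 V) :
    (fun y => l (f y)) ∈ 𝒪 := mem_Vals_self.1 (linear_mem_Vals l hf)

theorem smul_mem_Vals {a : Y → k} (ha : a ∈ 𝒪) {f : Y → V} (hf : f ∈ Vals 𝒪 V) :
    (fun y => a y • f y) ∈ Vals 𝒪 V :=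
  bilinear_mem_Vals (LinearMap.lsmul k V) (mem_Vals_self.2 ha) hf

theorem apply_mem_Vals {f : Y → V →ₗ[k] V'} {g : Y → V} (hf : f ∈ Vals 𝒪 (V →ₗ[k] V'))
    (hg : g ∈ Vals 𝒪 V) : (fun y => f y (g y)) ∈ Vals 𝒪 V' :=
  bilinear_mem_Vals LinearMap.id hf hg

theorem comp_mem_Vals {f : Y → V' →ₗ[k] V''} {g : Y → V →ₗ[k] V'}
    (hf : f ∈ Vals 𝒪 (V' →ₗ[k] V'')) (hg : g ∈ Vals 𝒪 (V →ₗ[k] V')) :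
    (fun y => f y ∘ₗ g y) ∈ Vals 𝒪 (V →ₗ[k] V'') :=
  bilinear_mem_Vals (LinearMap.llcomp k V V' V'') hf hg

/-- A linear left inverse of `j` recovers `f`. This lets families in a subspace be regarded as
families with values in the subspace. -/
theorem mem_Vals_of_injective {j : V →ₗ[k] V'} (hj : Function.Injective j) {f : Y → V}
    (hf : (fun y => j (f y)) ∈ Vals 𝒪 V') : f ∈ Vals 𝒪 V := by
  obtain ⟨p, hp⟩ := j.exists_leftInverse_of_injective (LinearMap.ker_eq_bot.2 hj)
  have := linear_mem_Vals p hf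
  convert this using 1
  ext y
  exact (LinearMap.congr_fun hp (f y)).symm

theorem mem_Vals_of_basis {ι : Type*} [Fintype ι] (b : Module.Basis ι k V) {f : Y → V}
    (h : ∀ i, (fun y => b.repr (f y) i) ∈ 𝒪) : f ∈ Vals 𝒪 V := by
  have : f = ∑ i, fun y => b.repr (f y) i • b i := by
    ext y
    rw [Finset.sum_apply]
    exact (b.sum_repr (f y)).symm
  rw [this]
  exact sum_mem fun i _ => smul_const_mem_Vals (h i) (b i)

/-- The adjugate of a family of endomorphisms. -/
theorem exists_adjugate_mem_Vals [FiniteDimensional k V] {u : Y → V →ₗ[k] V}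
    (hu : u ∈ Vals 𝒪 (V →ₗ[k] V)) :
    (fun y => LinearMap.det (u y)) ∈ 𝒪 ∧ ∃ u' ∈ Vals 𝒪 (V →ₗ[k] V),
      (∀ y, u y ∘ₗ u' y = LinearMap.det (u y) • LinearMap.id) ∧
      ∀ y, u' y ∘ₗ u y = LinearMap.det (u y) • LinearMap.id := by
  let b := Module.finBasis k V
  have hM : ∀ i j, (fun y => LinearMap.toMatrix b b (u y) i j) ∈ 𝒪 := fun i j =>
    dual_mem_of_mem_Vals (Matrix.entryLinearMap k k i j ∘ₗ
        (LinearMap.toMatrix b b : (V →ₗ[k] V) ≃ₗ[k] Matrix _ _ k).toLinearMap) hu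
  let M : Matrix _ _ 𝒪 := Matrix.of fun i j => ⟨_, hM i j⟩
  let ev : Y → 𝒪 →+* k := fun y => (Pi.evalRingHom _ y).comp 𝒪.toSubring.subtype
  have hev : ∀ y, (ev y).mapMatrix M = LinearMap.toMatrix b b (u y) := fun y => rfl
  have hdet : ∀ y, LinearMap.det (u y) = ev y M.det := fun y => by
    rw [RingHom.map_det, hev, LinearMap.det_toMatrix]
  have hadj : ∀ y, (LinearMap.toMatrix b b (u y)).adjugate = (ev y).mapMatrix M.adjugate :=
    fun y => by rw [RingHom.map_adjugate, hev]
  refine ⟨?_, fun y => Matrix.toLin b b (LinearMap.toMatrix b b (u y)).adjugate, ?_,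
    fun y => ?_, fun y => ?_⟩
  · simp only [hdet]
    exact M.det.2
  · have h1 : (fun y => (LinearMap.toMatrix b b (u y)).adjugate) ∈ Vals 𝒪 (Matrix _ _ k) := by
      refine mem_Vals_of_basis (Matrix.stdBasis k _ _) fun i => ?_
      have : (fun y => (Matrix.stdBasis k _ _).repr (LinearMap.toMatrix b b (u y)).adjugate i) =
          (M.adjugate i.1 i.2).1 := by
        ext y
        rw [hadj]
        rfl
      rw [this]
      exact (M.adjugate i.1 i.2).2
    exact linear_mem_Vals (Matrix.toLin b b : Matrix _ _ k →ₗ[k] V →ₗ[k] V) h1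
  · apply (LinearMap.toMatrix b b).injective
    rw [LinearMap.toMatrix_comp b b b, LinearMap.toMatrix_toLin, Matrix.mul_adjugate,
      LinearMap.det_toMatrix, map_smul, LinearMap.toMatrix_id]
  · apply (LinearMap.toMatrix b b).injective
    rw [LinearMap.toMatrix_comp b b b, LinearMap.toMatrix_toLin, Matrix.adjugate_mul,
      LinearMap.det_toMatrix, map_smul, LinearMap.toMatrix_id]

variable {V₀ V₁ V₂ V₃ : Type*} [AddCommGroup V₀] [Module k V₀] [AddCommGroup V₁] [Module k V₁]
  [AddCommGroup V₂] [Module k V₂] [AddCommGroup V₃] [Module k V₃]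

/-- A homotopy at an exact spot. -/
theorem exists_homotopy {d₂ : V₂ →ₗ[k] V₁} {d₃ : V₃ →ₗ[k] V₂} 
    (hex : LinearMap.ker d₂ ≤ LinearMap.range d₃) {h₂ : V₁ →ₗ[k] V₂} (hh : d₂ ∘ₗ h₂ ∘ₗ d₂ = d₂) :
    ∃ h₃ : V₂ →ₗ[k] V₃, d₃ ∘ₗ h₃ + h₂ ∘ₗ d₂ = LinearMap.id := by
  obtain ⟨j, hj⟩ := d₃.rangeRestrict.exists_rightInverse_of_surjective d₃.range_rangeRestrict
  have hm : ∀ x, (LinearMap.id - h₂ ∘ₗ d₂ : V₂ →ₗ[k] V₂) x ∈ LinearMap.range d₃ := fun x => hex (by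
    have := LinearMap.congr_fun hh x
    simp only [LinearMap.comp_apply] at this
    simp [this])
  refine ⟨j ∘ₗ (LinearMap.id - h₂ ∘ₗ d₂ : V₂ →ₗ[k] V₂).codRestrict _ hm, ?_⟩
  ext x
  have h : d₃ (j ((LinearMap.id - h₂ ∘ₗ d₂ : V₂ →ₗ[k] V₂).codRestrict _ hm x)) = x - h₂ (d₂ x) :=
    congrArg Subtype.val (LinearMap.congr_fun hj _)
  simp only [LinearMap.add_apply, LinearMap.comp_apply, h]
  simp

theorem exists_generalized_inverse (d : V₂ →ₗ[k] V₁) : ∃ h : V₁ →ₗ[k] V₂, d ∘ₗ h ∘ₗ d = d := by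
  obtain ⟨j, hj⟩ := d.rangeRestrict.exists_rightInverse_of_surjective d.range_rangeRestrict
  obtain ⟨p, hp⟩ := (LinearMap.range d).subtype.exists_leftInverse_of_injective
    (Submodule.ker_subtype _)
  refine ⟨j ∘ₗ p, ?_⟩
  ext x
  have h1 : p (d x) = d.rangeRestrict x := LinearMap.congr_fun hp (d.rangeRestrict x)
  have h2 : d (j (d.rangeRestrict x)) = d x :=
    congrArg Subtype.val (LinearMap.congr_fun hj (d.rangeRestrict x))
  simp only [LinearMap.comp_apply, h1, h2]

/-- Exactness of a family of complexes at a point extends to a neighbourhood. -/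
theorem exists_lift_of_exact_at [FiniteDimensional k V₁] [FiniteDimensional k V₂]
    {d₁ : Y → V₁ →ₗ[k] V₀} {d₂ : Y → V₂ →ₗ[k] V₁} {d₃ : Y → V₃ →ₗ[k] V₂}
    (h₁ : d₁ ∈ Vals 𝒪 (V₁ →ₗ[k] V₀)) (h₂ : d₂ ∈ Vals 𝒪 (V₂ →ₗ[k] V₁))
    (h₃ : d₃ ∈ Vals 𝒪 (V₃ →ₗ[k] V₂)) (h12 : ∀ y, d₁ y ∘ₗ d₂ y = 0) (h23 : ∀ y, d₂ y ∘ₗ d₃ y = 0)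
    {y₀ : Y} (hex₂ : LinearMap.ker (d₂ y₀) ≤ LinearMap.range (d₃ y₀))
    (hex₁ : LinearMap.ker (d₁ y₀) ≤ LinearMap.range (d₂ y₀)) {z : Y → V₂} (hz : z ∈ Vals 𝒪 V₂)
    (hdz : ∀ y, d₂ y (z y) = 0) :
    ∃ r ∈ Vals 𝒪 V₃, ∃ q ∈ 𝒪, q y₀ ≠ 0 ∧ ∀ y, d₃ y (r y) = q y • z y := by
  obtain ⟨H₂, hH₂⟩ := exists_generalized_inverse (d₂ y₀)
  obtain ⟨H₃, hH₃⟩ := exists_homotopy hex₂ hH₂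
  -- By exactness at `V₁`, `d₂ H₂` is the identity on the kernel of `d₁`, so `id - d₂ H₂` factors
  -- through `d₁`.
  obtain ⟨H₁, hH₁⟩ : ∃ H₁ : V₀ →ₗ[k] V₁, d₂ y₀ ∘ₗ H₂ + H₁ ∘ₗ d₁ y₀ = LinearMap.id := by
    have hk : LinearMap.ker (d₁ y₀) ≤ LinearMap.ker (LinearMap.id - d₂ y₀ ∘ₗ H₂) := fun x hx => by
      obtain ⟨w, rfl⟩ := hex₁ hx
      have := LinearMap.congr_fun hH₂ w
      simp only [LinearMap.comp_apply] at this
      simp [this]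
    obtain ⟨H₁, hH₁⟩ := LinearMap.exists_extend
      (((LinearMap.ker (d₁ y₀)).liftQ _ hk) ∘ₗ (d₁ y₀).quotKerEquivRange.symm.toLinearMap)
    refine ⟨H₁, ?_⟩
    ext x
    have h : H₁ (d₁ y₀ x) = _ := LinearMap.congr_fun hH₁ ((d₁ y₀).rangeRestrict x)
    have h' : (d₁ y₀).quotKerEquivRange.symm ((d₁ y₀).rangeRestrict x) =
        (LinearMap.ker (d₁ y₀)).mkQ x := (d₁ y₀).quotKerEquivRange_symm_apply_image x _
    simp only [LinearMap.comp_apply, LinearEquiv.coe_coe, h', Submodule.mkQ_apply,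
      Submodule.liftQ_apply] at h
    simp [h]
  -- The homotopies chosen at `y₀` are kept constant. The operators `u₂, u₁` become the identity at
  -- `y₀`, so their determinants do not vanish there, and `d₂ u₂ = u₁ d₂` everywhere.
  obtain ⟨u₂, hU₂⟩ : ∃ u, u = fun y => d₃ y ∘ₗ H₃ + H₂ ∘ₗ d₂ y := ⟨_, rfl⟩
  obtain ⟨u₁, hU₁⟩ : ∃ u, u = fun y => d₂ y ∘ₗ H₂ + H₁ ∘ₗ d₁ y := ⟨_, rfl⟩
  have hu₂ : u₂ ∈ Vals 𝒪 (V₂ →ₗ[k] V₂) := hU₂ ▸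
    add_mem (comp_mem_Vals h₃ (const_mem_Vals H₃)) (comp_mem_Vals (const_mem_Vals H₂) h₂)
  have hu₁ : u₁ ∈ Vals 𝒪 (V₁ →ₗ[k] V₁) := hU₁ ▸
    add_mem (comp_mem_Vals h₂ (const_mem_Vals H₂)) (comp_mem_Vals (const_mem_Vals H₁) h₁)
  obtain ⟨hq₂, v₂, hv₂, huv₂, -⟩ := exists_adjugate_mem_Vals hu₂
  obtain ⟨hq₁, v₁, -, -, hvu₁⟩ := exists_adjugate_mem_Vals hu₁
  have hcomm : ∀ y x, d₂ y ((d₃ y ∘ₗ H₃ + H₂ ∘ₗ d₂ y) x) =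
      (d₂ y ∘ₗ H₂ + H₁ ∘ₗ d₁ y) (d₂ y x) := fun y x => by
    have e1 := LinearMap.congr_fun (h12 y) x
    have e2 := LinearMap.congr_fun (h23 y) (H₃ x)
    simp only [LinearMap.comp_apply, LinearMap.zero_apply] at e1 e2
    simp [e1, e2]
  have hU₂' : ∀ y, d₃ y ∘ₗ H₃ + H₂ ∘ₗ d₂ y = u₂ y := fun y => (congrFun hU₂ y).symm
  have hU₁' : ∀ y, d₂ y ∘ₗ H₂ + H₁ ∘ₗ d₁ y = u₁ y := fun y => (congrFun hU₁ y).symm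
  simp only [hU₂', hU₁'] at hcomm hH₁ hH₃
  -- The vector `v₂ z` satisfies `u₂ v₂ z = det(u₂) z`. From `u₁ d₂ v₂ z = d₂ u₂ v₂ z = 0` it is a
  -- cycle after multiplication by `det(u₁)`; then `d₃ H₃` alone computes `u₂`.
  have hz₂ : (fun y => LinearMap.det (u₁ y) • v₂ y (z y)) ∈ Vals 𝒪 V₂ :=
    smul_mem_Vals hq₁ (apply_mem_Vals hv₂ hz)
  refine ⟨fun y => H₃ (LinearMap.det (u₁ y) • v₂ y (z y)), linear_mem_Vals H₃ hz₂,
    fun y => LinearMap.det (u₁ y) * LinearMap.det (u₂ y), mul_mem hq₁ hq₂, ?_, fun y => ?_⟩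
  · simp [hH₁, hH₃]
  · have e1 : u₂ y (v₂ y (z y)) = LinearMap.det (u₂ y) • z y := LinearMap.congr_fun (huv₂ y) _
    have e2 : LinearMap.det (u₁ y) • d₂ y (v₂ y (z y)) = 0 := by
      rw [← LinearMap.id_apply (R := k) (d₂ y (v₂ y (z y))), ← LinearMap.smul_apply, ← hvu₁,
        LinearMap.comp_apply, ← hcomm, e1, map_smul, hdz, smul_zero, map_zero]
    have e3 := LinearMap.congr_fun (hU₂' y) (LinearMap.det (u₁ y) • v₂ y (z y))
    simp only [LinearMap.add_apply, LinearMap.comp_apply, map_smul, e1] at e3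
    rw [smul_add, ← map_smul H₂, e2, map_zero, add_zero] at e3
    simp only [map_smul, e3, smul_smul]

end Vals

end TateModel

end

/-! ### Relative exactness and the passage from a complex to a subcomplex -/

noncomputable section

namespace TateModel

section Relative

variable {k : Type*} [Field k] {Y : Type*} {𝒪 : Subalgebra k (Y → k)}
variable {V : Type*} [AddCommGroup V] [Module k V]

/-- A section `S` and an extension `Q` of the projection turn the differentials induced on `D/B`
into families of maps `Q d S` between fixed vector spaces. -/
theorem exists_subquotient (B D : Submodule k V) :
    ∃ (Q : V →ₗ[k] D ⧸ B.submoduleOf D) (S : (D ⧸ B.submoduleOf D) →ₗ[k] V),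
      (∀ c, S c ∈ D) ∧ (∀ c, Q (S c) = c) ∧ ∀ x ∈ D, Q x = 0 ↔ x ∈ B := by
  obtain ⟨S, hS⟩ := (B.submoduleOf D).mkQ.exists_rightInverse_of_surjective
    (Submodule.range_mkQ _)
  obtain ⟨Q, hQ⟩ := LinearMap.exists_extend (B.submoduleOf D).mkQ
  have hQ' : ∀ x : D, Q x = (B.submoduleOf D).mkQ x := fun x => LinearMap.congr_fun hQ x
  refine ⟨Q, D.subtype ∘ₗ S, fun c => (S c).2, fun c => ?_, fun x hx => ?_⟩
  · exact (hQ' (S c)).trans (LinearMap.congr_fun hS c)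
  · rw [hQ' ⟨x, hx⟩, Submodule.mkQ_apply, Submodule.Quotient.mk_eq_zero]
    exact Iff.rfl

/-- Relative exactness of a family of filtered complexes at a point extends to a neighbourhood. -/
theorem exists_relative_lift {D B : ℕ → Submodule k V}
    [∀ j, FiniteDimensional k (D j)] {d : Y → V →ₗ[k] V} (hd : d ∈ Vals 𝒪 (V →ₗ[k] V))
    (hdd : ∀ y x, d y (d y x) = 0) (hD : ∀ y j, ∀ x ∈ D (j + 1), d y x ∈ D j)
    (hB : ∀ y j, ∀ x ∈ B (j + 1), d y x ∈ B j) {y₀ : Y} {i : ℕ}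
    (hex₁ : ∀ x ∈ D (i + 1), d y₀ x ∈ B i → ∃ w ∈ D (i + 2), x - d y₀ w ∈ B (i + 1))
    (hex₂ : ∀ x ∈ D (i + 2), d y₀ x ∈ B (i + 1) → ∃ w ∈ D (i + 3), x - d y₀ w ∈ B (i + 2))
    {z : Y → V} (hz : z ∈ Vals 𝒪 V) (hzD : ∀ y, z y ∈ D (i + 2))
    (hdz : ∀ y, d y (z y) ∈ B (i + 1)) :
    ∃ r ∈ Vals 𝒪 V, ∃ q ∈ 𝒪, q y₀ ≠ 0 ∧ (∀ y, r y ∈ D (i + 3)) ∧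
      ∀ y, q y • z y - d y (r y) ∈ B (i + 2) := by
  choose Q S hSD hQS hQ using fun j => exists_subquotient (B j) (D j)
  have hSQ : ∀ j, ∀ x ∈ D j, S j (Q j x) - x ∈ B j := fun j x hx => by
    rw [← hQ j _ (sub_mem (hSD j _) hx), map_sub, hQS, sub_self]
  have hQdSQ : ∀ y j, ∀ x ∈ D (j + 1), Q j (d y (S (j + 1) (Q (j + 1) x))) = Q j (d y x) :=
    fun y j x hx => by
      rw [← sub_eq_zero, ← map_sub, ← map_sub, hQ j]
      · exact hB y j _ (hSQ _ x hx)
      · exact hD y j _ (sub_mem (hSD _ _) hx)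
  have hmem : ∀ j, (fun y => Q j ∘ₗ d y ∘ₗ S (j + 1)) ∈
      Vals 𝒪 ((D (j + 1) ⧸ (B (j + 1)).submoduleOf (D (j + 1))) →ₗ[k]
        (D j ⧸ (B j).submoduleOf (D j))) := fun j =>
    comp_mem_Vals (const_mem_Vals _) (comp_mem_Vals hd (const_mem_Vals _))
  have hcomp : ∀ j y, (Q j ∘ₗ d y ∘ₗ S (j + 1)) ∘ₗ (Q (j + 1) ∘ₗ d y ∘ₗ S (j + 2)) = 0 :=
    fun j y => by
      refine LinearMap.ext fun c => ?_
      simp only [LinearMap.comp_apply]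
      rw [hQdSQ y j _ (hD y _ _ (hSD _ _)), hdd, map_zero, LinearMap.zero_apply]
  have hexact : ∀ j, (∀ x ∈ D (j + 1), d y₀ x ∈ B j → ∃ w ∈ D (j + 2), x - d y₀ w ∈ B (j + 1)) →
      LinearMap.ker (Q j ∘ₗ d y₀ ∘ₗ S (j + 1)) ≤
        LinearMap.range (Q (j + 1) ∘ₗ d y₀ ∘ₗ S (j + 2)) := fun j hj c hc => by
    obtain ⟨w, hw, hxw⟩ := hj _ (hSD _ c) ((hQ _ _ (hD _ _ _ (hSD _ _))).1 hc)
    refine ⟨Q (j + 2) w, ?_⟩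
    simp only [LinearMap.comp_apply]
    rw [hQdSQ y₀ (j + 1) w hw]
    have := (hQ _ _ (sub_mem (hSD _ c) (hD _ _ _ hw))).2 hxw
    rw [map_sub, hQS, sub_eq_zero] at this
    exact this.symm
  obtain ⟨r, hr, q, hq, hq0, hrq⟩ := exists_lift_of_exact_at (hmem i) (hmem (i + 1)) (hmem (i + 2))
    (hcomp i) (hcomp (i + 1)) (hexact (i + 1) hex₂) (hexact i hex₁)
    (linear_mem_Vals (Q (i + 2)) hz) (fun y => by
      simp only [LinearMap.comp_apply]
      rw [hQdSQ y _ _ (hzD y)]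
      exact (hQ _ _ (hD _ _ _ (hzD y))).2 (hdz y))
  refine ⟨_, linear_mem_Vals (S (i + 3)) hr, q, hq, hq0, fun y => hSD _ _, fun y => ?_⟩
  rw [← hQ _ _ (sub_mem (Submodule.smul_mem _ _ (hzD y)) (hD _ _ _ (hSD _ _))), map_sub, map_smul,
    ← hrq y, sub_eq_zero]
  rfl

end Relative

section LocalExactness

variable {k : Type*} [Field k] {M : Type*} [AddCommGroup M] [Module k M]

variable (k M) in
/-- The differential as a linear function of the parameters. -/
def gdiffL : (Module.Dual k M × M) →ₗ[k]
    Polynomial (ExteriorAlgebra k M) →ₗ[k] Polynomial (ExteriorAlgebra k M) where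
  toFun p := gdiff p.1 p.2
  map_add' p q := by
    apply LinearMap.ext
    intro x
    ext1 j
    simp only [LinearMap.add_apply, Polynomial.coeff_add, coeff_gdiff, Prod.fst_add, Prod.snd_add,
      map_add, add_mul, smul_add]
    abel
  map_smul' c p := by
    apply LinearMap.ext
    intro x
    ext1 j
    simp only [LinearMap.smul_apply, Polynomial.coeff_smul, coeff_gdiff, Prod.smul_fst,
      Prod.smul_snd, map_smul, smul_add, smul_mul_assoc, RingHom.id_apply, smul_comm c]

theorem gdiffL_apply (φ : Module.Dual k M) (t : M) : gdiffL k M (φ, t) = gdiff φ t := rfl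

variable {Y : Type*} {𝒪 : Subalgebra k (Y → k)}

theorem pair_mem_Vals {V V' : Type*} [AddCommGroup V] [Module k V] [AddCommGroup V'] [Module k V']
    {f : Y → V} {g : Y → V'} (hf : f ∈ Vals 𝒪 V) (hg : g ∈ Vals 𝒪 V') :
    (fun y => (f y, g y)) ∈ Vals 𝒪 (V × V') := by
  convert add_mem (linear_mem_Vals (LinearMap.inl k V V') hf)
    (linear_mem_Vals (LinearMap.inr k V V') hg) using 1
  ext y <;> simp

theorem gdiff_mem_Vals {φ : Y → Module.Dual k M} {t : Y → M} (hφ : φ ∈ Vals 𝒪 (Module.Dual k M))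
    (ht : t ∈ Vals 𝒪 M) : (fun y => gdiff (φ y) (t y)) ∈ Vals 𝒪
      (Polynomial (ExteriorAlgebra k M) →ₗ[k] Polynomial (ExteriorAlgebra k M)) := by
  simp only [← gdiffL_apply]
  exact linear_mem_Vals (gdiffL k M) (f := fun y => (φ y, t y)) (pair_mem_Vals hφ ht)

variable {W : Type*} [AddCommGroup W] [Module k W] [FiniteDimensional k W]

variable (k W) in
/-- The coefficients of the elements of `Fil k W e i`. -/
def filCoeff (e i : ℕ) : Fil k W e i →ₗ[k] (Fin (i + 1) → Lam2 k W) where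
  toFun := fun p j => p.1.coeff j
  map_add' := fun p q => by ext1 j; exact Polynomial.coeff_add _ _ _
  map_smul' := fun c p => by ext1 j; exact Polynomial.coeff_smul _ _ _

omit [FiniteDimensional k W] in
theorem filCoeff_injective (e i : ℕ) : Function.Injective (filCoeff k W e i) := by
  intro p q h
  apply Subtype.ext
  ext1 j
  rcases Nat.lt_or_ge i (2 * j) with hj | hj
  · rw [(p.2 j).2 hj, (q.2 j).2 hj]
  · exact congrFun h ⟨j, by omega⟩

instance finiteDimensional_Fil (e i : ℕ) : FiniteDimensional k (Fil k W e i) :=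
  Module.Finite.of_injective (filCoeff k W e i) (filCoeff_injective e i)

variable [CharZero k]

/-- If the Tate complex is locally exact, so is its subcomplex. -/
theorem exists_primitive_of_exact {φ : Y → Module.Dual k (W × W)}
    (hφ : φ ∈ Vals 𝒪 (Module.Dual k (W × W))) {w₁ w₂ : Y → W} (hw₁ : w₁ ∈ Vals 𝒪 W)
    (hw₂ : w₂ ∈ Vals 𝒪 W) (h : ∀ y, φ y (-w₂ y, w₁ y) = 0) {y₀ : Y} {ζ₁ ζ₂ : Module.Dual k W}
    (h11 : ζ₁ (w₁ y₀) = 1) (h12 : ζ₁ (w₂ y₀) = 0) (h21 : ζ₂ (w₁ y₀) = 0) (h22 : ζ₂ (w₂ y₀) = 1)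
    {i : ℕ} (hi : i + 4 ≤ 2 * Module.finrank k W)
    (hD : ∀ z ∈ Vals 𝒪 (Polynomial (Lam2 k W)), (∀ y, z y ∈ Fil k W 0 (i + 1)) →
      (∀ y, gdiff (φ y) (-w₂ y, w₁ y) (z y) = 0) →
      ∃ r ∈ Vals 𝒪 (Polynomial (Lam2 k W)), ∃ q ∈ 𝒪, q y₀ ≠ 0 ∧ (∀ y, r y ∈ Fil k W 0 (i + 2)) ∧
        ∀ y, gdiff (φ y) (-w₂ y, w₁ y) (r y) = q y • z y)
    {z : Y → Polynomial (Lam2 k W)} (hz : z ∈ Vals 𝒪 (Polynomial (Lam2 k W)))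
    (hzF : ∀ y, z y ∈ Fil k W (i + 2 - Module.finrank k W) (i + 1))
    (hdz : ∀ y, gdiff (φ y) (-w₂ y, w₁ y) (z y) = 0) :
    ∃ r ∈ Vals 𝒪 (Polynomial (Lam2 k W)), ∃ q ∈ 𝒪, q y₀ ≠ 0 ∧
      (∀ y, r y ∈ Fil k W (i + 3 - Module.finrank k W) (i + 2)) ∧
        ∀ y, gdiff (φ y) (-w₂ y, w₁ y) (r y) = q y • z y := by
  obtain ⟨r₁, hr₁, q₁, hq₁, hq₁0, hr₁D, hr₁z⟩ := hD z hz (fun y => Fil_anti (Nat.zero_le _) (hzF y))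
    hdz
  have hg : (fun y => gdiff (φ y) (-w₂ y, w₁ y)) ∈ Vals 𝒪
      (Polynomial (Lam2 k W) →ₗ[k] Polynomial (Lam2 k W)) :=
    gdiff_mem_Vals hφ (pair_mem_Vals (f := fun y => -w₂ y) (Submodule.neg_mem _ hw₂) hw₁)
  have hgg : ∀ y x, gdiff (φ y) (-w₂ y, w₁ y) (gdiff (φ y) (-w₂ y, w₁ y) x) = 0 :=
    fun y x => gdiff_gdiff (h y) x
  have hDD : ∀ y j, ∀ x ∈ Fil k W 0 (j + 1), gdiff (φ y) (-w₂ y, w₁ y) x ∈ Fil k W 0 j :=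
    fun y j x hx => by
      have := gdiff_mem_Fil (φ y) (-w₂ y, w₁ y) hx
      rwa [Nat.zero_sub] at this
  have hBB : ∀ y j, ∀ x ∈ Fil k W (j + 1 + 1 - Module.finrank k W) (j + 1),
      gdiff (φ y) (-w₂ y, w₁ y) x ∈ Fil k W (j + 1 - Module.finrank k W) j :=
    fun y j x hx => by
      have := gdiff_mem_Fil (φ y) (-w₂ y, w₁ y) hx
      rwa [show j + 1 + 1 - Module.finrank k W - 1 = j + 1 - Module.finrank k W by omega] at this
  have hex : ∀ j, j + 3 ≤ 2 * Module.finrank k W → ∀ x ∈ Fil k W 0 (j + 1),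
      gdiff (φ y₀) (-w₂ y₀, w₁ y₀) x ∈ Fil k W (j + 1 - Module.finrank k W) j →
      ∃ w ∈ Fil k W 0 (j + 2),
        x - gdiff (φ y₀) (-w₂ y₀, w₁ y₀) w ∈ Fil k W (j + 1 + 1 - Module.finrank k W) (j + 1) :=
    fun j hj x hx hdx => exists_sub_gdiff_mem_Fil h11 h12 h21 h22 (h y₀) hj hx hdx
  -- The primitive in `D` has its differential in `B`, so it is a cycle of `D/B`.
  have hz₁ : ∀ y, gdiff (φ y) (-w₂ y, w₁ y) (r₁ y) ∈
      Fil k W (i + 1 + 1 - Module.finrank k W) (i + 1) := fun y => by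
    rw [hr₁z y]
    exact Submodule.smul_mem _ _ (hzF y)
  generalize hgd : (fun y => gdiff (φ y) (-w₂ y, w₁ y)) = g at hg
  have hgd' : ∀ y, gdiff (φ y) (-w₂ y, w₁ y) = g y := fun y => congrFun hgd y
  simp only [hgd'] at hgg hDD hBB hex hz₁ hr₁z ⊢
  -- Two consecutive degrees of `D/B` are needed: exactness at the spot of `r₁`, and at the
  -- preceding one for spreading it to a neighbourhood.
  obtain ⟨r₂, hr₂, q₂, hq₂, hq₂0, hr₂D, hr₂B⟩ := exists_relative_lift
    (D := fun j => Fil k W 0 j) (B := fun j => Fil k W (j + 1 - Module.finrank k W) j)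
    hg hgg hDD hBB (hex i (by omega)) (hex (i + 1) (by omega)) hr₁ hr₁D hz₁
  refine ⟨fun y => q₂ y • r₁ y - g y (r₂ y),
    sub_mem (smul_mem_Vals hq₂ hr₁) (apply_mem_Vals hg hr₂), q₂ * q₁, mul_mem hq₂ hq₁,
    mul_ne_zero hq₂0 hq₁0, hr₂B, fun y => ?_⟩
  rw [map_sub, map_smul, hgg, hr₁z, smul_smul, sub_zero, Pi.mul_apply]

end LocalExactness

end TateModel

end

/-! ### Exactness of the Koszul complex on polynomial functions -/

noncomputable section

namespace TateModel

section Koszul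

local notation:70 φ "⌋" x:70 => CliffordAlgebra.contractLeft (Q := (0 : QuadraticForm _ _)) φ x

variable (σ k : Type*) [Field k]

/-- The algebra of polynomial functions on `k ^ σ`. -/
def polyFun : Subalgebra k ((σ → k) → k) :=
  (MvPolynomial.aeval (fun (i : σ) (y : σ → k) => y i) :
    MvPolynomial σ k →ₐ[k] ((σ → k) → k)).range

variable {σ k}

theorem mem_polyFun {f : (σ → k) → k} :
    f ∈ polyFun σ k ↔ ∃ p : MvPolynomial σ k, ∀ y, f y = MvPolynomial.eval y p := by
  have h : ∀ (p : MvPolynomial σ k) (y : σ → k),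
      MvPolynomial.aeval (fun (i : σ) (y : σ → k) => y i) p y = MvPolynomial.eval y p := by
    intro p y
    induction p using MvPolynomial.induction_on with
    | C a => simp
    | add p q hp hq => simp [hp, hq]
    | mul_X p i hp => simp [hp]
  constructor
  · rintro ⟨p, rfl⟩
    exact ⟨p, fun y => h p y⟩
  · rintro ⟨p, hp⟩
    exact ⟨p, funext fun y => (h p y).trans (hp y).symm⟩

theorem coord_mem_polyFun (i : σ) : (fun y : σ → k => y i) ∈ polyFun σ k :=
  mem_polyFun.2 ⟨MvPolynomial.X i, by simp⟩

variable {V V' : Type*} [AddCommGroup V] [Module k V] [AddCommGroup V'] [Module k V']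

variable (V) in
/-- Evaluation of vector valued polynomials. -/
def evT (y : σ → k) : MvPolynomial σ k ⊗[k] V →ₗ[k] V :=
  TensorProduct.lift ((LinearMap.lsmul k V).comp (MvPolynomial.aeval y).toLinearMap)

theorem evT_tmul (y : σ → k) (p : MvPolynomial σ k) (v : V) :
    evT V y (p ⊗ₜ v) = MvPolynomial.eval y p • v := rfl

theorem evT_map_id (f : V →ₗ[k] V') (y : σ → k) (z : MvPolynomial σ k ⊗[k] V) :
    evT V' y (TensorProduct.map LinearMap.id f z) = f (evT V y z) := by
  induction z with
  | zero => simp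
  | add x y hx hy => simp only [map_add, hx, hy]
  | tmul p v => simp [evT_tmul]

theorem evT_mem_Vals (z : MvPolynomial σ k ⊗[k] V) : (fun y => evT V y z) ∈ Vals (polyFun σ k) V := by
  induction z with
  | zero => simpa using const_mem_Vals (𝒪 := polyFun σ k) (0 : V)
  | add x y hx hy => simp only [map_add]; exact add_mem hx hy
  | tmul p v => exact smul_const_mem_Vals (mem_polyFun.2 ⟨p, fun _ => rfl⟩) v

theorem exists_evT_eq {f : (σ → k) → V} (hf : f ∈ Vals (polyFun σ k) V) :
    ∃ z, ∀ y, evT V y z = f y := by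
  induction f, hf using Vals_induction with
  | smul a ha v =>
    obtain ⟨p, hp⟩ := mem_polyFun.1 ha
    exact ⟨p ⊗ₜ v, fun y => by rw [evT_tmul, ← hp]⟩
  | zero => exact ⟨0, fun y => map_zero _⟩
  | add f g _ _ hf hg =>
    obtain ⟨z, hz⟩ := hf
    obtain ⟨w, hw⟩ := hg
    exact ⟨z + w, fun y => by rw [map_add, hz, hw, Pi.add_apply]⟩

/-- Over an infinite field a polynomial is determined by its values, and this is applied to the
coordinates in a basis. -/
theorem eq_zero_of_evT_eq_zero [Infinite k] {z : MvPolynomial σ k ⊗[k] V}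
    (h : ∀ y, evT V y z = 0) : z = 0 := by
  let b := Module.Free.chooseBasis k V
  apply (b.baseChange (MvPolynomial σ k)).repr.injective
  ext1 i
  rw [map_zero, Finsupp.zero_apply]
  refine MvPolynomial.funext fun y => ?_
  rw [map_zero]
  have key : MvPolynomial.eval y ((b.baseChange (MvPolynomial σ k)).repr z i) =
      b.repr (evT V y z) i := by
    clear h
    induction z with
    | zero => simp
    | add x y hx hy => simp only [map_add, Finsupp.add_apply, hx, hy]
    | tmul p v => simp [evT_tmul, Module.Basis.baseChange_repr_tmul, mul_comm]
  rw [key, h, map_zero, Finsupp.zero_apply]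

variable {κ : Type*} [Fintype κ] (ρ : κ → σ)

/-- Division of the monomials by their degree in part of the variables, plus `q`. -/
def invDeg (q : ℕ) : MvPolynomial σ k →ₗ[k] MvPolynomial σ k :=
  (MvPolynomial.basisMonomials σ k).constr k fun α =>
    MvPolynomial.monomial α ((∑ a, α (ρ a) + q : ℕ) : k)⁻¹

theorem invDeg_monomial (q : ℕ) (α : σ →₀ ℕ) (c : k) :
    invDeg ρ q (MvPolynomial.monomial α c) =
      MvPolynomial.monomial α (c * ((∑ a, α (ρ a) + q : ℕ) : k)⁻¹) := by
  have : MvPolynomial.monomial α c = c • MvPolynomial.basisMonomials σ k α := by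
    simp [MvPolynomial.smul_monomial]
  rw [this, map_smul, invDeg, Module.Basis.constr_basis, MvPolynomial.smul_monomial, smul_eq_mul]

/-- Multiplication by a variable raises the polynomial degree by one, which the shift of `q`
compensates. -/
theorem invDeg_X_mul {ρ : κ → σ} (hρ : Function.Injective ρ) (q : ℕ) (a : κ)
    (p : MvPolynomial σ k) :
    invDeg ρ q (MvPolynomial.X (ρ a) * p) = MvPolynomial.X (ρ a) * invDeg ρ (q + 1) p := by
  induction p using MvPolynomial.induction_on' with
  | add p q hp hq => simp only [mul_add, map_add, hp, hq]
  | monomial α c =>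
    rw [MvPolynomial.X, MvPolynomial.monomial_mul, invDeg_monomial, invDeg_monomial,
      MvPolynomial.monomial_mul, one_mul, one_mul]
    congr 4
    classical
    have : ∑ b, (Finsupp.single (ρ a) 1 + α : σ →₀ ℕ) (ρ b) = 1 + ∑ b, α (ρ b) := by
      simp only [Finsupp.add_apply, Finset.sum_add_distrib, Finsupp.single_apply, hρ.eq_iff,
        Finset.sum_ite_eq, Finset.mem_univ, if_true]
    rw [this]; ring

/-- Euler's formula: on monomials of degree `p` in the variables selected by `ρ` the operator in
parentheses is multiplication by `p + q`, which is nonzero as `q > 0`. -/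
theorem invDeg_euler [CharZero k] {q : ℕ} (hq : 0 < q) (p : MvPolynomial σ k) :
    invDeg ρ q (∑ a, MvPolynomial.X (ρ a) * MvPolynomial.pderiv (ρ a) p + (q : k) • p) = p := by
  induction p using MvPolynomial.induction_on' with
  | add p q hp hq =>
    conv_rhs => rw [← hp, ← hq]
    rw [← map_add]
    congr 1
    simp only [map_add, mul_add, Finset.sum_add_distrib, smul_add]
    abel
  | monomial α c =>
    simp only [MvPolynomial.X_mul_pderiv_monomial]
    rw [← Finset.sum_smul, ← Nat.cast_smul_eq_nsmul k, ← add_smul, map_smul, invDeg_monomial,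
      MvPolynomial.smul_monomial, smul_eq_mul]
    congr 1
    have : ((∑ a, α (ρ a) + q : ℕ) : k) ≠ 0 := Nat.cast_ne_zero.2 (by omega)
    push_cast at this ⊢
    field_simp

variable {M : Type*} [AddCommGroup M] [Module k M]

theorem sum_ι_mul_contract {ι : Type*} [Fintype ι] {e : ι → M} {ε : ι → Module.Dual k M}
    (h : ∀ m, ∑ a, ε a m • e a = m) {d : ℕ} {x : ExteriorAlgebra k M} (hx : x ∈ ⋀[k]^d M) :
    ∑ a, ExteriorAlgebra.ι k (e a) * (ε a⌋x) = (d : k) • x := by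
  induction d, x, hx using exteriorPower_induction with
  | algebraMap r => simp
  | add d x y _ _ hx hy => simp only [map_add, mul_add, Finset.sum_add_distrib, hx, hy, smul_add]
  | ι_mul d x m _ hx =>
    have h1 : ∀ a, ExteriorAlgebra.ι k (e a) * (ε a⌋(ExteriorAlgebra.ι k m * x)) =
        ExteriorAlgebra.ι k (ε a m • e a) * x +
          ExteriorAlgebra.ι k m * (ExteriorAlgebra.ι k (e a) * (ε a⌋x)) := fun a => by
      rw [contract_ι_mul, mul_sub, mul_smul_comm, map_smul, smul_mul_assoc, sub_eq_add_neg]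
      congr 1
      rw [← mul_assoc, ← mul_assoc, ← neg_mul]
      congr 1
      exact neg_eq_of_add_eq_zero_left (ExteriorAlgebra.ι_add_mul_swap m (e a))
    simp only [h1, Finset.sum_add_distrib, ← Finset.sum_mul, ← Finset.mul_sum, hx, ← map_sum, h]
    rw [mul_smul_comm]
    push_cast
    rw [add_smul, one_smul, add_comm]

variable (e : κ → M) (ε : κ → Module.Dual k M)

/-- The Koszul differential on polynomials with values in an exterior algebra. -/
def koszulD : MvPolynomial σ k ⊗[k] ExteriorAlgebra k M →ₗ[k]
    MvPolynomial σ k ⊗[k] ExteriorAlgebra k M :=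
  ∑ a, TensorProduct.map (LinearMap.mulLeft k (MvPolynomial.X (ρ a)))
    (CliffordAlgebra.contractLeft (ε a))

/-- The de Rham differential on polynomials with values in an exterior algebra. -/
def deRham : MvPolynomial σ k ⊗[k] ExteriorAlgebra k M →ₗ[k]
    MvPolynomial σ k ⊗[k] ExteriorAlgebra k M :=
  ∑ a, TensorProduct.map (MvPolynomial.pderiv (ρ a)).toLinearMap
    (LinearMap.mulLeft k (ExteriorAlgebra.ι k (e a)))

theorem koszulD_tmul (p : MvPolynomial σ k) (w : ExteriorAlgebra k M) :
    koszulD ρ ε (p ⊗ₜ w) = ∑ a, (MvPolynomial.X (ρ a) * p) ⊗ₜ (ε a⌋w) := by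
  simp [koszulD, LinearMap.sum_apply]

theorem deRham_tmul (p : MvPolynomial σ k) (w : ExteriorAlgebra k M) :
    deRham ρ e (p ⊗ₜ w) =
      ∑ a, (MvPolynomial.pderiv (ρ a) p) ⊗ₜ (ExteriorAlgebra.ι k (e a) * w) := by
  simp [deRham, LinearMap.sum_apply]

variable {ρ e ε}

/-- Cartan's formula: the anticommutator of the Koszul and the de Rham differential is the sum of
the Euler operators on polynomials and on the exterior algebra. -/
theorem koszulD_deRham [DecidableEq κ] (hρ : Function.Injective ρ)
    (hε : ∀ a b, ε a (e b) = if a = b then 1 else 0)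
    (p : MvPolynomial σ k) (w : ExteriorAlgebra k M) :
    koszulD ρ ε (deRham ρ e (p ⊗ₜ w)) + deRham ρ e (koszulD ρ ε (p ⊗ₜ w)) =
      (∑ a, MvPolynomial.X (ρ a) * MvPolynomial.pderiv (ρ a) p) ⊗ₜ w +
        p ⊗ₜ (∑ a, ExteriorAlgebra.ι k (e a) * (ε a⌋w)) := by
  rw [deRham_tmul, koszulD_tmul, map_sum, map_sum]
  simp only [koszulD_tmul, deRham_tmul]
  have h1 : ∀ a b, MvPolynomial.pderiv (ρ a) (MvPolynomial.X (ρ b) * p) =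
      (if a = b then p else 0) + MvPolynomial.X (ρ b) * MvPolynomial.pderiv (ρ a) p := by
    intro a b
    rw [MvPolynomial.pderiv_mul]
    split_ifs with h
    · rw [h, MvPolynomial.pderiv_X_self, one_mul]
    · rw [MvPolynomial.pderiv_X_of_ne (fun h' => h (hρ h').symm), zero_mul]
  rw [Finset.sum_comm, ← Finset.sum_add_distrib]
  simp only [← Finset.sum_add_distrib, h1, contract_ι_mul, hε, TensorProduct.add_tmul,
    TensorProduct.tmul_sub, sub_add_add_cancel]
  simp only [Finset.sum_add_distrib, ite_smul, one_smul, zero_smul, TensorProduct.tmul_ite,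
    TensorProduct.ite_tmul, Finset.sum_ite_eq,
    Finset.sum_ite_eq', Finset.mem_univ, if_true, TensorProduct.sum_tmul, TensorProduct.tmul_sum]

theorem evT_koszulD (y : σ → k) (z : MvPolynomial σ k ⊗[k] ExteriorAlgebra k M) :
    evT _ y (koszulD ρ ε z) = ∑ a, y (ρ a) • (ε a⌋(evT _ y z)) := by
  induction z with
  | zero => simp
  | add z w hz hw => simp only [map_add, hz, hw, smul_add, Finset.sum_add_distrib]
  | tmul p w => simp [koszulD_tmul, evT_tmul, mul_smul]

theorem koszulD_invDeg (hρ : Function.Injective ρ) (q : ℕ)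
    (z : MvPolynomial σ k ⊗[k] ExteriorAlgebra k M) :
    TensorProduct.map (invDeg ρ q) LinearMap.id (koszulD ρ ε z) =
      koszulD ρ ε (TensorProduct.map (invDeg ρ (q + 1)) LinearMap.id z) := by
  induction z with
  | zero => simp
  | add z w hz hw => simp only [map_add, hz, hw]
  | tmul p w => simp [koszulD_tmul, invDeg_X_mul hρ]

/-- Exactness of the Koszul complex on polynomial functions. -/
theorem exists_koszul_primitive [CharZero k] [DecidableEq κ] {e₀ : M} {ξ : Module.Dual k M}
    (hρ : Function.Injective ρ) (hε : ∀ a b, ε a (e b) = if a = b then 1 else 0)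
    (hξ : ∀ a, ξ (e a) = 0) (hdec : ∀ m, ξ m • e₀ + ∑ a, ε a m • e a = m) {q : ℕ} (hq : 0 < q)
    {f : (σ → k) → ExteriorAlgebra k M} (hf : f ∈ Vals (polyFun σ k) (ExteriorAlgebra k M))
    (hfm : ∀ y, f y ∈ ⋀[k]^q M) (hfξ : ∀ y, ξ⌋(f y) = 0)
    (hfd : ∀ y, ∑ a, y (ρ a) • (ε a⌋(f y)) = 0) :
    ∃ r ∈ Vals (polyFun σ k) (ExteriorAlgebra k M), (∀ y, r y ∈ ⋀[k]^(q + 1) M) ∧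
      (∀ y, ξ⌋(r y) = 0) ∧ ∀ y, ∑ a, y (ρ a) • (ε a⌋(r y)) = f y := by
  -- The coefficients are restricted to degree `q` and to the kernel of contraction with `ξ`. There
  -- the Euler operator of the `e a` alone is multiplication by `q`, since the `e₀`-term of the full
  -- Euler operator vanishes.
  let L : Submodule k (ExteriorAlgebra k M) :=
    ⋀[k]^q M ⊓ LinearMap.ker (CliffordAlgebra.contractLeft (Q := (0 : QuadraticForm k M)) ξ)
  obtain ⟨z, hz⟩ := exists_evT_eq (V := L) (f := fun y => ⟨f y, hfm y, hfξ y⟩)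
    (mem_Vals_of_injective L.subtype_injective hf)
  have hN : ∀ w ∈ L, ∑ a, ExteriorAlgebra.ι k (e a) * (ε a⌋w) = (q : k) • w := by
    rintro w ⟨hw, hwξ⟩
    have h : ∀ m, ∑ a : Option κ, (a.elim ξ ε : Module.Dual k M) m • (a.elim e₀ e : M) = m :=
      fun m => by rw [Fintype.sum_option]; exact hdec m
    have := sum_ι_mul_contract h hw
    rw [Fintype.sum_option] at this
    simp only [Option.elim_none, Option.elim_some] at this
    rwa [LinearMap.mem_ker.1 hwξ, mul_zero, zero_add] at this
  have hzf : ∀ y, evT _ y (TensorProduct.map LinearMap.id L.subtype z) = f y := fun y => by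
    rw [evT_map_id, hz]; rfl
  have hd : koszulD ρ ε (TensorProduct.map LinearMap.id L.subtype z) = 0 :=
    eq_zero_of_evT_eq_zero fun y => by rw [evT_koszulD, hzf, hfd]
  have hhom : ∀ z : MvPolynomial σ k ⊗[k] L,
      TensorProduct.map (invDeg ρ q) LinearMap.id
        (koszulD ρ ε (deRham ρ e (TensorProduct.map LinearMap.id L.subtype z)) +
          deRham ρ e (koszulD ρ ε (TensorProduct.map LinearMap.id L.subtype z))) =
      TensorProduct.map LinearMap.id L.subtype z := by
    intro z
    induction z with
    | zero => simp
    | add z w hz hw =>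
      conv_rhs => rw [map_add, ← hz, ← hw, ← map_add]
      congr 1
      simp only [map_add]
      abel
    | tmul p w =>
      rw [TensorProduct.map_tmul, LinearMap.id_apply, Submodule.subtype_apply,
        koszulD_deRham hρ hε, hN w w.2, ← TensorProduct.smul_tmul, ← TensorProduct.add_tmul,
        TensorProduct.map_tmul, invDeg_euler ρ hq, LinearMap.id_apply]
  have hmain := hhom z
  rw [hd, map_zero, add_zero, koszulD_invDeg hρ] at hmain
  have hmem : ∀ (z : MvPolynomial σ k ⊗[k] L) (y : σ → k),
      evT _ y (TensorProduct.map (invDeg ρ (q + 1)) LinearMap.id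
        (deRham ρ e (TensorProduct.map LinearMap.id L.subtype z))) ∈
      ⋀[k]^(q + 1) M ⊓
        LinearMap.ker (CliffordAlgebra.contractLeft (Q := (0 : QuadraticForm k M)) ξ) := by
    intro z y
    induction z with
    | zero => simp
    | add z w hz hw => simp only [map_add]; exact add_mem hz hw
    | tmul p w =>
      simp only [TensorProduct.map_tmul, LinearMap.id_apply, Submodule.subtype_apply, deRham_tmul,
        map_sum, evT_tmul]
      refine sum_mem fun a _ => Submodule.smul_mem _ _ ⟨ι_mul_mem _ w.2.1, ?_⟩
      have hw : ξ⌋(w : ExteriorAlgebra k M) = 0 := w.2.2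
      show ξ⌋(ExteriorAlgebra.ι k (e a) * (w : ExteriorAlgebra k M)) = 0
      rw [contract_ι_mul, hξ, zero_smul, hw, mul_zero, sub_zero]
  refine ⟨_, evT_mem_Vals (TensorProduct.map (invDeg ρ (q + 1)) LinearMap.id
    (deRham ρ e (TensorProduct.map LinearMap.id L.subtype z))), fun y => (hmem z y).1,
    fun y => (hmem z y).2, fun y => ?_⟩
  rw [← evT_koszulD, hmain, hzf]

end Koszul

end TateModel

end

/-! ### Local exactness of the Tate complex off the diagonal and at the diagonal -/

noncomputable section

namespace TateModel

section TateExactness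

local notation:70 φ "⌋" x:70 => CliffordAlgebra.contractLeft (Q := (0 : QuadraticForm _ _)) φ x

variable {k : Type*} [Field k] {M : Type*} [AddCommGroup M] [Module k M]

theorem gdiff_C_ι_mul (φ : Module.Dual k M) (t m : M) (p : Polynomial (ExteriorAlgebra k M)) :
    gdiff φ t (Polynomial.C (ExteriorAlgebra.ι k m) * p) =
      φ m • p - Polynomial.C (ExteriorAlgebra.ι k m) * gdiff φ t p := by
  ext1 j
  rw [Polynomial.coeff_sub, Polynomial.coeff_smul, Polynomial.coeff_C_mul, coeff_gdiff, coeff_gdiff,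
    Polynomial.coeff_C_mul, Polynomial.coeff_C_mul, contract_ι_mul, mul_add, mul_smul_comm]
  have h : ExteriorAlgebra.ι k t * (ExteriorAlgebra.ι k m * p.coeff (j + 1)) =
      -(ExteriorAlgebra.ι k m * (ExteriorAlgebra.ι k t * p.coeff (j + 1))) := by
    rw [← mul_assoc, ← mul_assoc, ← neg_mul]
    congr 1
    exact eq_neg_of_add_eq_zero_left (ExteriorAlgebra.ι_add_mul_swap t m)
  rw [h, smul_neg]
  abel

theorem gdiff_C (φ : Module.Dual k M) (t : M) (w : ExteriorAlgebra k M) :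
    gdiff φ t (Polynomial.C w) = Polynomial.C (φ⌋w) := by
  rw [← Polynomial.monomial_zero_left, gdiff_monomial]
  simp

/-- The operator `w T^j ↦ (j + 1)⁻¹ (ξ ⌋ w) T^(j + 1)`. -/
def integral (ξ : Module.Dual k M) :
    Polynomial (ExteriorAlgebra k M) →ₗ[k] Polynomial (ExteriorAlgebra k M) :=
  Polynomial.lsum fun j =>
    (j + 1 : k)⁻¹ • ((Polynomial.monomial (R := ExteriorAlgebra k M) (j + 1)).restrictScalars k).comp
        (CliffordAlgebra.contractLeft ξ)

theorem integral_monomial (ξ : Module.Dual k M) (j : ℕ) (w : ExteriorAlgebra k M) :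
    integral ξ (Polynomial.monomial j w) =
      Polynomial.monomial (j + 1) ((j + 1 : k)⁻¹ • (ξ⌋w)) := by
  rw [integral, Polynomial.lsum_apply, Polynomial.sum_monomial_index, ← Polynomial.smul_monomial]
  · rfl
  · exact map_zero _

theorem coeff_integral_succ (ξ : Module.Dual k M) (p : Polynomial (ExteriorAlgebra k M)) (j : ℕ) :
    (integral ξ p).coeff (j + 1) = (j + 1 : k)⁻¹ • (ξ⌋(p.coeff j)) := by
  induction p using Polynomial.induction_on' with
  | add p q hp hq => simp only [map_add, Polynomial.coeff_add, hp, hq, smul_add]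
  | monomial i w =>
    rw [integral_monomial]
    simp only [Polynomial.coeff_monomial, Nat.add_right_cancel_iff]
    split_ifs with h
    · rw [h]
    · simp

theorem coeff_integral_zero (ξ : Module.Dual k M) (p : Polynomial (ExteriorAlgebra k M)) :
    (integral ξ p).coeff 0 = 0 := by
  induction p using Polynomial.induction_on' with
  | add p q hp hq => simp only [map_add, Polynomial.coeff_add, hp, hq, add_zero]
  | monomial i w => rw [integral_monomial, Polynomial.coeff_monomial, if_neg (Nat.succ_ne_zero i)]

/-- Since `ξ t = 1`, contraction with `ξ` is a homotopy for multiplication by `t`. Contracting the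
equation for the coefficient of `T^j` in `d p = 0` recovers `p.coeff (j + 1)` up to exactly the
terms produced by `integral ξ`, so modulo a boundary only the constant term survives. -/
theorem sub_gdiff_integral [CharZero k] {φ ξ : Module.Dual k M} {t : M} (hξ : ξ t = 1)
    {p : Polynomial (ExteriorAlgebra k M)} (hp : gdiff φ t p = 0) :
    p - gdiff φ t (integral ξ p) =
      Polynomial.C (p.coeff 0 - ExteriorAlgebra.ι k t * (ξ⌋(p.coeff 0))) := by
  ext1 j
  have h0 : (j + 1 : k) ≠ 0 := Nat.cast_add_one_ne_zero j
  rw [Polynomial.coeff_sub, coeff_gdiff, coeff_integral_succ, mul_smul_comm, smul_smul,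
    mul_inv_cancel₀ h0, one_smul]
  rcases j with _ | j
  · rw [coeff_integral_zero, map_zero, zero_add, Polynomial.coeff_C_zero]
  · have h1 : (j + 1 : k) ≠ 0 := Nat.cast_add_one_ne_zero j
    have h := congrArg (fun x => (j + 1 : k)⁻¹ • (ξ⌋x)) (congrArg (fun q => q.coeff j) hp)
    simp only [coeff_gdiff, map_add, map_smul, contract_ι_mul, hξ, one_smul, smul_add, smul_smul,
      inv_mul_cancel₀ h1, Polynomial.coeff_zero, map_zero, smul_zero] at h
    rw [Polynomial.coeff_C_succ, coeff_integral_succ, map_smul, contract_comm, ← h, smul_neg]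
    abel

variable {Y : Type*} {𝒪 : Subalgebra k (Y → k)} {W : Type*} [AddCommGroup W] [Module k W]

/-- Local exactness of the Tate complex off the diagonal. -/
theorem exists_primitive_of_ne_zero {φ : Y → Module.Dual k (W × W)}
    (hφ : φ ∈ Vals 𝒪 (Module.Dual k (W × W))) {t : Y → W × W} {y₀ : Y} {m : W × W}
    (hm : φ y₀ m ≠ 0) {i : ℕ} {z : Y → Polynomial (Lam2 k W)}
    (hz : z ∈ Vals 𝒪 (Polynomial (Lam2 k W))) (hzF : ∀ y, z y ∈ Fil k W 0 i)
    (hdz : ∀ y, gdiff (φ y) (t y) (z y) = 0) :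
    ∃ r ∈ Vals 𝒪 (Polynomial (Lam2 k W)), ∃ q ∈ 𝒪, q y₀ ≠ 0 ∧ (∀ y, r y ∈ Fil k W 0 (i + 1)) ∧
        ∀ y, gdiff (φ y) (t y) (r y) = q y • z y := by
  refine ⟨_, linear_mem_Vals (LinearMap.mulLeft k (Polynomial.C (ExteriorAlgebra.ι k m))) hz,
    fun y => φ y m, dual_mem_of_mem_Vals (LinearMap.applyₗ m) hφ, hm, fun y j => ?_, fun y => ?_⟩
  · rw [LinearMap.mulLeft_apply, Polynomial.coeff_C_mul]
    rcases Nat.lt_or_ge i (2 * j) with h | h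
    · rw [(hzF y j).2 h, mul_zero]
      exact ⟨fun _ => zero_mem _, fun _ => rfl⟩
    · refine ⟨fun _ => ?_, fun h' => by omega⟩
      have := ι_mul_filQ m ((hzF y j).1 h)
      rwa [show i - 2 * j + 1 = i + 1 - 2 * j by omega] at this
  · rw [LinearMap.mulLeft_apply, gdiff_C_ι_mul, hdz, mul_zero, sub_zero]

theorem integral_mem_Fil {ξ : Module.Dual k (W × W)} {i : ℕ}
    {p : Polynomial (Lam2 k W)} (hp : p ∈ Fil k W 0 i) : integral ξ p ∈ Fil k W 0 (i + 1) := by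
  intro j
  rcases j with _ | j
  · rw [coeff_integral_zero]
    exact ⟨fun _ => zero_mem _, fun _ => rfl⟩
  · rw [coeff_integral_succ]
    rcases Nat.lt_or_ge i (2 * j) with h | h
    · rw [(hp j).2 h, map_zero, smul_zero]
      exact ⟨fun _ => zero_mem _, fun _ => rfl⟩
    · have h1 := (hp j).1 h
      rcases Nat.eq_zero_or_pos (i - 2 * j) with h2 | h2
      · rw [h2] at h1
        rw [contract_filQ_zero ξ h1, smul_zero]
        exact ⟨fun _ => zero_mem _, fun _ => rfl⟩
      · refine ⟨fun _ => Submodule.smul_mem _ _ ?_, fun _ => by omega⟩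
        rw [show i - 2 * j = i + 1 - 2 * (j + 1) + 1 by omega] at h1
        exact filQ_anti (by omega) (contract_filQ ξ h1)

variable [CharZero k] {σ κ : Type*} [Fintype κ] [DecidableEq κ]

/-- Local exactness of the Tate complex at the diagonal. -/
theorem exists_primitive_of_coordinates {ρ : κ → σ} {e : κ → W × W}
    {ε : κ → Module.Dual k (W × W)} {e₀ : W × W} {ξ : Module.Dual k (W × W)}
    (hρ : Function.Injective ρ) (hε : ∀ a b, ε a (e b) = if a = b then 1 else 0)
    (hξ : ∀ a, ξ (e a) = 0) (hdec : ∀ m, ξ m • e₀ + ∑ a, ε a m • e a = m)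
    {φ : (σ → k) → Module.Dual k (W × W)}
    (hφ : ∀ y, φ y = φ y e₀ • ξ + ∑ a, y (ρ a) • ε a)
    {t : (σ → k) → W × W} (ht : t ∈ Vals (polyFun σ k) (W × W)) (hξt : ∀ y, ξ (t y) = 1)
    (hφt : ∀ y, φ y (t y) = 0) {i : ℕ} (hi : 0 < i) {z : (σ → k) → Polynomial (Lam2 k W)}
    (hz : z ∈ Vals (polyFun σ k) (Polynomial (Lam2 k W))) (hzF : ∀ y, z y ∈ Fil k W 0 i)
    (hdz : ∀ y, gdiff (φ y) (t y) (z y) = 0) :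
    ∃ r ∈ Vals (polyFun σ k) (Polynomial (Lam2 k W)), (∀ y, r y ∈ Fil k W 0 (i + 1)) ∧
        ∀ y, gdiff (φ y) (t y) (r y) = z y := by
  have hsplit : ∀ (y : σ → k) (w : Lam2 k W), ξ⌋w = 0 → φ y⌋w = ∑ a, y (ρ a) • (ε a⌋w) := by
    intro y w hw
    conv_lhs => rw [hφ y]
    simp only [map_add, map_smul, map_sum, LinearMap.add_apply, LinearMap.smul_apply,
      LinearMap.sum_apply, hw, smul_zero, zero_add]
  -- The constant term left after integration. It is annihilated by contraction with `ξ`, so on it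
  -- `φ y` acts through the coordinates `y (ρ a)` and the Koszul complex applies.
  let f : (σ → k) → Lam2 k W := fun y =>
    (z y).coeff 0 - ExteriorAlgebra.ι k (t y) * (ξ⌋((z y).coeff 0))
  have hz0 : (fun y => (z y).coeff 0) ∈ Vals (polyFun σ k) (Lam2 k W) :=
    linear_mem_Vals ((Polynomial.lcoeff (Lam2 k W) 0).restrictScalars k) hz
  have hf : f ∈ Vals (polyFun σ k) (Lam2 k W) :=
    sub_mem hz0 (bilinear_mem_Vals (LinearMap.mul k (Lam2 k W))
      (linear_mem_Vals (ExteriorAlgebra.ι k) ht)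
      (linear_mem_Vals (CliffordAlgebra.contractLeft (Q := (0 : QuadraticForm k (W × W))) ξ) hz0))
  have hzf : ∀ y, z y - gdiff (φ y) (t y) (integral ξ (z y)) = Polynomial.C (f y) :=
    fun y => sub_gdiff_integral (hξt y) (hdz y)
  have hfξ : ∀ y, ξ⌋(f y) = 0 := fun y => by
    simp only [f, map_sub, contract_ι_mul, hξt, one_smul, contract_contract, mul_zero, sub_zero,
      sub_self]
  have hfφ : ∀ y, φ y⌋(f y) = 0 := fun y => by
    have := congrArg (gdiff (φ y) (t y)) (hzf y)
    rw [map_sub, gdiff_gdiff (hφt y), hdz, sub_zero, gdiff_C] at this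
    exact Polynomial.C_eq_zero.1 this.symm
  have hfm : ∀ y, f y ∈ ⋀[k]^i (W × W) := fun y => by
    have h0 : (z y).coeff 0 ∈ ⋀[k]^i (W × W) := filQ_le _ _ ((hzF y 0).1 (Nat.zero_le _))
    obtain ⟨c, rfl⟩ : ∃ c, i = c + 1 := ⟨i - 1, by omega⟩
    exact sub_mem h0 (ι_mul_mem _ (contract_mem _ h0))
  obtain ⟨r, hr, hrm, hrξ, hrf⟩ := exists_koszul_primitive hρ hε hξ hdec hi hf hfm hfξ
    (fun y => by rw [← hsplit y _ (hfξ y), hfφ])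
  refine ⟨fun y => integral ξ (z y) + Polynomial.C (r y), add_mem (linear_mem_Vals (integral ξ) hz)
    (linear_mem_Vals ((Polynomial.monomial (R := Lam2 k W) 0).restrictScalars k) hr),
    fun y => add_mem (integral_mem_Fil (hzF y)) ?_, fun y => ?_⟩
  · rw [← Polynomial.monomial_zero_left]
    refine monomial_mem_Fil (Nat.zero_le _) ?_
    rw [Nat.zero_sub, filQ_zero]
    exact hrm y
  · rw [map_add, gdiff_C, hsplit y _ (hrξ y), hrf, ← hzf, add_sub_cancel]

end TateExactness

end TateModel

end

/-! ### Row and column sums in the group algebra -/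

noncomputable section

namespace TateModel

section GroupAlgebra

variable {G : Type*} [Group G] [Fintype G]

variable (k : Type*) [Field k]

/-- The sum of the elements of a subgroup, twisted by a sign character. -/
def twistSum (H : Subgroup G) [DecidablePred (· ∈ H)] (χ : G →* ℤˣ) : MonoidAlgebra k G :=
  ∑ g ∈ Finset.univ.filter (· ∈ H), MonoidAlgebra.single g ((χ g : ℤ) : k)

variable (H H' : Subgroup G) [DecidablePred (· ∈ H)] [DecidablePred (· ∈ H')] (χ χ' : G →* ℤˣ)

theorem single_mul_twistSum {g : G} (hg : g ∈ H) :
    MonoidAlgebra.single g ((χ g : ℤ) : k) * twistSum k H χ = twistSum k H χ := by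
  rw [twistSum, Finset.mul_sum]
  refine Finset.sum_bij' (fun h _ => g * h) (fun h _ => g⁻¹ * h) ?_ ?_ ?_ ?_ ?_
  · intro h hh
    simp only [Finset.mem_filter, Finset.mem_univ, true_and] at hh ⊢
    exact H.mul_mem hg hh
  · intro h hh
    simp only [Finset.mem_filter, Finset.mem_univ, true_and] at hh ⊢
    exact H.mul_mem (H.inv_mem hg) hh
  · intro h _; simp
  · intro h _; simp
  · intro h _
    rw [MonoidAlgebra.single_mul_single, map_mul]
    push_cast
    rfl

theorem twistSum_mul_self :
    twistSum k H χ * twistSum k H χ =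
      ((Finset.univ.filter (· ∈ H)).card : k) • twistSum k H χ := by
  conv_lhs => rw [twistSum, Finset.sum_mul]
  rw [← twistSum, Finset.sum_congr rfl fun g hg => single_mul_twistSum k H χ (by simpa using hg)]
  rw [Finset.sum_const, Nat.cast_smul_eq_nsmul]

theorem card_filter_ne_zero : (Finset.univ.filter (· ∈ H)).card ≠ 0 :=
  Finset.card_ne_zero_of_mem (a := 1) (by simp)

variable {k}

/-- The standard scalar product on the rational group algebra. -/
def gform (x y : MonoidAlgebra ℚ G) : ℚ := ∑ g, x.coeff g * y.coeff g

theorem eq_zero_of_gform_self {x : MonoidAlgebra ℚ G} (h : gform x x = 0) : x = 0 := by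
  have := (Finset.sum_eq_zero_iff_of_nonneg fun g _ => mul_self_nonneg (x.coeff g)).1 h
  ext g
  simpa using this g (Finset.mem_univ g)

theorem gform_single_mul (g : G) (c : ℚ) (x y : MonoidAlgebra ℚ G) :
    gform (MonoidAlgebra.single g c * x) y = gform x (MonoidAlgebra.single g⁻¹ c * y) := by
  simp only [gform, MonoidAlgebra.coeff_single_mul_apply, inv_inv]
  refine Fintype.sum_equiv (Equiv.mulLeft g⁻¹) _ _ fun h => ?_
  simp only [Equiv.coe_mulLeft, mul_inv_cancel_left]
  ring

theorem gform_twistSum_mul (x y : MonoidAlgebra ℚ G) :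
    gform (twistSum ℚ H χ * x) y = gform x (twistSum ℚ H χ * y) := by
  have h1 : ∀ (s : Finset G) (f : G → MonoidAlgebra ℚ G) (z : MonoidAlgebra ℚ G),
      gform (∑ g ∈ s, f g) z = ∑ g ∈ s, gform (f g) z := fun s f z => by
    simp only [gform, MonoidAlgebra.coeff_sum, Finset.sum_apply', Finset.sum_mul]
    exact Finset.sum_comm
  have h2 : ∀ (s : Finset G) (f : G → MonoidAlgebra ℚ G) (z : MonoidAlgebra ℚ G),
      gform z (∑ g ∈ s, f g) = ∑ g ∈ s, gform z (f g) := fun s f z => by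
    simp only [gform, MonoidAlgebra.coeff_sum, Finset.sum_apply', Finset.mul_sum]
    exact Finset.sum_comm
  rw [twistSum, Finset.sum_mul, Finset.sum_mul, h1, h2]
  simp only [gform_single_mul]
  refine Finset.sum_bij' (fun h _ => h⁻¹) (fun h _ => h⁻¹) ?_ ?_ ?_ ?_ ?_
  · intro h hh
    simpa using hh
  · intro h hh
    simpa using hh
  · intro h _; simp
  · intro h _; simp
  · intro h _
    rw [map_inv, Int.units_inv_eq_self]

/-- Positivity over `ℚ`: the sums `R` and `C` are self-adjoint for the standard scalar product and
idempotent up to a positive scalar. If `R C R C x = 0`, then `C R C x` has norm zero, and then so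
does `R C x`. -/
theorem eq_zero_of_twistSum_mul {x : MonoidAlgebra ℚ G}
    (h : twistSum ℚ H χ * (twistSum ℚ H' χ' * (twistSum ℚ H χ * (twistSum ℚ H' χ' * x))) = 0) :
    twistSum ℚ H χ * (twistSum ℚ H' χ' * x) = 0 := by
  set R := twistSum ℚ H χ
  set C := twistSum ℚ H' χ'
  have hRR : ∀ x, R * (R * x) = ((Finset.univ.filter (· ∈ H)).card : ℚ) • (R * x) := fun x => by
    rw [← mul_assoc, twistSum_mul_self, smul_mul_assoc]
  have hCC : ∀ x, C * (C * x) = ((Finset.univ.filter (· ∈ H')).card : ℚ) • (C * x) := fun x => by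
    rw [← mul_assoc, twistSum_mul_self, smul_mul_assoc]
  have hz : ∀ c : ℚ, ∀ y, gform y (c • (0 : MonoidAlgebra ℚ G)) = 0 := fun c y => by
    simp [gform]
  have h1 : C * (R * (C * x)) = 0 := by
    apply eq_zero_of_gform_self
    have : C * (R * (C * (C * (R * (C * x))))) = 0 := by
      rw [hCC]
      simp only [mul_smul_comm]
      rw [h, mul_zero, smul_zero]
    rw [gform_twistSum_mul, gform_twistSum_mul, gform_twistSum_mul, this]
    simp [gform]
  apply eq_zero_of_gform_self
  rw [gform_twistSum_mul, hRR, gform_twistSum_mul]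
  simp only [mul_smul_comm]
  rw [h1]
  simp [gform]

instance finiteDimensional_monoidAlgebra : FiniteDimensional ℚ (MonoidAlgebra ℚ G) :=
  Module.Finite.equiv (MonoidAlgebra.coeffLinearEquiv ℚ :
    MonoidAlgebra ℚ G ≃ₗ[ℚ] G →₀ ℚ).symm

/-- Multiplication by `R C` is injective on its own image, hence bijective there by finite
dimension. -/
theorem exists_twistSum_mul_eq_rat :
    ∃ e : MonoidAlgebra ℚ G,
      twistSum ℚ H χ * (twistSum ℚ H' χ' * (twistSum ℚ H χ * (twistSum ℚ H' χ' * e))) =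
        twistSum ℚ H χ * twistSum ℚ H' χ' := by
  let f : MonoidAlgebra ℚ G →ₗ[ℚ] MonoidAlgebra ℚ G :=
    LinearMap.mulLeft ℚ (twistSum ℚ H χ * twistSum ℚ H' χ')
  have hf : ∀ x, f x = twistSum ℚ H χ * (twistSum ℚ H' χ' * x) := fun x => mul_assoc _ _ _
  let g : LinearMap.range f →ₗ[ℚ] LinearMap.range f :=
    (f ∘ₗ (LinearMap.range f).subtype).codRestrict _ fun x => ⟨_, rfl⟩
  have hg : Function.Injective g := by
    rw [← LinearMap.ker_eq_bot, LinearMap.ker_eq_bot']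
    rintro ⟨_, x, rfl⟩ hx
    have h1 : f (f x) = 0 := congrArg Subtype.val hx
    apply Subtype.ext
    simp only [hf] at h1
    exact (hf x).trans (eq_zero_of_twistSum_mul H H' χ χ' h1)
  obtain ⟨⟨_, e, rfl⟩, he⟩ := (LinearMap.injective_iff_surjective.1 hg) ⟨f 1, 1, rfl⟩
  refine ⟨e, ?_⟩
  have h1 : f (f e) = f 1 := congrArg Subtype.val he
  simpa only [hf, mul_one] using h1

-- The identity has rational coefficients and is mapped to any field of characteristic zero.
variable (k) in
theorem exists_twistSum_mul_eq [CharZero k] :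
    ∃ e : MonoidAlgebra k G,
      twistSum k H χ * (twistSum k H' χ' * (twistSum k H χ * (twistSum k H' χ' * e))) =
        twistSum k H χ * twistSum k H' χ' := by
  obtain ⟨e, he⟩ := exists_twistSum_mul_eq_rat H H' χ χ'
  have h : ∀ (H : Subgroup G) [DecidablePred (· ∈ H)] (χ : G →* ℤˣ),
      MonoidAlgebra.mapRingHom G (algebraMap ℚ k) (twistSum ℚ H χ) = twistSum k H χ := by
    intro H _ χ
    rw [twistSum, map_sum, twistSum]
    refine Finset.sum_congr rfl fun g _ => ?_
    rw [MonoidAlgebra.mapRingHom_single]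
    simp
  refine ⟨MonoidAlgebra.mapRingHom G (algebraMap ℚ k) e, ?_⟩
  have := congrArg (MonoidAlgebra.mapRingHom G (algebraMap ℚ k)) he
  simpa only [map_mul, h] using this

end GroupAlgebra

end TateModel

end

/-! ### Young symmetrizers on tensor powers and the Cauchy summands -/

noncomputable section

namespace TateModel

open SpGrTate

section TensorPower

variable (k : Type*) [Field k] (ι : Type) [Fintype ι] [DecidableEq ι] (E : Type*)
  [AddCommGroup E] [Module k E]

/-- The action of the permutations of the factors on a tensor power. -/
def permRep : Equiv.Perm ι →* Module.End k (PiTensorProduct k fun _ : ι => E) where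
  toFun σ := (PiTensorProduct.reindex k (fun _ : ι => E) σ).toLinearMap
  map_one' := by
    apply PiTensorProduct.ext
    ext f
    exact PiTensorProduct.reindex_tprod 1 f
  map_mul' σ τ := by
    apply PiTensorProduct.ext
    ext f
    have h : ∀ (σ : Equiv.Perm ι) (f : ι → E), PiTensorProduct.reindex k (fun _ : ι => E) σ
        (PiTensorProduct.tprod k f) = PiTensorProduct.tprod k fun i => f (σ.symm i) :=
      fun σ f => PiTensorProduct.reindex_tprod σ f
    change PiTensorProduct.reindex k (fun _ : ι => E) (σ * τ) (PiTensorProduct.tprod k f) =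
      PiTensorProduct.reindex k (fun _ : ι => E) σ (PiTensorProduct.reindex k (fun _ : ι => E) τ
        (PiTensorProduct.tprod k f))
    rw [h, h, h]
    rfl

variable {k ι E}

omit [Fintype ι] [DecidableEq ι] in
theorem permRep_tprod (σ : Equiv.Perm ι) (f : ι → E) :
    permRep k ι E σ (PiTensorProduct.tprod k f) = PiTensorProduct.tprod k fun i => f (σ⁻¹ i) :=
  PiTensorProduct.reindex_tprod σ f

variable (k ι E) in
/-- The action of the group algebra of the permutations of the factors on a tensor power. -/
def algRep : MonoidAlgebra k (Equiv.Perm ι) →ₐ[k]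
    Module.End k (PiTensorProduct k fun _ : ι => E) :=
  MonoidAlgebra.lift k _ _ (permRep k ι E)

omit [Fintype ι] [DecidableEq ι] in
theorem algRep_single (σ : Equiv.Perm ι) (c : k) :
    algRep k ι E (MonoidAlgebra.single σ c) = c • permRep k ι E σ :=
  MonoidAlgebra.lift_single _ _ _

/-- The permutations that preserve a function. -/
def fiberStab (f : ι → ℕ) : Subgroup (Equiv.Perm ι) where
  carrier := {p | ∀ b, f (p b) = f b}
  one_mem' _ := rfl
  mul_mem' {p q} hp hq b := (hp (q b)).trans (hq b)
  inv_mem' {p} hp b := by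
    have h := hp (p⁻¹ b)
    rw [show p (p⁻¹ b) = b from p.apply_symm_apply b] at h
    exact h.symm

instance decidableMemFiberStab (f : ι → ℕ) : DecidablePred (· ∈ fiberStab f) := fun p =>
  inferInstanceAs (Decidable (∀ b, f (p b) = f b))

theorem twistSum_eq_sum_inv {G : Type*} [Group G] [Fintype G] (H : Subgroup G)
    [DecidablePred (· ∈ H)] (χ : G →* ℤˣ) :
    twistSum k H χ =
      ∑ g ∈ Finset.univ.filter (· ∈ H), MonoidAlgebra.single g⁻¹ ((χ g : ℤ) : k) := by
  refine Finset.sum_bij' (fun h _ => h⁻¹) (fun h _ => h⁻¹) ?_ ?_ ?_ ?_ ?_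
  · intro h hh
    simpa using hh
  · intro h hh
    simpa using hh
  · intro h _; simp
  · intro h _; simp
  · intro h _
    rw [map_inv, Int.units_inv_eq_self, inv_inv]

/-- The right action of a permutation is the left action of its inverse. Inversion reverses the
product of the row and column sums and leaves each of them unchanged. -/
theorem youngSymmetrizer_eq (row col : ι → ℕ) :
    youngSymmetrizer (k := k) (E := E) row col =
      algRep k ι E (twistSum k (fiberStab col) Equiv.Perm.sign * twistSum k (fiberStab row) 1) := by
  rw [twistSum_eq_sum_inv, twistSum_eq_sum_inv, Finset.sum_mul, map_sum, youngSymmetrizer,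
    Finset.sum_comm]
  refine Finset.sum_congr rfl fun q _ => ?_
  rw [Finset.mul_sum, map_sum]
  refine Finset.sum_congr rfl fun p _ => ?_
  rw [MonoidAlgebra.single_mul_single, algRep_single, ← mul_inv_rev, MonoidHom.one_apply,
    Units.val_one, Int.cast_one, mul_one]
  rfl

omit [Fintype ι] [DecidableEq ι] in
theorem map_permRep {E' : Type*} [AddCommGroup E'] [Module k E'] (f : E →ₗ[k] E')
    (σ : Equiv.Perm ι) (x : PiTensorProduct k fun _ : ι => E) :
    PiTensorProduct.map (fun _ => f) (permRep k ι E σ x) =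
      permRep k ι E' σ (PiTensorProduct.map (fun _ => f) x) := by
  induction x using PiTensorProduct.induction_on with
  | smul_tprod r v => simp only [map_smul, permRep_tprod, PiTensorProduct.map_tprod]
  | add x y hx hy => simp only [map_add, hx, hy]

omit [Fintype ι] [DecidableEq ι] in
theorem map_algRep {E' : Type*} [AddCommGroup E'] [Module k E'] (f : E →ₗ[k] E')
    (u : MonoidAlgebra k (Equiv.Perm ι)) (x : PiTensorProduct k fun _ : ι => E) :
    PiTensorProduct.map (fun _ => f) (algRep k ι E u x) =
      algRep k ι E' u (PiTensorProduct.map (fun _ => f) x) := by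
  induction u using MonoidAlgebra.induction_linear with
  | zero => simp
  | add u v hu hv => simp only [map_add, LinearMap.add_apply, hu, hv]
  | single σ c => simp only [algRep_single, LinearMap.smul_apply, map_smul, map_permRep]

omit [Fintype ι] [DecidableEq ι] in
theorem algRep_mem_range_map (A : Submodule k E) (u : MonoidAlgebra k (Equiv.Perm ι))
    {y : PiTensorProduct k fun _ : ι => E}
    (hy : y ∈ LinearMap.range (PiTensorProduct.map fun _ : ι => A.subtype)) :
    algRep k ι E u y ∈ LinearMap.range (PiTensorProduct.map fun _ : ι => A.subtype) := by
  obtain ⟨z, rfl⟩ := LinearMap.mem_range.1 hy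
  rw [← map_algRep]
  exact LinearMap.mem_range_self _ _

omit [Fintype ι] [DecidableEq ι] in
theorem tprod_mem_range_map {A : Submodule k E} {v : ι → E} (hv : ∀ i, v i ∈ A) :
    PiTensorProduct.tprod k v ∈
      LinearMap.range (PiTensorProduct.map fun _ : ι => A.subtype) :=
  LinearMap.mem_range.2
    ⟨PiTensorProduct.tprod k fun i => ⟨v i, hv i⟩, PiTensorProduct.map_tprod _ _⟩

omit [Fintype ι] [DecidableEq ι] in
theorem range_map_induction {A : Submodule k E} {L : Submodule k (PiTensorProduct k fun _ : ι => E)}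
    (h : ∀ v : ι → E, (∀ i, v i ∈ A) → PiTensorProduct.tprod k v ∈ L) :
    LinearMap.range (PiTensorProduct.map fun _ : ι => A.subtype) ≤ L := by
  rintro x hx
  obtain ⟨z, rfl⟩ := LinearMap.mem_range.1 hx
  clear hx
  induction z using PiTensorProduct.induction_on with
  | smul_tprod r v =>
    rw [map_smul, PiTensorProduct.map_tprod]
    exact L.smul_mem _ (h _ fun i => (v i).2)
  | add x y hx hy =>
    rw [map_add]
    exact add_mem hx hy

theorem algRep_twistSum_tprod (c : ι → ℕ) (w : ι → E) (hw : ∀ i j, c i = c j → w i = w j) :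
    algRep k ι E (twistSum k (fiberStab c) 1) (PiTensorProduct.tprod k w) =
      ((Finset.univ.filter (· ∈ fiberStab c)).card : k) • PiTensorProduct.tprod k w := by
  rw [twistSum, map_sum, LinearMap.sum_apply, Nat.cast_smul_eq_nsmul, ← Finset.sum_const]
  refine Finset.sum_congr rfl fun σ hσ => ?_
  rw [algRep_single, MonoidHom.one_apply, Units.val_one, Int.cast_one, one_smul, permRep_tprod]
  congr 1
  ext i
  exact hw _ _ ((fiberStab c).inv_mem (by simpa using hσ) i)

theorem permRep_algRep_twistSum (H : Subgroup (Equiv.Perm ι)) [DecidablePred (· ∈ H)]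
    {σ : Equiv.Perm ι} (hσ : σ ∈ H) (y : PiTensorProduct k fun _ : ι => E) :
    permRep k ι E σ (algRep k ι E (twistSum k H 1) y) = algRep k ι E (twistSum k H 1) y := by
  have := single_mul_twistSum k H 1 hσ
  rw [MonoidHom.one_apply, Units.val_one, Int.cast_one] at this
  conv_rhs => rw [← this, map_mul, Module.End.mul_apply, algRep_single, one_smul]

end TensorPower

section Wedge

variable {n : ℕ} {k : Type*} [Field k] {a b : ℕ}

local notation "ρV" => algRep k (Box a b) (V n k)
local notation "ρD" => algRep k (Box a b) (Module.Dual k (V n k))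

theorem wedgeBoxes_tprod (v : Box a b → V n k) (f : Box a b → Module.Dual k (V n k)) :
    wedgeBoxes n k a b (PiTensorProduct.tprod k v) (PiTensorProduct.tprod k f) =
      ExteriorAlgebra.ιMulti k (a + b)
        ((fun i => v i ⊗ₜ[k] f i) ∘ (finSumFinEquiv (m := a) (n := b)).symm) := by
  rw [wedgeBoxes, LinearMap.compr₂_apply, PiTensorProduct.map₂_tprod_tprod,
    PiTensorProduct.lift.tprod]
  rfl

theorem wedgeBoxes_tprod_perm (σ : Equiv.Perm (Box a b)) (v : Box a b → V n k)
    (f : Box a b → Module.Dual k (V n k)) :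
    wedgeBoxes n k a b (PiTensorProduct.tprod k fun i => v (σ⁻¹ i))
        (PiTensorProduct.tprod k fun i => f (σ⁻¹ i)) =
      ((Equiv.Perm.sign σ : ℤ) : k) •
        wedgeBoxes n k a b (PiTensorProduct.tprod k v) (PiTensorProduct.tprod k f) := by
  simp only [wedgeBoxes_tprod]
  have h := (ExteriorAlgebra.ιMulti k (a + b) (M := SpGrTate.E n k)).map_perm
    ((fun i => v i ⊗ₜ[k] f i) ∘ (finSumFinEquiv (m := a) (n := b)).symm)
    (((finSumFinEquiv (m := a) (n := b)).symm.trans σ⁻¹).trans finSumFinEquiv)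
  rw [Equiv.Perm.sign_symm_trans_trans, Equiv.Perm.sign_inv, Units.smul_def,
    ← Int.cast_smul_eq_zsmul k] at h
  rw [← h]
  congr 1
  ext i
  simp

theorem wedgeBoxes_permRep (σ : Equiv.Perm (Box a b))
    (x : PiTensorProduct k fun _ : Box a b => V n k)
    (y : PiTensorProduct k fun _ : Box a b => Module.Dual k (V n k)) :
    wedgeBoxes n k a b (permRep k _ _ σ x) (permRep k _ _ σ y) =
      ((Equiv.Perm.sign σ : ℤ) : k) • wedgeBoxes n k a b x y := by
  induction x using PiTensorProduct.induction_on with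
  | smul_tprod r v =>
    induction y using PiTensorProduct.induction_on with
    | smul_tprod s f =>
      simp only [map_smul, LinearMap.smul_apply, permRep_tprod, wedgeBoxes_tprod_perm, smul_smul]
      congr 1
      ring
    | add x y hx hy => simp only [map_add, hx, hy, smul_add]
  | add x y hx hy => simp only [map_add, LinearMap.add_apply, hx, hy, smul_add]

/-- A simultaneous permutation of both tensors changes the exterior product by the sign. A sum on
the first argument therefore moves to the second one with its character twisted by the sign. -/
theorem wedgeBoxes_twistSum (H : Subgroup (Equiv.Perm (Box a b))) [DecidablePred (· ∈ H)]
    (χ : Equiv.Perm (Box a b) →* ℤˣ)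
    (x : PiTensorProduct k fun _ : Box a b => V n k)
    (y : PiTensorProduct k fun _ : Box a b => Module.Dual k (V n k)) :
    wedgeBoxes n k a b (ρV (twistSum k H χ) x) y =
      wedgeBoxes n k a b x (ρD (twistSum k H (χ * Equiv.Perm.sign)) y) := by
  have h : ∀ σ : Equiv.Perm (Box a b), wedgeBoxes n k a b (permRep k _ _ σ x) y =
      ((Equiv.Perm.sign σ : ℤ) : k) • wedgeBoxes n k a b x (permRep k _ _ σ⁻¹ y) := fun σ => by
    rw [← wedgeBoxes_permRep, ← Module.End.mul_apply, ← map_mul, mul_inv_cancel, map_one,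
      Module.End.one_apply]
  rw [twistSum_eq_sum_inv H (χ * Equiv.Perm.sign), twistSum]
  simp only [map_sum, LinearMap.sum_apply, algRep_single, LinearMap.smul_apply, map_smul, h]
  refine Finset.sum_congr rfl fun σ _ => ?_
  rw [smul_smul, MonoidHom.mul_apply]
  push_cast
  rfl

/-- The column antisymmetrization on the side of `V` becomes column symmetrization on the side of
`V*`. -/
theorem wedgeBoxes_youngSymmetrizer (row col : Box a b → ℕ)
    (x : PiTensorProduct k fun _ : Box a b => V n k)
    (y : PiTensorProduct k fun _ : Box a b => Module.Dual k (V n k)) :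
    wedgeBoxes n k a b (youngSymmetrizer row col x) (youngSymmetrizer col row y) =
      wedgeBoxes n k a b (ρV (twistSum k (fiberStab row) 1) x)
        (ρD (twistSum k (fiberStab col) 1) (youngSymmetrizer col row y)) := by
  have h : Equiv.Perm.sign * Equiv.Perm.sign = (1 : Equiv.Perm (Box a b) →* ℤˣ) :=
    MonoidHom.ext fun σ => Int.units_mul_self _
  rw [youngSymmetrizer_eq row col, map_mul, Module.End.mul_apply, wedgeBoxes_twistSum, h]

variable [Fact (2 ≤ n)]

/-- Symmetrizing `x` along rows and `y` along columns already gives an element of `LamPart`. For the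
element `e` with `R C R C e = R C`, replacing `y` by `e y` inserts the missing Young symmetrizer
without changing the product. -/
theorem wedgeBoxes_mem_LamPart [CharZero k] {x : PiTensorProduct k fun _ : Box a b => V n k}
    {y : PiTensorProduct k fun _ : Box a b => Module.Dual k (V n k)}
    (hx : x ∈ LinearMap.range (PiTensorProduct.map fun _ : Box a b => (V₂ n k).subtype))
    (hy : y ∈ LinearMap.range (PiTensorProduct.map fun _ : Box a b => (V₂perp n k).subtype)) :
    wedgeBoxes n k a b (ρV (twistSum k (fiberStab (boxRow a b)) 1) x)
      (ρD (twistSum k (fiberStab (boxCol a b)) 1) y) ∈ LamPart n k a b := by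
  obtain ⟨e, he⟩ := exists_twistSum_mul_eq k (fiberStab (boxRow a b)) (fiberStab (boxCol a b))
    Equiv.Perm.sign 1
  have h := wedgeBoxes_youngSymmetrizer (boxRow a b) (boxCol a b) x (ρD e y)
  have h1 : ∀ x y, wedgeBoxes n k a b (ρV (twistSum k (fiberStab (boxRow a b)) 1) x) y =
      wedgeBoxes n k a b x (ρD (twistSum k (fiberStab (boxRow a b)) Equiv.Perm.sign) y) :=
    fun x y => by rw [wedgeBoxes_twistSum, one_mul]
  have h2 : ρD (twistSum k (fiberStab (boxRow a b)) Equiv.Perm.sign)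
      (ρD (twistSum k (fiberStab (boxCol a b)) 1)
        (youngSymmetrizer (boxCol a b) (boxRow a b) (ρD e y))) =
      ρD (twistSum k (fiberStab (boxRow a b)) Equiv.Perm.sign)
        (ρD (twistSum k (fiberStab (boxCol a b)) 1) y) := by
    rw [youngSymmetrizer_eq (boxCol a b) (boxRow a b)]
    simp only [← Module.End.mul_apply, ← map_mul, mul_assoc, he]
  rw [h1, h2, ← h1] at h
  rw [← h]
  exact Submodule.apply_mem_map₂ _ (Submodule.mem_map_of_mem hx)
    (Submodule.mem_map_of_mem (algRep_mem_range_map _ _ hy))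

theorem wedgeBoxes_tprod_mem_LamPart [CharZero k] {v : Box a b → V n k}
    {f : Box a b → Module.Dual k (V n k)} (hv : ∀ i, v i ∈ V₂ n k) (hf : ∀ i, f i ∈ V₂perp n k)
    (hrow : ∀ i j, boxRow a b i = boxRow a b j → v i = v j)
    (hcol : ∀ i j, boxCol a b i = boxCol a b j → f i = f j) :
    wedgeBoxes n k a b (PiTensorProduct.tprod k v) (PiTensorProduct.tprod k f) ∈
      LamPart n k a b := by
  have hv' : PiTensorProduct.tprod k v ∈
      LinearMap.range (PiTensorProduct.map fun _ : Box a b => (V₂ n k).subtype) :=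
    tprod_mem_range_map hv
  have hf' : PiTensorProduct.tprod k f ∈
      LinearMap.range (PiTensorProduct.map fun _ : Box a b => (V₂perp n k).subtype) :=
    tprod_mem_range_map hf
  have h := wedgeBoxes_mem_LamPart hv' hf'
  rw [algRep_twistSum_tprod _ _ hrow, algRep_twistSum_tprod _ _ hcol, map_smul, map_smul,
    LinearMap.smul_apply, smul_smul] at h
  exact (Submodule.smul_mem_iff _ (mul_ne_zero
    (Nat.cast_ne_zero.2 (card_filter_ne_zero _)) (Nat.cast_ne_zero.2 (card_filter_ne_zero _)))).1 h

/-- An upper bound for `LamPart`, from the symmetry in the columns. -/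
theorem LamPart_le [CharZero k] {S : Type*} [Fintype S] [Nonempty S]
    {T : S → Equiv.Perm (Box a b)}
    (hT : ∀ s, T s ∈ fiberStab (boxCol a b)) {L : Submodule k (Lam n k)}
    (hL : ∀ (v : Box a b → V n k) (f : Box a b → Module.Dual k (V n k)), (∀ i, v i ∈ V₂ n k) →
      (∀ i, f i ∈ V₂perp n k) → ∑ s, wedgeBoxes n k a b (PiTensorProduct.tprod k v)
        (PiTensorProduct.tprod k fun i => f ((T s)⁻¹ i)) ∈ L) :
    LamPart n k a b ≤ L := by
  have hL' : ∀ x ∈ LinearMap.range (PiTensorProduct.map fun _ : Box a b => (V₂ n k).subtype),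
      ∀ y ∈ LinearMap.range (PiTensorProduct.map fun _ : Box a b => (V₂perp n k).subtype),
      ∑ s, wedgeBoxes n k a b x (permRep k _ _ (T s) y) ∈ L := by
    intro x hx y hy
    let F : (PiTensorProduct k fun _ : Box a b => V n k) →ₗ[k]
        (PiTensorProduct k fun _ : Box a b => Module.Dual k (V n k)) →ₗ[k] Lam n k :=
      ∑ s, (wedgeBoxes n k a b).compl₂ (permRep k _ _ (T s))
    have hF : ∀ x y, F x y = ∑ s, wedgeBoxes n k a b x (permRep k _ _ (T s) y) := fun x y => by
      simp only [F, LinearMap.sum_apply, LinearMap.compl₂_apply]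
    rw [← hF]
    have h1 : ∀ v : Box a b → V n k, (∀ i, v i ∈ V₂ n k) →
        LinearMap.range (PiTensorProduct.map fun _ : Box a b => (V₂perp n k).subtype) ≤
          L.comap (F (PiTensorProduct.tprod k v)) := fun v hv =>
      range_map_induction fun f hf => by
        rw [Submodule.mem_comap, hF]
        simp only [permRep_tprod]
        exact hL v f hv hf
    have h2 : LinearMap.range (PiTensorProduct.map fun _ : Box a b => (V₂ n k).subtype) ≤
        L.comap (F.flip y) :=
      range_map_induction fun v hv => h1 v hv hy
    exact h2 hx
  refine Submodule.map₂_le.2 ?_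
  intro x' hx' y' hy'
  obtain ⟨x, hx, rfl⟩ := Submodule.mem_map.1 hx'
  obtain ⟨y, hy, rfl⟩ := Submodule.mem_map.1 hy'
  rw [wedgeBoxes_youngSymmetrizer, youngSymmetrizer_eq]
  have h := hL' _ (algRep_mem_range_map (V₂ n k) (twistSum k (fiberStab (boxRow a b)) 1) hx) _
    (algRep_mem_range_map (V₂perp n k) (twistSum k (fiberStab (boxCol a b)) 1)
    (algRep_mem_range_map (V₂perp n k) (twistSum k (fiberStab (boxRow a b)) Equiv.Perm.sign *
      twistSum k (fiberStab (boxCol a b)) 1) hy))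
  -- Column symmetrization absorbs every `T s`, so all summands coincide and the sum is a nonzero
  -- multiple of the given element.
  simp only [permRep_algRep_twistSum _ (hT _)] at h
  rw [Finset.sum_const, ← Nat.cast_smul_eq_nsmul k] at h
  exact (Submodule.smul_mem_iff _ (Nat.cast_ne_zero.2 (by simp))).1 h

end Wedge

end TateModel

end

/-! ### Comparison of the Cauchy summands with the isotypic components -/

noncomputable section

namespace TateModel

open SpGrTate

section Columns

theorem exists_ιMulti_comp_equiv {R M ι : Type*} [CommRing R] [AddCommGroup M] [Module R M]
    {d e : ℕ} (f : ι ≃ Fin d) (g : ι ≃ Fin e) :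
    ∃ ε : ℤˣ, ∀ m : ι → M, ExteriorAlgebra.ιMulti R d (m ∘ f.symm) =
      ε • ExteriorAlgebra.ιMulti R e (m ∘ g.symm) := by
  obtain rfl : d = e := by simpa using Fintype.card_congr (f.symm.trans g)
  refine ⟨Equiv.Perm.sign (f.symm.trans g), fun m => ?_⟩
  rw [← (ExteriorAlgebra.ιMulti R d (M := M)).map_perm]
  congr 1
  ext i
  simp

/-- The boxes of a diagram with two rows, sorted into its columns. -/
def boxEquiv (b r : ℕ) : Box (b + r) b ≃ Fin (b * 2 + r) where
  toFun := Sum.elim (Fin.addCases (fun j => Fin.castAdd r (finProdFinEquiv (j, 0)))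
    (fun l => Fin.natAdd (b * 2) l)) (fun j => Fin.castAdd r (finProdFinEquiv (j, 1)))
  invFun := Fin.addCases (fun i => if (finProdFinEquiv.symm i).2 = 0 then
    Sum.inl (Fin.castAdd r (finProdFinEquiv.symm i).1) else Sum.inr (finProdFinEquiv.symm i).1)
    (fun l => Sum.inl (Fin.natAdd b l))
  left_inv i := by
    rcases i with i | j
    · refine Fin.addCases (fun j => ?_) (fun l => ?_) i <;> simp [-finProdFinEquiv_apply_val, -finProdFinEquiv_symm_apply]
    · simp [-finProdFinEquiv_apply_val, -finProdFinEquiv_symm_apply]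
  right_inv i := by
    refine Fin.addCases (fun j => ?_) (fun l => ?_) i
    · obtain ⟨⟨j, c⟩, rfl⟩ := finProdFinEquiv.surjective j
      fin_cases c <;> simp [-finProdFinEquiv_apply_val, -finProdFinEquiv_symm_apply]
    · simp

variable {A : Type*} [Monoid A]

/-- The product over the boxes of a diagram with two rows, column by column. -/
def colProd {b r : ℕ} (p : Box (b + r) b → A) : A :=
  (List.ofFn fun j : Fin b => p (Sum.inl (Fin.castAdd r j)) * p (Sum.inr j)).prod *
    (List.ofFn fun l : Fin r => p (Sum.inl (Fin.natAdd b l))).prod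

theorem map_colProd {A' : Type*} [Monoid A'] (f : A →* A') {b r : ℕ} (p : Box (b + r) b → A) :
    f (colProd p) = colProd fun i => f (p i) := by
  simp only [colProd, map_mul, map_list_prod, List.map_ofFn, Function.comp_def]

theorem prod_ofFn_boxEquiv {b r : ℕ} (p : Box (b + r) b → A) :
    (List.ofFn fun i => p ((boxEquiv b r).symm i)).prod = colProd p := by
  rw [List.ofFn_add, List.prod_append, List.ofFn_mul, List.prod_flatten, List.map_ofFn, colProd]
  congr 3
  · ext j
    have h : ∀ c : Fin 2, ∀ h, (Fin.castLE (Nat.le_add_right (b * 2) r) ⟨j * 2 + c, h⟩) =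
        Fin.castAdd r (finProdFinEquiv (j, c)) := fun c h => by
      ext; simp [add_comm, mul_comm]
    simp only [Function.comp_apply, h, List.ofFn_succ, List.ofFn_zero, List.prod_cons,
      List.prod_nil, mul_one]
    simp [boxEquiv, -finProdFinEquiv_apply_val, -finProdFinEquiv_symm_apply]
  · ext l
    simp [boxEquiv]

theorem exists_ιMulti_eq_colProd {R M : Type*} [CommRing R] [AddCommGroup M] [Module R M]
    (b r : ℕ) : ∃ ε : ℤˣ, ∀ m : Box (b + r) b → M,
      ExteriorAlgebra.ιMulti R (b + r + b) (m ∘ finSumFinEquiv.symm) =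
        ε • colProd fun i => ExteriorAlgebra.ι R (m i) := by
  obtain ⟨ε, h⟩ := exists_ιMulti_comp_equiv (R := R) (M := M)
    (finSumFinEquiv (m := b + r) (n := b)) (boxEquiv b r)
  refine ⟨ε, fun m => ?_⟩
  rw [h, ← prod_ofFn_boxEquiv, ExteriorAlgebra.ιMulti_apply]
  rfl

/-- The exchange of the two boxes in each of the columns in a set, as a function. -/
def colFlipFun {b : ℕ} (r : ℕ) (s : Finset (Fin b)) : Box (b + r) b → Box (b + r) b :=
  Sum.elim (Fin.addCases
    (fun j => if j ∈ s then Sum.inr j else Sum.inl (Fin.castAdd r j))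
    (fun l => Sum.inl (Fin.natAdd b l)))
    (fun j => if j ∈ s then Sum.inl (Fin.castAdd r j) else Sum.inr j)

theorem colFlipFun_involutive {b : ℕ} (r : ℕ) (s : Finset (Fin b)) :
    Function.Involutive (colFlipFun r s) := by
  rintro (i | j)
  · refine Fin.addCases (fun j => ?_) (fun l => ?_) i
    · by_cases hj : j ∈ s <;> simp [colFlipFun, hj]
    · simp [colFlipFun]
  · by_cases hj : j ∈ s <;> simp [colFlipFun, hj]

/-- The exchange of the two boxes in each of the columns in a set. -/
def colFlip {b : ℕ} (r : ℕ) (s : Finset (Fin b)) : Equiv.Perm (Box (b + r) b) :=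
  (colFlipFun_involutive r s).toPerm

theorem colFlip_apply {b : ℕ} (r : ℕ) (s : Finset (Fin b)) (i : Box (b + r) b) :
    colFlip r s i = colFlipFun r s i := rfl

theorem colFlip_inv {b : ℕ} (r : ℕ) (s : Finset (Fin b)) : (colFlip r s)⁻¹ = colFlip r s := rfl

theorem colFlip_inl_castAdd {b : ℕ} (r : ℕ) (s : Finset (Fin b)) (j : Fin b) :
    colFlip r s (Sum.inl (Fin.castAdd r j)) =
      if j ∈ s then Sum.inr j else Sum.inl (Fin.castAdd r j) := by
  simp [colFlip_apply, colFlipFun]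

theorem colFlip_inl_natAdd {b : ℕ} (r : ℕ) (s : Finset (Fin b)) (l : Fin r) :
    colFlip r s (Sum.inl (Fin.natAdd b l)) = Sum.inl (Fin.natAdd b l) := by
  simp [colFlip_apply, colFlipFun]

theorem colFlip_inr {b : ℕ} (r : ℕ) (s : Finset (Fin b)) (j : Fin b) :
    colFlip r s (Sum.inr j) = if j ∈ s then Sum.inl (Fin.castAdd r j) else Sum.inr j := by
  simp [colFlip_apply, colFlipFun]

theorem colFlip_mem_fiberStab {b : ℕ} (r : ℕ) (s : Finset (Fin b)) :
    colFlip r s ∈ fiberStab (boxCol (b + r) b) := by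
  rintro (i | j)
  · refine Fin.addCases (fun j => ?_) (fun l => ?_) i
    · rw [colFlip_inl_castAdd]; split_ifs <;> simp [boxCol]
    · rw [colFlip_inl_natAdd]
  · rw [colFlip_inr]; split_ifs <;> simp [boxCol]

end Columns

/-- Modulo `L`, and after any linear form, the sum is a polynomial in `σ` with infinitely many
zeros. -/
theorem mem_of_forall_sum_pow_smul_mem {k M : Type*} [Field k] [Infinite k] [AddCommGroup M]
    [Module k M] {L : Submodule k M} {N : ℕ} {w : ℕ → M}
    (h : ∀ σ : k, ∑ e ∈ Finset.range N, σ ^ e • w e ∈ L) {e : ℕ} (he : e < N) : w e ∈ L := by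
  rw [← Submodule.Quotient.mk_eq_zero, ← Module.forall_dual_apply_eq_zero_iff k]
  intro φ
  let ψ : M →ₗ[k] k := φ ∘ₗ L.mkQ
  have h1 : (∑ e ∈ Finset.range N, Polynomial.monomial e (ψ (w e))) = 0 := by
    refine Polynomial.funext fun σ => ?_
    have : ψ (∑ e ∈ Finset.range N, σ ^ e • w e) = 0 := by
      simp only [ψ, LinearMap.comp_apply, (Submodule.Quotient.mk_eq_zero L).2 (h σ),
        Submodule.mkQ_apply, map_zero]
    rw [Polynomial.eval_finsetSum, Polynomial.eval_zero, ← this, map_sum]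
    refine Finset.sum_congr rfl fun e _ => ?_
    rw [Polynomial.eval_monomial, map_smul, smul_eq_mul, mul_comm]
  have h2 := congrArg (fun p => Polynomial.coeff p e) h1
  have h3 : ψ (w e) = 0 := by
    simpa [Polynomial.finsetSum_coeff, Polynomial.coeff_monomial, he] using h2
  exact h3

section Spans

variable {k : Type*} [Field k] {W : Type*} [AddCommGroup W] [Module k W]

-- Polarization of the quadratic map `f ↦ (v₁ ⊗ f)(v₂ ⊗ f)`.
variable (k W) in
theorem Qspan_eq_span_sq [CharZero k] :
    Qspan k W = Submodule.span k (Set.range fun f : W => av k f * cv k f) := by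
  refine le_antisymm (Submodule.span_le.2 ?_) (Submodule.span_le.2 ?_)
  · rintro _ ⟨⟨f, g⟩, rfl⟩
    have h : qv (k := k) f g = av k (f + g) * cv k (f + g) - av k f * cv k f - av k g * cv k g := by
      simp only [qv, map_add]; noncomm_ring
    have hm : ∀ f : W, av k f * cv k f ∈
        Submodule.span k (Set.range fun f : W => av k f * cv k f) :=
      fun f => Submodule.subset_span ⟨f, rfl⟩
    simp only [SetLike.mem_coe, h]
    exact sub_mem (sub_mem (hm _) (hm _)) (hm _)
  · rintro _ ⟨f, rfl⟩
    have h : av k f * cv k f = (2 : k)⁻¹ • qv (k := k) f f := by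
      rw [qv, ← two_smul k, smul_smul, inv_mul_cancel₀ two_ne_zero, one_smul]
    simp only [SetLike.mem_coe, h]
    exact Submodule.smul_mem _ _ (qv_mem_Qspan f f)

variable (k W) in
theorem gen_eq_span [CharZero k] (β r : ℕ) : gen k W β r =
    Submodule.span k (Set.range fun p : (Fin β → W) × (Fin r → W) =>
      (List.ofFn fun j => av k (p.1 j) * cv k (p.1 j)).prod *
        (List.ofFn fun l => av k (p.2 l)).prod) := by
  have h1 : LinearMap.range (av k (W := W)) = Submodule.span k (Set.range (av k (W := W))) := by
    rw [← LinearMap.coe_range, Submodule.span_eq]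
  rw [gen, Qspan_eq_span_sq, h1, Submodule.span_pow, Submodule.span_pow, Submodule.span_mul_span]
  congr 1
  ext x
  constructor
  · rintro ⟨y, hy, z, hz, rfl⟩
    obtain ⟨f, rfl⟩ := Set.mem_pow.1 hy
    obtain ⟨g, rfl⟩ := Set.mem_pow.1 hz
    choose f' hf' using fun j => (f j).2
    choose g' hg' using fun j => (g j).2
    refine ⟨(f', g'), ?_⟩
    simp only [hf', hg']
  · rintro ⟨⟨f, g⟩, rfl⟩
    refine ⟨_, Set.mem_pow.2 ⟨fun j => ⟨_, f j, rfl⟩, rfl⟩, _,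
      Set.mem_pow.2 ⟨fun j => ⟨_, g j, rfl⟩, rfl⟩, rfl⟩

variable (k W) in
/-- The action of the unipotent element `v₁ ↦ v₁ + σ v₂`. -/
def expF (σ : k) : Lam2 k W →ₐ[k] Lam2 k W :=
  ExteriorAlgebra.map (LinearMap.id + σ • (LinearMap.inr k W W ∘ₗ LinearMap.fst k W W))

theorem expF_av (σ : k) (f : W) : expF k W σ (av k f) = av k f + σ • cv k f := by
  simp only [expF, av, cv, LinearMap.comp_apply, ExteriorAlgebra.map_apply_ι, ← map_smul, ← map_add]
  congr 1
  ext <;> simp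

theorem expF_cv (σ : k) (f : W) : expF k W σ (cv k f) = cv k f := by
  simp [expF, cv]

/-- `expF` is the exponential of `σ F`, and the series stops because `F ^ (r + 1)` kills `u`. -/
theorem expF_gen [CharZero k] (σ : k) {β r : ℕ} {u : Lam2 k W} (hu : u ∈ gen k W β r) :
    expF k W σ u =
      ∑ e ∈ Finset.range (r + 1), σ ^ e • ((e.factorial : k)⁻¹ • (opF k W ^ e) u) := by
  induction β, r, u, hu using gen_induction with
  | zero => simp
  | add β r x y _ _ hx hy => simp only [map_add, hx, hy, smul_add, Finset.sum_add_distrib]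
  | algebraMap c => simp
  | a_mul r f x hx ih =>
    rw [map_mul, ih, expF_av, Finset.sum_range_succ' _ (r + 1)]
    have h0 : ∀ e : ℕ, σ ^ (e + 1) • (((e + 1).factorial : k)⁻¹ • (opF k W ^ (e + 1)) (av k f * x))
        = σ • (cv k f * (σ ^ e • ((e.factorial : k)⁻¹ • (opF k W ^ e) x))) +
          av k f * (σ ^ (e + 1) • (((e + 1).factorial : k)⁻¹ • (opF k W ^ (e + 1)) x)) := by
      intro e
      have hc : (((e + 1).factorial : k)⁻¹) * (e + 1 : k) = (e.factorial : k)⁻¹ := by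
        rw [Nat.factorial_succ, Nat.cast_mul, mul_inv_rev, mul_assoc, Nat.cast_add_one,
          inv_mul_cancel₀ (Nat.cast_add_one_ne_zero e), mul_one]
      rw [pow_opF_av_mul]
      simp only [smul_add, mul_smul_comm, smul_smul]
      rw [hc]
      ring_nf
    simp only [h0, Finset.sum_add_distrib]
    rw [add_assoc, ← Finset.smul_sum, ← Finset.mul_sum, ← Finset.mul_sum]
    have h1 : (∑ e ∈ Finset.range (r + 1), σ ^ (e + 1) • (((e + 1).factorial : k)⁻¹ •
        (opF k W ^ (e + 1)) x)) + x =
        ∑ e ∈ Finset.range (r + 1), σ ^ e • ((e.factorial : k)⁻¹ • (opF k W ^ e) x) := by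
      have := Finset.sum_range_succ' (fun e => σ ^ e • ((e.factorial : k)⁻¹ • (opF k W ^ e) x))
        (r + 1)
      rw [Finset.sum_range_succ, pow_opF_gen hx, smul_zero, smul_zero, add_zero] at this
      rw [this]; simp
    rw [add_mul, ← h1, smul_mul_assoc, h1, ← h1, mul_add, pow_zero, pow_zero, Nat.factorial_zero,
      Nat.cast_one, inv_one, one_smul, one_smul, Module.End.one_apply]
    abel
  | q_mul β r f g x hx ih =>
    have h : expF k W σ (qv f g) = qv f g := by
      have hcc := cv_mul_cv (k := k) f g
      simp only [qv, map_add, map_mul, expF_av, expF_cv, add_mul, smul_mul_assoc]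
      rw [hcc, smul_neg]
      abel
    rw [map_mul, ih, h, Finset.mul_sum]
    refine Finset.sum_congr rfl fun e _ => ?_
    rw [pow_opF_qv_mul, mul_smul_comm, mul_smul_comm]

/-- The terms with two equal vectors `vᵢ` are alternating in `f, g` and cancel. In the mixed terms
the determinant of the coefficients appears, as `Λ²V₂` is one-dimensional. -/
theorem add_mul_add_flip (α β γ δ : k) (f g : W) :
    (α • av k g + β • cv k g) * (γ • av k f + δ • cv k f) +
      (α • av k f + β • cv k f) * (γ • av k g + δ • cv k g) = (α * δ - β * γ) • qv f g := by
  have h1 : cv k g * av k f = -(av k f * cv k g) := cv_mul_av g f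
  have h2 : cv k f * av k g = -(av k g * cv k f) := cv_mul_av f g
  have h3 : av k g * av k f = -(av k f * av k g) := av_mul_av g f
  have h4 : cv k g * cv k f = -(cv k f * cv k g) := cv_mul_cv g f
  simp only [qv, mul_add, add_mul, smul_mul_smul_comm, h1, h2, h3, h4]
  module

theorem list_prod_smul_qv_mul_mem_filQ {β b d : ℕ} {x : Lam2 k W} (hx : x ∈ filQ k W β d)
    (c : Fin b → k) (f g : Fin b → W) :
    (List.ofFn fun j => c j • qv (k := k) (f j) (g j)).prod * x ∈
      filQ k W (β + b) (d + 2 * b) := by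
  induction b with
  | zero => simpa using hx
  | succ b ih =>
    rw [List.ofFn_succ, List.prod_cons, mul_assoc, smul_mul_assoc]
    exact Submodule.smul_mem _ _ (qv_mul_filQ _ _ (ih (fun j => c j.succ) (fun j => f j.succ)
      (fun j => g j.succ)))

end Spans

theorem list_prod_ι_mem_exteriorPower {R M : Type*} [CommRing R] [AddCommGroup M] [Module R M]
    {r : ℕ} (m : Fin r → M) :
    (List.ofFn fun l => ExteriorAlgebra.ι R (m l)).prod ∈ ⋀[R]^r M := by
  rw [← ExteriorAlgebra.ιMulti_apply]
  exact ExteriorAlgebra.ιMulti_range R r (Set.mem_range_self m)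

section LamPart

variable {n : ℕ} {k : Type*} [Field k] [Fact (2 ≤ n)]

variable (n k) in
/-- The map `(f, g) ↦ v₁ ⊗ f + v₂ ⊗ g`. -/
def jlin : (↥(V₂perp n k) × ↥(V₂perp n k)) →ₗ[k] SpGrTate.E n k :=
  (TensorProduct.mk k (V n k) _ (v₁ n k) ∘ₗ (V₂perp n k).subtype).coprod
    (TensorProduct.mk k (V n k) _ (v₂ n k) ∘ₗ (V₂perp n k).subtype)

theorem jlin_apply (m : ↥(V₂perp n k) × ↥(V₂perp n k)) :
    jlin n k m = v₁ n k ⊗ₜ[k] (m.1 : Module.Dual k (V n k)) + v₂ n k ⊗ₜ[k] (m.2 : Module.Dual k (V n k)) :=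
  rfl

variable (n k) in
/-- The map from the model exterior algebra to the exterior algebra of `V ⊗ V*`. -/
def jmap : Lam2 k (V₂perp n k) →ₐ[k] Lam n k := ExteriorAlgebra.map (jlin n k)

theorem jmap_ι (m) : jmap n k (ExteriorAlgebra.ι k m) = ExteriorAlgebra.ι k (jlin n k m) :=
  ExteriorAlgebra.map_apply_ι _ _

theorem jmap_av (f : V₂perp n k) :
    jmap n k (av k f) = ExteriorAlgebra.ι k (v₁ n k ⊗ₜ[k] (f : Module.Dual k (V n k))) := by
  rw [av, LinearMap.comp_apply, jmap_ι, jlin_apply]; simp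

theorem jmap_cv (f : V₂perp n k) :
    jmap n k (cv k f) = ExteriorAlgebra.ι k (v₂ n k ⊗ₜ[k] (f : Module.Dual k (V n k))) := by
  rw [cv, LinearMap.comp_apply, jmap_ι, jlin_apply]; simp

theorem v₁_mem : v₁ n k ∈ V₂ n k := Submodule.subset_span ⟨0, rfl⟩
theorem v₂_mem : v₂ n k ∈ V₂ n k := Submodule.subset_span ⟨1, rfl⟩

theorem exists_eq_of_mem_V₂ {v : V n k} (hv : v ∈ V₂ n k) :
    ∃ α β : k, v = α • v₁ n k + β • v₂ n k := by
  have : v ∈ Submodule.span k {v₁ n k, v₂ n k} := by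
    rwa [V₂, Matrix.range_cons, Matrix.range_cons, Matrix.range_empty, Set.union_empty,
      Set.singleton_union] at hv
  obtain ⟨α, β, h⟩ := Submodule.mem_span_pair.1 this
  exact ⟨α, β, h.symm⟩

omit [Fact (2 ≤ n)] in
theorem exists_wedgeBoxes_eq_colProd (b r : ℕ) : ∃ ε : ℤˣ, ∀ (v : Box (b + r) b → V n k)
    (f : Box (b + r) b → Module.Dual k (V n k)),
    wedgeBoxes n k (b + r) b (PiTensorProduct.tprod k v) (PiTensorProduct.tprod k f) =
      ε • colProd fun i => ExteriorAlgebra.ι k (v i ⊗ₜ[k] f i) := by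
  obtain ⟨ε, h⟩ := exists_ιMulti_eq_colProd (R := k) (M := SpGrTate.E n k) b r
  exact ⟨ε, fun v f => by rw [wedgeBoxes_tprod, h]⟩

/-- Averaging over the exchanges of the two boxes in each column turns every column of length two
into a multiple of some `qv`, so the product has `b` factors from `Q`. -/
theorem LamPart_le_map_filQ [CharZero k] (b r : ℕ) :
    LamPart n k (b + r) b ≤ (filQ k (V₂perp n k) b (2 * b + r)).map (jmap n k).toLinearMap := by
  obtain ⟨ε, hε⟩ := exists_wedgeBoxes_eq_colProd (n := n) (k := k) b r
  refine LamPart_le (T := fun s : Finset (Fin b) => colFlip r s)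
    (fun s => colFlip_mem_fiberStab r s) ?_
  intro v f hv hf
  choose α β hαβ using fun i => exists_eq_of_mem_V₂ (hv i)
  let f' : Box (b + r) b → V₂perp n k := fun i => ⟨f i, hf i⟩
  let p : Box (b + r) b → Box (b + r) b → Lam2 k (V₂perp n k) := fun i j =>
    α i • av k (f' j) + β i • cv k (f' j)
  have hp : ∀ i j, ExteriorAlgebra.ι k (v i ⊗ₜ[k] f j) = jmap n k (p i j) := fun i j => by
    simp only [p, map_add, map_smul, jmap_av, jmap_cv, f']
    rw [hαβ i, TensorProduct.add_tmul, map_add, ← TensorProduct.smul_tmul', ← TensorProduct.smul_tmul',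
      map_smul, map_smul]
  let P1 : Fin b → Lam2 k (V₂perp n k) := fun j =>
    p (Sum.inl (Fin.castAdd r j)) (Sum.inl (Fin.castAdd r j)) * p (Sum.inr j) (Sum.inr j)
  let P2 : Fin b → Lam2 k (V₂perp n k) := fun j =>
    p (Sum.inl (Fin.castAdd r j)) (Sum.inr j) * p (Sum.inr j) (Sum.inl (Fin.castAdd r j))
  let R : Lam2 k (V₂perp n k) :=
    (List.ofFn fun l : Fin r => p (Sum.inl (Fin.natAdd b l)) (Sum.inl (Fin.natAdd b l))).prod
  have hs : ∀ s : Finset (Fin b), wedgeBoxes n k (b + r) b (PiTensorProduct.tprod k v)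
      (PiTensorProduct.tprod k fun i => f ((colFlip r s)⁻¹ i)) =
      ε • jmap n k ((List.ofFn (s.piecewise P2 P1)).prod * R) := by
    intro s
    have h0 : (List.ofFn (s.piecewise P2 P1)).prod * R =
        colProd fun i => p i ((colFlip r s)⁻¹ i) := by
      rw [colProd]
      refine congrArg₂ (· * ·) (congrArg (fun q => (List.ofFn q).prod) (funext fun j => ?_))
        (congrArg (fun q => (List.ofFn q).prod) (funext fun l => ?_))
      · rw [colFlip_inv, colFlip_inl_castAdd, colFlip_inr, Finset.piecewise]
        split_ifs <;> rfl
      · rw [colFlip_inv, colFlip_inl_natAdd]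
    rw [hε, h0]
    simp only [hp]
    exact congrArg (ε • ·) (map_colProd (jmap n k : Lam2 k (V₂perp n k) →* Lam n k) _).symm
  simp only [hs]
  -- The sum over all sets of flipped columns is the expansion of the product of the sums `P2 j + P1
  -- j`.
  have h1 := (MultilinearMap.mkPiAlgebraFin k b (Lam2 k (V₂perp n k))).map_add_univ P2 P1
  simp only [MultilinearMap.mkPiAlgebraFin_apply] at h1
  have h2 : P2 + P1 = fun j => (α (Sum.inl (Fin.castAdd r j)) * β (Sum.inr j) -
      β (Sum.inl (Fin.castAdd r j)) * α (Sum.inr j)) •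
        qv (k := k) (f' (Sum.inl (Fin.castAdd r j))) (f' (Sum.inr j)) := by
    funext j
    exact add_mul_add_flip _ _ _ _ _ _
  rw [← Finset.smul_sum, ← map_sum, ← Finset.sum_mul, ← h1, h2, Units.smul_def]
  refine zsmul_mem (Submodule.mem_map_of_mem (f := (jmap n k).toLinearMap) ?_) _
  have hR : R ∈ filQ k (V₂perp n k) 0 r := by
    rw [filQ_zero]
    have : R = (List.ofFn fun l : Fin r => ExteriorAlgebra.ι k
        (α (Sum.inl (Fin.natAdd b l)) • f' (Sum.inl (Fin.natAdd b l)),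
          β (Sum.inl (Fin.natAdd b l)) • f' (Sum.inl (Fin.natAdd b l)))).prod := by
      simp only [R, p, ι_eq, map_smul]
    rw [this]
    exact list_prod_ι_mem_exteriorPower _
  have := list_prod_smul_qv_mul_mem_filQ hR (fun j => (α (Sum.inl (Fin.castAdd r j)) *
    β (Sum.inr j) - β (Sum.inl (Fin.castAdd r j)) * α (Sum.inr j)))
    (fun j => f' (Sum.inl (Fin.castAdd r j))) (fun j => f' (Sum.inr j))
  rwa [zero_add, add_comm r] at this

/-- A spanning element of `gen b r` moved by `v₁ ↦ v₁ + σ v₂` is the exterior product of boxes whose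
vectors are constant along rows and whose linear forms are constant along columns, so
`wedgeBoxes_tprod_mem_LamPart` applies. -/
theorem jmap_expF_mem_LamPart [CharZero k] (σ : k) {b r : ℕ} {u : Lam2 k (V₂perp n k)}
    (hu : u ∈ gen k (V₂perp n k) b r) : jmap n k (expF k _ σ u) ∈ LamPart n k (b + r) b := by
  obtain ⟨ε, hε⟩ := exists_wedgeBoxes_eq_colProd (n := n) (k := k) b r
  rw [gen_eq_span] at hu
  have : Submodule.span k (Set.range fun p : (Fin b → V₂perp n k) × (Fin r → V₂perp n k) =>
      (List.ofFn fun j => av k (p.1 j) * cv k (p.1 j)).prod *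
        (List.ofFn fun l => av k (p.2 l)).prod) ≤
      (LamPart n k (b + r) b).comap ((jmap n k).toLinearMap ∘ₗ (expF k _ σ).toLinearMap) := by
    refine Submodule.span_le.2 ?_
    rintro _ ⟨⟨f, g⟩, rfl⟩
    -- The first row carries the moved vector `v₁ + σ v₂`, the second row the fixed vector `v₂`.
    let v : Box (b + r) b → V n k :=
      Sum.elim (fun _ => v₁ n k + σ • v₂ n k) (fun _ => v₂ n k)
    let F : Box (b + r) b → V₂perp n k := Sum.elim (Fin.addCases f g) f
    have hw := wedgeBoxes_tprod_mem_LamPart (v := v) (f := fun i => (F i).1)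
      (by rintro (i | j)
          · exact add_mem v₁_mem (Submodule.smul_mem _ _ v₂_mem)
          · exact v₂_mem) (fun i => (F i).2)
      (by rintro (i | j) (i' | j') <;> simp [boxRow, v])
      (by
        have aux : ∀ (i : Fin (b + r)) (j : Fin b), (i : ℕ) = j → i = Fin.castAdd r j :=
          fun i j h => Fin.ext h
        rintro (i | j) (i' | j') h
        · have : i = i' := Fin.ext h
          rw [this]
        · obtain rfl := aux i j' h; simp [F]
        · obtain rfl := aux i' j h.symm; simp [F]
        · have : j = j' := Fin.ext h
          rw [this])
    rw [hε, Units.smul_def] at hw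
    have hw' := zsmul_mem hw (ε : ℤ)
    rw [smul_smul, ← Units.val_mul, Int.units_mul_self, Units.val_one, one_smul] at hw'
    rw [SetLike.mem_coe, Submodule.mem_comap]
    convert hw' using 1
    have h1 : ∀ f : V₂perp n k, jmap n k (expF k _ σ (av k f)) =
        ExteriorAlgebra.ι k ((v₁ n k + σ • v₂ n k) ⊗ₜ[k] (f : Module.Dual k (V n k))) := fun f => by
      rw [expF_av, map_add, map_smul, jmap_av, jmap_cv, TensorProduct.add_tmul, map_add,
        ← TensorProduct.smul_tmul', map_smul]
    have h2 : ∀ f : V₂perp n k, jmap n k (expF k _ σ (cv k f)) =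
        ExteriorAlgebra.ι k (v₂ n k ⊗ₜ[k] (f : Module.Dual k (V n k))) := fun f => by
      rw [expF_cv, jmap_cv]
    simp only [LinearMap.comp_apply, AlgHom.toLinearMap_apply, map_mul, map_list_prod,
      List.map_ofFn, Function.comp_def, h1, h2, colProd, F, v, Sum.elim_inl, Sum.elim_inr,
      Fin.addCases_left, Fin.addCases_right]
  exact this hu

/-- The membership for all `σ` of the exponential series of `σ F` gives that of each `F ^ a (u a)`.
-/
theorem map_SS_le_LamPart [CharZero k] (b r : ℕ) :
    (SS k (V₂perp n k) b r).map (jmap n k).toLinearMap ≤ LamPart n k (b + r) b := by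
  rintro _ ⟨_, ⟨u, hu, rfl⟩, rfl⟩
  rw [map_sum]
  refine sum_mem fun a ha => ?_
  have h : ∀ σ : k, ∑ e ∈ Finset.range (r + 1), σ ^ e •
      jmap n k ((e.factorial : k)⁻¹ • (opF k _ ^ e) (u a)) ∈ LamPart n k (b + r) b := fun σ => by
    have := jmap_expF_mem_LamPart σ (hu a)
    rw [expF_gen σ (hu a), map_sum] at this
    simpa only [map_smul] using this
  have h2 := mem_of_forall_sum_pow_smul_mem h (Finset.mem_range.1 ha)
  rw [map_smul] at h2
  exact (Submodule.smul_mem_iff _ (inv_ne_zero (Nat.cast_ne_zero.2 (Nat.factorial_ne_zero _)))).1 h2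

-- One inclusion sorts a Cauchy summand into the filtration, the other puts each isotypic component
-- into the corresponding summand. Equality of the sums is all that is needed; no summand has to be
-- identified individually.
variable (n k) in
theorem iSup_LamPart [CharZero k] (β d : ℕ) :
    ⨆ b, ⨆ _ : β ≤ b ∧ 2 * b ≤ d, LamPart n k (d - b) b =
      (filQ k (V₂perp n k) β d).map (jmap n k).toLinearMap := by
  refine le_antisymm (iSup_le fun b => iSup_le fun ⟨h1, h2⟩ => ?_) ?_
  · obtain ⟨r, rfl⟩ := Nat.exists_eq_add_of_le h2
    rw [show 2 * b + r - b = b + r by omega]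
    exact (LamPart_le_map_filQ b r).trans (Submodule.map_mono (filQ_anti h1))
  · rw [filQ_eq_tot, tot, Submodule.map_iSup]
    refine iSup_le fun b => ?_
    rw [Submodule.map_iSup]
    refine iSup_le fun r => ?_
    rw [Submodule.map_iSup]
    refine iSup_le fun ⟨h1, h2⟩ => ?_
    subst h2
    refine (map_SS_le_LamPart b r).trans ?_
    have := le_iSup₂_of_le (f := fun b' (_ : β ≤ b' ∧ 2 * b' ≤ 2 * b + r) =>
      LamPart n k (2 * b + r - b') b') b ⟨h1, by omega⟩ (le_refl _)
    rwa [show 2 * b + r - b = b + r by omega] at this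

end LamPart

end TateModel

end

/-! ### The bundles and the differential in terms of the model -/

noncomputable section

namespace TateModel

open SpGrTate

variable {n : ℕ} {k : Type*} [Field k] [Fact (2 ≤ n)]

theorem iSup_map_monomial_filQ {W : Type*} [AddCommGroup W] [Module k W] (e i : ℕ) :
    ⨆ j, ⨆ _ : 2 * j ≤ i, (filQ k W (e - j) (i - 2 * j)).map
      ((Polynomial.monomial (R := Lam2 k W) j).restrictScalars k) = Fil k W e i := by
  refine le_antisymm (iSup_le fun j => iSup_le fun h => ?_) fun p hp => ?_
  · rintro _ ⟨w, hw, rfl⟩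
    exact monomial_mem_Fil h hw
  · rw [p.as_sum_range' (i + 1) (by
      refine Nat.lt_succ_of_le (Polynomial.natDegree_le_iff_coeff_eq_zero.2 fun j hj => ?_)
      exact (hp j).2 (by omega))]
    refine sum_mem fun j _ => ?_
    rcases Nat.lt_or_ge i (2 * j) with h | h
    · rw [(hp j).2 h, map_zero]
      exact zero_mem _
    · exact Submodule.mem_iSup_of_mem j (Submodule.mem_iSup_of_mem h
        (Submodule.mem_map_of_mem (f := (Polynomial.monomial (R := Lam2 k W) j).restrictScalars k)
          ((hp j).1 h)))

variable (n k) in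
/-- The map from polynomials over the model exterior algebra to the ambient algebra of `M`. -/
def jpol : Polynomial (Lam2 k (V₂perp n k)) →ₗ[k] Amb n k where
  toFun p := p.map (jmap n k).toRingHom
  map_add' _ _ := Polynomial.map_add _
  map_smul' c p := by
    ext1 j
    simp only [Polynomial.coeff_map, Polynomial.coeff_smul, RingHom.id_apply]
    exact map_smul (jmap n k) c (p.coeff j)

theorem jpol_apply (p : Polynomial (Lam2 k (V₂perp n k))) :
    jpol n k p = p.map (jmap n k).toRingHom := rfl

theorem jpol_comp_monomial (j : ℕ) :
    jpol n k ∘ₗ (Polynomial.monomial (R := Lam2 k (V₂perp n k)) j).restrictScalars k =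
      mulT n k j ∘ₗ (jmap n k).toLinearMap :=
  LinearMap.ext fun _ => Polynomial.map_monomial _

variable (n k) in
theorem map_Fil (e i : ℕ) : (Fil k (V₂perp n k) e i).map (jpol n k) =
    ⨆ j, ⨆ _ : 2 * j ≤ i, ((filQ k (V₂perp n k) (e - j) (i - 2 * j)).map
      (jmap n k).toLinearMap).map (mulT n k j) := by
  rw [← iSup_map_monomial_filQ, Submodule.map_iSup]
  refine iSup_congr fun j => ?_
  rw [Submodule.map_iSup]
  refine iSup_congr fun h => ?_
  rw [← Submodule.map_comp, ← Submodule.map_comp, jpol_comp_monomial]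

variable (n k) in
theorem range_jlin : LinearMap.range (jlin n k) =
    Submodule.map₂ (TensorProduct.mk k (V n k) (Module.Dual k (V n k))) (V₂ n k) (V₂perp n k) := by
  refine le_antisymm ?_ (Submodule.map₂_le.2 fun v hv f hf => ?_)
  · rintro _ ⟨m, rfl⟩
    rw [jlin_apply]
    exact add_mem (Submodule.apply_mem_map₂ _ v₁_mem m.1.2)
      (Submodule.apply_mem_map₂ _ v₂_mem m.2.2)
  · obtain ⟨α, β, rfl⟩ := exists_eq_of_mem_V₂ hv
    refine ⟨(α • ⟨f, hf⟩, β • ⟨f, hf⟩), ?_⟩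
    rw [jlin_apply, TensorProduct.mk_apply, TensorProduct.add_tmul]
    simp [TensorProduct.smul_tmul]

variable (n k) in
theorem D_eq (i : ℕ) : D n k i = (Fil k (V₂perp n k) 0 i).map (jpol n k) := by
  rw [map_Fil, D]
  refine iSup_congr fun j => iSup_congr fun h => ?_
  rw [Nat.zero_sub, filQ_zero, ← range_jlin]
  congr 1
  have h1 : (LinearMap.range (jlin n k)).map (ExteriorAlgebra.ι k) =
      (LinearMap.range (ExteriorAlgebra.ι k (M := ↥(V₂perp n k) × ↥(V₂perp n k)))).map
        (jmap n k).toLinearMap := by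
    rw [← LinearMap.range_comp, ← LinearMap.range_comp]
    congr 1
    exact LinearMap.ext fun m => (jmap_ι m).symm
  rw [h1, ← Submodule.map_pow]

-- For `α = (a, b)` with `a + b = i`, the inequality `a < 2n - 2` reads `b ≥ i + 3 - 2n`. The part
-- with `T^j` has second row `b - j`, which is why the step in `Fil` drops by `j`.
variable (n k) in
theorem B_eq [CharZero k] (i : ℕ) :
    B n k i = (Fil k (V₂perp n k) (i + 3 - 2 * n) i).map (jpol n k) := by
  rw [map_Fil, B]
  simp only [← iSup_LamPart, Mpart]
  refine le_antisymm ?_ ?_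
  · refine iSup_le fun a => iSup_le fun b => iSup_le fun ⟨h1, h2, h3⟩ => iSup_le fun j =>
      iSup_le fun hj => ?_
    refine le_iSup₂_of_le j (by omega) (Submodule.map_mono ?_)
    have := le_iSup₂_of_le (f := fun b' (_ : i + 3 - 2 * n - j ≤ b' ∧ 2 * b' ≤ i - 2 * j) =>
      LamPart n k (i - 2 * j - b') b') (b - j) ⟨by omega, by omega⟩ (le_refl _)
    rwa [show i - 2 * j - (b - j) = a - j by omega] at this
  · refine iSup_le fun j => iSup_le fun hj => ?_
    rw [Submodule.map_iSup]
    refine iSup_le fun b => ?_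
    rw [Submodule.map_iSup]
    refine iSup_le fun ⟨h1, h2⟩ => ?_
    -- A summand with second row `b` next to `T^j` belongs to the partition with second row `b + j`.
    refine le_iSup_of_le (i - (b + j)) (le_iSup_of_le (b + j)
      (le_iSup_of_le ⟨by omega, by omega, by omega⟩ (le_iSup₂_of_le j (by omega) ?_)))
    rw [show i - (b + j) - j = i - 2 * j - b by omega, Nat.add_sub_cancel]

theorem jlin_injective : Function.Injective (jlin n k) := by
  have h : i₁ n ≠ i₂ n := by simp [i₁, i₂]
  rw [injective_iff_map_eq_zero]
  rintro ⟨f, g⟩ hm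
  rw [jlin_apply] at hm
  have key : ∀ i : Idx n, (x i (v₁ n k)) • (f : Module.Dual k (V n k)) +
      (x i (v₂ n k)) • (g : Module.Dual k (V n k)) = 0 := fun i => by
    have := congrArg ((TensorProduct.lid k (Module.Dual k (V n k))).toLinearMap ∘ₗ
      LinearMap.rTensor (Module.Dual k (V n k)) (x (k := k) i)) hm
    simpa only [LinearMap.comp_apply, map_add, LinearMap.rTensor_tmul, map_zero,
      LinearEquiv.coe_coe, TensorProduct.lid_tmul] using this
  have h1 := key (i₁ n)
  have h2 := key (i₂ n)
  simp [v₁, v₂, e, x, h, h.symm] at h1 h2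
  exact Prod.ext h1 h2

theorem jmap_injective : Function.Injective (jmap n k) :=
  ExteriorAlgebra.map_injective_field (LinearMap.ker_eq_bot_of_injective jlin_injective)

theorem jpol_injective : Function.Injective (jpol n k) :=
  Polynomial.map_injective _ jmap_injective

variable (n k) in
theorem finrank_V₂perp : Module.finrank k (V₂perp n k) = 2 * n - 2 := by
  have h := Subspace.finrank_add_finrank_dualAnnihilator_eq (V₂ n k)
  have h2 : Module.finrank k (V₂ n k) = 2 :=
    (finrank_span_eq_card (linearIndependent_v₁_v₂ (n := n) (k := k))).trans (Fintype.card_fin 2)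
  rw [h2] at h
  simp only [Module.finrank_fintype_fun_eq_card, Fintype.card_sum, Fintype.card_fin] at h
  rw [V₂perp]
  omega

theorem B_le_D [CharZero k] (i : ℕ) : B n k i ≤ D n k i := by
  rw [B_eq, D_eq]
  exact Submodule.map_mono (Fil_anti (Nat.zero_le _))

instance finiteDimensional_B [CharZero k] (i : ℕ) : FiniteDimensional k (B n k i) := by
  rw [B_eq]
  infer_instance

theorem diff_eq_gdiff (g h : G n k) : diff g h = gdiff (pairing g h) (tCycle g h) := rfl

variable (n k) in
/-- The first two columns of a matrix as a linear form on `V₂ ⊗ (V / V₂)*`. -/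
def colForm (u : Matrix (Idx n) (Idx n) k) : Module.Dual k (↥(V₂perp n k) × ↥(V₂perp n k)) :=
  (Module.Dual.eval k (V n k) (u.mulVec (v₁ n k)) ∘ₗ (V₂perp n k).subtype).coprod
    (Module.Dual.eval k (V n k) (u.mulVec (v₂ n k)) ∘ₗ (V₂perp n k).subtype)

theorem colForm_apply (u : Matrix (Idx n) (Idx n) k) (m : ↥(V₂perp n k) × ↥(V₂perp n k)) :
    colForm n k u m = (m.1 : Module.Dual k (V n k)) (u.mulVec (v₁ n k)) +
      (m.2 : Module.Dual k (V n k)) (u.mulVec (v₂ n k)) := rfl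

theorem x_inr_mem_V₂perp (i : Fin n) : x (k := k) (Sum.inr i) ∈ V₂perp n k := by
  rw [V₂perp, Submodule.mem_dualAnnihilator]
  exact fun v hv => form_V₂ v hv i

/-- The element `∑ vᵢ x_{n+i}` of `(V / V₂)*`. -/
def topForm (v : V n k) : V₂perp n k :=
  ∑ i : Fin n, v (Sum.inl i) • (⟨x (Sum.inr i), x_inr_mem_V₂perp i⟩ : V₂perp n k)

theorem coe_topForm (v : V n k) : (topForm v : Module.Dual k (V n k)) =
    ∑ i : Fin n, v (Sum.inl i) • x (Sum.inr i) := by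
  simp [topForm]

omit [Fact (2 ≤ n)] in
theorem actDual_actV (g h : G n k) (f : Module.Dual k (V n k)) (v : V n k) :
    actDual h f (actV g v) = f ((h⁻¹ * g).1.mulVec v) := by
  simp [actDual, actV]

theorem pairing_comp_jlin (g h : G n k) :
    pairing g h ∘ₗ jlin n k = colForm n k (h⁻¹ * g).1 := by
  refine LinearMap.ext fun m => ?_
  rw [LinearMap.comp_apply, jlin_apply, colForm_apply, map_add]
  simp only [pairing, TensorProduct.lift.tmul, LinearMap.compl₁₂_apply, Module.Dual.eval_apply,
    actDual_actV]

theorem tCycle_eq (g h : G n k) : tCycle g h = jlin n k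
    (-topForm ((h⁻¹ * g).1.mulVec (v₂ n k)), topForm ((h⁻¹ * g).1.mulVec (v₁ n k))) := by
  rw [jlin_apply, tCycle]
  simp only [Submodule.coe_neg, coe_topForm, actDual_actV, TensorProduct.sub_tmul,
    Finset.sum_sub_distrib, TensorProduct.tmul_neg, TensorProduct.tmul_sum,
    ← TensorProduct.smul_tmul', TensorProduct.tmul_smul]
  rw [sub_eq_add_neg, add_comm]
  rfl

theorem gdiff_jpol (φ : Module.Dual k (SpGrTate.E n k)) (t : ↥(V₂perp n k) × ↥(V₂perp n k))
    (p : Polynomial (Lam2 k (V₂perp n k))) :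
    gdiff φ (jlin n k t) (jpol n k p) = jpol n k (gdiff (φ ∘ₗ jlin n k) t p) := by
  have h := map_gdiff (jlin n k) φ t p
  exact h

theorem diff_jpol (g h : G n k) (p : Polynomial (Lam2 k (V₂perp n k))) :
    diff g h (jpol n k p) = jpol n k (gdiff (colForm n k (h⁻¹ * g).1)
      (-topForm ((h⁻¹ * g).1.mulVec (v₂ n k)), topForm ((h⁻¹ * g).1.mulVec (v₁ n k))) p) := by
  rw [diff_eq_gdiff, tCycle_eq, ← pairing_comp_jlin]
  exact gdiff_jpol _ _ _

/-- This value is the symplectic product of the first two columns of `u`, which span an isotropic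
plane. -/
theorem colForm_topForm (u : G n k) : colForm n k u.1
    (-topForm (u.1.mulVec (v₂ n k)), topForm (u.1.mulVec (v₁ n k))) = 0 := by
  have h : (u.1.mulVec (v₂ n k)) ⬝ᵥ (Matrix.J (Fin n) k).mulVec (u.1.mulVec (v₁ n k)) = 0 :=
    (toPoint u).2.2 _ ⟨_, v₂_mem, rfl⟩ _ ⟨_, v₁_mem, rfl⟩
  rw [colForm_apply]
  revert h
  generalize u.1.mulVec (v₁ n k) = a
  generalize u.1.mulVec (v₂ n k) = b
  intro h
  simp only [Submodule.coe_neg, coe_topForm, LinearMap.neg_apply, LinearMap.sum_apply,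
    LinearMap.smul_apply, x, LinearMap.proj_apply, smul_eq_mul]
  rw [← h, Matrix.J, Matrix.fromBlocks_mulVec]
  simp [dotProduct, Fintype.sum_sum_type, Matrix.neg_mulVec, mul_comm]

end TateModel

end

/-! ### Algebra endomorphisms sending `X` to `δ (X + c)` -/

noncomputable section

namespace TateModel

open SpGrTate

section Twist

variable {k : Type*} [Field k] {M : Type*} [AddCommGroup M] [Module k M]

theorem polynomial_exterior_induction {p : Polynomial (ExteriorAlgebra k M) → Prop}
    (algebraMap : ∀ r : k, p (Polynomial.C (algebraMap k _ r)))
    (add : ∀ x y, p x → p y → p (x + y))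
    (ι_mul : ∀ x m, p x → p (Polynomial.C (ExteriorAlgebra.ι k m) * x))
    (X_mul : ∀ x, p x → p (Polynomial.X * x)) : ∀ x, p x := by
  have hC : ∀ w, p (Polynomial.C w) := fun w => by
    induction w using exterior_induction with
    | algebraMap r => exact algebraMap r
    | add x y hx hy => rw [map_add]; exact add _ _ hx hy
    | ι_mul x m hx => rw [map_mul]; exact ι_mul _ _ hx
  intro x
  induction x using Polynomial.induction_on' with
  | add x y hx hy => exact add _ _ hx hy
  | monomial j w =>
    induction j with
    | zero => exact hC w
    | succ j ih =>
      rw [← Polynomial.X_mul_monomial]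
      exact X_mul _ ih

theorem gdiff_X_mul (φ : Module.Dual k M) (t : M) (p : Polynomial (ExteriorAlgebra k M)) :
    gdiff φ t (Polynomial.X * p) =
      Polynomial.X * gdiff φ t p + Polynomial.C (ExteriorAlgebra.ι k t) * p := by
  ext1 j
  rw [coeff_gdiff, Polynomial.coeff_add, Polynomial.coeff_C_mul, Polynomial.coeff_X_mul]
  rcases j with _ | j
  · simp
  · rw [Polynomial.coeff_X_mul, Polynomial.coeff_X_mul, coeff_gdiff]
    push_cast
    module

/-- The algebra endomorphism that extends a linear map and sends `X` to `δ (X + c)`. -/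
def twist (f : M →ₗ[k] M) (δ : k) (c : ExteriorAlgebra k M) :
    Polynomial (ExteriorAlgebra k M) →ₗ[k] Polynomial (ExteriorAlgebra k M) :=
  Polynomial.lsum fun j =>
    (LinearMap.mulRight k ((δ • (Polynomial.X + Polynomial.C c) :
      Polynomial (ExteriorAlgebra k M)) ^ j)).comp
      (((Polynomial.monomial (R := ExteriorAlgebra k M) 0).restrictScalars k).comp
        (ExteriorAlgebra.map f).toLinearMap)

theorem twist_monomial (f : M →ₗ[k] M) (δ : k) (c : ExteriorAlgebra k M) (j : ℕ)
    (w : ExteriorAlgebra k M) : twist f δ c (Polynomial.monomial j w) =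
      Polynomial.C (ExteriorAlgebra.map f w) * (δ • (Polynomial.X + Polynomial.C c)) ^ j := by
  rw [twist, Polynomial.lsum_apply, Polynomial.sum_monomial_index]
  · rfl
  · exact map_zero _

theorem twist_C (f : M →ₗ[k] M) (δ : k) (c : ExteriorAlgebra k M) (w : ExteriorAlgebra k M) :
    twist f δ c (Polynomial.C w) = Polynomial.C (ExteriorAlgebra.map f w) := by
  rw [← Polynomial.monomial_zero_left, twist_monomial, pow_zero, mul_one]

theorem twist_C_mul (f : M →ₗ[k] M) (δ : k) (c w : ExteriorAlgebra k M)
    (p : Polynomial (ExteriorAlgebra k M)) :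
    twist f δ c (Polynomial.C w * p) = Polynomial.C (ExteriorAlgebra.map f w) * twist f δ c p := by
  induction p using Polynomial.induction_on' with
  | add p q hp hq => rw [mul_add, map_add, hp, hq, map_add, mul_add]
  | monomial j v =>
    rw [Polynomial.C_mul_monomial, twist_monomial, twist_monomial, map_mul, map_mul, mul_assoc]

theorem twist_X_mul (f : M →ₗ[k] M) (δ : k) {c : ExteriorAlgebra k M} (hc : ∀ w, Commute c w)
    (p : Polynomial (ExteriorAlgebra k M)) :
    twist f δ c (Polynomial.X * p) =
      (δ • (Polynomial.X + Polynomial.C c)) * twist f δ c p := by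
  induction p using Polynomial.induction_on' with
  | add p q hp hq => rw [mul_add, map_add, hp, hq, map_add, mul_add]
  | monomial j v =>
    have h : Commute (Polynomial.C (ExteriorAlgebra.map f v))
        (δ • (Polynomial.X + Polynomial.C c)) := by
      refine Commute.smul_right (Commute.add_right (Polynomial.commute_X _).symm ?_) δ
      rw [commute_iff_eq, ← map_mul, ← map_mul, (hc _).eq]
    rw [Polynomial.X_mul_monomial, twist_monomial, twist_monomial, pow_succ', ← mul_assoc, h.eq,
      mul_assoc]

/-- The differential is a skew derivation with `d X = t`, so compatibility has to be checked only on
generators. On `X` it says that the differential of `δ (X + c)`, namely `δ (t + b)`, is the image of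
`t'`. -/
theorem twist_gdiff {f : M →ₗ[k] M} {δ : k} {c : ExteriorAlgebra k M} (hc : ∀ w, Commute c w)
    {φ : Module.Dual k M} {t t' b : M}
    (hd : ∀ p, gdiff φ t (Polynomial.C c * p) =
      Polynomial.C (ExteriorAlgebra.ι k b) * p + Polynomial.C c * gdiff φ t p)
    (ht : f t' = δ • (t + b)) (p : Polynomial (ExteriorAlgebra k M)) :
    gdiff φ t (twist f δ c p) = twist f δ c (gdiff (φ ∘ₗ f) t' p) := by
  induction p using polynomial_exterior_induction with
  | algebraMap r =>
    rw [twist_C, AlgHom.commutes, gdiff_C, gdiff_C, CliffordAlgebra.contractLeft_algebraMap,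
      CliffordAlgebra.contractLeft_algebraMap, map_zero, map_zero]
  | add p q hp hq => simp only [map_add, hp, hq]
  | ι_mul p m hp =>
    rw [twist_C_mul, ExteriorAlgebra.map_apply_ι, gdiff_C_ι_mul, gdiff_C_ι_mul, map_sub, map_smul,
      twist_C_mul, ExteriorAlgebra.map_apply_ι, hp, LinearMap.comp_apply]
  | X_mul p hp =>
    have h4 : ∀ A B C D : Polynomial (ExteriorAlgebra k M), A + B + (C + D) = A + D + (B + C) :=
      fun A B C D => by abel
    rw [twist_X_mul f δ hc, gdiff_X_mul, map_add, twist_X_mul f δ hc, twist_C_mul,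
      ExteriorAlgebra.map_apply_ι, ht, ← hp, smul_mul_assoc, smul_mul_assoc, add_mul, add_mul,
      map_smul, map_add, gdiff_X_mul, hd, map_smul, ← Polynomial.smul_C, smul_mul_assoc, map_add,
      map_add, add_mul, ← smul_add, h4]

theorem twist_twist {f f' : M →ₗ[k] M} {δ δ' : k} {c c' d : ExteriorAlgebra k M}
    (hc : ∀ w, Commute c w) (hc' : ∀ w, Commute c' w) (hd : ∀ w, Commute d w)
    (h : ExteriorAlgebra.map f c' = δ • d) (p : Polynomial (ExteriorAlgebra k M)) :
    twist f δ c (twist f' δ' c' p) = twist (f ∘ₗ f') (δ * δ') (c + d) p := by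
  have hcd : ∀ w, Commute (c + d) w := fun w => (hc w).add_left (hd w)
  induction p using polynomial_exterior_induction with
  | algebraMap r => simp only [twist_C, AlgHom.commutes]
  | add p q hp hq => simp only [map_add, hp, hq]
  | ι_mul p m hp => simp only [twist_C_mul, ExteriorAlgebra.map_apply_ι, hp, LinearMap.comp_apply]
  | X_mul p hp =>
    rw [twist_X_mul _ _ hc', twist_X_mul _ _ hcd, smul_mul_assoc, map_smul, add_mul, map_add,
      twist_X_mul _ _ hc, twist_C_mul, h, hp, ← Polynomial.smul_C, ← add_mul, ← smul_add,
      ← smul_mul_assoc, smul_smul, mul_comm δ', add_assoc, map_add]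

theorem commute_ι_mul_ι (m m' : M) (w : ExteriorAlgebra k M) :
    Commute (ExteriorAlgebra.ι k m * ExteriorAlgebra.ι k m') w := by
  have h : ∀ m m' : M, ExteriorAlgebra.ι k m * ExteriorAlgebra.ι k m' =
      -(ExteriorAlgebra.ι k m' * ExteriorAlgebra.ι k m) := fun m m' =>
    eq_neg_of_add_eq_zero_left (ExteriorAlgebra.ι_add_mul_swap m m')
  induction w using exterior_induction with
  | algebraMap r => exact Algebra.commute_algebraMap_right r _
  | add x y hx hy => exact hx.add_right hy
  | ι_mul x a hx =>
    refine Commute.mul_right ?_ hx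
    rw [commute_iff_eq, mul_assoc, h m' a, mul_neg, ← mul_assoc, h m a, neg_mul, neg_neg, mul_assoc]

variable {Y : Type*} {𝒪 : Subalgebra k (Y → k)}

theorem mul_mem_Vals {A : Type*} [Ring A] [Algebra k A] {f g : Y → A} (hf : f ∈ Vals 𝒪 A)
    (hg : g ∈ Vals 𝒪 A) : (fun y => f y * g y) ∈ Vals 𝒪 A :=
  bilinear_mem_Vals (LinearMap.mul k A) hf hg

theorem twist_mem_Vals {f : Y → M →ₗ[k] M} (hf : f ∈ Vals 𝒪 (M →ₗ[k] M)) {δ : Y → k} (hδ : δ ∈ 𝒪)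
    {c : Y → ExteriorAlgebra k M} (hc : c ∈ Vals 𝒪 (ExteriorAlgebra k M))
    (hcc : ∀ y w, Commute (c y) w) {p : Y → Polynomial (ExteriorAlgebra k M)}
    (hp : p ∈ Vals 𝒪 (Polynomial (ExteriorAlgebra k M))) :
    (fun y => twist (f y) (δ y) (c y) (p y)) ∈ Vals 𝒪 (Polynomial (ExteriorAlgebra k M)) := by
  have key : ∀ p, (fun y => twist (f y) (δ y) (c y) p) ∈
      Vals 𝒪 (Polynomial (ExteriorAlgebra k M)) := by
    intro p
    induction p using polynomial_exterior_induction with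
    | algebraMap r =>
      simp only [twist_C, AlgHom.commutes]
      exact const_mem_Vals _
    | add p q hp hq => simp only [map_add]; exact add_mem hp hq
    | ι_mul p m hp =>
      simp only [twist_C_mul, ExteriorAlgebra.map_apply_ι]
      refine mul_mem_Vals ?_ hp
      exact linear_mem_Vals ((Polynomial.monomial (R := ExteriorAlgebra k M) 0).restrictScalars k ∘ₗ
        ExteriorAlgebra.ι k) (linear_mem_Vals (LinearMap.applyₗ m) hf)
    | X_mul p hp =>
      simp only [twist_X_mul _ _ (hcc _)]
      refine mul_mem_Vals (smul_mem_Vals hδ (add_mem (const_mem_Vals _) ?_)) hp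
      exact linear_mem_Vals ((Polynomial.monomial (R := ExteriorAlgebra k M) 0).restrictScalars k) hc
  induction p, hp using Vals_induction with
  | smul a ha v => simp only [map_smul]; exact smul_mem_Vals ha (key v)
  | zero => simpa using const_mem_Vals (𝒪 := 𝒪) (0 : Polynomial (ExteriorAlgebra k M))
  | add p q _ _ hp hq => simp only [Pi.add_apply, map_add]; exact add_mem hp hq

end Twist

end TateModel

end

/-! ### The cocycle `q η - η` and the equivariance of the differential -/

noncomputable section

namespace TateModel

open SpGrTate

section SymmetricTensors

variable {k : Type*} [Field k] {W : Type*} [AddCommGroup W] [Module k W]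

/-- A symmetric tensor is half the sum of itself and its flip, and such sums are generated by `f ⊗ g
+ g ⊗ f`. -/
theorem symmetric_induction [CharZero k] {p : W ⊗[k] W → Prop}
    (add : ∀ x y, p x → p y → p (x + y)) (smul : ∀ (c : k) x, p x → p (c • x))
    (tmul : ∀ f g : W, p (f ⊗ₜ[k] g + g ⊗ₜ[k] f)) {z : W ⊗[k] W}
    (hz : TensorProduct.comm k W W z = z) : p z := by
  have h : ∀ z, p (z + TensorProduct.comm k W W z) := fun z => by
    induction z with
    | zero => simpa using tmul 0 0
    | tmul f g => exact tmul f g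
    | add x y hx hy => rw [map_add, add_add_add_comm]; exact add _ _ hx hy
  have h2 := smul (2⁻¹ : k) _ (h z)
  rwa [hz, ← two_smul k, smul_smul, inv_mul_cancel₀ two_ne_zero, one_smul] at h2

end SymmetricTensors

section Cocycle

variable {n : ℕ} {k : Type*} [Field k]

theorem dualDistrib_ext {z z' : Module.Dual k (V n k) ⊗[k] Module.Dual k (V n k)}
    (h : ∀ v w, TensorProduct.dualDistrib k _ _ z (v ⊗ₜ[k] w) =
      TensorProduct.dualDistrib k _ _ z' (v ⊗ₜ[k] w)) : z = z' :=
  (TensorProduct.dualDistribEquiv k (V n k) (V n k)).injective (TensorProduct.ext' h)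

theorem dualDistrib_comm (z : Module.Dual k (V n k) ⊗[k] Module.Dual k (V n k)) (v w : V n k) :
    TensorProduct.dualDistrib k _ _ (TensorProduct.comm k _ _ z) (v ⊗ₜ[k] w) =
      TensorProduct.dualDistrib k _ _ z (w ⊗ₜ[k] v) := by
  induction z with
  | zero => simp
  | tmul f g => simp [mul_comm]
  | add x y hx hy => simp only [map_add, LinearMap.add_apply, hx, hy]

theorem dualDistrib_actDual (q : G n k) (z : Module.Dual k (V n k) ⊗[k] Module.Dual k (V n k))
    (v w : V n k) :
    TensorProduct.dualDistrib k _ _ (TensorProduct.map (actDual q) (actDual q) z) (v ⊗ₜ[k] w) =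
      TensorProduct.dualDistrib k _ _ z (actV q⁻¹ v ⊗ₜ[k] actV q⁻¹ w) := by
  induction z with
  | zero => simp
  | tmul f g => simp [actDual]
  | add x y hx hy => simp only [map_add, LinearMap.add_apply, hx, hy]

theorem dualDistrib_eta (v w : V n k) :
    TensorProduct.dualDistrib k _ _ (eta (n := n) (k := k)) (v ⊗ₜ[k] w) =
      ∑ i : Fin n, v (Sum.inl i) * w (Sum.inr i) := by
  simp [eta, x]

theorem dualDistrib_eta_sub (v w : V n k) :
    TensorProduct.dualDistrib k _ _ (eta (n := n) (k := k)) (v ⊗ₜ[k] w) -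
      TensorProduct.dualDistrib k _ _ (eta (n := n) (k := k)) (w ⊗ₜ[k] v) =
      -(v ⬝ᵥ (Matrix.J (Fin n) k).mulVec w) := by
  rw [dualDistrib_eta, dualDistrib_eta, Matrix.J, Matrix.fromBlocks_mulVec]
  simp [dotProduct, Fintype.sum_sum_type, Matrix.neg_mulVec, mul_comm, sub_eq_add_neg]
  exact add_comm _ _

theorem form_actV (u : G n k) (v w : V n k) :
    (actV u v) ⬝ᵥ (Matrix.J (Fin n) k).mulVec (actV u w) =
      v ⬝ᵥ (Matrix.J (Fin n) k).mulVec w := by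
  have hg := SymplecticGroup.mem_iff'.1 u.2
  conv_rhs => rw [← hg]
  rw [← Matrix.mulVec_mulVec, ← Matrix.mulVec_mulVec, Matrix.dotProduct_mulVec v,
    Matrix.vecMul_transpose]
  rfl

/-- The antisymmetric part of `η` is, up to a factor, the symplectic form, which `q` preserves. So
`q η - η` has no antisymmetric part. -/
theorem comm_actDual_eta_sub (q : G n k) :
    TensorProduct.comm k _ _ (TensorProduct.map (actDual q) (actDual q) (eta (n := n) (k := k)) - eta) =
      TensorProduct.map (actDual q) (actDual q) eta - eta := by
  refine dualDistrib_ext fun v w => ?_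
  rw [dualDistrib_comm, map_sub, LinearMap.sub_apply, LinearMap.sub_apply, dualDistrib_actDual,
    dualDistrib_actDual]
  have h1 := dualDistrib_eta_sub (actV q⁻¹ v) (actV q⁻¹ w)
  have h2 := dualDistrib_eta_sub v w
  rw [form_actV] at h1
  linear_combination h2 - h1

theorem eq_sum_dualDistrib (z : Module.Dual k (V n k) ⊗[k] Module.Dual k (V n k)) :
    z = ∑ a : Idx n, ∑ b : Idx n,
      TensorProduct.dualDistrib k _ _ z (e a ⊗ₜ[k] e b) • (x a ⊗ₜ[k] x b) := by
  refine dualDistrib_ext fun v w => ?_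
  have hv : ∀ v : V n k, v = ∑ a, v a • e a := fun v => by
    ext i; simp [e, Pi.single_apply]
  conv_lhs => rw [hv v, hv w]
  simp only [map_sum, LinearMap.sum_apply, TensorProduct.sum_tmul, TensorProduct.tmul_sum,
    ← TensorProduct.smul_tmul', TensorProduct.tmul_smul, map_smul, LinearMap.smul_apply,
    TensorProduct.dualDistrib_apply, x, LinearMap.proj_apply, smul_eq_mul]
  rw [Finset.sum_comm]
  refine Finset.sum_congr rfl fun a _ => ?_
  rw [Finset.mul_sum]
  exact Finset.sum_congr rfl fun b _ => by ring

variable [Fact (2 ≤ n)]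

theorem x_mem_V₂perp {i : Idx n} (h1 : i ≠ i₁ n) (h2 : i ≠ i₂ n) : x (k := k) i ∈ V₂perp n k := by
  rw [V₂perp, Submodule.mem_dualAnnihilator]
  intro v hv
  obtain ⟨α, β, rfl⟩ := exists_eq_of_mem_V₂ hv
  simp [x, v₁, v₂, e, h1, h2]

theorem mem_map₂_V₂perp {z : Module.Dual k (V n k) ⊗[k] Module.Dual k (V n k)}
    (hl : ∀ v ∈ V₂ n k, ∀ w, TensorProduct.dualDistrib k _ _ z (v ⊗ₜ[k] w) = 0)
    (hr : ∀ v, ∀ w ∈ V₂ n k, TensorProduct.dualDistrib k _ _ z (v ⊗ₜ[k] w) = 0) :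
    z ∈ Submodule.map₂ (TensorProduct.mk k _ _) (V₂perp n k) (V₂perp n k) := by
  rw [eq_sum_dualDistrib z]
  refine sum_mem fun a _ => sum_mem fun b _ => ?_
  by_cases ha : a = i₁ n ∨ a = i₂ n
  · have : (e a : V n k) ∈ V₂ n k := by
      rcases ha with rfl | rfl
      · exact v₁_mem
      · exact v₂_mem
    rw [hl _ this, zero_smul]
    exact zero_mem _
  · by_cases hb : b = i₁ n ∨ b = i₂ n
    · have : (e b : V n k) ∈ V₂ n k := by
        rcases hb with rfl | rfl
        · exact v₁_mem
        · exact v₂_mem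
      rw [hr _ _ this, zero_smul]
      exact zero_mem _
    · push Not at ha hb
      exact Submodule.smul_mem _ _ (Submodule.apply_mem_map₂ _ (x_mem_V₂perp ha.1 ha.2)
        (x_mem_V₂perp hb.1 hb.2))

theorem wedge₁₂_tmul (f g : Module.Dual k (V n k)) : wedge₁₂ (f ⊗ₜ[k] g) =
    ExteriorAlgebra.ι k (v₁ n k ⊗ₜ[k] f) * ExteriorAlgebra.ι k (v₂ n k ⊗ₜ[k] g) := rfl

theorem commute_wedge₁₂ (z : Module.Dual k (V n k) ⊗[k] Module.Dual k (V n k)) (w : Lam n k) :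
    Commute (wedge₁₂ z) w := by
  induction z with
  | zero => rw [map_zero]; exact Commute.zero_left w
  | tmul f g => rw [wedge₁₂_tmul]; exact commute_ι_mul_ι _ _ w
  | add x y hx hy => rw [map_add]; exact hx.add_left hy

theorem commute_cocycle (q : G n k) (w : Lam n k) : Commute (cocycle q) w := commute_wedge₁₂ _ w

theorem wedge₁₂_mem_map_Qspan [CharZero k]
    {z : Module.Dual k (V n k) ⊗[k] Module.Dual k (V n k)}
    (hz : z ∈ Submodule.map₂ (TensorProduct.mk k _ _) (V₂perp n k) (V₂perp n k))
    (hs : TensorProduct.comm k _ _ z = z) :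
    wedge₁₂ z ∈ (Qspan k (V₂perp n k)).map (jmap n k).toLinearMap := by
  have h : Submodule.map₂ (TensorProduct.mk k _ _) (V₂perp n k) (V₂perp n k) ≤
      ((Qspan k (V₂perp n k)).map (jmap n k).toLinearMap).comap
        (wedge₁₂ ∘ₗ (LinearMap.id + (TensorProduct.comm k _ _).toLinearMap)) := by
    refine Submodule.map₂_le.2 fun f hf g hg => ?_
    refine ⟨qv ⟨f, hf⟩ ⟨g, hg⟩, qv_mem_Qspan _ _, ?_⟩
    simp only [qv, AlgHom.toLinearMap_apply, map_add, map_mul, jmap_av, jmap_cv,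
      LinearMap.comp_apply, LinearMap.add_apply, LinearMap.id_apply, TensorProduct.mk_apply,
      LinearEquiv.coe_coe, TensorProduct.comm_tmul, wedge₁₂_tmul]
  have h2 := h hz
  rw [Submodule.mem_comap, LinearMap.comp_apply, LinearMap.add_apply, LinearMap.id_apply,
    LinearEquiv.coe_coe, hs, ← two_smul k, map_smul] at h2
  exact (Submodule.smul_mem_iff _ two_ne_zero).1 h2

theorem inv_mem_P {p : G n k} (hp : p ∈ P n k) : p⁻¹ ∈ P n k := by
  change (V₂ n k).map (actV p⁻¹) = V₂ n k
  conv_lhs => rw [← (show (V₂ n k).map (actV p) = V₂ n k from hp)]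
  rw [← Submodule.map_comp]
  convert Submodule.map_id (V₂ n k)
  refine LinearMap.ext fun v => ?_
  have h3 : (p⁻¹).1 * p.1 = 1 := congrArg Subtype.val (inv_mul_cancel p)
  simp only [actV, LinearMap.comp_apply, Matrix.mulVecLin_apply, Matrix.mulVec_mulVec]
  rw [h3, Matrix.one_mulVec, LinearMap.id_apply]

theorem actV_mem {p : G n k} (hp : p ∈ P n k) {v : V n k} (hv : v ∈ V₂ n k) :
    actV p v ∈ V₂ n k :=
  (show (V₂ n k).map (actV p) = V₂ n k from hp) ▸ Submodule.mem_map_of_mem hv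

theorem actDual_mem {q : G n k} (hq : q ∈ P n k) {f : Module.Dual k (V n k)}
    (hf : f ∈ V₂perp n k) : actDual q f ∈ V₂perp n k := by
  rw [V₂perp, Submodule.mem_dualAnnihilator] at hf ⊢
  exact fun v hv => hf _ (actV_mem (inv_mem_P hq) hv)

/-- As a bilinear form `η` vanishes when its second argument lies in `V₂`, and `q` preserves `V₂`.
By symmetry `q η - η` vanishes on `V₂` in both arguments, so it comes from `Sym² (V/V₂)*`. -/
theorem cocycle_mem [CharZero k] {q : G n k} (hq : q ∈ P n k) :
    cocycle q ∈ (Qspan k (V₂perp n k)).map (jmap n k).toLinearMap := by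
  have h0 : ∀ v, ∀ w ∈ V₂ n k,
      TensorProduct.dualDistrib k _ _ (eta (n := n) (k := k)) (v ⊗ₜ[k] w) = 0 := fun v w hw => by
    rw [dualDistrib_eta]
    exact Finset.sum_eq_zero fun i _ => by rw [form_V₂ w hw, mul_zero]
  have h1 : ∀ v, ∀ w ∈ V₂ n k, TensorProduct.dualDistrib k _ _
      (TensorProduct.map (actDual q) (actDual q) (eta (n := n) (k := k)) - eta) (v ⊗ₜ[k] w) = 0 := by
    intro v w hw
    rw [map_sub, LinearMap.sub_apply, dualDistrib_actDual, h0 _ _ hw,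
      h0 _ _ (actV_mem (inv_mem_P hq) hw), sub_zero]
  refine wedge₁₂_mem_map_Qspan (mem_map₂_V₂perp (fun v hv w => ?_) h1) (comm_actDual_eta_sub q)
  rw [← comm_actDual_eta_sub, dualDistrib_comm, h1 _ _ hv]

theorem detV₂_eq (p : G n k) : detV₂ p =
    actV p (v₁ n k) (i₁ n) * actV p (v₂ n k) (i₂ n) -
      actV p (v₂ n k) (i₁ n) * actV p (v₁ n k) (i₂ n) := by
  rw [detV₂, Matrix.det_fin_two]
  simp [actV, v₁, v₂, e]

theorem exists_actV_v {p : G n k} (hp : p ∈ P n k) : ∃ α β γ δ : k,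
    actV p (v₁ n k) = α • v₁ n k + γ • v₂ n k ∧ actV p (v₂ n k) = β • v₁ n k + δ • v₂ n k ∧
      detV₂ p = α * δ - γ * β := by
  have hi : i₁ n ≠ i₂ n := by simp [i₁, i₂]
  obtain ⟨α, γ, h1⟩ := exists_eq_of_mem_V₂ (actV_mem hp v₁_mem)
  obtain ⟨β, δ, h2⟩ := exists_eq_of_mem_V₂ (actV_mem hp v₂_mem)
  refine ⟨α, β, γ, δ, h1, h2, ?_⟩
  rw [detV₂_eq, h1, h2]
  simp [v₁, v₂, e, hi, hi.symm, mul_comm]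

/-- The map of `V* ⊗ V*` to `V ⊗ V*` that sends `η` to the cycle `t`. -/
def cycleMap (φ : Module.Dual k (SpGrTate.E n k)) :
    Module.Dual k (V n k) ⊗[k] Module.Dual k (V n k) →ₗ[k] SpGrTate.E n k :=
  LinearMap.rTensor _ ((φ ∘ₗ TensorProduct.mk k (V n k) _ (v₁ n k)).smulRight (v₂ n k) -
    (φ ∘ₗ TensorProduct.mk k (V n k) _ (v₂ n k)).smulRight (v₁ n k))

theorem cycleMap_tmul (φ : Module.Dual k (SpGrTate.E n k)) (f g : Module.Dual k (V n k)) :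
    cycleMap φ (f ⊗ₜ[k] g) =
      (φ (v₁ n k ⊗ₜ[k] f) • v₂ n k - φ (v₂ n k ⊗ₜ[k] f) • v₁ n k) ⊗ₜ[k] g := rfl

theorem tCycle_eq_cycleMap (g h : G n k) : tCycle g h = cycleMap (pairing g h) eta := by
  rw [eta, map_sum]
  rfl

/-- For symmetric `z` the differential of `(v₁ ∧ v₂) ⊠ z` is given by the formula that defines `d T`
from `η`. -/
theorem gdiff_wedge₁₂_mul [CharZero k] (φ : Module.Dual k (SpGrTate.E n k)) (t : SpGrTate.E n k)
    {z : Module.Dual k (V n k) ⊗[k] Module.Dual k (V n k)}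
    (hz : TensorProduct.comm k _ _ z = z) (p : Amb n k) :
    gdiff φ t (Polynomial.C (wedge₁₂ z) * p) =
      Polynomial.C (ExteriorAlgebra.ι k (cycleMap φ z)) * p +
        Polynomial.C (wedge₁₂ z) * gdiff φ t p := by
  refine symmetric_induction (p := fun z => gdiff φ t (Polynomial.C (wedge₁₂ z) * p) =
    Polynomial.C (ExteriorAlgebra.ι k (cycleMap φ z)) * p +
      Polynomial.C (wedge₁₂ z) * gdiff φ t p) (fun x y hx hy => ?_) (fun c x hx => ?_)
    (fun f g => ?_) hz
  · simp only [map_add, add_mul, hx, hy]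
    exact add_add_add_comm _ _ _ _
  · simp only [map_smul, ← Polynomial.smul_C, smul_mul_assoc, hx, smul_add]
  · simp only [map_add, wedge₁₂_tmul, cycleMap_tmul, map_mul, add_mul, mul_assoc, gdiff_C_ι_mul,
      mul_sub, TensorProduct.sub_tmul, ← TensorProduct.smul_tmul', map_sub, map_smul,
      ← Polynomial.smul_C, sub_mul, smul_mul_assoc, mul_smul_comm]
    abel

theorem map_wedge₁₂ [CharZero k] {p : G n k} (hp : p ∈ P n k) (q : G n k)
    {z : Module.Dual k (V n k) ⊗[k] Module.Dual k (V n k)}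
    (hz : TensorProduct.comm k _ _ z = z) :
    ExteriorAlgebra.map (TensorProduct.map (actV p) (actDual q)) (wedge₁₂ z) =
      detV₂ p • wedge₁₂ (TensorProduct.map (actDual q) (actDual q) z) := by
  obtain ⟨α, β, γ, δ, h1, h2, h3⟩ := exists_actV_v hp
  refine symmetric_induction (p := fun z =>
    ExteriorAlgebra.map (TensorProduct.map (actV p) (actDual q)) (wedge₁₂ z) =
      detV₂ p • wedge₁₂ (TensorProduct.map (actDual q) (actDual q) z)) (fun x y hx hy => ?_)
    (fun c x hx => ?_) (fun f g => ?_) hz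
  · simp only [map_add, smul_add, hx, hy]
  · simp only [map_smul, hx, smul_comm c]
  · have hs : ∀ m m' : SpGrTate.E n k, ExteriorAlgebra.ι k m * ExteriorAlgebra.ι k m' =
        -(ExteriorAlgebra.ι k m' * ExteriorAlgebra.ι k m) := fun m m' =>
      eq_neg_of_add_eq_zero_left (ExteriorAlgebra.ι_add_mul_swap m m')
    simp only [map_add, wedge₁₂_tmul, map_mul, ExteriorAlgebra.map_apply_ι, TensorProduct.map_tmul,
      h1, h2, h3, TensorProduct.add_tmul, ← TensorProduct.smul_tmul', map_smul]
    generalize actDual q f = f'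
    generalize actDual q g = g'
    have e1 := hs (v₁ n k ⊗ₜ[k] f') (v₁ n k ⊗ₜ[k] g')
    have e2 := hs (v₂ n k ⊗ₜ[k] f') (v₂ n k ⊗ₜ[k] g')
    have e3 := hs (v₂ n k ⊗ₜ[k] f') (v₁ n k ⊗ₜ[k] g')
    have e4 := hs (v₂ n k ⊗ₜ[k] g') (v₁ n k ⊗ₜ[k] f')
    simp only [mul_add, add_mul, smul_mul_smul_comm, e1, e2, e3, e4]
    module

theorem map_cycleMap {p : G n k} (hp : p ∈ P n k) (q : G n k)
    (φ : Module.Dual k (SpGrTate.E n k))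
    (z : Module.Dual k (V n k) ⊗[k] Module.Dual k (V n k)) :
    TensorProduct.map (actV p) (actDual q)
        (cycleMap (φ ∘ₗ TensorProduct.map (actV p) (actDual q)) z) =
      detV₂ p • cycleMap φ (TensorProduct.map (actDual q) (actDual q) z) := by
  obtain ⟨α, β, γ, δ, h1, h2, h3⟩ := exists_actV_v hp
  induction z with
  | zero => simp
  | add x y hx hy => simp only [map_add, smul_add, hx, hy]
  | tmul f g =>
    simp only [cycleMap_tmul, TensorProduct.map_tmul, LinearMap.comp_apply, map_sub, map_smul, h1,
      h2, h3, TensorProduct.add_tmul, ← TensorProduct.smul_tmul', map_add]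
    rw [TensorProduct.smul_tmul']
    congr 1
    module

omit [Fact (2 ≤ n)] in
theorem pairing_mul (g h p q : G n k) : pairing (g * p) (h * q) =
    pairing g h ∘ₗ TensorProduct.map (actV p) (actDual q) := by
  refine TensorProduct.ext' fun v f => ?_
  simp [pairing, actV, actDual, Matrix.mulVec_mulVec]

theorem actM_eq_twist (p q : G n k) : actM p q =
    twist (TensorProduct.map (actV p) (actDual q)) (detV₂ p) (cocycle q) := rfl

/-- By `twist_gdiff` only the cycle has to be compared: `t` is the image of `η` under `cycleMap`,
and `map_cycleMap` together with the cocycle produces the factor `δ (t + b)`. -/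
theorem diff_actM [CharZero k] (g h : G n k) {p : G n k} (hp : p ∈ P n k) (q : G n k)
    (w : Amb n k) : diff g h (actM p q w) = actM p q (diff (g * p) (h * q) w) := by
  rw [diff_eq_gdiff, diff_eq_gdiff, actM_eq_twist, pairing_mul]
  refine twist_gdiff (commute_wedge₁₂ _)
    (fun p => gdiff_wedge₁₂_mul _ _ (comm_actDual_eta_sub q) p) ?_ w
  rw [tCycle_eq_cycleMap, tCycle_eq_cycleMap, pairing_mul, map_cycleMap hp, map_sub]
  congr 1
  abel

omit [Fact (2 ≤ n)] in
theorem actV_mul (p p' : G n k) : actV (p * p') = actV p ∘ₗ actV p' := by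
  refine LinearMap.ext fun v => ?_
  simp [actV, Matrix.mulVec_mulVec]

omit [Fact (2 ≤ n)] in
theorem actDual_mul (p p' : G n k) : actDual (p * p') = actDual p ∘ₗ actDual p' := by
  refine LinearMap.ext fun f => LinearMap.ext fun v => ?_
  simp [actDual, actV, Matrix.mulVec_mulVec]

theorem detV₂_mul {p p' : G n k} (hp : p ∈ P n k) (hp' : p' ∈ P n k) :
    detV₂ (p * p') = detV₂ p * detV₂ p' := by
  obtain ⟨α, β, γ, δ, h1, h2, h3⟩ := exists_actV_v hp
  obtain ⟨α', β', γ', δ', h1', h2', h3'⟩ := exists_actV_v hp'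
  have hi : i₁ n ≠ i₂ n := by simp [i₁, i₂]
  have k1 : actV (p * p') (v₁ n k) =
      (α' * α + γ' * β) • v₁ n k + (α' * γ + γ' * δ) • v₂ n k := by
    rw [actV_mul, LinearMap.comp_apply, h1', map_add, map_smul, map_smul, h1, h2]; module
  have k2 : actV (p * p') (v₂ n k) =
      (β' * α + δ' * β) • v₁ n k + (β' * γ + δ' * δ) • v₂ n k := by
    rw [actV_mul, LinearMap.comp_apply, h2', map_add, map_smul, map_smul, h1, h2]; module
  rw [h3, h3', detV₂_eq, k1, k2]
  simp [v₁, v₂, e, hi, hi.symm]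
  ring

/-- The identity `q q' η - η = (q η - η) + q (q' η - η)`, together with the multiplicativity of the
determinant on `V₂`. -/
theorem actM_actM [CharZero k] {p p' : G n k} (hp : p ∈ P n k) (hp' : p' ∈ P n k) (q q' : G n k)
    (w : Amb n k) : actM p q (actM p' q' w) = actM (p * p') (q * q') w := by
  have h : ExteriorAlgebra.map (TensorProduct.map (actV p) (actDual q)) (cocycle q') =
      detV₂ p • wedge₁₂ (TensorProduct.map (actDual q) (actDual q)
        (TensorProduct.map (actDual q') (actDual q') eta - eta)) :=
    map_wedge₁₂ hp q (comm_actDual_eta_sub q')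
  have hc : cocycle q + wedge₁₂ (TensorProduct.map (actDual q) (actDual q)
      (TensorProduct.map (actDual q') (actDual q') eta - eta)) = cocycle (q * q') := by
    have h2 : TensorProduct.map (actDual q) (actDual q) eta - eta +
        TensorProduct.map (actDual q) (actDual q)
          (TensorProduct.map (actDual q') (actDual q') eta - eta) =
        TensorProduct.map (actDual (q * q')) (actDual (q * q')) (eta (n := n) (k := k)) - eta := by
      rw [map_sub, actDual_mul, TensorProduct.map_comp, LinearMap.comp_apply]
      abel
    exact (map_add _ _ _).symm.trans (congrArg _ h2)
  rw [actM_eq_twist, actM_eq_twist, actM_eq_twist, twist_twist (commute_cocycle q)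
    (commute_cocycle q') (commute_wedge₁₂ _) h, hc, detV₂_mul hp hp', ← TensorProduct.map_comp,
    actV_mul, actDual_mul]

end Cocycle

end TateModel

end

/-! ### Stability under `P × P`, and regularity of families of operators -/

noncomputable section

namespace TateModel

open SpGrTate

section Stability

variable {n : ℕ} {k : Type*} [Field k]

theorem map_wedgeBoxes (f : V n k →ₗ[k] V n k)
    (g : Module.Dual k (V n k) →ₗ[k] Module.Dual k (V n k)) {a b : ℕ}
    (x : PiTensorProduct k fun _ : Box a b => V n k)
    (y : PiTensorProduct k fun _ : Box a b => Module.Dual k (V n k)) :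
    ExteriorAlgebra.map (TensorProduct.map f g) (wedgeBoxes n k a b x y) =
      wedgeBoxes n k a b (PiTensorProduct.map (fun _ => f) x)
        (PiTensorProduct.map (fun _ => g) y) := by
  induction x using PiTensorProduct.induction_on with
  | smul_tprod r v =>
    induction y using PiTensorProduct.induction_on with
    | smul_tprod s w =>
      simp only [map_smul, LinearMap.smul_apply, PiTensorProduct.map_tprod, wedgeBoxes_tprod,
        ExteriorAlgebra.map_apply_ιMulti]
      rfl
    | add x y hx hy => simp only [map_add, hx, hy]
  | add x y hx hy => simp only [map_add, LinearMap.add_apply, hx, hy]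

theorem map_mem_schur {ι : Type} [Fintype ι] [DecidableEq ι] {E : Type*} [AddCommGroup E]
    [Module k E] (row col : ι → ℕ) {A : Submodule k E} {f : E →ₗ[k] E} (hf : ∀ v ∈ A, f v ∈ A)
    {x : PiTensorProduct k fun _ : ι => E} (hx : x ∈ schur row col A) :
    PiTensorProduct.map (fun _ => f) x ∈ schur row col A := by
  obtain ⟨y, hy, rfl⟩ := Submodule.mem_map.1 hx
  have h : LinearMap.range (PiTensorProduct.map fun _ : ι => A.subtype) ≤
      (LinearMap.range (PiTensorProduct.map fun _ : ι => A.subtype)).comap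
        (PiTensorProduct.map fun _ => f) :=
    range_map_induction fun v hv => by
      rw [Submodule.mem_comap, PiTensorProduct.map_tprod]
      exact tprod_mem_range_map fun i => hf _ (hv i)
  rw [youngSymmetrizer_eq, map_algRep, ← youngSymmetrizer_eq]
  exact Submodule.mem_map_of_mem (h hy)

variable [Fact (2 ≤ n)]

theorem map_mem_LamPart {p q : G n k} (hp : p ∈ P n k) (hq : q ∈ P n k) {a b : ℕ} {w : Lam n k}
    (hw : w ∈ LamPart n k a b) :
    ExteriorAlgebra.map (TensorProduct.map (actV p) (actDual q)) w ∈ LamPart n k a b := by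
  have : LamPart n k a b ≤ (LamPart n k a b).comap
      (ExteriorAlgebra.map (TensorProduct.map (actV p) (actDual q))).toLinearMap := by
    refine Submodule.map₂_le.2 fun x hx y hy => ?_
    rw [Submodule.mem_comap, AlgHom.toLinearMap_apply, map_wedgeBoxes]
    exact Submodule.apply_mem_map₂ _ (map_mem_schur _ _ (fun v hv => actV_mem hp hv) hx)
      (map_mem_schur _ _ (fun v hv => actDual_mem hq hv) hy)
  exact this hw

variable [CharZero k]

/-- The definition of `filQ` uses the basis of `V₂`, but its description as a sum of Schur functors
is functorial. -/
theorem map_mem_map_filQ {p q : G n k} (hp : p ∈ P n k) (hq : q ∈ P n k) {β d : ℕ} {w : Lam n k}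
    (hw : w ∈ (filQ k (V₂perp n k) β d).map (jmap n k).toLinearMap) :
    ExteriorAlgebra.map (TensorProduct.map (actV p) (actDual q)) w ∈
      (filQ k (V₂perp n k) β d).map (jmap n k).toLinearMap := by
  rw [← iSup_LamPart] at hw ⊢
  have : (⨆ b, ⨆ _ : β ≤ b ∧ 2 * b ≤ d, LamPart n k (d - b) b) ≤
      (⨆ b, ⨆ _ : β ≤ b ∧ 2 * b ≤ d, LamPart n k (d - b) b).comap
      (ExteriorAlgebra.map (TensorProduct.map (actV p) (actDual q))).toLinearMap := by
    refine iSup_le fun b => iSup_le fun h x hx => ?_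
    exact Submodule.mem_iSup_of_mem b (Submodule.mem_iSup_of_mem h (map_mem_LamPart hp hq hx))
  exact this hw

omit [Fact (2 ≤ n)] [CharZero k] in
theorem X_mul_mem_Fil {W : Type*} [AddCommGroup W] [Module k W] {e i : ℕ}
    {p : Polynomial (Lam2 k W)} (hp : p ∈ Fil k W e i) :
    Polynomial.X * p ∈ Fil k W (e + 1) (i + 2) := by
  rintro (_ | j)
  · rw [Polynomial.coeff_X_mul_zero]
    exact ⟨fun _ => zero_mem _, fun _ => rfl⟩
  · rw [Polynomial.coeff_X_mul]
    refine ⟨fun h => ?_, fun h => (hp j).2 (by omega)⟩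
    have := (hp j).1 (by omega)
    rwa [show e - j = e + 1 - (j + 1) by omega,
      show i - 2 * j = i + 2 - 2 * (j + 1) by omega] at this

omit [Fact (2 ≤ n)] [CharZero k] in
theorem Qspan_mul_mem_filQ {W : Type*} [AddCommGroup W] [Module k W] {β d : ℕ}
    {c x : Lam2 k W} (hc : c ∈ Qspan k W) (hx : x ∈ filQ k W β d) :
    c * x ∈ filQ k W (β + 1) (d + 2) := by
  have : Qspan k W ≤ (filQ k W (β + 1) (d + 2)).comap (LinearMap.mulRight k x) := by
    refine Submodule.span_le.2 ?_
    rintro _ ⟨⟨f, g⟩, rfl⟩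
    exact qv_mul_filQ f g hx
  exact this hc

omit [Fact (2 ≤ n)] [CharZero k] in
theorem C_mul_mem_Fil {W : Type*} [AddCommGroup W] [Module k W] {e i : ℕ} {c : Lam2 k W}
    (hc : c ∈ Qspan k W) {p : Polynomial (Lam2 k W)} (hp : p ∈ Fil k W e i) :
    Polynomial.C c * p ∈ Fil k W (e + 1) (i + 2) := by
  intro j
  rw [Polynomial.coeff_C_mul]
  rcases Nat.lt_or_ge i (2 * j) with h | h
  · rw [(hp j).2 h, mul_zero]
    exact ⟨fun _ => zero_mem _, fun _ => rfl⟩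
  · refine ⟨fun _ => ?_, fun h' => by omega⟩
    have := Qspan_mul_mem_filQ hc ((hp j).1 h)
    rw [show i - 2 * j + 2 = i + 2 - 2 * j by omega] at this
    exact filQ_anti (by omega) this

theorem pow_mul_mem_map_Fil {q : G n k} (hq : q ∈ P n k) (δ : k) (j : ℕ) {e i : ℕ} {w : Amb n k}
    (hw : w ∈ (Fil k (V₂perp n k) e i).map (jpol n k)) :
    (δ • (Polynomial.X + Polynomial.C (cocycle q))) ^ j * w ∈
      (Fil k (V₂perp n k) (e + j) (i + 2 * j)).map (jpol n k) := by
  obtain ⟨p, hp, rfl⟩ := Submodule.mem_map.1 hw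
  obtain ⟨c, hc, hc'⟩ := Submodule.mem_map.1 (cocycle_mem hq)
  rw [← hc']
  clear hw
  induction j with
  | zero => rw [pow_zero, one_mul]; exact Submodule.mem_map_of_mem hp
  | succ j ih =>
    obtain ⟨p', hp', h⟩ := Submodule.mem_map.1 ih
    rw [pow_succ', mul_assoc, ← h, smul_mul_assoc, add_mul]
    refine Submodule.smul_mem _ _ ?_
    have h1 : Polynomial.X * jpol n k p' + Polynomial.C ((jmap n k).toLinearMap c) * jpol n k p' =
        jpol n k (Polynomial.X * p' + Polynomial.C c * p') := by
      simp only [jpol_apply, Polynomial.map_add, Polynomial.map_mul, Polynomial.map_X,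
        Polynomial.map_C]
      rfl
    rw [h1]
    exact Submodule.mem_map_of_mem (add_mem (X_mul_mem_Fil hp') (C_mul_mem_Fil hc hp'))

/-- `T` goes to a multiple of `T + c` with `c` in `Q`, and multiplication by either term raises the
filtration step by one and the degree by two. -/
theorem actM_mem_map_Fil {p q : G n k} (hp : p ∈ P n k) (hq : q ∈ P n k) {e i : ℕ} {w : Amb n k}
    (hw : w ∈ (Fil k (V₂perp n k) e i).map (jpol n k)) :
    actM p q w ∈ (Fil k (V₂perp n k) e i).map (jpol n k) := by
  have : (Fil k (V₂perp n k) e i).map (jpol n k) ≤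
      ((Fil k (V₂perp n k) e i).map (jpol n k)).comap (actM p q) := by
    conv_lhs => rw [map_Fil]
    refine iSup_le fun j => iSup_le fun hj => ?_
    rintro _ ⟨w, hw, rfl⟩
    have h1 := map_mem_map_filQ hp hq hw
    obtain ⟨v, hv, hv'⟩ := Submodule.mem_map.1 h1
    rw [Submodule.mem_comap, actM_eq_twist]
    have h2 : twist (TensorProduct.map (actV p) (actDual q)) (detV₂ p) (cocycle q) (mulT n k j w) =
        (detV₂ p • (Polynomial.X + Polynomial.C (cocycle q))) ^ j *
          jpol n k (Polynomial.C v) := by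
      refine (twist_monomial _ _ _ j w).trans ?_
      have hcomm : Commute (Polynomial.C (ExteriorAlgebra.map
          (TensorProduct.map (actV p) (actDual q)) w))
          (detV₂ p • (Polynomial.X + Polynomial.C (cocycle q))) := by
        refine Commute.smul_right (Commute.add_right (Polynomial.commute_X _).symm ?_) _
        rw [commute_iff_eq, ← map_mul, ← map_mul, (commute_cocycle q _).eq]
      rw [(hcomm.pow_right j).eq, ← hv', jpol_apply, Polynomial.map_C]
      rfl
    rw [h2]
    have h3 : Polynomial.C v ∈ Fil k (V₂perp n k) (e - j) (i - 2 * j) := by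
      rw [← Polynomial.monomial_zero_left]
      exact monomial_mem_Fil (Nat.zero_le _) hv
    have h4 := pow_mul_mem_map_Fil hq (detV₂ p) j (Submodule.mem_map_of_mem (f := jpol n k) h3)
    rw [show i - 2 * j + 2 * j = i by omega] at h4
    exact Submodule.map_mono (Fil_anti (by omega)) h4
  exact this hw

theorem actM_mem_B {p q : G n k} (hp : p ∈ P n k) (hq : q ∈ P n k) {i : ℕ} {w : Amb n k}
    (hw : w ∈ B n k i) : actM p q w ∈ B n k i := by
  rw [B_eq] at hw ⊢
  exact actM_mem_map_Fil hp hq hw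

end Stability

section Families

variable {n : ℕ} {k : Type*} [Field k] {Y : Type*} {𝒪 : Subalgebra k (Y → k)}

theorem entry_mem {a b : Type*} [Fintype a] [Fintype b] {F : Y → Matrix a b k}
    (hF : F ∈ Vals 𝒪 (Matrix a b k)) (i : a) (j : b) : (fun y => F y i j) ∈ 𝒪 :=
  dual_mem_of_mem_Vals (Matrix.entryLinearMap k k i j) hF

theorem matrix_mem_Vals {a b : Type*} [Fintype a] [Fintype b] [DecidableEq a] [DecidableEq b]
    {F : Y → Matrix a b k} (hF : ∀ i j, (fun y => F y i j) ∈ 𝒪) : F ∈ Vals 𝒪 (Matrix a b k) :=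
  mem_Vals_of_basis (Matrix.stdBasis k a b) fun ij => by
    have : ∀ A : Matrix a b k, (Matrix.stdBasis k a b).repr A ij = A ij.1 ij.2 := fun A => by
      conv_lhs => rw [Matrix.matrix_eq_sum_single A]
      simp only [map_sum, Finsupp.coe_finsetSum, Finset.sum_apply]
      rw [Finset.sum_eq_single ij.1, Finset.sum_eq_single ij.2]
      · have := (Matrix.stdBasis k a b).repr_self ij
        rw [← mul_one (A ij.1 ij.2), ← smul_eq_mul, ← Matrix.smul_single, map_smul,
          ← Matrix.stdBasis_eq_single, this]
        simp
      · intro j _ hj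
        rw [← mul_one (A ij.1 j), ← smul_eq_mul, ← Matrix.smul_single, map_smul,
          ← Matrix.stdBasis_eq_single, Module.Basis.repr_self]
        simp [Prod.ext_iff, hj]
      · simp
      · intro i _ hi
        refine Finset.sum_eq_zero fun j _ => ?_
        rw [← mul_one (A i j), ← smul_eq_mul, ← Matrix.smul_single, map_smul,
          ← Matrix.stdBasis_eq_single, Module.Basis.repr_self]
        simp [Prod.ext_iff, hi]
      · simp
    simpa only [this] using hF ij.1 ij.2

theorem matrix_mul_mem_Vals {a b c : Type*} [Fintype a] [Fintype b] [Fintype c] [DecidableEq a]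
    [DecidableEq c] {F : Y → Matrix a b k} {F' : Y → Matrix b c k}
    (hF : F ∈ Vals 𝒪 (Matrix a b k)) (hF' : F' ∈ Vals 𝒪 (Matrix b c k)) :
    (fun y => F y * F' y) ∈ Vals 𝒪 (Matrix a c k) := by
  refine matrix_mem_Vals fun i j => ?_
  have : (fun y => (F y * F' y) i j) = ∑ l, (fun y => F y i l) * (fun y => F' y l j) := by
    ext y; simp [Matrix.mul_apply]
  rw [this]
  exact sum_mem fun l _ => mul_mem (entry_mem hF i l) (entry_mem hF' l j)

theorem transpose_mem_Vals {a b : Type*} [Fintype a] [Fintype b] [DecidableEq a] [DecidableEq b]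
    {F : Y → Matrix a b k} (hF : F ∈ Vals 𝒪 (Matrix a b k)) :
    (fun y => (F y).transpose) ∈ Vals 𝒪 (Matrix b a k) :=
  matrix_mem_Vals fun i j => entry_mem hF j i

theorem det_mem {a : Type*} [Fintype a] [DecidableEq a] {F : Y → Matrix a a k}
    (hF : F ∈ Vals 𝒪 (Matrix a a k)) : (fun y => (F y).det) ∈ 𝒪 := by
  have : (fun y => (F y).det) =
      ∑ σ : Equiv.Perm a, (Equiv.Perm.sign σ : ℤ) • ∏ i, (fun y => F y (σ i) i) := by
    ext y; simp [Matrix.det_apply, Units.smul_def]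
  rw [this]
  exact sum_mem fun σ _ => zsmul_mem (prod_mem fun i _ => entry_mem hF _ _) _

theorem adjugate_mem_Vals {a : Type*} [Fintype a] [DecidableEq a] {F : Y → Matrix a a k}
    (hF : F ∈ Vals 𝒪 (Matrix a a k)) : (fun y => (F y).adjugate) ∈ Vals 𝒪 (Matrix a a k) := by
  refine matrix_mem_Vals fun i j => ?_
  simp only [Matrix.adjugate_apply]
  refine det_mem (matrix_mem_Vals fun i' j' => ?_)
  simp only [Matrix.updateRow_apply]
  split_ifs
  · exact mem_Vals_self.1 (const_mem_Vals _)
  · exact entry_mem hF i' j'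

theorem symplectic_inv_mem_Vals {p : Y → G n k}
    (hp : (fun y => (p y).1) ∈ Vals 𝒪 (Matrix (Idx n) (Idx n) k)) :
    (fun y => ((p y)⁻¹).1) ∈ Vals 𝒪 (Matrix (Idx n) (Idx n) k) := by
  simp only [SymplecticGroup.coe_inv]
  exact matrix_mul_mem_Vals (matrix_mul_mem_Vals (const_mem_Vals _) (transpose_mem_Vals hp))
    (const_mem_Vals _)

theorem symplectic_mul_mem_Vals {p q : Y → G n k}
    (hp : (fun y => (p y).1) ∈ Vals 𝒪 (Matrix (Idx n) (Idx n) k))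
    (hq : (fun y => (q y).1) ∈ Vals 𝒪 (Matrix (Idx n) (Idx n) k)) :
    (fun y => (p y * q y).1) ∈ Vals 𝒪 (Matrix (Idx n) (Idx n) k) :=
  matrix_mul_mem_Vals hp hq

theorem actV_mem_Vals {p : Y → G n k}
    (hp : (fun y => (p y).1) ∈ Vals 𝒪 (Matrix (Idx n) (Idx n) k)) :
    (fun y => actV (p y)) ∈ Vals 𝒪 (V n k →ₗ[k] V n k) :=
  linear_mem_Vals (Matrix.toLin' (R := k) (m := Idx n) (n := Idx n)).toLinearMap hp

theorem actDual_mem_Vals {p : Y → G n k}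
    (hp : (fun y => (p y).1) ∈ Vals 𝒪 (Matrix (Idx n) (Idx n) k)) :
    (fun y => actDual (p y)) ∈ Vals 𝒪 (Module.Dual k (V n k) →ₗ[k] Module.Dual k (V n k)) :=
  linear_mem_Vals (V := V n k →ₗ[k] V n k)
    (V' := Module.Dual k (V n k) →ₗ[k] Module.Dual k (V n k))
    (Module.Dual.transpose (R := k) (M := V n k) (M' := V n k))
    (f := fun y => actV (p y)⁻¹) (actV_mem_Vals (symplectic_inv_mem_Vals hp))

theorem tensorMap_mem_Vals {M M' : Type*} [AddCommGroup M] [Module k M] [AddCommGroup M']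
    [Module k M'] {f : Y → M →ₗ[k] M} {g : Y → M' →ₗ[k] M'} (hf : f ∈ Vals 𝒪 (M →ₗ[k] M))
    (hg : g ∈ Vals 𝒪 (M' →ₗ[k] M')) :
    (fun y => TensorProduct.map (f y) (g y)) ∈ Vals 𝒪 (M ⊗[k] M' →ₗ[k] M ⊗[k] M') :=
  bilinear_mem_Vals (TensorProduct.mapBilinear (RingHom.id k) M M' M M') hf hg

theorem tensorMap_sub_mem_Vals {M : Type*} [AddCommGroup M] [Module k M] {f : Y → M →ₗ[k] M}
    (hf : f ∈ Vals 𝒪 (M →ₗ[k] M)) (z : M ⊗[k] M) :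
    (fun y => TensorProduct.map (f y) (f y) z - z) ∈ Vals 𝒪 (M ⊗[k] M) :=
  sub_mem (apply_mem_Vals (tensorMap_mem_Vals hf hf) (const_mem_Vals z)) (const_mem_Vals z)

variable [Fact (2 ≤ n)]

theorem cocycle_mem_Vals {q : Y → G n k}
    (hq : (fun y => (q y).1) ∈ Vals 𝒪 (Matrix (Idx n) (Idx n) k)) :
    (fun y => cocycle (q y)) ∈ Vals 𝒪 (Lam n k) := by
  have h := tensorMap_sub_mem_Vals (actDual_mem_Vals hq) (eta (n := n) (k := k))
  exact linear_mem_Vals (V' := Lam n k) wedge₁₂ h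

theorem actM_mem_Vals {p q : Y → G n k}
    (hp : (fun y => (p y).1) ∈ Vals 𝒪 (Matrix (Idx n) (Idx n) k))
    (hq : (fun y => (q y).1) ∈ Vals 𝒪 (Matrix (Idx n) (Idx n) k))
    {s : Y → Amb n k} (hs : s ∈ Vals 𝒪 (Amb n k)) :
    (fun y => actM (p y) (q y) (s y)) ∈ Vals 𝒪 (Amb n k) := by
  have hδ : (fun y => detV₂ (p y)) ∈ 𝒪 := by
    refine det_mem (matrix_mem_Vals fun i j => ?_)
    exact entry_mem hp _ _
  exact twist_mem_Vals (tensorMap_mem_Vals (actV_mem_Vals hp) (actDual_mem_Vals hq)) hδ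
    (cocycle_mem_Vals hq) (fun y w => commute_cocycle (q y) w) hs

theorem colForm_mem_Vals {u : Y → Matrix (Idx n) (Idx n) k}
    (hu : u ∈ Vals 𝒪 (Matrix (Idx n) (Idx n) k)) :
    (fun y => colForm n k (u y)) ∈ Vals 𝒪 (Module.Dual k (↥(V₂perp n k) × ↥(V₂perp n k))) := by
  let L : Matrix (Idx n) (Idx n) k →ₗ[k] Module.Dual k (↥(V₂perp n k) × ↥(V₂perp n k)) :=
    { toFun := colForm n k
      map_add' := fun A A' => by
        refine LinearMap.ext fun m => ?_
        simp only [colForm_apply, Matrix.add_mulVec, map_add, LinearMap.add_apply]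
        abel
      map_smul' := fun c A => by
        refine LinearMap.ext fun m => ?_
        simp only [colForm_apply, Matrix.smul_mulVec, map_smul, LinearMap.smul_apply,
          RingHom.id_apply, smul_add] }
  exact linear_mem_Vals L hu

theorem topForm_mem_Vals {u : Y → Matrix (Idx n) (Idx n) k}
    (hu : u ∈ Vals 𝒪 (Matrix (Idx n) (Idx n) k)) (v : V n k) :
    (fun y => topForm ((u y).mulVec v)) ∈ Vals 𝒪 (V₂perp n k) := by
  let L : Matrix (Idx n) (Idx n) k →ₗ[k] V₂perp n k :=
    { toFun := fun A => topForm (A.mulVec v)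
      map_add' := fun A A' => by
        simp only [topForm, Matrix.add_mulVec, Pi.add_apply, add_smul, Finset.sum_add_distrib]
      map_smul' := fun c A => by
        simp only [topForm, Matrix.smul_mulVec, Pi.smul_apply, smul_eq_mul, mul_smul,
          Finset.smul_sum, RingHom.id_apply] }
  exact linear_mem_Vals (V' := ↥(V₂perp n k)) L hu

end Families

end TateModel

end

/-! ### Local sections of `G → X` and normalized columns -/

noncomputable section

namespace TateModel

open SpGrTate

section Slice

variable {n : ℕ} {k : Type*} [Field k]

/-- Since `M² = 0`, `1 - M` is the inverse of `1 + M`. The matrix is the product of the symplectic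
matrices of the shear by the symmetric `S` and of `1 + M` acting on the two Lagrangian halves. -/
theorem fromBlocks_mem_symplecticGroup {M S : Matrix (Fin n) (Fin n) k} (hM : M * M = 0)
    (hS : S.transpose = S) :
    Matrix.fromBlocks (1 + M) 0 (S * (1 + M)) (1 - M).transpose ∈
      Matrix.symplecticGroup (Fin n) k := by
  have h1 : (1 + M) * (1 - M) = 1 := by rw [add_mul, mul_sub, mul_sub, hM]; simp
  have h2 : (1 - M).transpose * (1 + M).transpose = 1 := by
    rw [← Matrix.transpose_mul, h1, Matrix.transpose_one]
  rw [SymplecticGroup.mem_iff, Matrix.J, Matrix.fromBlocks_transpose, Matrix.fromBlocks_multiply,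
    Matrix.fromBlocks_multiply]
  simp only [Matrix.mul_zero, Matrix.zero_mul, Matrix.mul_neg, Matrix.mul_one, zero_add, add_zero,
    Matrix.transpose_zero, Matrix.transpose_mul, Matrix.transpose_transpose, hS,
    Matrix.neg_mul, h1, h2, ← mul_assoc]
  rw [mul_assoc S, h1]
  simp

variable (n k) in
/-- The projection of the span of `v₁, …, v_n` onto `V₂`. -/
def projTop : Matrix (Fin n) (Fin n) k := Matrix.diagonal fun i => if (i : ℕ) < 2 then 1 else 0

theorem projTop_mul_self : projTop n k * projTop n k = projTop n k := by
  rw [projTop, Matrix.diagonal_mul_diagonal]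
  congr 1
  ext i
  split_ifs <;> simp

theorem projTop_transpose : (projTop n k).transpose = projTop n k := Matrix.diagonal_transpose _

theorem one_sub_projTop_mul : (1 - projTop n k) * projTop n k = 0 := by
  rw [sub_mul, one_mul, projTop_mul_self, sub_self]

theorem projTop_mul_one_sub : projTop n k * (1 - projTop n k) = 0 := by
  rw [mul_sub, mul_one, projTop_mul_self, sub_self]

variable (n k) in
/-- The projection of `V` onto `V₂`. -/
def projV₂ : Matrix (Idx n) (Idx n) k := Matrix.fromBlocks (projTop n k) 0 0 0

theorem projV₂_mul_self : projV₂ n k * projV₂ n k = projV₂ n k := by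
  simp [projV₂, Matrix.fromBlocks_multiply, projTop_mul_self]

theorem projV₂_transpose : (projV₂ n k).transpose = projV₂ n k := by
  simp [projV₂, Matrix.fromBlocks_transpose, projTop_transpose]

/-- The middle entries in the first half of the rows. -/
def sliceM (c : Matrix (Idx n) (Idx n) k) : Matrix (Fin n) (Fin n) k :=
  (1 - projTop n k) * c.toBlocks₁₁ * projTop n k

/-- The middle entries in the second half of the rows. -/
def sliceK (c : Matrix (Idx n) (Idx n) k) : Matrix (Fin n) (Fin n) k :=
  (1 - projTop n k) * c.toBlocks₂₁ * projTop n k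

/-- The block that has to be symmetric. -/
def sliceR (c : Matrix (Idx n) (Idx n) k) : Matrix (Fin n) (Fin n) k :=
  projTop n k * c.toBlocks₂₁ * projTop n k - (sliceK c).transpose * sliceM c

/-- The symmetric matrix with the same lower triangle. -/
def symmLower (R : Matrix (Fin n) (Fin n) k) : Matrix (Fin n) (Fin n) k :=
  Matrix.of fun i j => R (max i j) (min i j)

omit [Field k] in
theorem symmLower_transpose (R : Matrix (Fin n) (Fin n) k) :
    (symmLower R).transpose = symmLower R := by
  ext i j
  simp [symmLower, max_comm, min_comm]

omit [Field k] in
theorem symmLower_of_symm {R : Matrix (Fin n) (Fin n) k} (h : R.transpose = R) :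
    symmLower R = R := by
  ext i j
  rcases le_total i j with hij | hij
  · simp only [symmLower, Matrix.of_apply, max_eq_right hij, min_eq_left hij]
    exact congrFun (congrFun h i) j
  · simp only [symmLower, Matrix.of_apply, max_eq_left hij, min_eq_right hij]

/-- The symmetric lower left block. -/
def sliceS (c : Matrix (Idx n) (Idx n) k) : Matrix (Fin n) (Fin n) k :=
  sliceK c + (sliceK c).transpose + symmLower (sliceR c)

theorem sliceM_mul_self (c : Matrix (Idx n) (Idx n) k) : sliceM c * sliceM c = 0 := by
  have : sliceM c * sliceM c = (1 - projTop n k) * c.toBlocks₁₁ *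
      (projTop n k * (1 - projTop n k)) * c.toBlocks₁₁ * projTop n k := by
    simp only [sliceM, mul_assoc]
  rw [this, projTop_mul_one_sub]
  simp

theorem sliceS_transpose (c : Matrix (Idx n) (Idx n) k) :
    (sliceS c).transpose = sliceS c := by
  rw [sliceS, Matrix.transpose_add, Matrix.transpose_add, Matrix.transpose_transpose,
    symmLower_transpose, add_comm (sliceK c).transpose]

/-- A slice of `G → X`: the symplectic matrices whose first two columns are those of `c`, as far as
these satisfy the isotropy condition. -/
def slice (c : Matrix (Idx n) (Idx n) k) : G n k :=
  ⟨_, fromBlocks_mem_symplecticGroup (sliceM_mul_self c) (sliceS_transpose c)⟩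

theorem coe_slice (c : Matrix (Idx n) (Idx n) k) : (slice c).1 = Matrix.fromBlocks
    (1 + sliceM c) 0 (sliceS c * (1 + sliceM c)) (1 - sliceM c).transpose := rfl

theorem slice_projV₂ : slice (projV₂ n k) = 1 := by
  have hM : sliceM (projV₂ n k) = 0 := by
    rw [sliceM, projV₂, Matrix.toBlocks_fromBlocks₁₁, one_sub_projTop_mul, zero_mul]
  have hK : sliceK (projV₂ n k) = 0 := by
    rw [sliceK, projV₂, Matrix.toBlocks_fromBlocks₂₁, mul_zero, zero_mul]
  have hR : sliceR (projV₂ n k) = 0 := by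
    rw [sliceR, hK, hM, projV₂, Matrix.toBlocks_fromBlocks₂₁]; simp
  have hS : sliceS (projV₂ n k) = 0 := by
    rw [sliceS, hK, hR]; ext i j; simp [symmLower]
  apply Subtype.ext
  rw [coe_slice, hM, hS]
  simp

theorem projTop_mul_sliceR (c : Matrix (Idx n) (Idx n) k) :
    projTop n k * sliceR c * projTop n k = sliceR c := by
  have hM : sliceM c * projTop n k = sliceM c := by rw [sliceM, mul_assoc, projTop_mul_self]
  have hK : projTop n k * (sliceK c).transpose = (sliceK c).transpose := by
    rw [sliceK, Matrix.transpose_mul, projTop_transpose, ← mul_assoc, projTop_mul_self]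
  rw [sliceR, mul_sub, sub_mul, ← mul_assoc _ (sliceK c).transpose, hK, mul_assoc _ (sliceM c), hM,
    ← mul_assoc, ← mul_assoc, projTop_mul_self, mul_assoc _ (projTop n k) (projTop n k),
    projTop_mul_self]

theorem sliceR_apply_eq_zero (c : Matrix (Idx n) (Idx n) k) {i j : Fin n}
    (h : ¬((i : ℕ) < 2 ∧ (j : ℕ) < 2)) : sliceR c i j = 0 := by
  rw [← projTop_mul_sliceR, projTop, Matrix.mul_diagonal, Matrix.diagonal_mul]
  by_cases hi : (i : ℕ) < 2 <;> by_cases hj : (j : ℕ) < 2 <;> simp_all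

theorem symmLower_sliceR_mul (c : Matrix (Idx n) (Idx n) k) :
    symmLower (sliceR c) * projTop n k = symmLower (sliceR c) := by
  ext i j
  rw [projTop, Matrix.mul_diagonal]
  by_cases hj : (j : ℕ) < 2
  · rw [if_pos hj, mul_one]
  · rw [if_neg hj, mul_zero, symmLower, Matrix.of_apply, sliceR_apply_eq_zero]
    rintro ⟨h1, h2⟩
    rcases le_total i j with hij | hij
    · rw [max_eq_right hij] at h1; exact hj h1
    · rw [min_eq_right hij] at h2; exact hj h2

theorem slice_mul_projV₂ (c : Matrix (Idx n) (Idx n) k) : (slice c).1 * projV₂ n k =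
    Matrix.fromBlocks (projTop n k + sliceM c) 0
      (sliceK c + ((sliceK c).transpose * sliceM c + symmLower (sliceR c))) 0 := by
  have hM : sliceM c * projTop n k = sliceM c := by rw [sliceM, mul_assoc, projTop_mul_self]
  have hK : sliceK c * projTop n k = sliceK c := by rw [sliceK, mul_assoc, projTop_mul_self]
  have hM' : projTop n k * sliceM c = 0 := by
    rw [sliceM, ← mul_assoc, ← mul_assoc, projTop_mul_one_sub, zero_mul, zero_mul]
  have hK' : (sliceK c).transpose * projTop n k = 0 := by
    rw [sliceK, Matrix.transpose_mul, Matrix.transpose_mul, Matrix.transpose_sub,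
      Matrix.transpose_one, projTop_transpose, mul_assoc, mul_assoc, one_sub_projTop_mul, mul_zero,
      mul_zero]
  have hKM : sliceK c * sliceM c = 0 := by rw [← hK, mul_assoc, hM', mul_zero]
  have hRM : symmLower (sliceR c) * sliceM c = 0 := by
    rw [← symmLower_sliceR_mul, mul_assoc, hM', mul_zero]
  rw [coe_slice, projV₂, Matrix.fromBlocks_multiply]
  congr 1
  · rw [mul_zero, add_zero, add_mul, one_mul, hM]
  · simp
  · rw [mul_zero, add_zero, mul_assoc, add_mul, one_mul, hM, sliceS, mul_add, add_mul, add_mul,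
      add_mul, add_mul, hK, hK', symmLower_sliceR_mul, hKM, hRM]
    abel
  · simp

/-- Isotropy of the two columns is equivalent to the symmetry of `sliceR`, and then `symmLower`
changes nothing. Using `symmLower` makes `slice` defined on the whole matrix space. -/
theorem slice_mul_projV₂_of_isotropic {ν : Matrix (Idx n) (Idx n) k}
    (h1 : projV₂ n k * ν = projV₂ n k) (h2 : ν * projV₂ n k = ν)
    (h3 : ν.transpose * Matrix.J (Fin n) k * ν = 0) : (slice ν).1 * projV₂ n k = ν := by
  obtain ⟨C, B, N, D, rfl⟩ : ∃ C B N D, ν = Matrix.fromBlocks C B N D :=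
    ⟨_, _, _, _, (Matrix.fromBlocks_toBlocks ν).symm⟩
  rw [projV₂, Matrix.fromBlocks_multiply, Matrix.fromBlocks_inj] at h1 h2
  simp only [zero_mul, mul_zero, add_zero] at h1 h2
  obtain ⟨hC, hB, -, -⟩ := h1
  obtain ⟨hC', rfl, hN, rfl⟩ := h2
  have hM : sliceM (Matrix.fromBlocks C 0 N 0) = C - projTop n k := by
    rw [sliceM, Matrix.toBlocks_fromBlocks₁₁, sub_mul, one_mul, hC, sub_mul, hC', projTop_mul_self]
  have hK : sliceK (Matrix.fromBlocks C 0 N 0) = N - projTop n k * N := by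
    rw [sliceK, Matrix.toBlocks_fromBlocks₂₁, mul_assoc, hN, sub_mul, one_mul]
  have hs : N.transpose * C = C.transpose * N := by
    rw [Matrix.J, Matrix.fromBlocks_transpose, Matrix.fromBlocks_multiply,
      Matrix.fromBlocks_multiply, ← Matrix.fromBlocks_zero, Matrix.fromBlocks_inj] at h3
    have := h3.1
    simp only [mul_zero, zero_add, add_zero, mul_one, mul_neg,
      neg_mul] at this
    rw [← sub_eq_zero, sub_eq_add_neg]
    exact this
  have hR : sliceR (Matrix.fromBlocks C 0 N 0) =
      projTop n k * N + N.transpose * projTop n k - N.transpose * C := by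
    have e1 : (projTop n k - 1) * (C - projTop n k) = projTop n k - C := by
      rw [sub_mul, mul_sub, hC, projTop_mul_self, sub_self, one_mul, zero_sub, neg_sub]
    rw [sliceR, hK, hM, Matrix.toBlocks_fromBlocks₂₁, mul_assoc, hN, Matrix.transpose_sub,
      Matrix.transpose_mul, projTop_transpose]
    have e2 : (N.transpose - N.transpose * projTop n k) * (C - projTop n k) =
        -(N.transpose * ((projTop n k - 1) * (C - projTop n k))) := by noncomm_ring
    rw [e2, e1]
    noncomm_ring
  have hRt : (sliceR (Matrix.fromBlocks C 0 N 0)).transpose =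
      sliceR (Matrix.fromBlocks C 0 N 0) := by
    rw [hR]
    simp only [Matrix.transpose_sub, Matrix.transpose_add, Matrix.transpose_mul, projTop_transpose,
      Matrix.transpose_transpose]
    rw [hs, add_comm]
  rw [slice_mul_projV₂, symmLower_of_symm hRt, sliceR, add_sub_cancel, Matrix.toBlocks_fromBlocks₂₁,
    hM, hK, mul_assoc, hN]
  congr 1 <;> abel

variable {Y : Type*} {𝒪 : Subalgebra k (Y → k)}

theorem slice_mem_Vals {c : Y → Matrix (Idx n) (Idx n) k}
    (hc : c ∈ Vals 𝒪 (Matrix (Idx n) (Idx n) k)) :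
    (fun y => (slice (c y)).1) ∈ Vals 𝒪 (Matrix (Idx n) (Idx n) k) := by
  have hM : (fun y => sliceM (c y)) ∈ Vals 𝒪 (Matrix (Fin n) (Fin n) k) :=
    matrix_mul_mem_Vals (matrix_mul_mem_Vals (const_mem_Vals _)
      (matrix_mem_Vals fun i j => entry_mem hc (Sum.inl i) (Sum.inl j))) (const_mem_Vals _)
  have hK : (fun y => sliceK (c y)) ∈ Vals 𝒪 (Matrix (Fin n) (Fin n) k) :=
    matrix_mul_mem_Vals (matrix_mul_mem_Vals (const_mem_Vals _)
      (matrix_mem_Vals fun i j => entry_mem hc (Sum.inr i) (Sum.inl j))) (const_mem_Vals _)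
  have hR : (fun y => sliceR (c y)) ∈ Vals 𝒪 (Matrix (Fin n) (Fin n) k) :=
    sub_mem (matrix_mul_mem_Vals (matrix_mul_mem_Vals (const_mem_Vals _)
      (matrix_mem_Vals fun i j => entry_mem hc (Sum.inr i) (Sum.inl j))) (const_mem_Vals _))
      (matrix_mul_mem_Vals (transpose_mem_Vals hK) hM)
  have hS : (fun y => sliceS (c y)) ∈ Vals 𝒪 (Matrix (Fin n) (Fin n) k) :=
    add_mem (add_mem hK (transpose_mem_Vals hK)) (matrix_mem_Vals fun i j => entry_mem hR _ _)
  have h1 : (fun y => 1 + sliceM (c y)) ∈ Vals 𝒪 (Matrix (Fin n) (Fin n) k) :=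
    add_mem (const_mem_Vals 1) hM
  have h2 := matrix_mul_mem_Vals hS h1
  have h3 := transpose_mem_Vals (sub_mem (const_mem_Vals (𝒪 := 𝒪) (1 : Matrix (Fin n) (Fin n) k)) hM)
  refine matrix_mem_Vals fun i j => ?_
  rcases i with i | i <;> rcases j with j | j
  · exact entry_mem h1 i j
  · exact zero_mem 𝒪
  · exact entry_mem h2 i j
  · exact entry_mem h3 i j

end Slice

section Parabolic

variable {n : ℕ} {k : Type*} [Field k]

/-- The block matrix of a matrix in the first two rows and columns. -/
def topBlock (g : Matrix (Idx n) (Idx n) k) : Matrix (Idx n) (Idx n) k :=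
  projV₂ n k * g * projV₂ n k + (1 - projV₂ n k)

theorem topBlock_one : topBlock (1 : Matrix (Idx n) (Idx n) k) = 1 := by
  rw [topBlock, mul_one, projV₂_mul_self, add_sub_cancel]

theorem projV₂_mul_topBlock (g : Matrix (Idx n) (Idx n) k) :
    projV₂ n k * topBlock g = projV₂ n k * g * projV₂ n k := by
  rw [topBlock, mul_add, mul_sub, mul_one, projV₂_mul_self, sub_self, add_zero, ← mul_assoc,
    ← mul_assoc, projV₂_mul_self]

theorem topBlock_mul_projV₂ (g : Matrix (Idx n) (Idx n) k) :
    topBlock g * projV₂ n k = projV₂ n k * g * projV₂ n k := by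
  rw [topBlock, add_mul, sub_mul, one_mul, projV₂_mul_self, sub_self, add_zero, mul_assoc,
    projV₂_mul_self]

theorem topBlock_mul {g p : Matrix (Idx n) (Idx n) k}
    (hp : p * projV₂ n k = projV₂ n k * p * projV₂ n k) :
    topBlock (g * p) = topBlock g * topBlock p := by
  have h : topBlock g * topBlock p = topBlock g * projV₂ n k * p * projV₂ n k +
      (topBlock g - topBlock g * projV₂ n k) := by
    conv_lhs => rw [topBlock.eq_def p]
    noncomm_ring
  rw [h, topBlock_mul_projV₂, mul_assoc _ p, mul_assoc _ (projV₂ n k) (p * _), ← mul_assoc _ p,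
    ← hp, topBlock, topBlock]
  noncomm_ring

/-- The first two columns of a matrix, normalized to have the identity in the first two rows. -/
def normCols (g : Matrix (Idx n) (Idx n) k) : Matrix (Idx n) (Idx n) k :=
  g * projV₂ n k * (topBlock g)⁻¹

theorem normCols_one : normCols (1 : Matrix (Idx n) (Idx n) k) = projV₂ n k := by
  rw [normCols, topBlock_one, inv_one, one_mul, mul_one]

/-- Right multiplication by `P` changes the first two columns by an invertible matrix, which the
normalization divides out; so `normCols` descends to `X`. -/
theorem normCols_mul {g p : Matrix (Idx n) (Idx n) k}
    (hp : p * projV₂ n k = projV₂ n k * p * projV₂ n k) (hdet : IsUnit (topBlock p).det) :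
    normCols (g * p) = normCols g := by
  rw [normCols, topBlock_mul hp, Matrix.mul_inv_rev, mul_assoc g, hp, ← projV₂_mul_topBlock,
    normCols, mul_assoc, mul_assoc, mul_assoc, Matrix.mul_nonsing_inv_cancel_left _ _ hdet,
    ← mul_assoc]

variable {g : Matrix (Idx n) (Idx n) k}

theorem normCols_mul_topBlock (hg : IsUnit (topBlock g).det) :
    normCols g * topBlock g = g * projV₂ n k := by
  rw [normCols, Matrix.nonsing_inv_mul_cancel_right _ _ hg]

theorem projV₂_mul_normCols (hg : IsUnit (topBlock g).det) :
    projV₂ n k * normCols g = projV₂ n k := by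
  rw [normCols, ← mul_assoc, ← mul_assoc, ← projV₂_mul_topBlock,
    Matrix.mul_nonsing_inv_cancel_right _ _ hg]

theorem normCols_mul_projV₂ (hg : IsUnit (topBlock g).det) :
    normCols g * projV₂ n k = normCols g := by
  have h : (topBlock g)⁻¹ * projV₂ n k = projV₂ n k * (topBlock g)⁻¹ := by
    have h1 : projV₂ n k * topBlock g = topBlock g * projV₂ n k := by
      rw [projV₂_mul_topBlock, topBlock_mul_projV₂]
    calc (topBlock g)⁻¹ * projV₂ n k
        = (topBlock g)⁻¹ * (projV₂ n k * topBlock g) * (topBlock g)⁻¹ := by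
          rw [← mul_assoc, Matrix.mul_nonsing_inv_cancel_right _ _ hg]
      _ = projV₂ n k * (topBlock g)⁻¹ := by
          rw [h1, Matrix.nonsing_inv_mul_cancel_left _ _ hg]
  rw [normCols, mul_assoc, h, ← mul_assoc, mul_assoc g, projV₂_mul_self]

theorem normCols_isotropic (g : G n k) :
    (normCols g.1).transpose * Matrix.J (Fin n) k * normCols g.1 = 0 := by
  have h1 : projV₂ n k * Matrix.J (Fin n) k * projV₂ n k = 0 := by
    simp [projV₂, Matrix.J, Matrix.fromBlocks_multiply]
  have h2 : (normCols g.1).transpose * Matrix.J (Fin n) k * normCols g.1 =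
      (topBlock g.1)⁻¹.transpose * (projV₂ n k * (g.1.transpose * Matrix.J (Fin n) k * g.1) *
        projV₂ n k) * (topBlock g.1)⁻¹ := by
    rw [normCols, Matrix.transpose_mul, Matrix.transpose_mul, projV₂_transpose]
    simp only [mul_assoc]
  rw [h2, SymplecticGroup.mem_iff'.1 g.2, h1, mul_zero, zero_mul]

variable {Y : Type*} {𝒪 : Subalgebra k (Y → k)}

theorem topBlock_mem_Vals {g : Y → Matrix (Idx n) (Idx n) k}
    (hg : g ∈ Vals 𝒪 (Matrix (Idx n) (Idx n) k)) :
    (fun y => topBlock (g y)) ∈ Vals 𝒪 (Matrix (Idx n) (Idx n) k) :=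
  add_mem (matrix_mul_mem_Vals (matrix_mul_mem_Vals (const_mem_Vals _) hg) (const_mem_Vals _))
    (const_mem_Vals (1 - projV₂ n k))

theorem normCols_mem_Vals {g : Y → Matrix (Idx n) (Idx n) k}
    (hg : g ∈ Vals 𝒪 (Matrix (Idx n) (Idx n) k))
    (hdet : (fun y => ((topBlock (g y)).det)⁻¹) ∈ 𝒪) :
    (fun y => normCols (g y)) ∈ Vals 𝒪 (Matrix (Idx n) (Idx n) k) := by
  refine matrix_mul_mem_Vals (matrix_mul_mem_Vals hg (const_mem_Vals _)) ?_
  simp only [Matrix.inv_def, Ring.inverse_eq_inv']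
  exact smul_mem_Vals hdet (adjugate_mem_Vals (topBlock_mem_Vals hg))

variable [Fact (2 ≤ n)]

theorem projV₂_mulVec_mem (v : V n k) : (projV₂ n k).mulVec v ∈ V₂ n k := by
  have h2 : 2 ≤ n := Fact.out
  have : (projV₂ n k).mulVec v = v (i₁ n) • v₁ n k + v (i₂ n) • v₂ n k := by
    rw [projV₂, Matrix.fromBlocks_mulVec]
    ext (i | i)
    · simp only [Matrix.zero_mulVec, add_zero, Sum.elim_inl, projTop, Matrix.mulVec_diagonal,
        Function.comp_apply, Pi.add_apply, Pi.smul_apply, v₁, v₂, e, smul_eq_mul, Pi.single_apply,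
        i₁, i₂, Sum.inl.injEq, Fin.ext_iff]
      rcases i with ⟨_ | _ | i, hi⟩ <;> simp
    · simp [v₁, v₂, e, i₁, i₂]
  rw [this]
  exact add_mem (Submodule.smul_mem _ _ v₁_mem) (Submodule.smul_mem _ _ v₂_mem)

theorem projV₂_mulVec_of_mem {v : V n k} (hv : v ∈ V₂ n k) : (projV₂ n k).mulVec v = v := by
  obtain ⟨α, β, rfl⟩ := exists_eq_of_mem_V₂ hv
  have h1 : (projV₂ n k).mulVec (v₁ n k) = v₁ n k := by
    ext (i | i) <;> simp [projV₂, v₁, e, projTop, i₁, Matrix.diagonal_apply, Pi.single_apply]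
    split_ifs with h <;> simp_all
  have h2 : (projV₂ n k).mulVec (v₂ n k) = v₂ n k := by
    ext (i | i) <;> simp [projV₂, v₂, e, projTop, i₂, Matrix.diagonal_apply, Pi.single_apply]
    split_ifs with h <;> simp_all
  rw [Matrix.mulVec_add, Matrix.mulVec_smul, Matrix.mulVec_smul, h1, h2]

theorem mul_projV₂_of_mem_P {p : G n k} (hp : p ∈ P n k) :
    p.1 * projV₂ n k = projV₂ n k * p.1 * projV₂ n k := by
  refine Matrix.toLin'.injective (LinearMap.ext fun v => ?_)
  simp only [Matrix.toLin'_apply, ← Matrix.mulVec_mulVec]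
  exact (projV₂_mulVec_of_mem (actV_mem hp (projV₂_mulVec_mem v))).symm

theorem mem_P_of_actV_mem {p : G n k} (h : ∀ v ∈ V₂ n k, actV p v ∈ V₂ n k) : p ∈ P n k := by
  refine Submodule.eq_of_le_of_finrank_eq (Submodule.map_le_iff_le_comap.2 h) ?_
  exact (Submodule.equivMapOfInjective _ (actV_injective p) (V₂ n k)).finrank_eq.symm

theorem mem_P_of_mul_projV₂ {p : G n k}
    (hp : p.1 * projV₂ n k = projV₂ n k * p.1 * projV₂ n k) : p ∈ P n k := by
  refine mem_P_of_actV_mem fun v hv => ?_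
  have : actV p v = (projV₂ n k).mulVec (p.1.mulVec v) := by
    conv_lhs => rw [← projV₂_mulVec_of_mem hv]
    conv_rhs => rw [← projV₂_mulVec_of_mem hv]
    simp only [actV, Matrix.mulVecLin_apply, Matrix.mulVec_mulVec, ← mul_assoc]
    rw [hp]
  rw [this]
  exact projV₂_mulVec_mem _

theorem isUnit_det_topBlock_of_mem_P {p : G n k} (hp : p ∈ P n k) :
    IsUnit (topBlock p.1).det := by
  have h := topBlock_mul (g := p⁻¹.1) (mul_projV₂_of_mem_P hp)
  have h3 : (p⁻¹).1 * p.1 = 1 := congrArg Subtype.val (inv_mul_cancel p)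
  rw [h3, topBlock_one] at h
  have h4 := congrArg Matrix.det h
  rw [Matrix.det_one, Matrix.det_mul] at h4
  exact IsUnit.of_mul_eq_one_right _ h4.symm

/-- The slice has the normalized columns of `g` as its first two columns, so both matrices send `V₂`
to the same plane. -/
theorem slice_normCols_inv_mul_mem_P {g : G n k} (hg : IsUnit (topBlock g.1).det) :
    (slice (normCols g.1))⁻¹ * g ∈ P n k := by
  set β := slice (normCols g.1)
  have h1 : β.1 * projV₂ n k = normCols g.1 := slice_mul_projV₂_of_isotropic
    (projV₂_mul_normCols hg) (normCols_mul_projV₂ hg) (normCols_isotropic g)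
  have h2 : (β⁻¹ * g).1 * projV₂ n k = projV₂ n k * topBlock g.1 := by
    have h3 : (β⁻¹).1 * β.1 = 1 := congrArg Subtype.val (inv_mul_cancel β)
    rw [Submonoid.coe_mul, mul_assoc, ← normCols_mul_topBlock hg, ← h1, mul_assoc β.1, ← mul_assoc,
      h3, one_mul]
  refine mem_P_of_mul_projV₂ ?_
  rw [mul_assoc, h2, ← mul_assoc, projV₂_mul_self]

theorem inv_mul_mem_P_of_toPoint_eq {g h : G n k} (H : toPoint g = toPoint h) :
    g⁻¹ * h ∈ P n k := by
  have h1 : (V₂ n k).map (actV g) = (V₂ n k).map (actV h) := congrArg Subtype.val H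
  refine mem_P_of_actV_mem fun v hv => ?_
  have h2 : actV h v ∈ (V₂ n k).map (actV g) := h1 ▸ Submodule.mem_map_of_mem hv
  obtain ⟨w, hw, h3⟩ := h2
  have h4 : actV (g⁻¹ * h) v = w := by
    rw [actV_mul, LinearMap.comp_apply, ← h3, ← LinearMap.comp_apply, ← actV_mul, inv_mul_cancel]
    simp [actV]
  rwa [h4]

theorem toPoint_mul {g p : G n k} (hp : p ∈ P n k) : toPoint (g * p) = toPoint g := by
  apply Subtype.ext
  change (V₂ n k).map (actV (g * p)) = (V₂ n k).map (actV g)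
  rw [actV_mul, Submodule.map_comp]
  congr 1

end Parabolic

end TateModel

end

/-! ### Representatives with independent upper halves -/

noncomputable section

namespace TateModel

open SpGrTate

section Transversality

variable {n : ℕ} {k : Type*} [Field k]

/-- The symplectic matrix that adds a symmetric transformation of the second half of the
coordinates to the first half. -/
theorem upper_mem_symplecticGroup {s : Matrix (Fin n) (Fin n) k} (hs : s.transpose = s) :
    Matrix.fromBlocks 1 s 0 1 ∈ Matrix.symplecticGroup (Fin n) k := by
  rw [SymplecticGroup.mem_iff, Matrix.J, Matrix.fromBlocks_transpose, Matrix.fromBlocks_multiply,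
    Matrix.fromBlocks_multiply]
  simp [hs]

/-- Two pairs of vectors whose translates by symmetric matrices are all dependent are
proportional. -/
theorem minors_eq_zero [CharZero k] {a₁ a₂ b₁ b₂ : Fin n → k} (hiso : a₁ ⬝ᵥ b₂ = a₂ ⬝ᵥ b₁)
    (H : ∀ s : Matrix (Fin n) (Fin n) k, s.transpose = s → ∀ i j,
      (a₁ i + s.mulVec b₁ i) * (a₂ j + s.mulVec b₂ j) =
        (a₁ j + s.mulVec b₁ j) * (a₂ i + s.mulVec b₂ i)) (i j : Fin n) :
    a₁ i * a₂ j = a₁ j * a₂ i ∧ b₁ i * b₂ j = b₁ j * b₂ i ∧ b₂ i * a₁ j = b₁ i * a₂ j := by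
  have h0 : ∀ i j, a₁ i * a₂ j = a₁ j * a₂ i := fun i j => by
    simpa using H 0 Matrix.transpose_zero i j
  -- Comparing `s` with `-s` separates the part of the relation that is linear in `s` from the
  -- quadratic one.
  have hp : ∀ s : Matrix (Fin n) (Fin n) k, s.transpose = s → ∀ i j,
      a₁ i * s.mulVec b₂ j + s.mulVec b₁ i * a₂ j = a₁ j * s.mulVec b₂ i + s.mulVec b₁ j * a₂ i ∧
      s.mulVec b₁ i * s.mulVec b₂ j = s.mulVec b₁ j * s.mulVec b₂ i := by
    intro s hs i j
    have e1 := H s hs i j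
    have e2 := H (-s) (by rw [Matrix.transpose_neg, hs]) i j
    simp only [Matrix.neg_mulVec, Pi.neg_apply] at e2
    have h2 : (2 : k) ≠ 0 := two_ne_zero
    constructor
    · apply mul_left_cancel₀ h2
      linear_combination e1 - e2
    · apply mul_left_cancel₀ h2
      linear_combination e1 + e2 - 2 * h0 i j
  have hb : ∀ i j, b₁ i * b₂ j = b₁ j * b₂ i := fun i j => by
    simpa using (hp 1 Matrix.transpose_one i j).2
  -- The linear relation for the matrix unit at `(l, l)`.
  have hoff : ∀ l j, j ≠ l → b₂ l * a₁ j = b₁ l * a₂ j := by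
    intro l j hj
    have := (hp (Matrix.single l l 1) (Matrix.transpose_single l l 1) j l).1
    simp [Matrix.single_mulVec, hj] at this
    linear_combination this
  have hdiag : ∀ l m, b₂ l * a₁ l - b₁ l * a₂ l = b₂ m * a₁ m - b₁ m * a₂ m := by
    intro l m
    by_cases hlm : l = m
    · rw [hlm]
    have hs : (Matrix.single l m (1 : k) + Matrix.single m l 1).transpose =
        Matrix.single l m 1 + Matrix.single m l 1 := by
      rw [Matrix.transpose_add, Matrix.transpose_single, Matrix.transpose_single, add_comm]
    have := (hp _ hs m l).1
    simp [Matrix.add_mulVec, Matrix.single_mulVec, hlm, Ne.symm hlm] at this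
    linear_combination -this
  -- By `hdiag` the diagonal differences are all equal, and isotropy says that their sum is zero; in
  -- characteristic zero each vanishes.
  have hall : ∀ l, b₂ l * a₁ l = b₁ l * a₂ l := by
    intro l
    have h1 : ∑ m, (b₂ m * a₁ m - b₁ m * a₂ m) = 0 := by
      rw [Finset.sum_sub_distrib, sub_eq_zero]
      simpa only [dotProduct, mul_comm] using hiso
    rw [Finset.sum_congr rfl fun m _ => hdiag m l, Finset.sum_const, Finset.card_univ,
      Fintype.card_fin, nsmul_eq_mul] at h1
    have hn : (n : k) ≠ 0 := Nat.cast_ne_zero.2 (by have := l.2; omega)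
    exact sub_eq_zero.1 ((mul_eq_zero.1 h1).resolve_left hn)
  refine ⟨h0 i j, hb i j, ?_⟩
  by_cases hij : j = i
  · rw [hij]; exact hall i
  · exact hoff i j hij

variable [Fact (2 ≤ n)]

/-- The first two columns of a matrix are independent in the first half of the rows. -/
def IsTransversal (u : Matrix (Idx n) (Idx n) k) : Prop :=
  ∃ i j : Fin n, u (Sum.inl i) (i₁ n) * u (Sum.inl j) (i₂ n) -
    u (Sum.inl j) (i₁ n) * u (Sum.inl i) (i₂ n) ≠ 0

theorem i₁_ne_i₂ : i₁ n ≠ i₂ n := by simp [i₁, i₂]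

theorem isTransversal_one : IsTransversal (1 : Matrix (Idx n) (Idx n) k) := by
  have h2 : 2 ≤ n := Fact.out
  refine ⟨⟨0, by omega⟩, ⟨1, by omega⟩, ?_⟩
  change (1 : Matrix (Idx n) (Idx n) k) (i₁ n) (i₁ n) * (1 : Matrix (Idx n) (Idx n) k) (i₂ n) (i₂ n) -
    (1 : Matrix (Idx n) (Idx n) k) (i₂ n) (i₁ n) * (1 : Matrix (Idx n) (Idx n) k) (i₁ n) (i₂ n) ≠ 0
  rw [Matrix.one_apply_eq, Matrix.one_apply_eq, Matrix.one_apply_ne i₁_ne_i₂.symm]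
  simp

theorem upper_mem_P {s : Matrix (Fin n) (Fin n) k} (hs : s.transpose = s) :
    (⟨_, upper_mem_symplecticGroup hs⟩ : G n k) ∈ P n k := by
  refine mem_P_of_mul_projV₂ ?_
  simp [projV₂, Matrix.fromBlocks_multiply, projTop_mul_self]

/-- If the shears by symmetric matrices, which fix `V₂`, never made the upper halves independent,
`minors_eq_zero` would make the first two columns of the invertible matrix `u` proportional. -/
theorem exists_isTransversal [CharZero k] (u : G n k) :
    ∃ p ∈ P n k, IsTransversal (p * u).1 := by
  by_contra! hcon
  set a : Idx n → Fin n → k := fun j i => u.1 (Sum.inl i) j with ha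
  set b : Idx n → Fin n → k := fun j i => u.1 (Sum.inr i) j with hb
  have hiso : a (i₁ n) ⬝ᵥ b (i₂ n) = a (i₂ n) ⬝ᵥ b (i₁ n) := by
    have h := congrFun (congrFun (SymplecticGroup.mem_iff'.1 u.2) (i₁ n)) (i₂ n)
    simp only [Matrix.mul_apply, Fintype.sum_sum_type, Matrix.J, Matrix.transpose_apply] at h
    simp [Matrix.one_apply, i₁, i₂] at h
    simp only [dotProduct, ha, hb, i₁, i₂]
    rw [← sub_eq_zero, ← neg_eq_zero, neg_sub]
    rw [← h, ← sub_eq_add_neg]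
    congr 1
    exact Finset.sum_congr rfl fun _ _ => mul_comm _ _
  have hH : ∀ s : Matrix (Fin n) (Fin n) k, s.transpose = s → ∀ i j,
      (a (i₁ n) i + s.mulVec (b (i₁ n)) i) * (a (i₂ n) j + s.mulVec (b (i₂ n)) j) =
        (a (i₁ n) j + s.mulVec (b (i₁ n)) j) * (a (i₂ n) i + s.mulVec (b (i₂ n)) i) := by
    intro s hs i j
    have h := hcon _ (upper_mem_P hs)
    simp only [IsTransversal, not_exists, not_not] at h
    have hent : ∀ i l, ((⟨_, upper_mem_symplecticGroup hs⟩ : G n k) * u).1 (Sum.inl i) l =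
        a l i + s.mulVec (b l) i := by
      intro i l
      simp [Submonoid.coe_mul, Matrix.mul_apply, Fintype.sum_sum_type, Matrix.one_apply, ha, hb,
        Matrix.mulVec, dotProduct]
    have := h i j
    rw [hent, hent, hent, hent] at this
    exact sub_eq_zero.1 this
  have hmin := minors_eq_zero hiso hH
  have hcol : ∀ p q : Idx n, u.1 p (i₁ n) * u.1 q (i₂ n) = u.1 p (i₂ n) * u.1 q (i₁ n) := by
    rintro (p | p) (q | q)
    · exact (hmin p q).1.trans (mul_comm _ _)
    · have := (hmin q p).2.2
      simp only [ha, hb] at this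
      linear_combination this
    · have := (hmin p q).2.2
      simp only [ha, hb] at this
      linear_combination -this
    · exact (hmin p q).2.1.trans (mul_comm _ _)
  -- With all minors zero, this combination of `v₁` and `v₂` is killed by `u`, so its coefficients
  -- vanish.
  have hzero : ∀ p : Idx n, u.1 p (i₁ n) = 0 := by
    intro p
    have h1 : actV u (u.1 p (i₂ n) • v₁ n k - u.1 p (i₁ n) • v₂ n k) = actV u 0 := by
      rw [map_zero, map_sub, map_smul, map_smul]
      ext q
      simp only [actV, Matrix.mulVecLin_apply, v₁, v₂, e, Matrix.mulVec_single_one, Pi.sub_apply,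
        Pi.smul_apply, smul_eq_mul, Matrix.col_apply, Pi.zero_apply]
      linear_combination -hcol p q
    have h2 := congrFun (actV_injective u h1) (i₂ n)
    simpa [v₁, v₂, e, i₁_ne_i₂.symm] using h2
  have h3 : actV u (v₁ n k) = actV u 0 := by
    rw [map_zero]
    ext q
    simp only [actV, Matrix.mulVecLin_apply, v₁, e, Matrix.mulVec_single_one]
    exact hzero q
  have h4 := congrFun (actV_injective u h3) (i₁ n)
  simp [v₁, e] at h4

/-- On the diagonal both points get the same representative. Off the diagonal only `h` is changed,
by an element of `P`, which multiplies `h⁻¹ g` by `P` from the left and keeps it outside `P`. -/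
theorem exists_adapted_representatives [CharZero k] (g h : G n k) : ∃ g' h' : G n k,
    toPoint g' = toPoint g ∧ toPoint h' = toPoint h ∧
      IsTransversal (h'⁻¹ * g').1 ∧ (h'⁻¹ * g' = 1 ∨ h'⁻¹ * g' ∉ P n k) := by
  by_cases hP : h⁻¹ * g ∈ P n k
  · refine ⟨h, h, ?_, rfl, ?_, Or.inl (inv_mul_cancel h)⟩
    · rw [← toPoint_mul hP, mul_inv_cancel_left]
    · rw [inv_mul_cancel]; exact isTransversal_one
  · obtain ⟨p, hp, ht⟩ := exists_isTransversal (h⁻¹ * g)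
    have e : (h * p⁻¹)⁻¹ * g = p * (h⁻¹ * g) := by group
    refine ⟨g, h * p⁻¹, rfl, toPoint_mul (inv_mem_P hp), by rwa [e], Or.inr ?_⟩
    rw [e]
    intro hmem
    refine hP (mem_P_of_actV_mem fun v hv => ?_)
    have := actV_mem (inv_mem_P hp) (actV_mem hmem hv)
    rwa [← LinearMap.comp_apply, ← actV_mul, inv_mul_cancel_left] at this

theorem exists_colForm_ne_zero {u : G n k} (hu : u ∉ P n k) : ∃ m, colForm n k u.1 m ≠ 0 := by
  by_contra! hcon
  have hmem : ∀ v, (∀ f ∈ V₂perp n k, f v = 0) → v ∈ V₂ n k := fun v hv =>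
    (Subspace.forall_mem_dualAnnihilator_apply_eq_zero_iff _ _).1 hv
  have h1 : actV u (v₁ n k) ∈ V₂ n k := hmem _ fun f hf => by
    simpa [colForm_apply, actV] using hcon (⟨f, hf⟩, 0)
  have h2 : actV u (v₂ n k) ∈ V₂ n k := hmem _ fun f hf => by
    simpa [colForm_apply, actV] using hcon (0, ⟨f, hf⟩)
  refine hu (mem_P_of_actV_mem fun v hv => ?_)
  obtain ⟨α, β, rfl⟩ := exists_eq_of_mem_V₂ hv
  rw [map_add, map_smul, map_smul]
  exact add_mem (Submodule.smul_mem _ _ h1) (Submodule.smul_mem _ _ h2)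

theorem topForm_apply_single (v : V n k) (i : Fin n) :
    (topForm v : Module.Dual k (V n k)) (e (Sum.inr i)) = v (Sum.inl i) := by
  rw [coe_topForm]
  simp [x, e, Pi.single_apply]

/-- Cramer's rule for the nonzero minor. -/
theorem exists_dual_topForm {u : Matrix (Idx n) (Idx n) k} (hu : IsTransversal u) :
    ∃ ζ₁ ζ₂ : Module.Dual k (V₂perp n k),
      ζ₁ (topForm (u.mulVec (v₁ n k))) = 1 ∧ ζ₁ (topForm (u.mulVec (v₂ n k))) = 0 ∧
      ζ₂ (topForm (u.mulVec (v₁ n k))) = 0 ∧ ζ₂ (topForm (u.mulVec (v₂ n k))) = 1 := by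
  obtain ⟨i, j, hij⟩ := hu
  set Δ := u (Sum.inl i) (i₁ n) * u (Sum.inl j) (i₂ n) -
    u (Sum.inl j) (i₁ n) * u (Sum.inl i) (i₂ n)
  let ev : Fin n → Module.Dual k (V₂perp n k) := fun i =>
    (Module.Dual.eval k (V n k) (e (Sum.inr i))) ∘ₗ (V₂perp n k).subtype
  have hev : ∀ i v, ev i (topForm v) = v (Sum.inl i) := fun i v => topForm_apply_single v i
  have hv1 : ∀ i, u.mulVec (v₁ n k) i = u i (i₁ n) := fun i => by simp [v₁, e]
  have hv2 : ∀ i, u.mulVec (v₂ n k) i = u i (i₂ n) := fun i => by simp [v₂, e]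
  refine ⟨Δ⁻¹ • (u (Sum.inl j) (i₂ n) • ev i - u (Sum.inl i) (i₂ n) • ev j),
    Δ⁻¹ • (u (Sum.inl i) (i₁ n) • ev j - u (Sum.inl j) (i₁ n) • ev i), ?_⟩
  simp only [LinearMap.smul_apply, LinearMap.sub_apply, hev, hv1, hv2, smul_eq_mul]
  refine ⟨?_, ?_, ?_, ?_⟩
  · rw [← inv_mul_cancel₀ hij]; congr 1; ring
  · ring
  · ring
  · rw [← inv_mul_cancel₀ hij]

end Transversality

section SliceEntries

variable {n : ℕ} {k : Type*} [Field k]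

theorem mul_projV₂_apply (u : Matrix (Idx n) (Idx n) k) (i : Idx n) {j : Fin n}
    (hj : (j : ℕ) < 2) : (u * projV₂ n k) i (Sum.inl j) = u i (Sum.inl j) := by
  rw [Matrix.mul_apply, Finset.sum_eq_single (Sum.inl j)]
  · rw [projV₂, Matrix.fromBlocks_apply₁₁, projTop, Matrix.diagonal_apply_eq, if_pos hj, mul_one]
  · rintro (l | l) - hl
    · have : l ≠ j := fun h => hl (h ▸ rfl)
      simp [projV₂, projTop, this]
    · simp [projV₂]
  · simp

theorem sliceM_apply (c : Matrix (Idx n) (Idx n) k) (i : Fin n) {j : Fin n} (hj : (j : ℕ) < 2) :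
    sliceM c i j = if (i : ℕ) < 2 then 0 else c (Sum.inl i) (Sum.inl j) := by
  rw [sliceM, projTop, Matrix.mul_diagonal, sub_mul, one_mul, Matrix.sub_apply,
    Matrix.diagonal_mul, if_pos hj]
  split_ifs <;> simp [Matrix.toBlocks₁₁]

theorem sliceK_apply (c : Matrix (Idx n) (Idx n) k) (i : Fin n) {j : Fin n} (hj : (j : ℕ) < 2) :
    sliceK c i j = if (i : ℕ) < 2 then 0 else c (Sum.inr i) (Sum.inl j) := by
  rw [sliceK, projTop, Matrix.mul_diagonal, sub_mul, one_mul, Matrix.sub_apply,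
    Matrix.diagonal_mul, if_pos hj]
  split_ifs <;> simp [Matrix.toBlocks₂₁]

theorem slice_apply_inl (c : Matrix (Idx n) (Idx n) k) (i : Fin n) {j : Fin n}
    (hj : (j : ℕ) < 2) : (slice c).1 (Sum.inl i) (Sum.inl j) =
      if (i : ℕ) < 2 then (if i = j then 1 else 0) else c (Sum.inl i) (Sum.inl j) := by
  rw [← mul_projV₂_apply (slice c).1 _ hj, slice_mul_projV₂, Matrix.fromBlocks_apply₁₁, Matrix.add_apply,
    sliceM_apply c i hj, projTop, Matrix.diagonal_apply]
  split_ifs with h1 h2 h3 <;> simp_all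

theorem slice_apply_inr (c : Matrix (Idx n) (Idx n) k) {i j : Fin n} (hij : j ≤ i)
    (hj : (j : ℕ) < 2) : (slice c).1 (Sum.inr i) (Sum.inl j) = c (Sum.inr i) (Sum.inl j) := by
  rw [← mul_projV₂_apply (slice c).1 _ hj, slice_mul_projV₂, Matrix.fromBlocks_apply₂₁, Matrix.add_apply,
    Matrix.add_apply, sliceK_apply c i hj, symmLower, Matrix.of_apply, max_eq_left hij,
    min_eq_right hij]
  by_cases hi : (i : ℕ) < 2
  · rw [if_pos hi, zero_add, sliceR, Matrix.sub_apply, add_sub_cancel, projTop,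
      Matrix.mul_diagonal, Matrix.diagonal_mul, if_pos hi, if_pos hj]
    simp [Matrix.toBlocks₂₁]
  · rw [if_neg hi, sliceR_apply_eq_zero c fun h => hi h.1, add_zero, Matrix.mul_apply,
      Finset.sum_eq_zero, add_zero]
    intro l _
    rw [Matrix.transpose_apply, sliceK, projTop, Matrix.mul_diagonal, if_neg hi, mul_zero, zero_mul]

end SliceEntries

end TateModel

end

/-! ### Local exactness on the slices -/

noncomputable section

namespace TateModel

open SpGrTate

section TateDifferential

variable {k W : Type*} [Field k] [AddCommGroup W] [Module k W]

/-- The differential with the cycle `v₂ ⊗ w₁ - v₁ ⊗ w₂`. -/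
def tateDiff (φ : Module.Dual k (W × W)) (w₁ w₂ : W) :
    Polynomial (Lam2 k W) →ₗ[k] Polynomial (Lam2 k W) := gdiff φ (-w₂, w₁)

/-- The condition that `v₂ ⊗ w₁ - v₁ ⊗ w₂` is a cycle. -/
def IsCycle (φ : Module.Dual k (W × W)) (w₁ w₂ : W) : Prop := φ (-w₂, w₁) = 0

theorem tateDiff_tateDiff {φ : Module.Dual k (W × W)} {w₁ w₂ : W} (h : IsCycle φ w₁ w₂)
    (p : Polynomial (Lam2 k W)) : tateDiff φ w₁ w₂ (tateDiff φ w₁ w₂ p) = 0 :=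
  gdiff_gdiff h p

theorem tateDiff_mem_Fil [CharZero k] (φ : Module.Dual k (W × W)) (w₁ w₂ : W) {e i : ℕ}
    {p : Polynomial (Lam2 k W)} (hp : p ∈ Fil k W e (i + 1)) :
    tateDiff φ w₁ w₂ p ∈ Fil k W (e - 1) i :=
  gdiff_mem_Fil _ _ hp

variable {Y : Type*} {𝒪 : Subalgebra k (Y → k)}

theorem tateDiff_mem_Vals {φ : Y → Module.Dual k (W × W)} {w₁ w₂ : Y → W}
    (hφ : φ ∈ Vals 𝒪 (Module.Dual k (W × W))) (hw₁ : w₁ ∈ Vals 𝒪 W) (hw₂ : w₂ ∈ Vals 𝒪 W) :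
    (fun y => tateDiff (φ y) (w₁ y) (w₂ y)) ∈ Vals 𝒪
      (Polynomial (Lam2 k W) →ₗ[k] Polynomial (Lam2 k W)) :=
  gdiff_mem_Vals hφ (pair_mem_Vals (f := fun y => -w₂ y) (Submodule.neg_mem _ hw₂) hw₁)

theorem exists_primitive_of_tateDiff [FiniteDimensional k W] [CharZero k]
    {φ : Y → Module.Dual k (W × W)} {w₁ w₂ : Y → W}
    (hφ : φ ∈ Vals 𝒪 (Module.Dual k (W × W))) (hw₁ : w₁ ∈ Vals 𝒪 W)
    (hw₂ : w₂ ∈ Vals 𝒪 W) (h : ∀ y, IsCycle (φ y) (w₁ y) (w₂ y)) {y₀ : Y}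
    (hζ : ∃ ζ₁ ζ₂ : Module.Dual k W, ζ₁ (w₁ y₀) = 1 ∧ ζ₁ (w₂ y₀) = 0 ∧ ζ₂ (w₁ y₀) = 0 ∧
      ζ₂ (w₂ y₀) = 1)
    {i : ℕ} (hi : i + 4 ≤ 2 * Module.finrank k W)
    (hD : (∃ m, φ y₀ m ≠ 0) ∨
      ∀ z ∈ Vals 𝒪 (Polynomial (Lam2 k W)), (∀ y, z y ∈ Fil k W 0 (i + 1)) →
      (∀ y, tateDiff (φ y) (w₁ y) (w₂ y) (z y) = 0) →
      ∃ r ∈ Vals 𝒪 (Polynomial (Lam2 k W)), (∀ y, r y ∈ Fil k W 0 (i + 2)) ∧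
        ∀ y, tateDiff (φ y) (w₁ y) (w₂ y) (r y) = z y)
    {z : Y → Polynomial (Lam2 k W)} (hz : z ∈ Vals 𝒪 (Polynomial (Lam2 k W)))
    (hzF : ∀ y, z y ∈ Fil k W (i + 2 - Module.finrank k W) (i + 1))
    (hdz : ∀ y, tateDiff (φ y) (w₁ y) (w₂ y) (z y) = 0) :
    ∃ r ∈ Vals 𝒪 (Polynomial (Lam2 k W)), ∃ q ∈ 𝒪, q y₀ ≠ 0 ∧
      (∀ y, r y ∈ Fil k W (i + 3 - Module.finrank k W) (i + 2)) ∧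
        ∀ y, tateDiff (φ y) (w₁ y) (w₂ y) (r y) = q y • z y := by
  obtain ⟨ζ₁, ζ₂, h11, h12, h21, h22⟩ := hζ
  refine exists_primitive_of_exact hφ hw₁ hw₂ h h11 h12 h21 h22 hi ?_ hz hzF hdz
  intro z hz hzF hdz
  rcases hD with ⟨m, hm⟩ | hD
  · exact exists_primitive_of_ne_zero hφ hm hz hzF hdz
  · obtain ⟨r, hr, hrF, hrz⟩ := hD z hz hzF hdz
    exact ⟨r, hr, 1, one_mem _, one_ne_zero, hrF,
      fun y => (hrz y).trans (by rw [Pi.one_apply, one_smul])⟩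

end TateDifferential

theorem exists_primitive_of_product_coordinates {k W σ ι₁ ι₂ : Type*} [Field k] [CharZero k]
    [AddCommGroup W] [Module k W] [Fintype ι₁] [DecidableEq ι₁] [Fintype ι₂] [DecidableEq ι₂]
    {ρ : ι₁ ⊕ ι₂ → σ} (hρ : Function.Injective ρ) {b₁ : ι₁ → W} {ε₁ : ι₁ → Module.Dual k W}
    (hε₁ : ∀ i j, ε₁ i (b₁ j) = if i = j then 1 else 0) (h₁ : ∀ f, ∑ i, ε₁ i f • b₁ i = f)
    {b₂ : ι₂ → W} {ε₂ : ι₂ → Module.Dual k W} (hε₂ : ∀ i j, ε₂ i (b₂ j) = if i = j then 1 else 0)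
    {w₀ : W} {ξ₀ : Module.Dual k W} (hξ₀ : ∀ i, ξ₀ (b₂ i) = 0)
    (h₂ : ∀ f, ξ₀ f • w₀ + ∑ i, ε₂ i f • b₂ i = f) {φ : (σ → k) → Module.Dual k (W × W)}
    (hφ₁ : ∀ y i, φ y (b₁ i, 0) = y (ρ (Sum.inl i)))
    (hφ₂ : ∀ y i, φ y (0, b₂ i) = y (ρ (Sum.inr i))) {w₁ w₂ : (σ → k) → W}
    (hw₁ : w₁ ∈ Vals (polyFun σ k) W) (hw₂ : w₂ ∈ Vals (polyFun σ k) W) (hξ : ∀ y, ξ₀ (w₁ y) = 1)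
    (hφw : ∀ y, IsCycle (φ y) (w₁ y) (w₂ y)) {i : ℕ} (hi : 0 < i)
    {z : (σ → k) → Polynomial (Lam2 k W)} (hz : z ∈ Vals (polyFun σ k) (Polynomial (Lam2 k W)))
    (hzF : ∀ y, z y ∈ Fil k W 0 i) (hdz : ∀ y, tateDiff (φ y) (w₁ y) (w₂ y) (z y) = 0) :
    ∃ r ∈ Vals (polyFun σ k) (Polynomial (Lam2 k W)), (∀ y, r y ∈ Fil k W 0 (i + 1)) ∧
        ∀ y, tateDiff (φ y) (w₁ y) (w₂ y) (r y) = z y := by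
  let e : ι₁ ⊕ ι₂ → W × W := Sum.elim (fun i => (b₁ i, 0)) (fun i => (0, b₂ i))
  let ε : ι₁ ⊕ ι₂ → Module.Dual k (W × W) :=
    Sum.elim (fun i => ε₁ i ∘ₗ LinearMap.fst k W W) (fun i => ε₂ i ∘ₗ LinearMap.snd k W W)
  have hε : ∀ a b, ε a (e b) = if a = b then 1 else 0 := by
    rintro (a | a) (b | b) <;> simp [ε, e, hε₁, hε₂]
  have hξe : ∀ a, (ξ₀ ∘ₗ LinearMap.snd k W W) (e a) = 0 := by
    rintro (a | a) <;> simp [e, hξ₀]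
  have hdec : ∀ m, (ξ₀ ∘ₗ LinearMap.snd k W W) m • ((0 : W), w₀) + ∑ a, ε a m • e a = m := by
    intro m
    rw [Fintype.sum_sum_type]
    refine Prod.ext ?_ ?_
    · rw [Prod.fst_add, Prod.fst_add, Prod.fst_sum, Prod.fst_sum]
      simpa [e, ε] using h₁ m.1
    · rw [Prod.snd_add, Prod.snd_add, Prod.snd_sum, Prod.snd_sum]
      simpa [e, ε] using h₂ m.2
  have hφe : ∀ y a, φ y (e a) = y (ρ a) := by
    rintro y (a | a)
    · exact hφ₁ y a
    · exact hφ₂ y a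
  refine exists_primitive_of_coordinates hρ hε hξe hdec (fun y => LinearMap.ext fun m => ?_)
    (pair_mem_Vals (f := fun y => -w₂ y) (Submodule.neg_mem _ hw₂) hw₁) hξ hφw hi hz hzF hdz
  conv_lhs => rw [← hdec m]
  rw [map_add, map_sum, map_smul]
  simp only [map_smul, hφe, LinearMap.add_apply, LinearMap.smul_apply, LinearMap.sum_apply,
    smul_eq_mul]
  congr 1
  · exact mul_comm _ _
  · exact Finset.sum_congr rfl fun a _ => mul_comm _ _

section CoordinatesNearTheDiagonal

variable {n : ℕ} {k : Type*} [Field k] [Fact (2 ≤ n)]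

variable (n) in
/-- The basis vector paired with `v₁`. -/
def j₁ : Idx n := Sum.inr ⟨0, lt_of_lt_of_le two_pos (Fact.out : 2 ≤ n)⟩

variable (n) in
/-- The indices of the basis of `(V / V₂)*`. -/
abbrev PerpIdx : Type := {i : Idx n // i ≠ i₁ n ∧ i ≠ i₂ n}

variable (k) in
/-- The basis of `(V / V₂)*`. -/
def perpVec (i : PerpIdx n) : V₂perp n k := ⟨x i.1, x_mem_V₂perp i.2.1 i.2.2⟩

theorem perpVec_apply (i : PerpIdx n) (v : V n k) :
    (perpVec k i : Module.Dual k (V n k)) v = v i.1 := rfl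

theorem sum_smul_perpVec (f : V₂perp n k) :
    ∑ i : PerpIdx n, (f : Module.Dual k (V n k)) (e i.1) • perpVec k i = f := by
  have hf : ∀ v ∈ V₂ n k, (f : Module.Dual k (V n k)) v = 0 :=
    fun v hv => (Submodule.mem_dualAnnihilator _).1 f.2 v hv
  apply Subtype.ext
  rw [Submodule.coe_sum]
  refine LinearMap.ext fun v => ?_
  rw [LinearMap.sum_apply]
  have h1 : ∀ i : PerpIdx n, ((((f : Module.Dual k (V n k)) (e i.1) • perpVec k i : V₂perp n k) :
      Module.Dual k (V n k)) v) = (fun i : Idx n => v i * (f : Module.Dual k (V n k)) (e i)) i.1 :=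
    fun i => mul_comm _ _
  rw [Finset.sum_congr rfl fun i _ => h1 i]
  have h2 : v = ∑ i, v i • e (k := k) i := by
    ext i
    simp [e, Finset.sum_apply, Pi.single_apply]
  conv_rhs => rw [h2, map_sum]
  simp only [map_smul, smul_eq_mul]
  have h3 := Fintype.sum_subtype_add_sum_subtype (fun i => i ≠ i₁ n ∧ i ≠ i₂ n)
    (fun i => v i * (f : Module.Dual k (V n k)) (e i))
  rw [← h3]
  refine (add_eq_left.2 (Finset.sum_eq_zero fun i _ => ?_)).symm
  have h4 : (f : Module.Dual k (V n k)) (e i.1) = 0 := by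
    rcases not_and_or.1 i.2 with h | h
    · rw [not_not.1 h]; exact hf _ v₁_mem
    · rw [not_not.1 h]; exact hf _ v₂_mem
  rw [h4, mul_zero]

variable (n) in
/-- The coordinates of the slice at the diagonal, as indices of a basis of a hyperplane in
`V₂ ⊗ (V / V₂)*`. -/
abbrev TangentIdx : Type := PerpIdx n ⊕ {i : PerpIdx n // i.1 ≠ j₁ n}

/-- The position of a coordinate in the matrix. -/
def tangentPos : TangentIdx n → Idx n × Idx n :=
  Sum.elim (fun i => (i.1, i₁ n)) (fun i => (i.1.1, i₂ n))

theorem tangentPos_injective : Function.Injective (tangentPos (n := n)) := by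
  rintro (i | i) (j | j) h <;> simp only [tangentPos, Sum.elim_inl, Sum.elim_inr, Prod.mk.injEq] at h
  · rw [Subtype.ext h.1]
  · exact absurd h.2 i₁_ne_i₂
  · exact absurd h.2 i₁_ne_i₂.symm
  · rw [Subtype.ext (Subtype.ext h.1)]

variable (k) in
/-- The evaluation of linear forms at a basis vector. -/
def perpEval (i : Idx n) : Module.Dual k (V₂perp n k) :=
  (Module.Dual.eval k (V n k) (e i)) ∘ₗ (V₂perp n k).subtype

theorem perpEval_perpVec (i : Idx n) (j : PerpIdx n) :
    perpEval k i (perpVec k j) = if i = j.1 then 1 else 0 := by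
  change (e i : V n k) j.1 = _
  simp [e, Pi.single_apply, eq_comm]

theorem j₁_ne : j₁ n ≠ i₁ n ∧ j₁ n ≠ i₂ n := by simp [j₁, i₁, i₂]

theorem sum_smul_perpVec' (f : V₂perp n k) :
    perpEval k (j₁ n) f • perpVec k ⟨j₁ n, j₁_ne⟩ +
      ∑ i : {i : PerpIdx n // i.1 ≠ j₁ n}, perpEval k i.1.1 f • perpVec k i.1 = f := by
  have h2 := sum_smul_perpVec f
  have h3 := Fintype.sum_subtype_add_sum_subtype (fun i : PerpIdx n => i.1 ≠ j₁ n)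
    (fun i => (f : Module.Dual k (V n k)) (e i.1) • perpVec k i)
  have h4 : ∑ i : {i : PerpIdx n // ¬i.1 ≠ j₁ n},
      (f : Module.Dual k (V n k)) (e i.1.1) • perpVec k i.1 =
        (f : Module.Dual k (V n k)) (e (j₁ n)) • perpVec k ⟨j₁ n, j₁_ne⟩ := by
    refine Fintype.sum_eq_single (⟨⟨j₁ n, j₁_ne⟩, not_not.2 rfl⟩ :
      {i : PerpIdx n // ¬i.1 ≠ j₁ n}) fun i hi => ?_
    exact absurd (Subtype.ext (Subtype.ext (not_not.1 i.2))) hi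
  rw [h2, h4, add_comm] at h3
  exact h3

theorem eq_of_lt_two {i : Fin n} (h : (i : ℕ) < 2) :
    (Sum.inl i : Idx n) = i₁ n ∨ (Sum.inl i : Idx n) = i₂ n := by
  simp only [i₁, i₂, Sum.inl.injEq, Fin.ext_iff]
  omega

variable (n) in
/-- The coordinates on pairs of matrices. -/
abbrev PairIdx : Type := (Idx n × Idx n) ⊕ (Idx n × Idx n)

/-- The matrix formed by the first coordinates. -/
def firstMatrix (y : PairIdx n → k) : Matrix (Idx n) (Idx n) k :=
  Matrix.of fun i j => y (Sum.inl (i, j))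

/-- The matrix formed by the second coordinates. -/
def secondMatrix (y : PairIdx n → k) : Matrix (Idx n) (Idx n) k :=
  Matrix.of fun i j => y (Sum.inr (i, j))

variable (n k) in
/-- The coordinates of the base point. -/
def basePoint : PairIdx n → k :=
  Sum.elim (fun p => projV₂ n k p.1 p.2) (fun p => projV₂ n k p.1 p.2)

omit [Fact (2 ≤ n)] in
theorem firstMatrix_basePoint : firstMatrix (basePoint n k) = projV₂ n k := rfl

omit [Fact (2 ≤ n)] in
theorem secondMatrix_basePoint : secondMatrix (basePoint n k) = projV₂ n k := rfl

omit [Fact (2 ≤ n)] in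
theorem firstMatrix_mem_Vals : firstMatrix ∈
    Vals (polyFun (PairIdx n) k) (Matrix (Idx n) (Idx n) k) :=
  matrix_mem_Vals fun i j => coord_mem_polyFun (Sum.inl (i, j))

omit [Fact (2 ≤ n)] in
theorem secondMatrix_mem_Vals : secondMatrix ∈
    Vals (polyFun (PairIdx n) k) (Matrix (Idx n) (Idx n) k) :=
  matrix_mem_Vals fun i j => coord_mem_polyFun (Sum.inr (i, j))

theorem colForm_slice_left (c : Matrix (Idx n) (Idx n) k) (i : PerpIdx n) :
    colForm n k (slice c).1 (perpVec k i, 0) = c i.1 (i₁ n) := by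
  obtain ⟨i, hi⟩ := i
  rw [colForm_apply]
  simp only [ZeroMemClass.coe_zero, LinearMap.zero_apply, add_zero, perpVec_apply, v₁, e,
    Matrix.mulVec_single_one, Matrix.col_apply]
  rcases i with i | i
  · rw [i₁, slice_apply_inl c i (by norm_num), if_neg]
    exact fun h => (eq_of_lt_two h).elim hi.1 hi.2
  · exact slice_apply_inr c (Nat.zero_le _) (by norm_num)

/-- The excluded row `j₁` is the entry above the diagonal of the symmetric block. It is determined
by the other coordinates, so one coordinate fewer than the rank of `V₂ ⊗ (V/V₂)*` is free. -/
theorem colForm_slice_right (c : Matrix (Idx n) (Idx n) k) {i : PerpIdx n} (hi' : i.1 ≠ j₁ n) :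
    colForm n k (slice c).1 (0, perpVec k i) = c i.1 (i₂ n) := by
  obtain ⟨i, hi⟩ := i
  rw [colForm_apply]
  simp only [ZeroMemClass.coe_zero, LinearMap.zero_apply, zero_add, perpVec_apply, v₂, e,
    Matrix.mulVec_single_one, Matrix.col_apply]
  rcases i with i | i
  · rw [i₂, slice_apply_inl c i (by norm_num), if_neg]
    exact fun h => (eq_of_lt_two h).elim hi.1 hi.2
  · refine slice_apply_inr c ?_ (by norm_num)
    rw [Fin.le_def]
    by_contra h
    exact hi' (congrArg Sum.inr (Fin.ext (Nat.lt_one_iff.1 (not_le.1 h))))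

/-- The differential of the Tate complex in the model. -/
def matDiff (u : Matrix (Idx n) (Idx n) k) :
    Polynomial (Lam2 k (V₂perp n k)) →ₗ[k] Polynomial (Lam2 k (V₂perp n k)) :=
  tateDiff (colForm n k u) (topForm (u.mulVec (v₁ n k))) (topForm (u.mulVec (v₂ n k)))

theorem diff_jpol_eq_matDiff (g h : G n k) (p : Polynomial (Lam2 k (V₂perp n k))) :
    diff g h (jpol n k p) = jpol n k (matDiff (h⁻¹ * g).1 p) := diff_jpol g h p

theorem isCycle_topForm (u : G n k) : IsCycle (colForm n k u.1) (topForm (u.1.mulVec (v₁ n k)))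
    (topForm (u.1.mulVec (v₂ n k))) := colForm_topForm u

/-- Local exactness of the Tate complex on the slice at the diagonal. -/
theorem exists_primitive_slice_one [CharZero k] {i : ℕ} (hi : 0 < i)
    {z : (PairIdx n → k) → Polynomial (Lam2 k (V₂perp n k))}
    (hz : z ∈ Vals (polyFun (PairIdx n) k) (Polynomial (Lam2 k (V₂perp n k))))
    (hzF : ∀ y, z y ∈ Fil k (V₂perp n k) 0 i)
    (hdz : ∀ y, matDiff (slice (firstMatrix y)).1 (z y) = 0) :
    ∃ r ∈ Vals (polyFun (PairIdx n) k) (Polynomial (Lam2 k (V₂perp n k))),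
      (∀ y, r y ∈ Fil k (V₂perp n k) 0 (i + 1)) ∧
        ∀ y, matDiff (slice (firstMatrix y)).1 (r y) = z y := by
  have hu : (fun y => (slice (firstMatrix y)).1) ∈
      Vals (polyFun (PairIdx n) k) (Matrix (Idx n) (Idx n) k) := slice_mem_Vals firstMatrix_mem_Vals
  have hw₁ := topForm_mem_Vals hu (v₁ n k)
  have hw₂ := topForm_mem_Vals hu (v₂ n k)
  have hpos : Function.Injective fun a : TangentIdx n => (Sum.inl (tangentPos a) : PairIdx n) :=
    fun a b h => tangentPos_injective (Sum.inl_injective h)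
  -- The slice is the identity in the first two rows and columns. So the direction of the dependent
  -- coordinate is the one in which the cycle has coefficient one.
  have hξ : ∀ y, perpEval k (j₁ n) (topForm ((slice (firstMatrix y)).1.mulVec (v₁ n k))) = 1 := by
    intro y
    change (topForm (n := n) (k := k) (Matrix.mulVec _ _) : Module.Dual k (V n k))
      (e (Sum.inr _)) = 1
    rw [topForm_apply_single, v₁, e, Matrix.mulVec_single_one, Matrix.col_apply, i₁,
      slice_apply_inl _ _ (by norm_num)]
    simp
  have key := @exists_primitive_of_product_coordinates k (V₂perp n k) (PairIdx n) (PerpIdx n)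
    {i : PerpIdx n // i.1 ≠ j₁ n} _ _ _ _ _ _ _ _
  exact key hpos (b₁ := perpVec k) (ε₁ := fun i => perpEval k i.1)
    (fun i j => (perpEval_perpVec i.1 j).trans (by simp only [Subtype.ext_iff]))
    sum_smul_perpVec (b₂ := fun i => perpVec k i.1) (ε₂ := fun i => perpEval k i.1.1)
    (fun i j => (perpEval_perpVec i.1.1 j.1).trans (by simp only [Subtype.ext_iff]))
    (w₀ := perpVec k ⟨j₁ n, j₁_ne⟩) (ξ₀ := perpEval k (j₁ n))
    (fun i => (perpEval_perpVec (j₁ n) i.1).trans (if_neg i.2.symm))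
    sum_smul_perpVec' (φ := fun y => colForm n k (slice (firstMatrix y)).1)
    (fun y i => colForm_slice_left (firstMatrix y) i)
    (fun y i => colForm_slice_right (firstMatrix y) i.2) hw₁ hw₂ hξ
    (fun y => isCycle_topForm (slice (firstMatrix y))) hi hz hzF hdz

/-- Local exactness of the Tate complex and its subcomplex on a slice. -/
theorem exists_primitive_slice [CharZero k] {u₀ : G n k} (ht : IsTransversal u₀.1)
    (h0 : u₀ = 1 ∨ u₀ ∉ P n k) {i : ℕ} (hi : i + 8 ≤ 4 * n)
    {z : (PairIdx n → k) → Polynomial (Lam2 k (V₂perp n k))}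
    (hz : z ∈ Vals (polyFun (PairIdx n) k) (Polynomial (Lam2 k (V₂perp n k))))
    (hzF : ∀ y, z y ∈ Fil k (V₂perp n k) (i + 4 - 2 * n) (i + 1))
    (hdz : ∀ y, matDiff (u₀ * slice (firstMatrix y)).1 (z y) = 0) :
    ∃ r ∈ Vals (polyFun (PairIdx n) k) (Polynomial (Lam2 k (V₂perp n k))),
      ∃ q ∈ polyFun (PairIdx n) k, q (basePoint n k) ≠ 0 ∧
        (∀ y, r y ∈ Fil k (V₂perp n k) (i + 5 - 2 * n) (i + 2)) ∧
        ∀ y, matDiff (u₀ * slice (firstMatrix y)).1 (r y) = q y • z y := by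
  have hn : 2 ≤ n := Fact.out
  have hbase : u₀ * slice (firstMatrix (basePoint n k)) = u₀ := by
    rw [firstMatrix_basePoint, slice_projV₂, mul_one]
  have hu : (fun y => (u₀ * slice (firstMatrix y)).1) ∈
      Vals (polyFun (PairIdx n) k) (Matrix (Idx n) (Idx n) k) :=
    symplectic_mul_mem_Vals (const_mem_Vals _) (slice_mem_Vals firstMatrix_mem_Vals)
  rw [show i + 4 - 2 * n = i + 2 - Module.finrank k (V₂perp n k) by
    rw [finrank_V₂perp]; omega] at hzF
  rw [show i + 5 - 2 * n = i + 3 - Module.finrank k (V₂perp n k) by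
    rw [finrank_V₂perp]; omega]
  have hζ := exists_dual_topForm ht
  rw [← hbase] at hζ
  have key := @exists_primitive_of_tateDiff k (V₂perp n k) _ _ _ (PairIdx n → k)
    (polyFun (PairIdx n) k) _ _
  refine key (y₀ := basePoint n k) (colForm_mem_Vals hu) (topForm_mem_Vals hu (v₁ n k))
    (topForm_mem_Vals hu (v₂ n k)) (fun y => isCycle_topForm (u₀ * slice (firstMatrix y))) hζ
    (by rw [finrank_V₂perp]; omega) ?_ hz hzF hdz
  -- At the diagonal the coordinates of the slice give exactness of the Tate complex; off it `u₀ ∉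
  -- P` means that the pairing is nonzero.
  rcases h0 with rfl | h0
  · refine Or.inr fun z hz hzF hdz => ?_
    simp only [one_mul] at hdz ⊢
    exact exists_primitive_slice_one (Nat.succ_pos i) hz hzF hdz
  · have hm := exists_colForm_ne_zero h0
    rw [← hbase] at hm
    exact Or.inl hm

end CoordinatesNearTheDiagonal

end TateModel

end

/-! ### Regular functions and local fractions -/

noncomputable section

namespace TateModel

open SpGrTate

section RegularFunctions

variable {n : ℕ} {k : Type*} [Field k]

theorem evalAt_add (y : G n k × G n k) (A B : Poly n k) :
    evalAt y (A + B) = evalAt y A + evalAt y B := map_add _ _ _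

theorem evalAt_mul (y : G n k × G n k) (A B : Poly n k) :
    evalAt y (A * B) = evalAt y A * evalAt y B := map_mul _ _ _

theorem evalAt_C (y : G n k × G n k) (c : k) : evalAt y (MvPolynomial.C c) = c :=
  MvPolynomial.eval_C _

theorem evalAt_one (y : G n k × G n k) : evalAt y 1 = 1 := map_one _

/-- The algebra of regular functions. -/
def regFun (Ω : Set (G n k × G n k)) : Subalgebra k (G n k × G n k → k) where
  carrier := {f | IsRegularOn Ω f}
  mul_mem' := by
    intro f g hf hg y hy
    obtain ⟨A, Q, hQ, hA⟩ := hf y hy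
    obtain ⟨A', Q', hQ', hA'⟩ := hg y hy
    refine ⟨A * A', Q * Q', by rw [evalAt_mul]; exact mul_ne_zero hQ hQ', fun z hz hne => ?_⟩
    rw [evalAt_mul] at hne
    rw [Pi.mul_apply, hA z hz (left_ne_zero_of_mul hne), hA' z hz (right_ne_zero_of_mul hne),
      evalAt_mul, evalAt_mul, div_mul_div_comm]
  add_mem' := by
    intro f g hf hg y hy
    obtain ⟨A, Q, hQ, hA⟩ := hf y hy
    obtain ⟨A', Q', hQ', hA'⟩ := hg y hy
    refine ⟨A * Q' + Q * A', Q * Q', by rw [evalAt_mul]; exact mul_ne_zero hQ hQ',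
      fun z hz hne => ?_⟩
    rw [evalAt_mul] at hne
    rw [Pi.add_apply, hA z hz (left_ne_zero_of_mul hne), hA' z hz (right_ne_zero_of_mul hne),
      evalAt_add, evalAt_mul, evalAt_mul, evalAt_mul,
      div_add_div _ _ (left_ne_zero_of_mul hne) (right_ne_zero_of_mul hne)]
  algebraMap_mem' := by
    intro c y _
    refine ⟨MvPolynomial.C c, 1, by rw [evalAt_one]; exact one_ne_zero, fun z _ _ => ?_⟩
    rw [evalAt_C, evalAt_one, div_one]
    rfl

theorem evalAt_mem_regFun (Ω : Set (G n k × G n k)) (A : Poly n k) :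
    (fun y => evalAt y A) ∈ regFun Ω := by
  intro y _
  refine ⟨A, 1, by rw [evalAt_one]; exact one_ne_zero, fun z _ _ => ?_⟩
  rw [evalAt_one, div_one]

theorem fst_mem_Vals_regFun (Ω : Set (G n k × G n k)) :
    (fun y => y.1.1) ∈ Vals (regFun Ω) (Matrix (Idx n) (Idx n) k) := by
  refine matrix_mem_Vals fun i j => ?_
  have := evalAt_mem_regFun Ω (MvPolynomial.X (Sum.inl (i, j)))
  simpa only [evalAt, MvPolynomial.eval_X, Sum.elim_inl] using this

theorem snd_mem_Vals_regFun (Ω : Set (G n k × G n k)) :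
    (fun y => y.2.1) ∈ Vals (regFun Ω) (Matrix (Idx n) (Idx n) k) := by
  refine matrix_mem_Vals fun i j => ?_
  have := evalAt_mem_regFun Ω (MvPolynomial.X (Sum.inr (i, j)))
  simpa only [evalAt, MvPolynomial.eval_X, Sum.elim_inr] using this

theorem inv_mem_regFun {Ω : Set (G n k × G n k)} {f : G n k × G n k → k} (hf : f ∈ regFun Ω)
    (hne : ∀ y ∈ Ω, f y ≠ 0) : (fun y => (f y)⁻¹) ∈ regFun Ω := by
  intro y hy
  obtain ⟨A, Q, hQ, hA⟩ := hf y hy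
  have hAy : evalAt y A ≠ 0 := fun h => hne y hy (by rw [hA y hy hQ, h, zero_div])
  refine ⟨Q * Q, Q * A, by rw [evalAt_mul]; exact mul_ne_zero hQ hAy, fun z hz hz' => ?_⟩
  rw [evalAt_mul] at hz'
  have hQz := left_ne_zero_of_mul hz'
  beta_reduce
  rw [hA z hz hQz, inv_div, evalAt_mul, evalAt_mul, mul_div_mul_left _ _ hQz]

theorem regFun_congr {Ω : Set (G n k × G n k)} {f g : G n k × G n k → k} (hf : f ∈ regFun Ω)
    (h : ∀ y ∈ Ω, g y = f y) : g ∈ regFun Ω := by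
  intro y hy
  obtain ⟨A, Q, hQ, hA⟩ := hf y hy
  exact ⟨A, Q, hQ, fun z hz hz' => (h z hz).trans (hA z hz hz')⟩

/-- The defining family consists of all polynomials whose nonvanishing locus is contained in the
set; local numerators and denominators of `f` show that these loci cover it. -/
theorem isOpenGG_ne_zero {Ω : Set (G n k × G n k)} (hΩ : IsOpenGG Ω) {f : G n k × G n k → k}
    (hf : f ∈ regFun Ω) : IsOpenGG {y | y ∈ Ω ∧ f y ≠ 0} := by
  obtain ⟨T, rfl⟩ := hΩ
  refine ⟨{R | ∀ y, evalAt y R ≠ 0 → (∃ Q ∈ T, evalAt y Q ≠ 0) ∧ f y ≠ 0}, ?_⟩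
  ext y
  constructor
  · rintro ⟨hy, hfy⟩
    obtain ⟨A, Q, hQ, hA⟩ := hf y hy
    obtain ⟨Q₀, hQ₀, hQ₀y⟩ := hy
    have hAy : evalAt y A ≠ 0 := fun h => hfy (by rw [hA y ⟨Q₀, hQ₀, hQ₀y⟩ hQ, h, zero_div])
    refine ⟨Q₀ * (Q * A), fun z hz => ?_, ?_⟩
    · rw [evalAt_mul, evalAt_mul] at hz
      have h1 := left_ne_zero_of_mul hz
      have h2 := left_ne_zero_of_mul (right_ne_zero_of_mul hz)
      refine ⟨⟨Q₀, hQ₀, h1⟩, ?_⟩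
      rw [hA z ⟨Q₀, hQ₀, h1⟩ h2]
      exact div_ne_zero (right_ne_zero_of_mul (right_ne_zero_of_mul hz)) h2
    · rw [evalAt_mul, evalAt_mul]
      exact mul_ne_zero hQ₀y (mul_ne_zero hQ hAy)
  · rintro ⟨R, hR, hy⟩
    exact hR y hy

/-- The algebra of polynomial functions on `G × G`. -/
def polyGG (n : ℕ) (k : Type*) [Field k] : Subalgebra k (G n k × G n k → k) where
  carrier := {f | ∃ A : Poly n k, ∀ y, f y = evalAt y A}
  mul_mem' := by
    rintro f g ⟨A, hA⟩ ⟨B, hB⟩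
    exact ⟨A * B, fun y => by rw [Pi.mul_apply, hA, hB, evalAt_mul]⟩
  add_mem' := by
    rintro f g ⟨A, hA⟩ ⟨B, hB⟩
    exact ⟨A + B, fun y => by rw [Pi.add_apply, hA, hB, evalAt_add]⟩
  algebraMap_mem' := fun c => ⟨MvPolynomial.C c, fun y => (evalAt_C y c).symm⟩

variable {V : Type*} [AddCommGroup V] [Module k V]

/-- Near a point, a vector valued regular function is a quotient of a polynomial function by a
polynomial. -/
theorem exists_local_fraction {Ω : Set (G n k × G n k)} (hΩ : IsOpenGG Ω) {y₀ : G n k × G n k}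
    (hy₀ : y₀ ∈ Ω) {s : G n k × G n k → V} (hs : s ∈ Vals (regFun Ω) V) :
    ∃ Q : Poly n k, evalAt y₀ Q ≠ 0 ∧ ∃ N ∈ Vals (polyGG n k) V, ∀ z, evalAt z Q ≠ 0 →
      z ∈ Ω ∧ evalAt z Q • s z = N z := by
  have hev : ∀ Q : Poly n k, (fun y => evalAt y Q) ∈ polyGG n k := fun Q => ⟨Q, fun _ => rfl⟩
  have hopen : ∃ Q : Poly n k, evalAt y₀ Q ≠ 0 ∧ ∀ z, evalAt z Q ≠ 0 → z ∈ Ω := by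
    obtain ⟨T, rfl⟩ := hΩ
    obtain ⟨Q, hQ, hQy⟩ := hy₀
    exact ⟨Q, hQy, fun z hz => ⟨Q, hQ, hz⟩⟩
  refine Vals_induction (p := fun s _ => ∃ Q : Poly n k, evalAt y₀ Q ≠ 0 ∧
    ∃ N ∈ Vals (polyGG n k) V, ∀ z, evalAt z Q ≠ 0 → z ∈ Ω ∧ evalAt z Q • s z = N z) ?_ ?_ ?_ s hs
  · intro a ha v
    obtain ⟨Q₀, hQ₀, hΩ₀⟩ := hopen
    obtain ⟨A, Q, hQ, hA⟩ := ha y₀ hy₀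
    refine ⟨Q₀ * Q, by rw [evalAt_mul]; exact mul_ne_zero hQ₀ hQ, fun y => evalAt y (Q₀ * A) • v,
      smul_const_mem_Vals (hev _) v, fun z hz => ?_⟩
    rw [evalAt_mul] at hz
    have hzΩ := hΩ₀ z (left_ne_zero_of_mul hz)
    have hzQ := right_ne_zero_of_mul hz
    refine ⟨hzΩ, ?_⟩
    beta_reduce
    rw [hA z hzΩ hzQ, smul_smul, evalAt_mul, evalAt_mul, mul_assoc, mul_div_cancel₀ _ hzQ]
  · obtain ⟨Q₀, hQ₀, hΩ₀⟩ := hopen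
    exact ⟨Q₀, hQ₀, 0, zero_mem _, fun z hz => ⟨hΩ₀ z hz, by simp⟩⟩
  · rintro f g - - ⟨Q, hQ, N, hN, h⟩ ⟨Q', hQ', N', hN', h'⟩
    refine ⟨Q * Q', by rw [evalAt_mul]; exact mul_ne_zero hQ hQ',
      fun y => evalAt y Q' • N y + evalAt y Q • N' y,
      add_mem (smul_mem_Vals (hev _) hN) (smul_mem_Vals (hev _) hN'), fun z hz => ?_⟩
    rw [evalAt_mul] at hz
    obtain ⟨h1, h2⟩ := h z (left_ne_zero_of_mul hz)
    obtain ⟨-, h3⟩ := h' z (right_ne_zero_of_mul hz)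
    refine ⟨h1, ?_⟩
    beta_reduce
    rw [← h2, ← h3, evalAt_mul, Pi.add_apply, smul_add, smul_smul, smul_smul, mul_comm]

end RegularFunctions

section Composition

variable {k : Type*} [Field k] {Y Y' V : Type*} [AddCommGroup V] [Module k V]

theorem comp_mem_Vals_of_forall {𝒪 : Subalgebra k (Y → k)} {𝒪' : Subalgebra k (Y' → k)}
    {γ : Y' → Y} (hγ : ∀ f ∈ 𝒪, (fun y => f (γ y)) ∈ 𝒪') {f : Y → V} (hf : f ∈ Vals 𝒪 V) :
    (fun y => f (γ y)) ∈ Vals 𝒪' V := by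
  refine Vals_induction (p := fun f _ => (fun y => f (γ y)) ∈ Vals 𝒪' V) ?_ ?_ ?_ f hf
  · exact fun a ha v => smul_const_mem_Vals (hγ a ha) v
  · exact zero_mem _
  · exact fun f g _ _ hf hg => add_mem hf hg

theorem eval_comp_mem {σ : Type*} {𝒪 : Subalgebra k (Y → k)} {γ : Y → σ → k}
    (hγ : ∀ i, (fun y => γ y i) ∈ 𝒪) (p : MvPolynomial σ k) :
    (fun y => MvPolynomial.eval (γ y) p) ∈ 𝒪 := by
  induction p using MvPolynomial.induction_on with
  | C a =>
    simp only [MvPolynomial.eval_C]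
    exact 𝒪.algebraMap_mem a
  | add p q hp hq =>
    simp only [map_add]
    exact add_mem hp hq
  | mul_X p i hp =>
    simp only [map_mul, MvPolynomial.eval_X]
    exact mul_mem hp (hγ i)

theorem polyFun_comp_mem {σ : Type*} {𝒪 : Subalgebra k (Y → k)} {γ : Y → σ → k}
    (hγ : ∀ i, (fun y => γ y i) ∈ 𝒪) {f : (σ → k) → k} (hf : f ∈ polyFun σ k) :
    (fun y => f (γ y)) ∈ 𝒪 := by
  obtain ⟨p, hp⟩ := mem_polyFun.1 hf
  simp only [hp]
  exact eval_comp_mem hγ p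

theorem polyGG_comp_mem {n : ℕ} {𝒪 : Subalgebra k (Y → k)} {γ : Y → G n k × G n k}
    (h₁ : (fun y => (γ y).1.1) ∈ Vals 𝒪 (Matrix (Idx n) (Idx n) k))
    (h₂ : (fun y => (γ y).2.1) ∈ Vals 𝒪 (Matrix (Idx n) (Idx n) k)) {f : G n k × G n k → k}
    (hf : f ∈ polyGG n k) : (fun y => f (γ y)) ∈ 𝒪 := by
  obtain ⟨A, hA⟩ := hf
  simp only [hA]
  refine eval_comp_mem (fun i => ?_) A
  rcases i with i | i
  · exact entry_mem h₁ i.1 i.2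
  · exact entry_mem h₂ i.1 i.2

end Composition

section Sections

variable {n : ℕ} {k : Type*} [Field k] [Fact (2 ≤ n)]

/-- A section of a bundle of finite rank agrees with a vector valued regular function. -/
theorem exists_regular_extension {F : Submodule k (Amb n k)} [FiniteDimensional k F]
    {U : Set (SpGr n k × SpGr n k)} {s : G n k × G n k → Amb n k} (hs : IsSection F U s) :
    ∃ s' ∈ Vals (regFun (preim U)) (Amb n k), (∀ y, s' y ∈ F) ∧ ∀ y ∈ preim U, s' y = s y := by
  let b := Module.finBasis k F
  -- Regularity of a section is stated for linear forms on the ambient space, so the coordinates on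
  -- `F` are extended to it. Rebuilding `s` from them gives values in `F` even outside the preimage
  -- of `U`.
  have hext : ∀ i, ∃ l : Module.Dual k (Amb n k), l ∘ₗ F.subtype = b.coord i :=
    fun i => LinearMap.exists_extend _
  choose l hl using hext
  refine ⟨fun y => ∑ i, l i (s y) • (b i : Amb n k), ?_, fun y => ?_, fun y hy => ?_⟩
  · have : (fun y => ∑ i, l i (s y) • (b i : Amb n k)) =
        ∑ i, fun y => l i (s y) • (b i : Amb n k) := by
      ext1 y; rw [Finset.sum_apply]
    rw [this]
    exact sum_mem fun i _ => smul_const_mem_Vals (hs.regular (l i)) _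
  · exact sum_mem fun i _ => F.smul_mem _ (b i).2
  · have h1 := congrArg Subtype.val (b.sum_repr ⟨s y, hs.mem y hy⟩)
    rw [Submodule.coe_sum] at h1
    refine Eq.trans (Finset.sum_congr rfl fun i _ => ?_) h1
    have h2 := LinearMap.congr_fun (hl i) ⟨s y, hs.mem y hy⟩
    exact congrArg (fun c => c • (b i : Amb n k)) h2

end Sections

end TateModel

end

/-! ### The subcomplex property and primitives on a parametrized neighbourhood -/

noncomputable section

namespace TateModel

open SpGrTate

section Subcomplex

variable {n : ℕ} {k : Type*} [Field k] [Fact (2 ≤ n)] [CharZero k]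

theorem exists_jpol_of_mem_B {i : ℕ} {w : Amb n k} (hw : w ∈ B n k i) :
    ∃ p ∈ Fil k (V₂perp n k) (i + 3 - 2 * n) i, jpol n k p = w := by
  rw [B_eq] at hw
  exact hw

theorem jpol_mem_B {i : ℕ} {p : Polynomial (Lam2 k (V₂perp n k))}
    (hp : p ∈ Fil k (V₂perp n k) (i + 3 - 2 * n) i) : jpol n k p ∈ B n k i := by
  rw [B_eq]
  exact Submodule.mem_map_of_mem hp

theorem diff_mem_B (g h : G n k) {i : ℕ} {w : Amb n k} (hw : w ∈ B n k (i + 1)) :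
    diff g h w ∈ B n k i := by
  obtain ⟨p, hp, rfl⟩ := exists_jpol_of_mem_B hw
  rw [diff_jpol_eq_matDiff]
  refine jpol_mem_B ?_
  rw [show i + 3 - 2 * n = i + 1 + 3 - 2 * n - 1 by omega]
  have key := @tateDiff_mem_Fil k (V₂perp n k) _ _ _ _
  exact key _ _ _ hp

theorem diff_diff_of_mem_B (g h : G n k) {i : ℕ} {w : Amb n k} (hw : w ∈ B n k i) :
    diff g h (diff g h w) = 0 := by
  obtain ⟨p, hp, rfl⟩ := exists_jpol_of_mem_B hw
  rw [diff_jpol_eq_matDiff, diff_jpol_eq_matDiff]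
  have key := @tateDiff_tateDiff k (V₂perp n k) _ _ _
  have h := key (isCycle_topForm (h⁻¹ * g)) p
  exact (congrArg (jpol n k) h).trans (map_zero _)

omit [CharZero k] in
theorem matDiff_mem_Vals {Y : Type*} {𝒪 : Subalgebra k (Y → k)} {u : Y → Matrix (Idx n) (Idx n) k}
    (hu : u ∈ Vals 𝒪 (Matrix (Idx n) (Idx n) k)) : (fun y => matDiff (u y)) ∈ Vals 𝒪
      (Polynomial (Lam2 k (V₂perp n k)) →ₗ[k] Polynomial (Lam2 k (V₂perp n k))) :=
  tateDiff_mem_Vals (colForm_mem_Vals hu) (topForm_mem_Vals hu (v₁ n k))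
    (topForm_mem_Vals hu (v₂ n k))

/-- A family with values in `B n k i` comes from a family in the model. -/
theorem exists_jpol_family {Y : Type*} {𝒪 : Subalgebra k (Y → k)} {i : ℕ} {s : Y → Amb n k}
    (hs : s ∈ Vals 𝒪 (Amb n k)) (hB : ∀ y, s y ∈ B n k i) :
    ∃ p ∈ Vals 𝒪 (Polynomial (Lam2 k (V₂perp n k))),
      (∀ y, p y ∈ Fil k (V₂perp n k) (i + 3 - 2 * n) i) ∧ ∀ y, jpol n k (p y) = s y := by
  choose p hp hps using fun y => exists_jpol_of_mem_B (hB y)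
  refine ⟨p, mem_Vals_of_injective jpol_injective ?_, hp, hps⟩
  simpa only [hps] using hs

theorem diff_mem_Vals {Y : Type*} {𝒪 : Subalgebra k (Y → k)} {g h : Y → G n k}
    (hg : (fun y => (g y).1) ∈ Vals 𝒪 (Matrix (Idx n) (Idx n) k))
    (hh : (fun y => (h y).1) ∈ Vals 𝒪 (Matrix (Idx n) (Idx n) k)) {i : ℕ} {s : Y → Amb n k}
    (hs : s ∈ Vals 𝒪 (Amb n k)) (hB : ∀ y, s y ∈ B n k i) :
    (fun y => diff (g y) (h y) (s y)) ∈ Vals 𝒪 (Amb n k) := by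
  obtain ⟨p, hp, -, hps⟩ := exists_jpol_family hs hB
  simp only [← hps, diff_jpol_eq_matDiff]
  exact linear_mem_Vals (jpol n k) (apply_mem_Vals (matDiff_mem_Vals
    (symplectic_mul_mem_Vals (symplectic_inv_mem_Vals hh) hg)) hp)

variable (n k) in
theorem isSubcomplex_B : IsSubcomplex n k (B n k) := by
  refine ⟨B_le_D, fun i U s _ hs => ⟨fun y hy => diff_mem_B _ _ (hs.mem y hy),
    fun y hy p hp q hq => ?_, fun l => ?_⟩,
    fun i U s _ hs y hy => diff_diff_of_mem_B _ _ (hs.mem y hy)⟩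
  · simp only [diffSec]
    rw [← diff_actM _ _ hp, hs.equivariant y hy p hp q hq]
  · obtain ⟨s', hs', hsB, hss⟩ := exists_regular_extension hs
    have h := dual_mem_of_mem_Vals l (diff_mem_Vals (fst_mem_Vals_regFun _) (snd_mem_Vals_regFun _)
      hs' hsB)
    exact regFun_congr h fun y hy => by rw [diffSec, hss y hy]

end Subcomplex

section LocalPrimitives

variable {n : ℕ} {k : Type*} [Field k]

/-- The parametrization of a neighbourhood of a point of `X × X`. -/
def param (h₀ u₀ : G n k) (t : PairIdx n → k) : G n k × G n k :=
  (h₀ * slice (secondMatrix t) * u₀ * slice (firstMatrix t), h₀ * slice (secondMatrix t))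

theorem param_inv_mul (h₀ u₀ : G n k) (t : PairIdx n → k) :
    (param h₀ u₀ t).2⁻¹ * (param h₀ u₀ t).1 = u₀ * slice (firstMatrix t) := by
  simp only [param]
  group

theorem param_basePoint (h₀ u₀ : G n k) : param h₀ u₀ (basePoint n k) = (h₀ * u₀, h₀) := by
  rw [param, firstMatrix_basePoint, secondMatrix_basePoint, slice_projV₂]
  simp

theorem param_snd_mem_Vals (h₀ u₀ : G n k) : (fun t => (param h₀ u₀ t).2.1) ∈
    Vals (polyFun (PairIdx n) k) (Matrix (Idx n) (Idx n) k) :=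
  symplectic_mul_mem_Vals (const_mem_Vals _) (slice_mem_Vals secondMatrix_mem_Vals)

theorem param_fst_mem_Vals (h₀ u₀ : G n k) : (fun t => (param h₀ u₀ t).1.1) ∈
    Vals (polyFun (PairIdx n) k) (Matrix (Idx n) (Idx n) k) :=
  symplectic_mul_mem_Vals (symplectic_mul_mem_Vals (param_snd_mem_Vals h₀ u₀) (const_mem_Vals _))
    (slice_mem_Vals firstMatrix_mem_Vals)

variable [Fact (2 ≤ n)] [CharZero k]

theorem exists_primitive_param {h₀ u₀ : G n k} (ht : IsTransversal u₀.1)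
    (h0 : u₀ = 1 ∨ u₀ ∉ P n k) {i : ℕ} (hi : i + 8 ≤ 4 * n) {U : Set (SpGr n k × SpGr n k)}
    (hU : IsOpenXX U) {s : G n k × G n k → Amb n k} (hs : IsSection (B n k (i + 1)) U s)
    (hds : ∀ y ∈ preim U, diffSec s y = 0) (hy₀ : (h₀ * u₀, h₀) ∈ preim U) :
    ∃ ρ ∈ Vals (polyFun (PairIdx n) k) (Amb n k), ∃ κ ∈ polyFun (PairIdx n) k,
      κ (basePoint n k) ≠ 0 ∧ (∀ t, ρ t ∈ B n k (i + 2)) ∧ ∀ t, κ t ≠ 0 →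
        param h₀ u₀ t ∈ preim U ∧
        diff (param h₀ u₀ t).1 (param h₀ u₀ t).2 (ρ t) = κ t • s (param h₀ u₀ t) := by
  obtain ⟨s', hs', hsB, hss⟩ := exists_regular_extension hs
  obtain ⟨Q, hQ, N, hN, hQN⟩ := exists_local_fraction hU hy₀ hs'
  have hcomp : ∀ f ∈ polyGG n k, (fun t => f (param h₀ u₀ t)) ∈ polyFun (PairIdx n) k :=
    fun f hf => polyGG_comp_mem (param_fst_mem_Vals h₀ u₀) (param_snd_mem_Vals h₀ u₀) hf
  set q₀ : (PairIdx n → k) → k := fun t => evalAt (param h₀ u₀ t) Q with hq₀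
  have hq₀m : q₀ ∈ polyFun (PairIdx n) k := hcomp (fun y => evalAt y Q) ⟨Q, fun _ => rfl⟩
  -- One more factor `q₀` makes the numerator vanish where the denominator does. Then membership in
  -- `B` and the cycle condition hold at every parameter, as the exactness statement on the slice
  -- requires.
  have hz₀ : (fun t => q₀ t • N (param h₀ u₀ t)) ∈ Vals (polyFun (PairIdx n) k) (Amb n k) :=
    smul_mem_Vals hq₀m (comp_mem_Vals_of_forall hcomp hN)
  have hval : ∀ t, q₀ t ≠ 0 → param h₀ u₀ t ∈ preim U ∧
      q₀ t • N (param h₀ u₀ t) = (q₀ t * q₀ t) • s (param h₀ u₀ t) := by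
    intro t ht
    obtain ⟨h1, h2⟩ := hQN _ ht
    refine ⟨h1, ?_⟩
    rw [← h2, hss _ h1, smul_smul]
  have hz₀B : ∀ t, q₀ t • N (param h₀ u₀ t) ∈ B n k (i + 1) := by
    intro t
    by_cases ht : q₀ t = 0
    · rw [ht, zero_smul]; exact zero_mem _
    · obtain ⟨h1, h2⟩ := hval t ht
      rw [h2]
      exact Submodule.smul_mem _ _ (hs.mem _ h1)
  have hdz₀ : ∀ t, diff (param h₀ u₀ t).1 (param h₀ u₀ t).2 (q₀ t • N (param h₀ u₀ t)) = 0 := by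
    intro t
    by_cases ht : q₀ t = 0
    · rw [ht, zero_smul, map_zero]
    · obtain ⟨h1, h2⟩ := hval t ht
      rw [h2, map_smul]
      have h3 := hds _ h1
      rw [diffSec] at h3
      rw [h3, smul_zero]
  obtain ⟨z, hz, hzF, hzz⟩ := exists_jpol_family hz₀ hz₀B
  have hdz : ∀ t, matDiff (u₀ * slice (firstMatrix t)).1 (z t) = 0 := by
    intro t
    apply jpol_injective
    rw [map_zero, ← hdz₀ t, ← hzz t, diff_jpol_eq_matDiff, param_inv_mul]
  obtain ⟨r, hr, q, hq, hq0, hrF, hrz⟩ := exists_primitive_slice ht h0 hi hz hzF hdz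
  refine ⟨fun t => jpol n k (r t), linear_mem_Vals (jpol n k) hr, fun t => q t * (q₀ t * q₀ t),
    mul_mem hq (mul_mem hq₀m hq₀m), ?_, fun t => jpol_mem_B (hrF t), fun t hκ => ?_⟩
  · have : q₀ (basePoint n k) ≠ 0 := by
      rw [hq₀]
      beta_reduce
      rwa [param_basePoint]
    exact mul_ne_zero hq0 (mul_ne_zero this this)
  · obtain ⟨h1, h2⟩ := hval t (left_ne_zero_of_mul (right_ne_zero_of_mul hκ))
    refine ⟨h1, ?_⟩
    rw [diff_jpol_eq_matDiff, param_inv_mul, hrz, map_smul, hzz, h2, smul_smul]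

end LocalPrimitives

end TateModel

end

/-! ### Charts of `X × X` and equivariant primitives -/

noncomputable section

namespace TateModel

open SpGrTate

section Chart

variable {n : ℕ} {k : Type*} [Field k]

/-- The coordinates of the second factor. -/
def sndCoord (h₀ : G n k) (y : G n k × G n k) : Matrix (Idx n) (Idx n) k :=
  normCols (h₀⁻¹ * y.2).1

/-- The first factor, moved to the origin of the chart. -/
def residual (h₀ u₀ : G n k) (y : G n k × G n k) : G n k :=
  u₀⁻¹ * (slice (sndCoord h₀ y))⁻¹ * (h₀⁻¹ * y.1)

/-- The coordinates of the point of `X × X` below a point of `G × G`. -/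
def chart (h₀ u₀ : G n k) (y : G n k × G n k) : PairIdx n → k :=
  Sum.elim (fun ij => normCols (residual h₀ u₀ y).1 ij.1 ij.2) (fun ij => sndCoord h₀ y ij.1 ij.2)

/-- The denominator of the coordinates of the second factor. -/
def sndDenom (h₀ : G n k) (y : G n k × G n k) : k := (topBlock (h₀⁻¹ * y.2).1).det

/-- The denominator of the coordinates of the first factor. -/
def fstDenom (h₀ u₀ : G n k) (y : G n k × G n k) : k := (topBlock (residual h₀ u₀ y).1).det

theorem firstMatrix_chart (h₀ u₀ : G n k) (y : G n k × G n k) :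
    firstMatrix (chart h₀ u₀ y) = normCols (residual h₀ u₀ y).1 := rfl

theorem secondMatrix_chart (h₀ u₀ : G n k) (y : G n k × G n k) :
    secondMatrix (chart h₀ u₀ y) = sndCoord h₀ y := rfl

theorem sndCoord_base (g h₀ : G n k) : sndCoord h₀ (g, h₀) = projV₂ n k := by
  rw [sndCoord, inv_mul_cancel, OneMemClass.coe_one, normCols_one]

theorem residual_base (h₀ u₀ : G n k) : residual h₀ u₀ (h₀ * u₀, h₀) = 1 := by
  rw [residual, sndCoord_base, slice_projV₂]
  group

theorem chart_base (h₀ u₀ : G n k) : chart h₀ u₀ (h₀ * u₀, h₀) = basePoint n k := by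
  have h1 : normCols (residual h₀ u₀ (h₀ * u₀, h₀)).1 = projV₂ n k := by
    rw [residual_base, OneMemClass.coe_one, normCols_one]
  rw [chart, h1, sndCoord_base]
  rfl

theorem sndDenom_base (g h₀ : G n k) : sndDenom h₀ (g, h₀) ≠ 0 := by
  rw [sndDenom, inv_mul_cancel, OneMemClass.coe_one, topBlock_one, Matrix.det_one]
  exact one_ne_zero

theorem fstDenom_base (h₀ u₀ : G n k) : fstDenom h₀ u₀ (h₀ * u₀, h₀) ≠ 0 := by
  rw [fstDenom, residual_base, OneMemClass.coe_one, topBlock_one, Matrix.det_one]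
  exact one_ne_zero

section Regularity

variable {Ω : Set (G n k × G n k)} (h₀ u₀ : G n k)

theorem inv_mul_snd_mem_Vals (Ω : Set (G n k × G n k)) :
    (fun y => (h₀⁻¹ * y.2).1) ∈ Vals (regFun Ω) (Matrix (Idx n) (Idx n) k) :=
  symplectic_mul_mem_Vals (const_mem_Vals _) (snd_mem_Vals_regFun Ω)

theorem sndDenom_mem_regFun (Ω : Set (G n k × G n k)) : sndDenom h₀ ∈ regFun Ω :=
  det_mem (topBlock_mem_Vals (inv_mul_snd_mem_Vals h₀ Ω))

variable {h₀} (h2 : ∀ y ∈ Ω, sndDenom h₀ y ≠ 0)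
include h2

theorem sndCoord_mem_Vals : sndCoord h₀ ∈ Vals (regFun Ω) (Matrix (Idx n) (Idx n) k) :=
  normCols_mem_Vals (inv_mul_snd_mem_Vals h₀ Ω) (inv_mem_regFun (sndDenom_mem_regFun h₀ Ω) h2)

theorem residual_mem_Vals :
    (fun y => (residual h₀ u₀ y).1) ∈ Vals (regFun Ω) (Matrix (Idx n) (Idx n) k) :=
  symplectic_mul_mem_Vals (symplectic_mul_mem_Vals (const_mem_Vals _)
    (symplectic_inv_mem_Vals (slice_mem_Vals (sndCoord_mem_Vals h2))))
    (symplectic_mul_mem_Vals (const_mem_Vals _) (fst_mem_Vals_regFun Ω))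

theorem fstDenom_mem_regFun : fstDenom h₀ u₀ ∈ regFun Ω :=
  det_mem (topBlock_mem_Vals (residual_mem_Vals u₀ h2))

variable {u₀} (h1 : ∀ y ∈ Ω, fstDenom h₀ u₀ y ≠ 0)
include h1

theorem chart_mem_regFun (i : PairIdx n) : (fun y => chart h₀ u₀ y i) ∈ regFun Ω := by
  rcases i with i | i
  · exact entry_mem (normCols_mem_Vals (residual_mem_Vals u₀ h2)
      (inv_mem_regFun (fstDenom_mem_regFun u₀ h2) h1)) i.1 i.2
  · exact entry_mem (sndCoord_mem_Vals h2) i.1 i.2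

theorem comp_chart_mem_regFun {f : (PairIdx n → k) → k} (hf : f ∈ polyFun (PairIdx n) k) :
    (fun y => f (chart h₀ u₀ y)) ∈ regFun Ω :=
  polyFun_comp_mem (chart_mem_regFun h2 h1) hf

theorem comp_chart_mem_Vals {W : Type*} [AddCommGroup W] [Module k W] {f : (PairIdx n → k) → W}
    (hf : f ∈ Vals (polyFun (PairIdx n) k) W) :
    (fun y => f (chart h₀ u₀ y)) ∈ Vals (regFun Ω) W :=
  comp_mem_Vals_of_forall (fun _ hf => comp_chart_mem_regFun h2 h1 hf) hf

end Regularity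

section Invariance

variable [Fact (2 ≤ n)] (h₀ u₀ : G n k) (y : G n k × G n k)

theorem sndCoord_mul (p : G n k) {q : G n k} (hq : q ∈ P n k) :
    sndCoord h₀ (y.1 * p, y.2 * q) = sndCoord h₀ y := by
  rw [sndCoord, ← mul_assoc, Submonoid.coe_mul]
  exact normCols_mul (mul_projV₂_of_mem_P hq) (isUnit_det_topBlock_of_mem_P hq)

theorem residual_mul (p : G n k) {q : G n k} (hq : q ∈ P n k) :
    residual h₀ u₀ (y.1 * p, y.2 * q) = residual h₀ u₀ y * p := by
  rw [residual, sndCoord_mul h₀ y p hq, residual]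
  group

theorem chart_mul {p q : G n k} (hp : p ∈ P n k) (hq : q ∈ P n k) :
    chart h₀ u₀ (y.1 * p, y.2 * q) = chart h₀ u₀ y := by
  have h1 : normCols (residual h₀ u₀ (y.1 * p, y.2 * q)).1 = normCols (residual h₀ u₀ y).1 := by
    rw [residual_mul h₀ u₀ y p hq, Submonoid.coe_mul]
    exact normCols_mul (mul_projV₂_of_mem_P hp) (isUnit_det_topBlock_of_mem_P hp)
  rw [chart, h1, sndCoord_mul h₀ y p hq]
  rfl

theorem sndDenom_mul (p : G n k) {q : G n k} (hq : q ∈ P n k) (hy : sndDenom h₀ y ≠ 0) :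
    sndDenom h₀ (y.1 * p, y.2 * q) ≠ 0 := by
  rw [sndDenom, ← mul_assoc, Submonoid.coe_mul, topBlock_mul (mul_projV₂_of_mem_P hq),
    Matrix.det_mul]
  exact mul_ne_zero hy (isUnit_det_topBlock_of_mem_P hq).ne_zero

theorem fstDenom_mul {p q : G n k} (hp : p ∈ P n k) (hq : q ∈ P n k)
    (hy : fstDenom h₀ u₀ y ≠ 0) : fstDenom h₀ u₀ (y.1 * p, y.2 * q) ≠ 0 := by
  rw [fstDenom, residual_mul h₀ u₀ y p hq, Submonoid.coe_mul,
    topBlock_mul (mul_projV₂_of_mem_P hp), Matrix.det_mul]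
  exact mul_ne_zero hy (isUnit_det_topBlock_of_mem_P hp).ne_zero

variable {h₀ u₀ y}

theorem param_chart_inv_mul_fst_mem_P (h : fstDenom h₀ u₀ y ≠ 0) :
    y.1⁻¹ * (param h₀ u₀ (chart h₀ u₀ y)).1 ∈ P n k := by
  have h1 := inv_mem_P (slice_normCols_inv_mul_mem_P (g := residual h₀ u₀ y) h.isUnit)
  have h2 : y.1⁻¹ * (param h₀ u₀ (chart h₀ u₀ y)).1 =
      ((slice (normCols (residual h₀ u₀ y).1))⁻¹ * residual h₀ u₀ y)⁻¹ := by
    rw [param, firstMatrix_chart, secondMatrix_chart, residual]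
    simp only [mul_inv_rev, inv_inv, mul_assoc]
  rwa [h2]

theorem param_chart_inv_mul_snd_mem_P (h : sndDenom h₀ y ≠ 0) :
    y.2⁻¹ * (param h₀ u₀ (chart h₀ u₀ y)).2 ∈ P n k := by
  have h1 := inv_mem_P (slice_normCols_inv_mul_mem_P (g := h₀⁻¹ * y.2) h.isUnit)
  have h2 : y.2⁻¹ * (param h₀ u₀ (chart h₀ u₀ y)).2 =
      ((slice (normCols (h₀⁻¹ * y.2).1))⁻¹ * (h₀⁻¹ * y.2))⁻¹ := by
    rw [param, secondMatrix_chart, sndCoord]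
    simp only [mul_inv_rev, inv_inv, mul_assoc]
  rwa [h2]

end Invariance

end Chart

section Exactness

variable {n : ℕ} {k : Type*} [Field k] [Fact (2 ≤ n)]

/-- The image in `X × X` of an invariant subset of `G × G`. -/
theorem preim_image_of_invariant {Ω : Set (G n k × G n k)}
    (hΩ : ∀ y ∈ Ω, ∀ p ∈ P n k, ∀ q ∈ P n k, (y.1 * p, y.2 * q) ∈ Ω) :
    preim ((fun y => (toPoint y.1, toPoint y.2)) '' Ω) = Ω := by
  ext y
  constructor
  · rintro ⟨y', hy', h⟩
    obtain ⟨h1, h2⟩ := Prod.ext_iff.1 h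
    have := hΩ y' hy' _ (inv_mul_mem_P_of_toPoint_eq h1) _ (inv_mul_mem_P_of_toPoint_eq h2)
    simpa only [mul_inv_cancel_left] using this
  · exact fun hy => ⟨y, hy, rfl⟩

theorem mul_mem_preim {U : Set (SpGr n k × SpGr n k)} {y : G n k × G n k} (hy : y ∈ preim U)
    {p q : G n k} (hp : p ∈ P n k) (hq : q ∈ P n k) : (y.1 * p, y.2 * q) ∈ preim U := by
  change (toPoint (y.1 * p), toPoint (y.2 * q)) ∈ U
  rw [toPoint_mul hp, toPoint_mul hq]
  exact hy

/-- A local primitive near a point with adapted representatives. -/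
theorem exists_section_primitive [CharZero k] {h₀ u₀ : G n k} (ht : IsTransversal u₀.1)
    (h0 : u₀ = 1 ∨ u₀ ∉ P n k) {i : ℕ} (hi : i + 8 ≤ 4 * n) {U : Set (SpGr n k × SpGr n k)}
    (hU : IsOpenXX U) {s : G n k × G n k → Amb n k} (hs : IsSection (B n k (i + 1)) U s)
    (hds : ∀ y ∈ preim U, diffSec s y = 0) (hy₀ : (h₀ * u₀, h₀) ∈ preim U) :
    ∃ (U' : Set (SpGr n k × SpGr n k)) (r : G n k × G n k → Amb n k),
      IsOpenXX U' ∧ (h₀ * u₀, h₀) ∈ preim U' ∧ U' ⊆ U ∧ IsSection (B n k (i + 2)) U' r ∧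
        ∀ y ∈ preim U', diffSec r y = s y := by
  obtain ⟨ρ, hρ, κ, hκ, hκ0, hρB, hdρ⟩ := exists_primitive_param ht h0 hi hU hs hds hy₀
  set Ω₁ : Set (G n k × G n k) := {y | y ∈ preim U ∧ sndDenom h₀ y ≠ 0} with hΩ₁
  have ho₁ : IsOpenGG Ω₁ := isOpenGG_ne_zero hU (sndDenom_mem_regFun h₀ _)
  set Ω₂ : Set (G n k × G n k) := {y | y ∈ Ω₁ ∧ fstDenom h₀ u₀ y ≠ 0} with hΩ₂
  have ho₂ : IsOpenGG Ω₂ := isOpenGG_ne_zero ho₁ (fstDenom_mem_regFun u₀ fun y hy => hy.2)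
  set Ω : Set (G n k × G n k) := {y | y ∈ Ω₂ ∧ κ (chart h₀ u₀ y) ≠ 0} with hΩ
  have ho : IsOpenGG Ω := isOpenGG_ne_zero ho₂
    (comp_chart_mem_regFun (fun y hy => hy.1.2) (fun y hy => hy.2) hκ)
  have hinv : ∀ y ∈ Ω, ∀ p ∈ P n k, ∀ q ∈ P n k, (y.1 * p, y.2 * q) ∈ Ω := by
    rintro y ⟨⟨⟨h1, h2⟩, h3⟩, h4⟩ p hp q hq
    refine ⟨⟨⟨mul_mem_preim h1 hp hq, sndDenom_mul h₀ y p hq h2⟩,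
      fstDenom_mul h₀ u₀ y hp hq h3⟩, ?_⟩
    rwa [chart_mul h₀ u₀ y hp hq]
  have h1Ω : ∀ y ∈ Ω, fstDenom h₀ u₀ y ≠ 0 := fun y hy => hy.1.2
  have h2Ω : ∀ y ∈ Ω, sndDenom h₀ y ≠ 0 := fun y hy => hy.1.1.2
  have hpre := preim_image_of_invariant hinv
  let π : G n k × G n k → G n k × G n k := fun y => param h₀ u₀ (chart h₀ u₀ y)
  -- The point `π y` is the representative, given by the parametrization, of the class of `y`. The
  -- elements `τ₁, τ₂` of `P` connect the two representatives and transport the primitive from `π y`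
  -- to `y`.
  let τ₁ : G n k × G n k → G n k := fun y => y.1⁻¹ * (π y).1
  let τ₂ : G n k × G n k → G n k := fun y => y.2⁻¹ * (π y).2
  have hτ₁ : ∀ y ∈ Ω, τ₁ y ∈ P n k := fun y hy => param_chart_inv_mul_fst_mem_P (h1Ω y hy)
  have hτ₂ : ∀ y ∈ Ω, τ₂ y ∈ P n k := fun y hy => param_chart_inv_mul_snd_mem_P (h2Ω y hy)
  refine ⟨_, fun y => actM (τ₁ y) (τ₂ y) ((κ (chart h₀ u₀ y))⁻¹ • ρ (chart h₀ u₀ y)),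
    (congrArg IsOpenGG hpre).mpr ho, ?_, ?_, ⟨?_, ?_, ?_⟩, ?_⟩
  · rw [hpre]
    refine ⟨⟨⟨hy₀, sndDenom_base _ h₀⟩, fstDenom_base h₀ u₀⟩, ?_⟩
    rwa [chart_base]
  · rintro _ ⟨y, hy, rfl⟩
    exact hy.1.1.1
  · rw [hpre]
    exact fun y hy => actM_mem_B (hτ₁ y hy) (hτ₂ y hy) (Submodule.smul_mem _ _ (hρB _))
  · rw [hpre]
    intro y hy p hp q hq
    have e0 := chart_mul h₀ u₀ y hp hq
    -- Since `chart` is invariant under `P × P`, `π` is too, and `τ₁` changes by `p⁻¹` on the left.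
    -- This is the equivariance of the transported section.
    have e1 : p * τ₁ (y.1 * p, y.2 * q) = τ₁ y := by
      simp only [τ₁, π, e0]; group
    have e2 : q * τ₂ (y.1 * p, y.2 * q) = τ₂ y := by
      simp only [τ₂, π, e0]; group
    rw [actM_actM hp (hτ₁ _ (hinv y hy p hp q hq)), e0, e1, e2]
  · rw [hpre]
    intro l
    have hπ : ∀ {f : (PairIdx n → k) → Matrix (Idx n) (Idx n) k}, f ∈ Vals (polyFun (PairIdx n) k)
        (Matrix (Idx n) (Idx n) k) → (fun y => f (chart h₀ u₀ y)) ∈ Vals (regFun Ω) _ :=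
      fun hf => comp_chart_mem_Vals h2Ω h1Ω hf
    have hm₁ : (fun y => (τ₁ y).1) ∈ Vals (regFun Ω) (Matrix (Idx n) (Idx n) k) :=
      symplectic_mul_mem_Vals (symplectic_inv_mem_Vals (fst_mem_Vals_regFun Ω))
        (hπ (param_fst_mem_Vals h₀ u₀))
    have hm₂ : (fun y => (τ₂ y).1) ∈ Vals (regFun Ω) (Matrix (Idx n) (Idx n) k) :=
      symplectic_mul_mem_Vals (symplectic_inv_mem_Vals (snd_mem_Vals_regFun Ω))
        (hπ (param_snd_mem_Vals h₀ u₀))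
    exact dual_mem_of_mem_Vals l (actM_mem_Vals hm₁ hm₂ (smul_mem_Vals
      (inv_mem_regFun (comp_chart_mem_regFun h2Ω h1Ω hκ) fun y hy => hy.2)
      (comp_chart_mem_Vals h2Ω h1Ω hρ)))
  · rw [hpre]
    intro y hy
    have hy' : y ∈ preim U := hy.1.1.1
    have e1 : y.1 * τ₁ y = (π y).1 := mul_inv_cancel_left _ _
    have e2 : y.2 * τ₂ y = (π y).2 := mul_inv_cancel_left _ _
    have e3 := (hdρ _ hy.2).2
    have e4 := hs.equivariant y hy' _ (hτ₁ y hy) _ (hτ₂ y hy)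
    rw [e1, e2] at e4
    rw [diffSec, diff_actM _ _ (hτ₁ y hy), e1, e2, map_smul, e3, smul_smul, inv_mul_cancel₀ hy.2,
      one_smul]
    exact e4

/-- Off the image of `G × G` there is nothing to prove. -/
theorem exists_section_primitive_of_forall_ne {F : Submodule k (Amb n k)}
    {s : G n k × G n k → Amb n k} {z : SpGr n k × SpGr n k}
    (hz : ∀ y : G n k × G n k, (toPoint y.1, toPoint y.2) ≠ z) :
    IsOpenXX {z} ∧ IsSection F {z} (0 : G n k × G n k → Amb n k) ∧
      ∀ y ∈ preim {z}, diffSec 0 y = s y := by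
  have h0 : ∀ y : G n k × G n k, y ∉ preim {z} := fun y hy => hz y hy
  refine ⟨⟨∅, ?_⟩, ⟨fun y hy => (h0 y hy).elim, fun y hy => (h0 y hy).elim,
    fun _ y hy => (h0 y hy).elim⟩, fun y hy => (h0 y hy).elim⟩
  ext y
  simpa using h0 y

/-- In degree `i + 1` the argument needs `i + 4 ≤ 2 dim W = 4n - 4`, which is `i + 1 < 4n - 6`. -/
theorem exactInDegree_B [CharZero k] {i : ℕ} (hi : 0 < i) (hi' : i < 4 * n - 6) :
    ExactInDegree n k (B n k) i := by
  intro U s hU hs hds z hz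
  obtain ⟨i, rfl⟩ := Nat.exists_eq_succ_of_ne_zero hi.ne'
  -- Transitivity of `G` on `X` is not needed: a point outside the image of `G × G` has empty
  -- preimage, so its singleton is open and all conditions there are void.
  by_cases hzr : ∃ y : G n k × G n k, (toPoint y.1, toPoint y.2) = z
  · obtain ⟨⟨g, h⟩, rfl⟩ := hzr
    obtain ⟨g₀, h₀, hg, hh, ht, h0⟩ := exists_adapted_representatives g h
    have e : (h₀ * (h₀⁻¹ * g₀), h₀) = (g₀, h₀) := by rw [mul_inv_cancel_left]
    have hp : ∀ U : Set (SpGr n k × SpGr n k), (h₀ * (h₀⁻¹ * g₀), h₀) ∈ preim U ↔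
        (toPoint g, toPoint h) ∈ U := by
      intro U
      rw [e, ← hg, ← hh]
      rfl
    obtain ⟨U', r, h1, h2, h3, h4, h5⟩ := exists_section_primitive ht h0 (i := i) (by omega) hU hs
      hds ((hp U).2 hz)
    exact ⟨U', r, h1, (hp U').1 h2, h3, h4, h5⟩
  · push Not at hzr
    obtain ⟨h1, h2, h3⟩ := exists_section_primitive_of_forall_ne (F := B n k (i + 2)) (s := s) hzr
    exact ⟨{z}, 0, h1, rfl, Set.singleton_subset_iff.2 hz, h2, h3⟩

end Exactness

end TateModel

end

/-- Let `X = SpGr(2, V)`, `dim V = N = 2n ≥ 4`, over an algebraically closed field of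
characteristic zero. The sub-complex `B_{2N-6} → ⋯ → B_1 = S ⊠ S^⊥ → B_0 = 𝒪_{X × X}` of the
Tate resolution is exact, that is, exact in the degrees `0 < i < 2N - 6 = 4n - 6`. -/
theorem theorem3p2 (n : ℕ) [Fact (2 ≤ n)] (k : Type*) [Field k] [IsAlgClosed k] [CharZero k] :
    SpGrTate.IsSubcomplex n k (SpGrTate.B n k) ∧
      ∀ i : ℕ, 0 < i → i < 4 * n - 6 → SpGrTate.ExactInDegree n k (SpGrTate.B n k) i := by
  exact ⟨TateModel.isSubcomplex_B n k, fun _ => TateModel.exactInDegree_B⟩
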